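/- Let $X$ be a complex manifold of complex dimension $n$ (Hausdorff, second countable), $M$ a $C^\infty$-smooth generic CR submanifold of $X$ of real codimension $k$, oriented and equipped with a smooth volume form $dV$, and $D$ a relatively compact domain in $M$ with $C^\infty$-smooth boundary. Here generic means that $H_{0,1}M=T_{0,1}X\cap T_{\mathbb C}M$ has complex rank $n-k$; $(r,q)$-forms on $M$ are sections of $\Lambda^r(T_{\mathbb C}M/H_{0,1}M)^*\otimes\Lambda^q(H_{0,1}M)^*$, and $\bar\partial_b$ is the tangential Cauchy-Riemann operator. For $p\ge 1$ let $L^p_{r,q}(D)$ be the space of $(r,q)$-forms on $D$ with $L^p$ coefficients (with respect to $dV$), with its $L^p$ topology. Let $H^{r,q}_{L^p}(D)$ be the cohomology of the complex $(L^p_{r,\bullet}(D),\bar\partial_b)$, where $\bar\partial_b$ is taken in the sense of currents on $D$ with domain $\{f\in L^p_{r,q}(D): \bar\partial_b f\in L^p_{r,q+1}(D)\}$, endowed with the quotient topology. Let $H^{r,q}_{\tilde c,L^p}(D)$ be the cohomology of the complex formed by the $L^p$ forms $f$ on $M$ with $\operatorname{supp} f\subset\overline D$, where $\bar\partial_b$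 is taken in the sense of currents on $M$ with domain $\{f\in L^p_{r,q}(M): \operatorname{supp} f\subset\overline D,\ \bar\partial_b f\in L^p_{r,q+1}(M)\}$. Let $p>1$ and $p'$ be real numbers with $\frac1p+\frac1{p'}=1$, and let $r,q$ be integers with $0\le r\le n$ and $1\le q\le n-k$. If $H^{n-r,n-k-q+1}_{L^{p'}}(D)$ is Hausdorff and $H^{n-r,n-k-q}_{L^{p'}}(D)=0$, then $$H^{r,q}_{\tilde c,L^p}(D)=0.$$ In other words, for every $(r,q)$-form $f$ with coefficients in $L^p(M)$ such that $\operatorname{supp} f\subset\overline D$ and $\bar\partial_b f=0$ weakly in $M$, there is an $(r,q-1)$-form $g$ with coefficients in $L^p(M)$ such that $\operatorname{supp} g\subset\overline D$ and $\bar\partial_b g=f$ weakly in $M$. -/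

import Mathlib

open Set Filter Topology MeasureTheory Manifold
open scoped Manifold ContDiff ENNReal

noncomputable section

namespace CRLp

/-- The model space of an `m`-dimensional real manifold. -/
abbrev EM (m : ℕ) : Type := EuclideanSpace ℝ (Fin m)

/-- The model space of an `n`-dimensional complex manifold. -/
abbrev EX (n : ℕ) : Type := EuclideanSpace ℂ (Fin n)

/-! ### Differential forms on a real manifold -/

section Forms

variable {m : ℕ} (M : Type*)

/-- (Not necessarily continuous) differential forms of degree `d` on `M` with values in `F`:
an alternating real multilinear form on every tangent space. The tangent space
`TangentSpace 𝓘(ℝ, EM m) x` is by definition the model space `EM m` (a tangent vector at `x` is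
written in the preferred chart at `x`), which is used here and below to keep the types simple. -/
abbrev DForm (d : ℕ) (F : Type*) [NormedAddCommGroup F] [NormedSpace ℝ F] : Type _ :=
  M → EM m [⋀^Fin d]→L[ℝ] F

variable {M} [TopologicalSpace M] [ChartedSpace (EM m) M] {F : Type*} [NormedAddCommGroup F] [NormedSpace ℝ F] {d : ℕ}

/-- The expression of a form in the preferred chart at `x₀`, i.e. its pullback under the inverse
of that chart, as a form on (the target of the chart in) the model space. -/
def inChart (η : DForm (m := m) M d F) (x₀ : M) (y : EM m) : EM m [⋀^Fin d]→L[ℝ] F :=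
  (η ((extChartAt 𝓘(ℝ, EM m) x₀).symm y)).compContinuousLinearMap
    (mfderiv 𝓘(ℝ, EM m) 𝓘(ℝ, EM m) (extChartAt 𝓘(ℝ, EM m) x₀).symm y : EM m →L[ℝ] EM m)

/-- Smooth forms: those with smooth coefficients in every chart. -/
def SmoothForm (η : DForm (m := m) M d F) : Prop :=
  ∀ x₀ : M, ContDiffOn ℝ ∞ (inChart η x₀) (extChartAt 𝓘(ℝ, EM m) x₀).target

/-- The exterior derivative, computed at `x` in the preferred chart at `x`. -/
def extD (η : DForm (m := m) M d F) : DForm (m := m) M (d + 1) F := fun x =>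
  (extDeriv (inChart η x) (extChartAt 𝓘(ℝ, EM m) x x)).compContinuousLinearMap
    (mfderiv 𝓘(ℝ, EM m) 𝓘(ℝ, EM m) (extChartAt 𝓘(ℝ, EM m) x) x : EM m →L[ℝ] EM m)

/-- `φ` has compact support contained in `U`. -/
def CompactSupportIn (φ : DForm (m := m) M d F) (U : Set M) : Prop :=
  IsCompact (closure {x | φ x ≠ 0}) ∧ closure {x | φ x ≠ 0} ⊆ U

/-- Smooth real vector fields on `M`. -/
def SmoothField [IsManifold 𝓘(ℝ, EM m) ∞ M] (V : M → EM m) : Prop :=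
  ContMDiff 𝓘(ℝ, EM m) (𝓘(ℝ, EM m)).tangent ∞
    (fun x => (⟨x, V x⟩ : TangentBundle 𝓘(ℝ, EM m) M))

end Forms

/-- The standard basis vectors `e₀, …, e_{m-1}` of `ℝ^m`, extended by `0` to all indices. -/
def stdFrame (m : ℕ) (i : ℕ) : EM m :=
  if h : i < m then EuclideanSpace.single ⟨i, h⟩ 1 else 0

/-- The value of the wedge product `α ∧ β` on the vectors `v₀, …, v_{a+b-1}`, in the normalization
for which `dx₀ ∧ dx₁ (e₀, e₁) = 1`. -/
def wedgeEval {T : Type*} [AddCommGroup T] [Module ℝ T] [TopologicalSpace T] {a b : ℕ}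
    (α : T [⋀^Fin a]→L[ℝ] ℂ) (β : T [⋀^Fin b]→L[ℝ] ℂ) (v : Fin (a + b) → T) : ℂ :=
  ((a.factorial : ℂ) * (b.factorial : ℂ))⁻¹ *
    ∑ σ : Equiv.Perm (Fin (a + b)), ((Equiv.Perm.sign σ : ℤ) : ℂ) *
      (α (fun i => v (σ (Fin.castAdd b i))) * β (fun j => v (σ (Fin.natAdd a j))))

section WedgeLinear

variable {T : Type*} [AddCommGroup T] [Module ℝ T] [TopologicalSpace T] {a b : ℕ}
  (α α' : T [⋀^Fin a]→L[ℝ] ℂ) (β : T [⋀^Fin b]→L[ℝ] ℂ) (v : Fin (a + b) → T) (c : ℂ)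

lemma wedgeEval_zero : wedgeEval (0 : T [⋀^Fin a]→L[ℝ] ℂ) β v = 0 := by
  simp [wedgeEval]

lemma wedgeEval_add : wedgeEval (α + α') β v = wedgeEval α β v + wedgeEval α' β v := by
  simp only [wedgeEval, ContinuousAlternatingMap.add_apply, add_mul, mul_add,
    Finset.sum_add_distrib]

lemma wedgeEval_smul : wedgeEval (c • α) β v = c * wedgeEval α β v := by
  simp only [wedgeEval, ContinuousAlternatingMap.smul_apply, smul_eq_mul, mul_assoc,
    mul_left_comm _ c, ← Finset.mul_sum]

end WedgeLinear

/-! ### Integration over a manifold with a volume form -/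

section Density

variable {m : ℕ} {M : Type*}

/-- For `a + b = m`: the function `h` with `α ∧ β = h · vol`. -/
def wedgeDensity (vol : DForm (m := m) M m ℝ) {a b : ℕ} (α : DForm (m := m) M a ℂ)
    (β : DForm (m := m) M b ℂ) (x : M) : ℂ :=
  wedgeEval (α x) (β x) (fun i => stdFrame m i) /
    ((vol x (fun i => stdFrame m i) : ℝ) : ℂ)

variable {vol : DForm (m := m) M m ℝ} {a b : ℕ} (α α' : DForm (m := m) M a ℂ) (β : DForm (m := m) M b ℂ) (c : ℂ)

lemma wedgeDensity_zero : wedgeDensity vol (0 : DForm (m := m) M a ℂ) β = 0 := by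
  funext x
  simp [wedgeDensity, wedgeEval_zero]

lemma wedgeDensity_add :
    wedgeDensity vol (α + α') β = wedgeDensity vol α β + wedgeDensity vol α' β := by
  funext x
  simp only [wedgeDensity, Pi.add_apply, wedgeEval_add, add_div]

lemma wedgeDensity_smul : wedgeDensity vol (c • α) β = c • wedgeDensity vol α β := by
  funext x
  simp only [wedgeDensity, Pi.smul_apply, wedgeEval_smul, smul_eq_mul, mul_div_assoc]

end Density

section Volume

variable {m : ℕ} {M : Type*} [TopologicalSpace M] [ChartedSpace (EM m) M]

/-- A volume form on `M`: a smooth nowhere vanishing real form of top degree. It determines an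
orientation of `M`, and it is the Riemannian volume form of some metric. -/
structure IsVolumeForm (vol : DForm (m := m) M m ℝ) : Prop where
  smooth : SmoothForm vol
  ne_zero : ∀ x, vol x ≠ 0

variable [MeasurableSpace M]

/-- The measure on `M` that lives on the domain of the preferred chart at `x₀` and is there
`|vol (e₀, …, e_{m-1})|` times the Lebesgue measure of the chart. -/
def chartMeasure (vol : DForm (m := m) M m ℝ) (x₀ : M) : Measure M :=
  (((volume : Measure (EM m)).restrict (extChartAt 𝓘(ℝ, EM m) x₀).target).withDensity
    (fun y => ENNReal.ofReal |inChart vol x₀ y (fun i => stdFrame m i)|)).map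
      (extChartAt 𝓘(ℝ, EM m) x₀).symm

/-- The measure `dV` defined by the volume form. The measures `chartMeasure vol x₀` agree where
their chart domains overlap, and `dV` is the least measure above all of them, that is, the one
that restricts to each of them on its chart domain. -/
def volMeasure (vol : DForm (m := m) M m ℝ) : Measure M :=
  ⨆ x₀ : M, chartMeasure vol x₀

/-- For `a + b = m`: the integral of `α ∧ β` over `M`, oriented by `vol`. -/
def wedgeIntegral (vol : DForm (m := m) M m ℝ) {a b : ℕ} (α : DForm (m := m) M a ℂ)
    (β : DForm (m := m) M b ℂ) : ℂ :=
  ∫ x, wedgeDensity vol α β x ∂(volMeasure vol)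

/-- Absolute convergence of the integral of `α ∧ β` over `M`. -/
def WedgeIntegrable (vol : DForm (m := m) M m ℝ) {a b : ℕ} (α : DForm (m := m) M a ℂ)
    (β : DForm (m := m) M b ℂ) : Prop :=
  Integrable (wedgeDensity vol α β) (volMeasure vol)

end Volume

/-! ### The CR structure of a submanifold of a complex manifold -/

section CR

variable {n m : ℕ} {X : Type*} [TopologicalSpace X] [ChartedSpace (EX n) X]
  {M : Type*} [TopologicalSpace M] [ChartedSpace (EM m) M]

/-- The differential of `ι : M → X` at `x`. -/
def dmap (ι : M → X) (x : M) : EM m →L[ℝ] EX n :=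
  mfderiv 𝓘(ℝ, EM m) 𝓘(ℝ, EX n) ι x

/-- `H_{0,1} M = T_ℂ M ∩ T_{0,1} X` at `x`. A complex tangent vector `a + i b` of `M` is written as
the pair `(a, b)`; it belongs to `T_{0,1} X` iff `b = J a`, where `J`, the complex structure of `X`,
is the multiplication by `i` in holomorphic coordinates. -/
def H01 (ι : M → X) (x : M) :
    Submodule ℝ (EM m × EM m) where
  carrier := {w | dmap (n := n) ι x w.2 = Complex.I • dmap (n := n) ι x w.1}
  add_mem' := by
    intro w w' hw hw'
    simp only [mem_ofPred_eq] at hw hw' ⊢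
    rw [Prod.snd_add, Prod.fst_add, map_add, map_add, hw, hw', smul_add]
  zero_mem' := by simp
  smul_mem' := by
    intro c w hw
    simp only [mem_ofPred_eq] at hw ⊢
    rw [Prod.smul_snd, Prod.smul_fst, map_smul, map_smul, hw, smul_comm]

/-- `ι` embeds `M` as a smooth generic CR submanifold of real codimension `k` in the complex
`n`-dimensional manifold `X`: `H_{0,1} M` has complex rank `n - k`, i.e. real rank `2 (n - k)`. -/
structure IsGenericCR (k : ℕ) (ι : M → X) : Prop where
  embedding : IsSmoothEmbedding 𝓘(ℝ, EM m) 𝓘(ℝ, EX n) ∞ ι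
  codim : m + k = 2 * n
  codim_le : k ≤ n
  generic : ∀ x : M, Module.finrank ℝ (H01 (m := m) (n := n) ι x) = 2 * (n - k)

/-- The value of the complex multilinear extension of `η` on complex tangent vectors
`w_j = a_j + i b_j`, written as pairs `(a_j, b_j)`. -/
def cEval {T : Type*} [AddCommGroup T] [Module ℝ T] [TopologicalSpace T] {d : ℕ}
    (η : T [⋀^Fin d]→L[ℝ] ℂ) (w : Fin d → T × T) : ℂ :=
  ∑ s : Finset (Fin d), Complex.I ^ s.card * η (fun j => if j ∈ s then (w j).2 else (w j).1)

section CEvalLinear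

variable {T : Type*} [AddCommGroup T] [Module ℝ T] [TopologicalSpace T] {d : ℕ}
  (η η' : T [⋀^Fin d]→L[ℝ] ℂ) (w : Fin d → T × T) (c : ℂ)

lemma cEval_zero : cEval (0 : T [⋀^Fin d]→L[ℝ] ℂ) w = 0 := by
  simp [cEval]

lemma cEval_add : cEval (η + η') w = cEval η w + cEval η' w := by
  simp only [cEval, ContinuousAlternatingMap.add_apply, mul_add, Finset.sum_add_distrib]

lemma cEval_smul : cEval (c • η) w = c * cEval η w := by
  simp only [cEval, ContinuousAlternatingMap.smul_apply, smul_eq_mul, mul_left_comm _ c,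
    ← Finset.mul_sum]

end CEvalLinear

/-- The forms at `x` that represent the bidegree `(r, q)`: forms of degree `r + q` that vanish as
soon as at least `q + 1` of their arguments are in `H_{0,1} M`. Such a form `η` induces the element
`(L̄₁, …, L̄_q) ↦ ((W₁, …, W_r) ↦ η (L̄₁, …, L̄_q, W₁, …, W_r))` of
`Λ^{r,q} M = Λ^r (T_ℂ M / H_{0,1} M)^* ⊗ Λ^q (H_{0,1} M)^*`; every element of `Λ^{r,q} M` arises in
this way, and it is zero iff `η` vanishes as soon as `q` arguments are in `H_{0,1} M`.
The exterior derivative preserves this filtration and induces the operator `∂̄_b` on `Λ^{r,q} M`. -/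
def bidegree (ι : M → X) (x : M) (r q : ℕ) :
    Submodule ℂ (EM m [⋀^Fin (r + q)]→L[ℝ] ℂ) where
  carrier := {η | ∀ w : Fin (r + q) → EM m × EM m,
    q + 1 ≤ {j | w j ∈ H01 (n := n) ι x}.ncard → cEval η w = 0}
  add_mem' := by
    intro η η' h h' w hw
    rw [cEval_add, h w hw, h' w hw, add_zero]
  zero_mem' := fun w _ => cEval_zero w
  smul_mem' := by
    intro c η h w hw
    rw [cEval_smul, h w hw, mul_zero]

end CR

/-! ### The weak tangential Cauchy-Riemann operator and its `L^p` cohomology -/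

section Cohomology

variable {n m : ℕ} (k : ℕ) {X : Type*} [TopologicalSpace X] [ChartedSpace (EX n) X]
  {M : Type*} [TopologicalSpace M] [ChartedSpace (EM m) M] [IsManifold 𝓘(ℝ, EM m) ∞ M]
  [MeasurableSpace M] (ι : M → X) (vol : DForm (m := m) M m ℝ)

/-- `∂̄_b g = f` in the weak sense (in the sense of currents) in the open set `U`, for `g` of
bidegree `(r, q)` and `f` of bidegree `(r, q + 1)`: one has
`∫ f ∧ φ = (-1)^{r+q+1} ∫ g ∧ ∂̄_b φ` for all smooth forms `φ` of the complementary bidegree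
`(n - r, n - k - q - 1)` with compact support in `U`. (For locally integrable `f` and `g` the
integrals always converge; both only depend on the elements of `Λ^{r,q} M`, `Λ^{r,q+1} M` induced
by `g` and `f`, and `∂̄_b φ` is represented by `dφ`.) -/
def WeakDbar (U : Set M) {r q : ℕ} (g : DForm (m := m) M (r + q) ℂ)
    (f : DForm (m := m) M (r + (q + 1)) ℂ) : Prop :=
  ∀ r' q' : ℕ, r + r' = n → q + q' + 1 + k = n →
    ∀ φ : DForm (m := m) M (r' + q') ℂ, SmoothForm φ → (∀ x, φ x ∈ bidegree (n := n) ι x r' q') →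
      CompactSupportIn φ U →
        WedgeIntegrable vol f φ ∧ WedgeIntegrable vol g (extD φ) ∧
          wedgeIntegral vol f φ = (-1) ^ (r + q + 1) * wedgeIntegral vol g (extD φ)

/-- The forms of bidegree `(r, q)` on the open set `U` with `L^p` coefficients and with support in
the closed set `S`. The coefficients are the values on smooth vector fields of `M`.
This is only used when `U ∩ S` is relatively compact in `M`. The values outside `U` are
irrelevant, and a form stands for its class in `Λ^{r,q} M`. -/
def LpForms (U S : Set M) (p : ℝ) (r q : ℕ) : Submodule ℂ (DForm (m := m) M (r + q) ℂ) where
  carrier := {f |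
    (∀ V : Fin (r + q) → M → EM m, (∀ i, SmoothField (V i)) →
      MemLp (fun x => f x (fun i => V i x)) (ENNReal.ofReal p) ((volMeasure vol).restrict U)) ∧
    (∀ᵐ x ∂(volMeasure vol).restrict U, f x ∈ bidegree (n := n) ι x r q) ∧
    (∀ᵐ x ∂(volMeasure vol).restrict U, x ∉ S → f x = 0)}
  add_mem' := by
    rintro f g ⟨hf, hf', hf''⟩ ⟨hg, hg', hg''⟩
    refine ⟨fun V hV => (hf V hV).add (hg V hV), ?_, ?_⟩
    · filter_upwards [hf', hg'] with x h h' using Submodule.add_mem _ h h'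
    · filter_upwards [hf'', hg''] with x h h' hx
      rw [Pi.add_apply, h hx, h' hx, add_zero]
  zero_mem' := by
    refine ⟨fun V _ => MemLp.zero', ?_, ?_⟩
    · exact Eventually.of_forall fun x => Submodule.zero_mem _
    · exact Eventually.of_forall fun x _ => rfl
  smul_mem' := by
    rintro c f ⟨hf, hf', hf''⟩
    refine ⟨fun V hV => (hf V hV).const_smul c, ?_, ?_⟩
    · filter_upwards [hf'] with x h using Submodule.smul_mem _ c h
    · filter_upwards [hf''] with x h hx
      rw [Pi.smul_apply, h hx, smul_zero]

variable {k ι vol}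

section Linear

variable {U : Set M} {r q : ℕ}

lemma WeakDbar.zero : WeakDbar (n := n) k ι vol U (0 : DForm (m := m) M (r + q) ℂ) 0 := by
  intro r' q' _ _ φ _ _ _
  simp only [WedgeIntegrable, wedgeIntegral, wedgeDensity_zero]
  exact ⟨integrable_zero _ _ _, integrable_zero _ _ _, by simp⟩

lemma WeakDbar.add {g g' : DForm (m := m) M (r + q) ℂ} {f f' : DForm (m := m) M (r + (q + 1)) ℂ}
    (h : WeakDbar (n := n) k ι vol U g f) (h' : WeakDbar (n := n) k ι vol U g' f') :
    WeakDbar (n := n) k ι vol U (g + g') (f + f') := by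
  intro r' q' hr hq φ h1 h2 h3
  obtain ⟨i1, i2, i3⟩ := h r' q' hr hq φ h1 h2 h3
  obtain ⟨j1, j2, j3⟩ := h' r' q' hr hq φ h1 h2 h3
  simp only [WedgeIntegrable, wedgeIntegral, wedgeDensity_add] at *
  refine ⟨i1.add j1, i2.add j2, ?_⟩
  rw [integral_add' i1 j1, integral_add' i2 j2, i3, j3, mul_add]

lemma WeakDbar.smul (c : ℂ) {g : DForm (m := m) M (r + q) ℂ} {f : DForm (m := m) M (r + (q + 1)) ℂ}
    (h : WeakDbar (n := n) k ι vol U g f) :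
    WeakDbar (n := n) k ι vol U (c • g) (c • f) := by
  intro r' q' hr hq φ h1 h2 h3
  obtain ⟨i1, i2, i3⟩ := h r' q' hr hq φ h1 h2 h3
  simp only [WedgeIntegrable, wedgeIntegral, wedgeDensity_smul] at *
  refine ⟨i1.smul c, i2.smul c, ?_⟩
  have e1 : ∫ x, (c • wedgeDensity vol f φ) x ∂(volMeasure vol) =
      c * ∫ x, wedgeDensity vol f φ x ∂(volMeasure vol) := integral_const_mul c _
  have e2 : ∫ x, (c • wedgeDensity vol g (extD φ)) x ∂(volMeasure vol) =
      c * ∫ x, wedgeDensity vol g (extD φ) x ∂(volMeasure vol) := integral_const_mul c _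
  rw [e1, e2, i3]
  ring

lemma WeakDbar.neg {g : DForm (m := m) M (r + q) ℂ} {f : DForm (m := m) M (r + (q + 1)) ℂ}
    (h : WeakDbar (n := n) k ι vol U g f) :
    WeakDbar (n := n) k ι vol U ((-1 : ℂ) • g) (-f) := by
  have e : -f = (-1 : ℂ) • f := (neg_one_smul ℂ f).symm
  rw [e]
  exact h.smul _

lemma WeakDbar.neg_zero {g : DForm (m := m) M (r + q) ℂ}
    (h : WeakDbar (n := n) k ι vol U g 0) : WeakDbar (n := n) k ι vol U (-g) 0 := by
  have e : -g = (-1 : ℂ) • g := (neg_one_smul ℂ g).symm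
  have e' : (0 : DForm (m := m) M (r + (q + 1)) ℂ) = (-1 : ℂ) • 0 := (smul_zero _).symm
  rw [e, e']
  exact h.smul _

end Linear

variable (k ι vol)

/-- The `∂̄_b`-closed forms in `LpForms`. -/
def LpClosed (U S : Set M) (p : ℝ) (r q : ℕ) :
    AddSubgroup (LpForms (n := n) ι vol U S p r q) where
  carrier := {f | WeakDbar (n := n) k ι vol U (f : DForm (m := m) M (r + q) ℂ) 0}
  add_mem' := by
    intro f f' h h'
    have := WeakDbar.add h h'
    rwa [add_zero] at this
  zero_mem' := WeakDbar.zero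
  neg_mem' := fun h => WeakDbar.neg_zero h

/-- The `∂̄_b`-exact forms in `LpForms`: the forms `∂̄_b g` with `g` in `LpForms` of bidegree
`(r, q - 1)`, and only `0` for `q = 0`. -/
def LpExact (U S : Set M) (p : ℝ) (r : ℕ) :
    (q : ℕ) → AddSubgroup (LpForms (n := n) ι vol U S p r q)
  | 0 =>
    { carrier := {f | ∀ᵐ x ∂(volMeasure vol).restrict U, (f : DForm (m := m) M (r + 0) ℂ) x = 0}
      add_mem' := by
        intro f f' h h'
        rw [mem_ofPred_eq] at h h' ⊢
        filter_upwards [h, h'] with x hx hx'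
        exact (congrArg₂ (· + ·) hx hx').trans (add_zero _)
      zero_mem' := by
        rw [mem_ofPred_eq]
        exact Eventually.of_forall fun x => rfl
      neg_mem' := by
        intro f h
        rw [mem_ofPred_eq] at h ⊢
        filter_upwards [h] with x hx
        exact (congrArg (- ·) hx).trans neg_zero }
  | q + 1 =>
    { carrier := {f | ∃ g ∈ LpForms (n := n) ι vol U S p r q,
        WeakDbar (n := n) k ι vol U g (f : DForm (m := m) M (r + (q + 1)) ℂ)}
      add_mem' := by
        rintro f f' ⟨g, hg, h⟩ ⟨g', hg', h'⟩
        exact ⟨g + g', Submodule.add_mem _ hg hg', h.add h'⟩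
      zero_mem' := ⟨0, Submodule.zero_mem _, WeakDbar.zero⟩
      neg_mem' := by
        rintro f ⟨g, hg, h⟩
        exact ⟨(-1 : ℂ) • g, Submodule.smul_mem _ _ hg, WeakDbar.neg h⟩ }

/-- The cohomology group: closed forms modulo exact forms. -/
abbrev LpCohomology (U S : Set M) (p : ℝ) (r q : ℕ) : Type _ :=
  LpClosed (n := n) k ι vol U S p r q ⧸
    (LpExact (n := n) k ι vol U S p r q).addSubgroupOf (LpClosed (n := n) k ι vol U S p r q)

/-- The `L^p` topology on forms, i.e. the topology of `L^p` convergence of all coefficients: the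
coarsest one for which `f ↦ ‖(f - f₀) (V₁, …, V_{r+q})‖_p` is continuous for all forms `f₀` and all
smooth vector fields `V_i`. -/
@[reducible]
def lpTopology (U S : Set M) (p : ℝ) (r q : ℕ) :
    TopologicalSpace (LpForms (n := n) ι vol U S p r q) :=
  ⨅ (V : {V : Fin (r + q) → M → EM m // ∀ i, SmoothField (V i)})
    (f₀ : LpForms (n := n) ι vol U S p r q),
    TopologicalSpace.induced
      (fun f => eLpNorm (fun x => ((f : DForm (m := m) M (r + q) ℂ) x -
        (f₀ : DForm (m := m) M (r + q) ℂ) x) (fun i => V.1 i x))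
        (ENNReal.ofReal p) ((volMeasure vol).restrict U)) inferInstance

/-- The cohomology group is Hausdorff for the quotient topology. -/
def HausdorffCohomology (U S : Set M) (p : ℝ) (r q : ℕ) : Prop :=
  @T2Space (LpCohomology (n := n) k ι vol U S p r q)
    (TopologicalSpace.coinduced (QuotientAddGroup.mk)
      (TopologicalSpace.induced Subtype.val (lpTopology (n := n) ι vol U S p r q)))

/-- `H^{r,q}_{L^p}(D)`: the cohomology of the weak maximal `∂̄_b` on `L^p` forms on `D`. -/
abbrev HLp (D : Set M) (p : ℝ) (r q : ℕ) : Type _ :=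
  LpCohomology (n := n) k ι vol D univ p r q

/-- `H^{r,q}_{L^p}(D)` is Hausdorff. -/
abbrev HLpHausdorff (D : Set M) (p : ℝ) (r q : ℕ) : Prop :=
  HausdorffCohomology (n := n) k ι vol D univ p r q

/-- `H^{r,q}_{c̃,L^p}(D)`: the cohomology of the weak `∂̄_b` of `M` on `L^p` forms on `M` with support
in the closure of `D`. -/
abbrev HcLp (D : Set M) (p : ℝ) (r q : ℕ) : Type _ :=
  LpCohomology (n := n) k ι vol univ (closure D) p r q

end Cohomology

/-- A relatively compact domain with smooth boundary in `M`: near every boundary point it is the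
sublevel set `{ρ < 0}` of a smooth real function `ρ` with `dρ ≠ 0` at that point. -/
structure IsSmoothDomain {m : ℕ} {M : Type*} [TopologicalSpace M] [ChartedSpace (EM m) M]
    (D : Set M) : Prop where
  isOpen : IsOpen D
  isConnected : IsConnected D
  isCompact_closure : IsCompact (closure D)
  smooth_boundary : ∀ x ∈ frontier D, ∃ (U : Set M) (ρ : M → ℝ), IsOpen U ∧ x ∈ U ∧
    ContMDiffOn 𝓘(ℝ, EM m) 𝓘(ℝ, ℝ) ∞ ρ U ∧ mfderiv 𝓘(ℝ, EM m) 𝓘(ℝ, ℝ) ρ x ≠ 0 ∧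
      D ∩ U = {y | ρ y < 0} ∩ U

end CRLp

end

/-!
The theorem is proved by duality. Let `f` be a `∂̄_b`-closed form of type `(r, q)` with `L^p`
coefficients and support in the closure of `D`, and consider on `L^{p'}` forms `u` on `D` the
functional `∂̄_b u ↦ ∫_D f ∧ u` on the range of `∂̄_b` (`exists_functional`).

* It is well defined: if `∂̄_b u = 0` then `u` is exact, since the cohomology in which it lies
  vanishes, and exact forms on `D` are orthogonal to `f` (`integral_wedge_exact_eq_zero`).
* It is continuous: the next cohomology group is Hausdorff, so that the range of `∂̄_b` is closed
  (`isClosed_range`), and the open mapping theorem applies to the closed relation given by the weak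
  operator (`exists_closed_relation`, `exists_functional_of_isClosed_range`). It extends to all
  `L^{p'}` forms by the Hahn–Banach theorem.
* The extension is given by `L^p` densities (`exists_riesz`, from the Radon–Nikodym theorem), and
  hence by an `L^p` form `g` on `D`, as the wedge product of complementary degrees is a perfect
  pairing (`exists_wedgeStd_eq`, `exists_form_of_density`). The form `g` is of type `(r, q - 1)`
  because the functional vanishes on the forms that represent zero (`ae_sum_filCoord_eq_zero`,
  `mem_Fil_of_wedgeStd_eq_zero`).
* The restriction to `D` of a smooth form `φ` on `M` is in the domain of `∂̄_b` on `D`, by Stokes'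
  theorem (`weakDbar_extD`). Testing the functional with `∂̄_b φ` shows that the extension of `g` by
  zero satisfies `∂̄_b g = f` on all of `M`; here the boundary of `D` is a null set
  (`volMeasure_frontier`).

The analytic core is the orthogonality of `f` and `∂̄_b ψ`, where neither form is regular at the
boundary. It is a Green formula without boundary term. Near a point of `M` the immersion, in
holomorphic coordinates of `X` and completed by linear functions, is a map to `ℂ^m` whose
complexified differential is invertible and carries `H_{0,1} M` to a constant subspace
(`LocalModel`, `exists_straightening`). The pullbacks of the constant forms of `ℂ^m` are closed, so
that in this frame `∂̄_b` is a first-order operator with divergence-free coefficients. As `D` has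
a smooth boundary, there is a cone of directions that point from its closure into `D`
(`exists_cone`). The equation for `f` holds across the boundary and is tested with
`χ(x) ρ((y - x) / ε)` as a function of `x`; the equation for `ψ` is tested with `ρ((y - x) / ε)` as
a function of `y`, which is supported in `D` if `ρ` is supported in the cone. Integrating both
against the other form over the second variable and adding, the terms of order `ε⁻¹` combine to
difference quotients of the coefficients, whose limit is a divergence and vanishes
(`green_of_doubled_equations`). What remains is the term with `dχ`, and these terms cancel in the
sum over a partition of unity.

Forms are represented by their coefficients in a frame `L`, a measurable family of maps to `ℂ^m`
with invertible complexification (`IsFrameOn`). The coefficients form a complex alternating form on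
`ℂ^m` (`CForm`), and the type `(r, q)` is the constant condition `Fil n q`, that the form vanishes
as soon as `q + 1` arguments are in the span of the last `m - n` coordinate directions. A frame need
not be continuous, so that it exists over the closure of `D` by gluing (`exists_isFrameOn`), and it
identifies the `L^p` forms on `D` with tuples of functions in `Lp`.
-/

set_option linter.unusedSectionVars false

noncomputable section

namespace CRLp

/-! ### The wedge product of alternating forms -/

section Wedge

variable {T : Type*}

/-- The alternating sum of a function of `N` vectors over all permutations of its arguments. -/
def altSum {N : ℕ} (G : (Fin N → T) → ℂ) (v : Fin N → T) : ℂ :=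
  ∑ σ : Equiv.Perm (Fin N), ((Equiv.Perm.sign σ : ℤ) : ℂ) * G (v ∘ σ)

lemma altSum_comp_perm {N : ℕ} (G : (Fin N → T) → ℂ) (v : Fin N → T) (τ : Equiv.Perm (Fin N)) :
    altSum (fun w => G (w ∘ τ)) v = ((Equiv.Perm.sign τ : ℤ) : ℂ) * altSum G v := by
  unfold altSum
  rw [Finset.mul_sum]
  refine Fintype.sum_equiv (Equiv.mulRight τ) _ _ fun σ => ?_
  have h : ((Equiv.Perm.sign τ : ℤ) : ℂ) * ((Equiv.Perm.sign τ : ℤ) : ℂ) = 1 := by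
    rw [← Int.cast_mul, ← Units.val_mul, Int.units_mul_self]; simp
  simp only [Equiv.coe_mulRight, map_mul, Units.val_mul, Int.cast_mul, Equiv.Perm.coe_mul,
    Function.comp_assoc]
  linear_combination (-((Equiv.Perm.sign σ : ℤ) : ℂ) * G (v ∘ ⇑σ ∘ ⇑τ)) * h

lemma altSum_cast {N N' : ℕ} (h : N = N') (G : (Fin N → T) → ℂ) (v : Fin N' → T) :
    altSum (fun w => G (w ∘ Fin.cast h)) v = altSum G (v ∘ Fin.cast h) := by
  subst h; rfl

lemma altSum_sum {N : ℕ} {I : Type*} (s : Finset I) (G : I → (Fin N → T) → ℂ) (v : Fin N → T) :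
    altSum (fun w => ∑ i ∈ s, G i w) v = ∑ i ∈ s, altSum (G i) v := by
  unfold altSum
  simp only [Finset.mul_sum]
  exact Finset.sum_comm

lemma altSum_const_mul {N : ℕ} (c : ℂ) (G : (Fin N → T) → ℂ) (v : Fin N → T) :
    altSum (fun w => c * G w) v = c * altSum G v := by
  unfold altSum
  rw [Finset.mul_sum]
  exact Finset.sum_congr rfl fun _ _ => by ring

variable [AddCommGroup T] [Module ℝ T] [TopologicalSpace T]

lemma wedgeEval_eq_altSum {a b : ℕ} (α : T [⋀^Fin a]→L[ℝ] ℂ) (β : T [⋀^Fin b]→L[ℝ] ℂ)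
    (v : Fin (a + b) → T) :
    wedgeEval α β v = ((a.factorial : ℂ) * (b.factorial : ℂ))⁻¹ *
      altSum (fun w => α (w ∘ Fin.castAdd b) * β (w ∘ Fin.natAdd a)) v := rfl

/-- Graded commutativity of the wedge product. The vectors are indexed by `ℕ` to avoid casts. -/
lemma exists_wedgeEval_comm (a b : ℕ) : ∃ ε : ℂ, ε * ε = 1 ∧
    ∀ {T : Type} [AddCommGroup T] [Module ℝ T] [TopologicalSpace T]
      (α : T [⋀^Fin a]→L[ℝ] ℂ) (β : T [⋀^Fin b]→L[ℝ] ℂ) (v : ℕ → T),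
      wedgeEval α β (fun i => v i) = ε * wedgeEval β α (fun i => v i) := by
  let τ : Equiv.Perm (Fin (a + b)) := (finCongr (Nat.add_comm a b)).trans finAddFlip
  refine ⟨((Equiv.Perm.sign τ : ℤ) : ℂ), ?_, fun {T} _ _ _ α β v => ?_⟩
  · rw [← Int.cast_mul, ← Units.val_mul, Int.units_mul_self]; simp
  have h1 := altSum_cast (Nat.add_comm b a)
    (fun w : Fin (b + a) → T => β (w ∘ Fin.castAdd a) * α (w ∘ Fin.natAdd b)) (fun i => v i)
  have h2 := altSum_comp_perm (fun w : Fin (a + b) → T =>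
        β ((w ∘ Fin.cast (Nat.add_comm b a)) ∘ Fin.castAdd a) *
          α ((w ∘ Fin.cast (Nat.add_comm b a)) ∘ Fin.natAdd b)) (fun i => v i) τ
  have h3 : ⇑τ ∘ Fin.cast (Nat.add_comm b a) ∘ Fin.castAdd a = Fin.natAdd a := by
    funext i; simp [τ]
  have h4 : ⇑τ ∘ Fin.cast (Nat.add_comm b a) ∘ Fin.natAdd b = Fin.castAdd b := by
    funext i; simp [τ]
  simp only [Function.comp_assoc, h3, h4] at h1 h2
  rw [h1] at h2
  rw [wedgeEval_eq_altSum, wedgeEval_eq_altSum, mul_left_comm, mul_comm (b.factorial : ℂ)]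
  refine congrArg _ (Eq.trans ?_ h2)
  exact congrArg (altSum · _) (funext fun w => mul_comm _ _)

end Wedge

section Alternatize

variable {T : Type*} [NormedAddCommGroup T] [NormedSpace ℝ T]

open ContinuousAlternatingMap in
/-- Moving a covector from the right factor of a wedge product to the left one. -/
lemma wedgeEval_alternatize_right {a b : ℕ} (α : T [⋀^Fin a]→L[ℝ] ℂ) (l : T →L[ℝ] ℂ)
    (β : T [⋀^Fin b]→L[ℝ] ℂ) (v : ℕ → T) :
    wedgeEval α (alternatizeUncurryFin (l.smulRight β)) (fun i => v i) =
      (-1) ^ a * wedgeEval (alternatizeUncurryFin (l.smulRight α)) β (fun i => v i) := by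
  -- both sides are multiples of the alternating sum of `l (w 0) * α (w 1, …) * β (…)`
  let G : (Fin (a + 1 + b) → T) → ℂ := fun w =>
    l (w (Fin.castAdd b 0)) * α ((w ∘ Fin.castAdd b) ∘ Fin.succ) * β (w ∘ Fin.natAdd (a + 1))
  let G' : (Fin (a + (b + 1)) → T) → ℂ := fun w =>
    α (w ∘ Fin.castAdd (b + 1)) * (l (w (Fin.natAdd a 0)) *
      β ((w ∘ Fin.natAdd a) ∘ Fin.succ))
  have hl : altSum (fun w : Fin (a + 1 + b) → T =>
      alternatizeUncurryFin (l.smulRight α) (w ∘ Fin.castAdd b) * β (w ∘ Fin.natAdd (a + 1)))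
      (fun i => v i) = (a + 1) * altSum G (fun i => v i) := by
    have h (i : Fin (a + 1)) := altSum_comp_perm G (fun i => v i)
      (finSumFinEquiv.permCongr (Equiv.Perm.sumCongr i.cycleRange.symm (1 : Equiv.Perm (Fin b))))
    have e : (fun w : Fin (a + 1 + b) → T =>
        alternatizeUncurryFin (l.smulRight α) (w ∘ Fin.castAdd b) * β (w ∘ Fin.natAdd (a + 1))) =
      fun w => ∑ i : Fin (a + 1), (-1) ^ (i : ℕ) * G (w ∘ (finSumFinEquiv.permCongr
        (Equiv.Perm.sumCongr i.cycleRange.symm (1 : Equiv.Perm (Fin b))))) := by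
      funext w
      rw [alternatizeUncurryFin_apply, Finset.sum_mul]
      refine Finset.sum_congr rfl fun i _ => ?_
      have e1 : i.removeNth (w ∘ Fin.castAdd b) = ((w ∘ ⇑(finSumFinEquiv.permCongr
        (Equiv.Perm.sumCongr i.cycleRange.symm (1 : Equiv.Perm (Fin b))))) ∘ Fin.castAdd b) ∘
          Fin.succ := by
        funext j
        simp [Fin.removeNth]
      have e2 : w ∘ Fin.natAdd (a + 1) = (w ∘ ⇑(finSumFinEquiv.permCongr
        (Equiv.Perm.sumCongr i.cycleRange.symm (1 : Equiv.Perm (Fin b))))) ∘ Fin.natAdd (a + 1) := by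
        funext j
        simp
      have e3 : (w ∘ ⇑(finSumFinEquiv.permCongr
        (Equiv.Perm.sumCongr i.cycleRange.symm (1 : Equiv.Perm (Fin b))))) (Fin.castAdd b 0) =
          w (Fin.castAdd b i) := by
        simp
      simp only [G, e1, ← e2, e3]
      simp [mul_assoc]
    rw [e, altSum_sum]
    have : ∀ i : Fin (a + 1), altSum (fun w => (-1) ^ (i : ℕ) * G (w ∘ (finSumFinEquiv.permCongr
        (Equiv.Perm.sumCongr i.cycleRange.symm (1 : Equiv.Perm (Fin b)))))) (fun i => v i) =
        altSum G (fun i => v i) := by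
      intro i
      rw [altSum_const_mul, h i]
      simp [Equiv.Perm.sign_symm, ← mul_assoc, ← mul_pow]
    rw [Finset.sum_congr rfl fun i _ => this i]
    simp
  have hr : altSum (fun w : Fin (a + (b + 1)) → T =>
      α (w ∘ Fin.castAdd (b + 1)) * alternatizeUncurryFin (l.smulRight β) (w ∘ Fin.natAdd a))
      (fun i => v i) = (b + 1) * altSum G' (fun i => v i) := by
    have h (i : Fin (b + 1)) := altSum_comp_perm G' (fun i => v i)
      (finSumFinEquiv.permCongr (Equiv.Perm.sumCongr (1 : Equiv.Perm (Fin a)) i.cycleRange.symm))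
    have e : (fun w : Fin (a + (b + 1)) → T =>
        α (w ∘ Fin.castAdd (b + 1)) * alternatizeUncurryFin (l.smulRight β) (w ∘ Fin.natAdd a)) =
      fun w => ∑ i : Fin (b + 1), (-1) ^ (i : ℕ) * G' (w ∘ (finSumFinEquiv.permCongr
        (Equiv.Perm.sumCongr (1 : Equiv.Perm (Fin a)) i.cycleRange.symm))) := by
      funext w
      rw [alternatizeUncurryFin_apply, Finset.mul_sum]
      refine Finset.sum_congr rfl fun i _ => ?_
      have e1 : i.removeNth (w ∘ Fin.natAdd a) = ((w ∘ ⇑(finSumFinEquiv.permCongr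
        (Equiv.Perm.sumCongr (1 : Equiv.Perm (Fin a)) i.cycleRange.symm))) ∘ Fin.natAdd a) ∘
          Fin.succ := by
        funext j
        simp [Fin.removeNth]
      have e2 : w ∘ Fin.castAdd (b + 1) = (w ∘ ⇑(finSumFinEquiv.permCongr
        (Equiv.Perm.sumCongr (1 : Equiv.Perm (Fin a)) i.cycleRange.symm))) ∘ Fin.castAdd (b + 1) := by
        funext j
        simp
      have e3 : (w ∘ ⇑(finSumFinEquiv.permCongr
        (Equiv.Perm.sumCongr (1 : Equiv.Perm (Fin a)) i.cycleRange.symm))) (Fin.natAdd a 0) =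
          w (Fin.natAdd a i) := by
        simp
      simp only [G', e1, ← e2, e3]
      simp [mul_left_comm]
    rw [e, altSum_sum]
    have : ∀ i : Fin (b + 1), altSum (fun w => (-1) ^ (i : ℕ) * G' (w ∘ (finSumFinEquiv.permCongr
        (Equiv.Perm.sumCongr (1 : Equiv.Perm (Fin a)) i.cycleRange.symm)))) (fun i => v i) =
        altSum G' (fun i => v i) := by
      intro i
      rw [altSum_const_mul, h i]
      simp [Equiv.Perm.sign_symm, ← mul_assoc, ← mul_pow]
    rw [Finset.sum_congr rfl fun i _ => this i]
    simp
  have hc : altSum G' (fun i => v i) = (-1) ^ a * altSum G (fun i => v i) := by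
    have hN : a + (b + 1) = a + 1 + b := by omega
    have h1 := altSum_cast hN G' (fun i => v i)
    have h2 := altSum_comp_perm G (fun i => v i) (finSumFinEquiv.permCongr
      (Equiv.Perm.sumCongr (Fin.last a).cycleRange.symm (1 : Equiv.Perm (Fin b))))
    have e : (fun w => G (w ∘ (finSumFinEquiv.permCongr
      (Equiv.Perm.sumCongr (Fin.last a).cycleRange.symm (1 : Equiv.Perm (Fin b)))))) =
        fun w => G' (w ∘ Fin.cast hN) := by
      funext w
      simp only [G, G']
      have e1 : ((w ∘ ⇑(finSumFinEquiv.permCongr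
        (Equiv.Perm.sumCongr (Fin.last a).cycleRange.symm (1 : Equiv.Perm (Fin b))))) ∘
          Fin.castAdd b) ∘ Fin.succ = (w ∘ Fin.cast hN) ∘ Fin.castAdd (b + 1) := by
        funext j
        simp [-Fin.cycleRange_last]
        rfl
      have e2 : (w ∘ ⇑(finSumFinEquiv.permCongr
        (Equiv.Perm.sumCongr (Fin.last a).cycleRange.symm (1 : Equiv.Perm (Fin b))))) ∘
          Fin.natAdd (a + 1) = ((w ∘ Fin.cast hN) ∘ Fin.natAdd a) ∘ Fin.succ := by
        funext j
        simp
        congr 1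
        ext
        simp
        omega
      have e3 : (w ∘ ⇑(finSumFinEquiv.permCongr
        (Equiv.Perm.sumCongr (Fin.last a).cycleRange.symm (1 : Equiv.Perm (Fin b)))))
          (Fin.castAdd b 0) = (w ∘ Fin.cast hN) (Fin.natAdd a 0) := by
        simp [-Fin.cycleRange_last]
        congr 1
      rw [e1, e2, e3]
      ring
    rw [e, h1] at h2
    refine Eq.trans ?_ (h2.trans ?_)
    · rfl
    · simp [Equiv.Perm.sign_symm]
  rw [wedgeEval_eq_altSum, wedgeEval_eq_altSum, hl, hr, hc]
  have ha : (a.factorial : ℂ) ≠ 0 := by exact_mod_cast a.factorial_ne_zero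
  have hb : (b.factorial : ℂ) ≠ 0 := by exact_mod_cast b.factorial_ne_zero
  have ha' : (a : ℂ) + 1 ≠ 0 := by exact_mod_cast a.succ_ne_zero
  have hb' : (b : ℂ) + 1 ≠ 0 := by exact_mod_cast b.succ_ne_zero
  rw [Nat.factorial_succ, Nat.factorial_succ]
  push_cast
  field_simp

end Alternatize

/-! ### Complex alternating forms as a model for forms on a real vector space -/

section Model

variable {m d a b : ℕ}

/-- Complex multilinear alternating forms on `ℂ^m`. -/
abbrev CForm (m d : ℕ) : Type := EX m [⋀^Fin d]→L[ℂ] ℂ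

/-- The standard basis vectors of `ℂ^m`, extended by `0` to all indices. -/
def stdC (m : ℕ) (i : ℕ) : EX m :=
  if h : i < m then EuclideanSpace.single ⟨i, h⟩ 1 else 0

/-- A complex alternating form, regarded as a real alternating form. -/
def realForm (θ : CForm m d) : EX m [⋀^Fin d]→L[ℝ] ℂ := θ.restrictScalars ℝ

lemma realForm_apply (θ : CForm m d) (v : Fin d → EX m) : realForm θ v = θ v := rfl

/-- The pullback of a complex form on `ℂ^m` under a real linear map `ℝ^m → ℂ^m`. -/
def pull (L : EM m →L[ℝ] EX m) (θ : CForm m d) : EM m [⋀^Fin d]→L[ℝ] ℂ :=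
  (realForm θ).compContinuousLinearMap L

lemma pull_apply (L : EM m →L[ℝ] EX m) (θ : CForm m d) (v : Fin d → EM m) :
    pull L θ v = θ (fun j => L (v j)) := rfl

lemma pull_add (L : EM m →L[ℝ] EX m) (θ θ' : CForm m d) :
    pull L (θ + θ') = pull L θ + pull L θ' := by
  ext v; rfl

lemma pull_smul (L : EM m →L[ℝ] EX m) (c : ℂ) (θ : CForm m d) :
    pull L (c • θ) = c • pull L θ := by
  ext v; rfl

lemma pull_comp (L : EM m →L[ℝ] EX m) (A : EM m →L[ℝ] EM m) (θ : CForm m d) :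
    (pull L θ).compContinuousLinearMap A = pull (L ∘L A) θ := by
  ext v; rfl

/-- The coefficient of `α ∧ β` with respect to the standard volume form of `ℂ^m`. -/
def wedgeStd (α : CForm m a) (β : CForm m b) : ℂ :=
  wedgeEval (realForm α) (realForm β) (fun i => stdC m i)

/-- The complex linear extension to `ℂ^m` of a real linear map on `ℝ^m`. -/
def cext (L : EM m →L[ℝ] EX m) : EX m →L[ℂ] EX m :=
  ∑ i : Fin m, (EuclideanSpace.proj i : EX m →L[ℂ] ℂ).smulRight (L (EuclideanSpace.single i 1))

/-- The vector `a + i b` of `ℂ^m`. -/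
def join (w : EM m × EM m) : EX m := WithLp.toLp 2 fun i => (w.1 i : ℂ) + Complex.I * (w.2 i : ℂ)

/-- The real and imaginary parts of a vector of `ℂ^m`. -/
def split (u : EX m) : EM m × EM m :=
  (WithLp.toLp 2 fun i => (u i).re, WithLp.toLp 2 fun i => (u i).im)

lemma join_split (u : EX m) : join (split u) = u := by
  ext i
  simp [join, split, mul_comm Complex.I, Complex.re_add_im]

lemma sum_single (v : EM m) : v = ∑ i, v i • EuclideanSpace.single i (1 : ℝ) := by
  ext j
  simp [Finset.sum_apply, Pi.single_apply]

lemma cext_apply (L : EM m →L[ℝ] EX m) (u : EX m) :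
    cext L u = ∑ i, u i • L (EuclideanSpace.single i 1) := by
  simp [cext]

lemma cext_join (L : EM m →L[ℝ] EX m) (w : EM m × EM m) :
    cext L (join w) = L w.1 + Complex.I • L w.2 := by
  conv_rhs => rw [sum_single w.1, sum_single w.2]
  rw [cext_apply]
  simp only [map_sum, map_smul, Finset.smul_sum, ← Finset.sum_add_distrib]
  refine Finset.sum_congr rfl fun i _ => ?_
  ext j
  simp [join]
  ring

lemma cext_stdC (L : EM m →L[ℝ] EX m) (i : ℕ) : cext L (stdC m i) = L (stdFrame m i) := by
  unfold stdC stdFrame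
  split_ifs with h
  · rw [cext_apply]
    simp
  · simp

lemma cEval_pull (L : EM m →L[ℝ] EX m) (θ : CForm m d) (w : Fin d → EM m × EM m) :
    cEval (pull L θ) w = θ (fun j => cext L (join (w j))) := by
  have h : (fun j => cext L (join (w j))) =
      (fun j => Complex.I • L (w j).2) + fun j => L (w j).1 := by
    funext j
    rw [cext_join, add_comm]
    rfl
  rw [h]
  have := θ.toMultilinearMap.map_add_univ (fun j => Complex.I • L (w j).2) fun j => L (w j).1
  refine Eq.trans ?_ this.symm
  refine Finset.sum_congr rfl fun s _ => ?_
  have e : (s.piecewise (fun j => Complex.I • L (w j).2) fun j => L (w j).1) =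
      s.piecewise (fun j => Complex.I • (L (if j ∈ s then (w j).2 else (w j).1)))
        (fun j => L (if j ∈ s then (w j).2 else (w j).1)) := by
    funext j
    by_cases hj : j ∈ s <;> simp [hj]
  rw [e]
  have h2 := θ.toMultilinearMap.map_piecewise_smul (fun _ => Complex.I)
    (fun j => L (if j ∈ s then (w j).2 else (w j).1)) s
  refine Eq.trans ?_ h2.symm
  simp
  rfl

lemma stdC_fin (i : Fin m) : stdC m i = EuclideanSpace.single i 1 := by
  simp [stdC]

lemma stdFrame_fin (i : Fin m) : stdFrame m i = EuclideanSpace.single i 1 := by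
  simp [stdFrame]

/-- A top-degree form is multiplied by the determinant under a change of frame. -/
lemma wedgeEval_linearMap (h : a + b = m) (α : CForm m a) (β : CForm m b) (A : EX m →ₗ[ℂ] EX m) :
    wedgeEval (realForm α) (realForm β) (fun i => A (stdC m i)) =
      LinearMap.det A * wedgeStd α β := by
  subst h
  let G : MultilinearMap ℂ (fun _ : Fin (a + b) => EX (a + b)) ℂ :=
    ((LinearMap.mul' ℂ ℂ).compMultilinearMap (MultilinearMap.domCoprod
      α.toMultilinearMap β.toMultilinearMap)).domDomCongr finSumFinEquiv
  let F := MultilinearMap.alternatization G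
  have hF (v : Fin (a + b) → EX (a + b)) : wedgeEval (realForm α) (realForm β) v =
      ((a.factorial : ℂ) * (b.factorial : ℂ))⁻¹ * F v := by
    simp only [F, MultilinearMap.alternatization_apply, wedgeEval]
    congr 1
    refine Finset.sum_congr rfl fun σ _ => ?_
    simp only [G, Units.smul_def, zsmul_eq_mul, MultilinearMap.domDomCongr_apply,
      LinearMap.compMultilinearMap_apply, MultilinearMap.domCoprod_apply, LinearMap.mul'_apply]
    simp [realForm_apply]
  let e := (EuclideanSpace.basisFun (Fin (a + b)) ℂ).toBasis
  have he : ∀ i : Fin (a + b), stdC (a + b) i = e i := by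
    intro i; simp [e, stdC_fin]
  have hFe := F.eq_smul_basis_det e
  unfold wedgeStd
  rw [hF, hF, hFe]
  simp only [he, AlternatingMap.smul_apply, smul_eq_mul]
  have h1 : (fun i => A (e i)) = A ∘ e := rfl
  have h2 : (fun i => e i) = e := rfl
  rw [h1, h2, Module.Basis.det_comp_basis, Module.Basis.det_self]
  simp
  ring

/-- In the frame given by the components of `L`, the wedge product of two forms is the constant
`wedgeStd α β` times the determinant of the frame. -/
lemma wedgeEval_pull (h : a + b = m) (L : EM m →L[ℝ] EX m) (α : CForm m a) (β : CForm m b) :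
    wedgeEval (pull L α) (pull L β) (fun i => stdFrame m i) =
      LinearMap.det (cext L : EX m →ₗ[ℂ] EX m) * wedgeStd α β := by
  rw [← wedgeEval_linearMap h]
  simp only [ContinuousLinearMap.coe_coe, cext_stdC]
  rfl

/-- The inclusion of `ℝ^m` into `ℂ^m`. -/
def inclR (m : ℕ) : EM m →L[ℝ] EX m :=
  LinearMap.toContinuousLinearMap
    { toFun := fun v => WithLp.toLp 2 fun i => (v i : ℂ)
      map_add' := fun v w => by ext i; simp
      map_smul' := fun c v => by ext i; simp }

lemma inclR_apply (v : EM m) (i : Fin m) : inclR m v i = (v i : ℂ) := rfl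

lemma cext_comp (L : EM m →L[ℝ] EX m) (A : EM m →L[ℝ] EM m) :
    cext (L ∘L A) = cext L ∘L cext (inclR m ∘L A) := by
  have key (v : EM m) : L v = cext L (inclR m v) := by
    rw [cext_apply]
    conv_lhs => rw [sum_single v]
    simp [inclR_apply]
  ext1 u
  simp only [cext_apply (L ∘L A), ContinuousLinearMap.comp_apply, cext_apply (inclR m ∘L A)]
  rw [map_sum]
  refine Finset.sum_congr rfl fun i _ => ?_
  rw [map_smul, key]

/-- The complexification of a real endomorphism has the same determinant. -/
lemma det_cext_inclR (A : EM m →L[ℝ] EM m) :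
    LinearMap.det (cext (inclR m ∘L A) : EX m →ₗ[ℂ] EX m) =
      ((LinearMap.det (A : EM m →ₗ[ℝ] EM m) : ℝ) : ℂ) := by
  rw [← LinearMap.det_toMatrix (EuclideanSpace.basisFun (Fin m) ℂ).toBasis,
    ← LinearMap.det_toMatrix (EuclideanSpace.basisFun (Fin m) ℝ).toBasis]
  have := RingHom.map_det (Complex.ofRealHom) (LinearMap.toMatrix
    (EuclideanSpace.basisFun (Fin m) ℝ).toBasis (EuclideanSpace.basisFun (Fin m) ℝ).toBasis
      (A : EM m →ₗ[ℝ] EM m))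
  refine Eq.trans ?_ this.symm
  congr 1
  ext i j
  simp [LinearMap.toMatrix_apply, inclR_apply, cext_apply]

lemma det_cext_comp (L : EM m →L[ℝ] EX m) (A : EM m →L[ℝ] EM m) :
    LinearMap.det (cext (L ∘L A) : EX m →ₗ[ℂ] EX m) =
      LinearMap.det (cext L : EX m →ₗ[ℂ] EX m) *
        ((LinearMap.det (A : EM m →ₗ[ℝ] EM m) : ℝ) : ℂ) := by
  rw [cext_comp, ← det_cext_inclR, ContinuousLinearMap.toLinearMap_comp, LinearMap.det_comp]

/-- Every real alternating form on `ℝ^m` is the restriction of a complex one. -/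
lemma exists_pull_inclR (η : EM m [⋀^Fin d]→L[ℝ] ℂ) : ∃ θ : CForm m d, pull (inclR m) θ = η := by
  let mono (σ : Fin d → Fin m) : CForm m d := ContinuousMultilinearMap.alternatization
    ((ContinuousMultilinearMap.mkPiAlgebra ℂ (Fin d) ℂ).compContinuousLinearMap
      fun j => (EuclideanSpace.proj (σ j) : EX m →L[ℂ] ℂ))
  have hmono (σ : Fin d → Fin m) (v : Fin d → EX m) :
      mono σ v = ∑ τ : Equiv.Perm (Fin d), ((Equiv.Perm.sign τ : ℤ) : ℂ) * ∏ j, v (τ j) (σ j) := by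
    simp only [mono, ContinuousMultilinearMap.alternatization_apply_apply, Units.smul_def, zsmul_eq_mul]
    rfl
  have hd : (d.factorial : ℂ) ≠ 0 := by exact_mod_cast d.factorial_ne_zero
  refine ⟨∑ σ : Fin d → Fin m, ((d.factorial : ℂ)⁻¹ *
    η (fun j => EuclideanSpace.single (σ j) 1)) • mono σ, ?_⟩
  ext v
  have hη : η v = ∑ σ : Fin d → Fin m, (∏ j, (v j (σ j) : ℂ)) *
      η (fun j => EuclideanSpace.single (σ j) 1) := by
    conv_lhs => rw [show v = fun j => ∑ i, v j i • EuclideanSpace.single i (1 : ℝ) from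
      funext fun j => sum_single (v j)]
    have := η.toMultilinearMap.map_sum (fun j i => v j i • EuclideanSpace.single i (1 : ℝ))
    refine Eq.trans this (Finset.sum_congr rfl fun σ _ => ?_)
    have := η.toMultilinearMap.map_smul_univ (fun j => v j (σ j))
      (fun j => EuclideanSpace.single (σ j) (1 : ℝ))
    refine Eq.trans this ?_
    simp [Complex.real_smul]
  rw [pull_apply, hη]
  simp only [ContinuousAlternatingMap.sum_apply, ContinuousAlternatingMap.smul_apply, smul_eq_mul,
    hmono, inclR_apply, Finset.mul_sum]
  rw [Finset.sum_comm]
  have (τ : Equiv.Perm (Fin d)) : ∑ σ : Fin d → Fin m, (d.factorial : ℂ)⁻¹ *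
      η (fun j => EuclideanSpace.single (σ j) 1) *
        (((Equiv.Perm.sign τ : ℤ) : ℂ) * ∏ j, (v (τ j) (σ j) : ℂ)) =
      (d.factorial : ℂ)⁻¹ * ∑ σ : Fin d → Fin m, (∏ j, (v j (σ j) : ℂ)) *
      η (fun j => EuclideanSpace.single (σ j) 1) := by
    rw [Finset.mul_sum]
    refine (Fintype.sum_equiv (Equiv.arrowCongr τ (Equiv.refl (Fin m))) _ _ fun σ => ?_)
    have e1 : η (fun j => EuclideanSpace.single (σ (τ.symm j)) (1 : ℝ)) =
        ((Equiv.Perm.sign τ : ℤ) : ℂ) * η (fun j => EuclideanSpace.single (σ j) 1) := by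
      have := η.toAlternatingMap.map_perm (fun j => EuclideanSpace.single (σ j) (1 : ℝ)) τ.symm
      refine Eq.trans this ?_
      simp [Units.smul_def]
    have e2 : ∏ j, (v j (σ (τ.symm j)) : ℂ) = ∏ j, (v (τ j) (σ j) : ℂ) := by
      rw [← Equiv.prod_comp τ]
      simp
    simp only [Equiv.arrowCongr_apply, Equiv.coe_refl, Function.comp_apply, id]
    rw [e1, e2]
    ring
  rw [Finset.sum_congr rfl fun τ _ => this τ, Finset.sum_const, Finset.card_univ,
    Fintype.card_perm, Fintype.card_fin, nsmul_eq_mul, ← mul_assoc, mul_inv_cancel₀ hd, one_mul]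

lemma CForm.ext_std {θ θ' : CForm m d} (h : ∀ σ : Fin d → Fin m, Function.Injective σ →
    θ (fun j => stdC m (σ j)) = θ' (fun j => stdC m (σ j))) : θ = θ' := by
  apply ContinuousAlternatingMap.toAlternatingMap_injective
  refine Module.Basis.ext_alternating (EuclideanSpace.basisFun (Fin m) ℂ).toBasis fun σ hσ => ?_
  simpa [stdC_fin] using h σ hσ

/-- The coefficients of a complex alternating form in the standard basis. -/
def coeffs (m d : ℕ) : CForm m d →ₗ[ℂ] ((Fin d → Fin m) → ℂ) where
  toFun θ := fun σ => θ (fun j => stdC m (σ j))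
  map_add' _ _ := rfl
  map_smul' _ _ := rfl

lemma coeffs_injective : Function.Injective (coeffs m d) := fun _ _ h =>
  CForm.ext_std fun σ _ => congrFun h σ

instance : FiniteDimensional ℂ (CForm m d) :=
  FiniteDimensional.of_injective _ coeffs_injective

instance : FiniteDimensional ℝ (CForm m d) := FiniteDimensional.complexToReal _

end Model

/-! ### Representing real forms in a complex frame -/

section Trivialization

variable {m d a b : ℕ}

lemma cext_inclR : cext (inclR m) = ContinuousLinearMap.id ℂ (EX m) := by
  ext u i
  simp [cext_apply, inclR_apply, apply_ite Complex.ofReal]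

/-- The complex multilinear extension to `ℂ^m` of a real alternating form on `ℝ^m`. -/
def extC (η : EM m [⋀^Fin d]→L[ℝ] ℂ) : CForm m d := (exists_pull_inclR η).choose

lemma pull_extC (η : EM m [⋀^Fin d]→L[ℝ] ℂ) : pull (inclR m) (extC η) = η :=
  (exists_pull_inclR η).choose_spec

lemma extC_apply (η : EM m [⋀^Fin d]→L[ℝ] ℂ) (v : Fin d → EX m) :
    extC η v = cEval η (fun j => split (v j)) := by
  conv_rhs => rw [← pull_extC η, cEval_pull]
  simp [cext_inclR, join_split]

/-- The complex form that represents the real form `η` in the complex frame given by the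
columns of `Z`. -/
def tri (Z : EX m →L[ℂ] EX m) (η : EM m [⋀^Fin d]→L[ℝ] ℂ) : CForm m d :=
  (extC η).compContinuousLinearMap Z

lemma tri_apply (Z : EX m →L[ℂ] EX m) (η : EM m [⋀^Fin d]→L[ℝ] ℂ) (v : Fin d → EX m) :
    tri Z η v = cEval η (fun j => split (Z (v j))) := extC_apply _ _

lemma cext_apply_inclR (L : EM m →L[ℝ] EX m) (v : EM m) : cext L (inclR m v) = L v := by
  rw [cext_apply]
  conv_rhs => rw [sum_single v]
  simp [inclR_apply]

lemma pull_tri {L : EM m →L[ℝ] EX m} {Z : EX m →L[ℂ] EX m} (h : ∀ u, Z (cext L u) = u)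
    (η : EM m [⋀^Fin d]→L[ℝ] ℂ) : pull L (tri Z η) = η := by
  ext v
  have : (fun j => Z (L (v j))) = fun j => inclR m (v j) := by
    funext j
    rw [← cext_apply_inclR L, h]
  conv_rhs => rw [← pull_extC η, pull_apply, ← this]
  rfl

lemma tri_pull {L : EM m →L[ℝ] EX m} {Z : EX m →L[ℂ] EX m} (h : ∀ u, cext L (Z u) = u)
    (θ : CForm m d) : tri Z (pull L θ) = θ := by
  ext v
  rw [tri_apply, cEval_pull]
  simp [join_split, h]

end Trivialization

/-! ### The filtration by the number of antiholomorphic arguments -/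

section Filtration

variable {m d a b n : ℕ}

/-- The span of the last `m - n` coordinate directions of `ℂ^m`. -/
def H0 (n m : ℕ) : Set (EX m) := {u | ∀ i : Fin m, (i : ℕ) < n → u i = 0}

/-- The complex forms that vanish as soon as `t + 1` of their arguments are in `H0 n m`. -/
def Fil (n t : ℕ) : Submodule ℂ (CForm m d) where
  carrier := {θ | ∀ v : Fin d → EX m, t + 1 ≤ {j | v j ∈ H0 n m}.ncard → θ v = 0}
  add_mem' := fun h h' v hv => by
    rw [ContinuousAlternatingMap.add_apply, h v hv, h' v hv, add_zero]
  zero_mem' := fun _ _ => rfl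
  smul_mem' := fun c θ h v hv => by
    rw [ContinuousAlternatingMap.smul_apply, h v hv, smul_zero]

/-- If `H` is the space of vectors that the frame `L` sends to the span of the last coordinate
directions, then vanishing on `t + 1` vectors of `H` is membership in `Fil n t` for the form of
coefficients in the frame. -/
lemma mem_Fil_iff_cEval {L : EM m →L[ℝ] EX m} (hL : Function.Surjective (cext L))
    {H : Set (EM m × EM m)} (hH : ∀ w, w ∈ H ↔ cext L (join w) ∈ H0 n m) (θ : CForm m d) (t : ℕ) :
    (∀ w : Fin d → EM m × EM m, t + 1 ≤ {j | w j ∈ H}.ncard → cEval (pull L θ) w = 0) ↔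
      θ ∈ Fil n t := by
  constructor
  · intro h v hv
    choose u hu using fun j => hL (v j)
    have := h (fun j => split (u j)) (by simpa [hH, join_split, hu] using hv)
    rw [cEval_pull] at this
    simpa [join_split, hu] using this
  · intro h w hw
    rw [cEval_pull]
    exact h _ (by simpa [hH] using hw)

open ContinuousAlternatingMap in
/-- The wedge product with a covector. -/
def wedge1 (l : EX m →L[ℂ] ℂ) (θ : CForm m d) : CForm m (d + 1) :=
  alternatizeUncurryFin (l.smulRight θ)

lemma wedge1_apply (l : EX m →L[ℂ] ℂ) (θ : CForm m d) (v : Fin (d + 1) → EX m) :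
    wedge1 l θ v = ∑ i : Fin (d + 1), (-1) ^ (i : ℕ) * (l (v i) * θ (i.removeNth v)) := by
  simp [wedge1, ContinuousAlternatingMap.alternatizeUncurryFin_apply]

open ContinuousAlternatingMap in
lemma realForm_wedge1 (l : EX m →L[ℂ] ℂ) (θ : CForm m d) :
    realForm (wedge1 l θ) =
      alternatizeUncurryFin ((l.restrictScalars ℝ).smulRight (realForm θ)) := by
  ext v
  rw [realForm_apply, wedge1_apply, alternatizeUncurryFin_apply]
  simp [realForm_apply]

open ContinuousAlternatingMap in
lemma pull_wedge1 (L : EM m →L[ℝ] EX m) (l : EX m →L[ℂ] ℂ) (θ : CForm m d) :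
    alternatizeUncurryFin (((l.restrictScalars ℝ) ∘L L).smulRight (pull L θ)) =
      pull L (wedge1 l θ) := by
  ext v
  rw [pull_apply, wedge1_apply, alternatizeUncurryFin_apply]
  simp [pull_apply]
  rfl

/-- Every complex covector on `ℝ^m` is a combination of the components of a frame. -/
lemma exists_covector {L : EM m →L[ℝ] EX m} {Z : EX m →L[ℂ] EX m} (h : ∀ u, Z (cext L u) = u)
    (l : EM m →L[ℝ] ℂ) : ∃ l' : EX m →L[ℂ] ℂ, l = (l'.restrictScalars ℝ) ∘L L := by
  refine ⟨(∑ i : Fin m, (EuclideanSpace.proj i : EX m →L[ℂ] ℂ).smulRight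
    (l (EuclideanSpace.single i 1))) ∘L Z, ?_⟩
  ext v
  have : Z (L v) = inclR m v := by rw [← cext_apply_inclR L, h]
  simp only [ContinuousLinearMap.comp_apply, ContinuousLinearMap.coe_restrictScalars', this]
  conv_lhs => rw [sum_single v]
  simp [inclR_apply]

/-- Omitting an argument lowers the number of arguments with the property `P` by at most one, and
not at all if the omitted argument does not have it. -/
lemma ncard_removeNth (P : EX m → Prop) (v : Fin (d + 1) → EX m) (i : Fin (d + 1)) :
    {j | P (v j)}.ncard ≤ {j | P (i.removeNth v j)}.ncard + 1 ∧
      (¬ P (v i) → {j | P (v j)}.ncard ≤ {j | P (i.removeNth v j)}.ncard) := by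
  have h1 : {j | P (v j)} ⊆ insert i (i.succAbove '' {j | P (i.removeNth v j)}) := by
    intro j hj
    rcases eq_or_ne j i with rfl | hji
    · exact mem_insert _ _
    · obtain ⟨k, rfl⟩ := Fin.exists_succAbove_eq hji
      exact mem_insert_of_mem _ ⟨k, hj, rfl⟩
  constructor
  · refine (ncard_le_ncard h1 (toFinite _)).trans ((ncard_insert_le _ _).trans ?_)
    exact Nat.add_le_add_right (ncard_image_le (toFinite _)) 1
  · intro hi
    have h2 : {j | P (v j)} ⊆ i.succAbove '' {j | P (i.removeNth v j)} := by
      intro j hj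
      rcases h1 hj with rfl | h
      · exact absurd hj hi
      · exact h
    exact (ncard_le_ncard h2 (toFinite _)).trans (ncard_image_le (toFinite _))

/-- A covector has at most one antiholomorphic argument. -/
lemma wedge1_mem_Fil (l : EX m →L[ℂ] ℂ) {θ : CForm m d} {t : ℕ} (h : θ ∈ Fil n t) :
    wedge1 l θ ∈ Fil n (t + 1) := by
  intro v hv
  rw [wedge1_apply]
  refine Finset.sum_eq_zero fun i _ => ?_
  have := (ncard_removeNth (· ∈ H0 n m) v i).1
  rw [h (i.removeNth v) (by omega)]
  simp

/-- A covector that vanishes on the antiholomorphic directions does not raise the filtration. -/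
lemma wedge1_mem_Fil_of_eq_zero {l : EX m →L[ℂ] ℂ} (hl : ∀ u ∈ H0 n m, l u = 0)
    {θ : CForm m d} {t : ℕ} (h : θ ∈ Fil n t) : wedge1 l θ ∈ Fil n t := by
  intro v hv
  rw [wedge1_apply]
  refine Finset.sum_eq_zero fun i _ => ?_
  by_cases hi : v i ∈ H0 n m
  · rw [hl _ hi]; simp
  · have := (ncard_removeNth (· ∈ H0 n m) v i).2 hi
    rw [h (i.removeNth v) (by omega)]
    simp

lemma wedgeStd_wedge1 (α : CForm m a) (l : EX m →L[ℂ] ℂ) (β : CForm m b) :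
    wedgeStd α (wedge1 l β) = (-1) ^ a * wedgeStd (wedge1 l α) β := by
  unfold wedgeStd
  rw [realForm_wedge1, realForm_wedge1]
  exact wedgeEval_alternatize_right _ _ _ _

lemma stdC_apply (i j : Fin m) : stdC m i j = if j = i then 1 else 0 := by
  simp [stdC_fin]

/-- The wedge pairing is nondegenerate, and the filtration tells how much of the second factor is
needed to detect a coefficient of the first one. -/
lemma exists_wedgeStd_ne_zero (b : ℕ) : ∀ (a t : ℕ), a + b = m → ∀ (θ : CForm m a)
    (σ : Fin a → Fin m), Function.Injective σ → {i : Fin m | n ≤ i ∧ i ∉ range σ}.ncard ≤ t →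
      θ (fun j => stdC m (σ j)) ≠ 0 → ∃ β ∈ Fil (m := m) (d := b) n t, wedgeStd θ β ≠ 0 := by
  induction b with
  | zero =>
    intro a t h θ σ hσ ht hθ
    obtain rfl : a = m := by omega
    refine ⟨ContinuousAlternatingMap.constOfIsEmpty ℂ (EX a) (Fin 0) 1, ?_, ?_⟩
    · intro v hv
      simp [Set.eq_empty_of_isEmpty] at hv
    · let e := Equiv.ofBijective σ (Finite.injective_iff_bijective.1 hσ)
      -- `σ` is a permutation, so `θ` is a nonzero multiple of the determinant
      have h1 : ∀ τ : Equiv.Perm (Fin a), θ (fun j => stdC a (τ j)) =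
          ((Equiv.Perm.sign τ : ℤ) : ℂ) * θ (fun j => stdC a j) := by
        intro τ
        have := θ.toAlternatingMap.map_perm (fun j => stdC a j) τ
        refine Eq.trans this ?_
        simp [Units.smul_def]
      have h2 : θ (fun j => stdC a j) ≠ 0 := by
        intro h0
        apply hθ
        have := h1 e
        rw [h0, mul_zero] at this
        exact this
      have hs (τ : Equiv.Perm (Fin a)) :
          ((Equiv.Perm.sign τ : ℤ) : ℂ) * ((Equiv.Perm.sign τ : ℤ) : ℂ) = 1 := by
        rw [← Int.cast_mul, ← Units.val_mul, Int.units_mul_self]; simp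
      have h3 : wedgeStd θ (ContinuousAlternatingMap.constOfIsEmpty ℂ (EX a) (Fin 0) 1) =
          θ (fun j => stdC a j) := by
        have : ∀ τ : Equiv.Perm (Fin (a + 0)), ((Equiv.Perm.sign τ : ℤ) : ℂ) *
            (θ (fun i => stdC a (τ (Fin.castAdd 0 i))) * 1) = θ (fun j => stdC a j) := by
          intro τ
          have := h1 τ
          rw [mul_one]
          refine (congrArg _ this).trans ?_
          rw [← mul_assoc, hs, one_mul]
        refine Eq.trans (congrArg (_ * ·) (Finset.sum_congr rfl fun τ _ => this τ)) ?_
        have hf : (a.factorial : ℂ) ≠ 0 := by exact_mod_cast a.factorial_ne_zero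
        simp [Fintype.card_perm, hf]
      rw [h3]
      exact h2
  | succ b ih =>
    intro a t h θ σ hσ ht hθ
    -- multiply `θ` by a coordinate covector `l` whose index `c` does not occur in `σ`, and find a
    -- `β` for the product: then `l ∧ β` serves for `θ`
    obtain ⟨c, hc⟩ : ∃ c, c ∉ range σ := by
      by_contra! hcon
      have := Fintype.card_le_of_surjective σ hcon
      simp at this
      omega
    let l : EX m →L[ℂ] ℂ := EuclideanSpace.proj c
    have hl (j : Fin a) : l (stdC m (σ j)) = 0 := by
      have : c ≠ σ j := fun h => hc ⟨j, h.symm⟩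
      simp [l, stdC_apply, this]
    let σ' : Fin (a + 1) → Fin m := Fin.cons c σ
    have hσ' : Function.Injective σ' := Fin.cons_injective_iff.2 ⟨hc, hσ⟩
    have hθ' : wedge1 l θ (fun j => stdC m (σ' j)) ≠ 0 := by
      rw [wedge1_apply, Fin.sum_univ_succ, Finset.sum_eq_zero]
      · have e : (Fin.removeNth 0 fun j => stdC m (σ' j)) = fun j => stdC m (σ j) := by
          funext j; simp [Fin.removeNth, σ']
        rw [e]
        simpa [σ', l, stdC_apply] using hθ
      · intro i _
        have : l (stdC m (σ' i.succ)) = 0 := hl i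
        rw [this]
        simp
    have hr : {i : Fin m | n ≤ i ∧ i ∉ range σ} \ {c} = {i : Fin m | n ≤ i ∧ i ∉ range σ'} := by
      ext i
      simp only [Set.mem_sdiff, mem_ofPred_eq, mem_singleton_iff, σ', Fin.range_cons, mem_insert_iff,
        not_or]
      tauto
    have key : ∀ β : CForm m b, wedgeStd (wedge1 l θ) β ≠ 0 → wedgeStd θ (wedge1 l β) ≠ 0 := by
      intro β hβ
      rw [wedgeStd_wedge1]
      exact mul_ne_zero (pow_ne_zero _ (by norm_num)) hβ
    -- an index `c ≥ n` uses up one of the `t` antiholomorphic arguments, an index `c < n` none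
    by_cases hcn : n ≤ c
    · have hmem : c ∈ {i : Fin m | n ≤ i ∧ i ∉ range σ} := ⟨hcn, hc⟩
      have h1 := ncard_sdiff_singleton_add_one hmem (toFinite _)
      rw [hr] at h1
      obtain ⟨t, rfl⟩ : ∃ t', t = t' + 1 := ⟨t - 1, by omega⟩
      obtain ⟨β, hβ, hβ'⟩ := ih (a + 1) t (by omega) (wedge1 l θ) σ' hσ' (by omega) hθ'
      exact ⟨wedge1 l β, wedge1_mem_Fil l hβ, key β hβ'⟩
    · have h1 : {i : Fin m | n ≤ i ∧ i ∉ range σ'}.ncard ≤ t := by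
        rw [← hr]
        exact (ncard_le_ncard sdiff_subset (toFinite _)).trans ht
      obtain ⟨β, hβ, hβ'⟩ := ih (a + 1) t (by omega) (wedge1 l θ) σ' hσ' h1 hθ'
      refine ⟨wedge1 l β, wedge1_mem_Fil_of_eq_zero (fun u hu => hu c (by omega)) hβ, key β hβ'⟩

lemma CForm.apply_eq_sum (θ : CForm m d) (v : Fin d → EX m) :
    θ v = ∑ σ : Fin d → Fin m, (∏ j, v j (σ j)) * θ (fun j => stdC m (σ j)) := by
  have hv (u : EX m) : u = ∑ i : Fin m, u i • stdC m i := by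
    ext j
    simp [stdC_apply]
  conv_lhs => rw [show v = fun j => ∑ i : Fin m, v j i • stdC m i from funext fun j => hv (v j)]
  have := θ.toMultilinearMap.map_sum (fun j (i : Fin m) => v j i • stdC m i)
  refine Eq.trans this (Finset.sum_congr rfl fun σ _ => ?_)
  exact θ.toMultilinearMap.map_smul_univ (fun j => v j (σ j)) (fun j => stdC m (σ j))

lemma ncard_ge (n m : ℕ) : {i : Fin m | n ≤ i}.ncard = m - n := by
  have : {i : Fin m | n ≤ (i : ℕ)} = ((Finset.univ.filter fun i : Fin m => ¬ (i : ℕ) < n : Finset (Fin m)) : Set (Fin m)) := by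
    ext i; simp
  rw [this, ncard_coe_finset]
  have h1 := Finset.card_filter_add_card_filter_not (s := (Finset.univ : Finset (Fin m))) (fun i : Fin m => (i : ℕ) < n)
  have h2 := Fin.card_filter_val_lt (n := m) (m := n)
  simp only [Finset.card_univ, Fintype.card_fin] at h1
  rw [h2] at h1
  omega

/-- A form that is orthogonal to a step of the filtration belongs to the complementary step. -/
lemma mem_Fil_of_wedgeStd_eq_zero (h : a + b = m) {s t : ℕ} (hst : m ≤ n + (t + s + 1))
    (θ : CForm m a) (hθ : ∀ β ∈ Fil (m := m) (d := b) n t, wedgeStd θ β = 0) : θ ∈ Fil n s := by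
  -- a coefficient with `s + 1` antiholomorphic indices leaves at most `t` of them to its
  -- complement, so it would be detected by some `β` in the orthogonal step
  have key (σ : Fin a → Fin m) (hs : s + 1 ≤ {j | n ≤ (σ j : ℕ)}.ncard) :
      θ (fun j => stdC m (σ j)) = 0 := by
    by_cases hσ : Function.Injective σ
    · by_contra hne
      have h1 : {i : Fin m | n ≤ i ∧ i ∉ range σ} = {i : Fin m | n ≤ i} \
          (σ '' {j | n ≤ (σ j : ℕ)}) := by
        ext i
        simp only [mem_ofPred_eq, Set.mem_sdiff, mem_image, not_exists, not_and, mem_range]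
        constructor
        · rintro ⟨h1, h2⟩
          exact ⟨h1, fun j _ => h2 j⟩
        · rintro ⟨h1, h2⟩
          refine ⟨h1, fun j hj => h2 j ?_ hj⟩
          rw [hj]; exact h1
      have h2 : {i : Fin m | n ≤ i ∧ i ∉ range σ}.ncard ≤ t := by
        rw [h1, ncard_sdiff (by rintro _ ⟨j, hj, rfl⟩; exact hj) (toFinite _),
          ncard_image_of_injective _ hσ, ncard_ge]
        omega
      obtain ⟨β, hβ, hβ'⟩ := exists_wedgeStd_ne_zero b a t h θ σ hσ h2 hne
      exact hβ' (hθ β hβ)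
    · simp only [Function.Injective, not_forall] at hσ
      obtain ⟨i, j, hij, hne⟩ := hσ
      exact θ.toAlternatingMap.map_eq_zero_of_eq _ (by simp [hij]) hne
  intro v hv
  rw [CForm.apply_eq_sum]
  refine Finset.sum_eq_zero fun σ _ => ?_
  by_cases hs : s + 1 ≤ {j | n ≤ (σ j : ℕ)}.ncard
  · rw [key σ hs, mul_zero]
  · obtain ⟨j, hj, hj'⟩ : ∃ j, v j ∈ H0 n m ∧ ¬ n ≤ (σ j : ℕ) := by
      by_contra! hcon
      exact hs (hv.trans (ncard_le_ncard (fun j hj => hcon j hj) (toFinite _)))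
    rw [Finset.prod_eq_zero (Finset.mem_univ j) (hj _ (by omega)), zero_mul]

/-- For reasons of bidegree: of the `m - n` antiholomorphic directions, at most `s` are accounted
for by `α` and at most `t` by `β`. -/
lemma wedgeStd_eq_zero (h : a + b = m) {s t : ℕ} (hst : n + (t + s) < m) {α : CForm m a}
    (hα : α ∈ Fil n s) {β : CForm m b} (hβ : β ∈ Fil n t) : wedgeStd α β = 0 := by
  subst h
  unfold wedgeStd wedgeEval
  rw [Finset.sum_eq_zero, mul_zero]
  intro σ _
  have h1 : σ ⁻¹' {i | n ≤ (i : ℕ)} ⊆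
      (Fin.castAdd b '' {j | n ≤ (σ (Fin.castAdd b j) : ℕ)}) ∪
        (Fin.natAdd a '' {j | n ≤ (σ (Fin.natAdd a j) : ℕ)}) := by
    intro i hi
    refine Fin.addCases (motive := fun i => n ≤ (σ i : ℕ) → i ∈ (Fin.castAdd b '' {j | n ≤ (σ (Fin.castAdd b j) : ℕ)}) ∪
        (Fin.natAdd a '' {j | n ≤ (σ (Fin.natAdd a j) : ℕ)})) (fun j hj => Or.inl ⟨j, hj, rfl⟩)
        (fun j hj => Or.inr ⟨j, hj, rfl⟩) i hi
  have h2 := (ncard_le_ncard h1 (toFinite _)).trans (ncard_union_le _ _)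
  rw [ncard_preimage_of_injective_subset_range σ.injective (by simp), ncard_ge] at h2
  have h3 := ncard_image_le (f := Fin.castAdd b) (toFinite {j | n ≤ (σ (Fin.castAdd b j) : ℕ)})
  have h4 := ncard_image_le (f := Fin.natAdd (m := b) a) (toFinite {j | n ≤ (σ (Fin.natAdd a j) : ℕ)})
  have hH (i : Fin (a + b)) (hi : n ≤ (i : ℕ)) : stdC (a + b) i ∈ H0 n (a + b) := by
    intro j hj
    rw [stdC_apply, if_neg]
    rintro rfl
    omega
  by_cases hs : s + 1 ≤ {j | n ≤ (σ (Fin.castAdd b j) : ℕ)}.ncard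
  · have := hα (fun i => stdC (a + b) (σ (Fin.castAdd b i)))
      (hs.trans (ncard_le_ncard (fun j hj => hH _ hj) (toFinite _)))
    rw [realForm_apply, this]
    simp
  · have hs' : t + 1 ≤ {j | n ≤ (σ (Fin.natAdd a j) : ℕ)}.ncard := by omega
    have := hβ (fun i => stdC (a + b) (σ (Fin.natAdd a i)))
      (hs'.trans (ncard_le_ncard (fun j hj => hH _ hj) (toFinite _)))
    rw [realForm_apply, realForm_apply, this]
    simp

end Filtration

/-! ### Green's formula for weak solutions by doubling of variables -/

section Doubling

variable {m : ℕ} {p q : ℝ≥0∞}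

/-- Hölder's inequality. -/
lemma norm_integral_mul_le [hpq : p.HolderConjugate q] {α : Type*} [MeasurableSpace α]
    {μ : Measure α} {a b : α → ℂ} (ha : MemLp a p μ) (hb : MemLp b q μ) :
    ∫ x, ‖a x‖ * ‖b x‖ ∂μ ≤ (eLpNorm a p μ).toReal * (eLpNorm b q μ).toReal := by
  have h1 : ∫ x, ‖a x‖ * ‖b x‖ ∂μ = (eLpNorm (a • b) 1 μ).toReal := by
    rw [eLpNorm_one_eq_lintegral_enorm, ← integral_norm_eq_lintegral_enorm]
    · simp
    · exact ha.1.smul hb.1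
  rw [h1, ← ENNReal.toReal_mul]
  exact ENNReal.toReal_mono (ENNReal.mul_ne_top ha.eLpNorm_ne_top hb.eLpNorm_ne_top)
    (eLpNorm_smul_le_mul_eLpNorm hb.1 ha.1)

lemma measurePreserving_add_smul (ε : ℝ) (z : EM m) :
    MeasurePreserving (fun x : EM m => x + ε • z) volume volume :=
  measurePreserving_add_right volume (ε • z)

lemma memLp_shift {b : EM m → ℂ} (hb : MemLp b q volume) (ε : ℝ) (z : EM m) :
    MemLp (fun x => b (x + ε • z)) q volume :=
  hb.comp_measurePreserving (measurePreserving_add_smul ε z)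

lemma eLpNorm_shift {b : EM m → ℂ} (hb : MemLp b q volume) (ε : ℝ) (z : EM m) :
    eLpNorm (fun x => b (x + ε • z)) q volume = eLpNorm b q volume :=
  eLpNorm_comp_measurePreserving hb.1 (measurePreserving_add_smul ε z)

lemma aestronglyMeasurable_shift {b : EM m → ℂ} (hb : AEStronglyMeasurable b volume) (ε : ℝ) :
    AEStronglyMeasurable (fun w : EM m × EM m => b (w.2 + ε • w.1)) (volume.prod volume) := by
  refine hb.comp_quasiMeasurePreserving (QuasiMeasurePreserving.prod_of_right
    (f := fun w : EM m × EM m => w.2 + ε • w.1) (by fun_prop) ?_)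
  exact Eventually.of_forall fun z => (measurePreserving_add_smul ε z).quasiMeasurePreserving

/-- Translation is continuous in `L^q`, for `q` finite. -/
lemma tendsto_eLpNorm_shift_sub [Fact (1 ≤ q)] (hq : q ≠ ⊤) {b : EM m → ℂ}
    (hb : MemLp b q volume) (z : EM m) :
    Tendsto (fun ε : ℝ => (eLpNorm (fun x => b (x + ε • z) - b x) q volume).toReal)
      (𝓝 0) (𝓝 0) := by
  let g : C(ℝ, C(EM m, EM m)) := (ContinuousMap.mk
    (fun w : ℝ × EM m => w.2 + w.1 • z) (by fun_prop)).curry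
  have h0 : g 0 = ContinuousMap.id (EM m) := by
    ext1 x; simp [g]
  have h := Tendsto.compMeasurePreservingLp (l := 𝓝 (0 : ℝ)) (f := fun _ => hb.toLp b)
    (tendsto_const_nhds) (g.continuous.tendsto 0)
    (fun ε => measurePreserving_add_smul ε z) (measurePreserving_add_smul 0 z) hq
  have e (ε : ℝ) : Lp.compMeasurePreserving (g ε) (measurePreserving_add_smul ε z) (hb.toLp b) =
      (memLp_shift hb ε z).toLp _ := Lp.toLp_compMeasurePreserving hb _
  simp only [e] at h
  rw [Lp.tendsto_Lp_iff_tendsto_eLpNorm''] at h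
  have := (ENNReal.tendsto_toReal ENNReal.zero_ne_top).comp h
  simpa [Function.comp_def, Pi.sub_def] using this

lemma integrable_shift_section [p.HolderConjugate q] {a b : EM m → ℂ} (ha : MemLp a p volume)
    (hb : MemLp b q volume) {c : EM m → ℂ} (hc : AEStronglyMeasurable c volume) {C : ℝ}
    (hC : ∀ x, ‖c x‖ ≤ C) (ε : ℝ) (z : EM m) :
    Integrable (fun x => a x * b (x + ε • z) * c x) volume :=
  (ha.integrable_mul (memLp_shift hb ε z)).mul_bdd (c := C) hc (Eventually.of_forall hC)

lemma norm_integral_shift_le [p.HolderConjugate q] {a b : EM m → ℂ} (ha : MemLp a p volume)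
    (hb : MemLp b q volume) {c : EM m → ℂ} {C : ℝ}
    (hC : ∀ x, ‖c x‖ ≤ C) :
    ∫ x, ‖a x * b x * c x‖ ≤
      C * ((eLpNorm a p volume).toReal * (eLpNorm b q volume).toReal) := by
  have hC0 : 0 ≤ C := (norm_nonneg _).trans (hC 0)
  refine le_trans ?_ (mul_le_mul_of_nonneg_left (norm_integral_mul_le ha hb) hC0)
  rw [← integral_const_mul]
  refine integral_mono_of_nonneg (Eventually.of_forall fun x => norm_nonneg _)
    (((ha.integrable_mul hb).norm.const_mul C).congr (Eventually.of_forall fun x => ?_))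
    (Eventually.of_forall fun x => ?_)
  · simp
  · simp only [norm_mul]
    rw [mul_comm]
    exact mul_le_mul_of_nonneg_right (hC x) (by positivity)

/-- The bound on `z` is needed since `a(x) b(x + εz)` is integrable in `x` only, uniformly in
`z`. -/
lemma integrable_shift [p.HolderConjugate q] {a b : EM m → ℂ} (ha : MemLp a p volume)
    (hb : MemLp b q volume) {c : EM m × EM m → ℂ} (hc : StronglyMeasurable c) {C R : ℝ}
    (hC : ∀ w, ‖c w‖ ≤ C) (hR : ∀ z x, R < ‖z‖ → c (z, x) = 0) (ε : ℝ) :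
    Integrable (fun w : EM m × EM m => a w.2 * b (w.2 + ε • w.1) * c w) (volume.prod volume) := by
  have hm : AEStronglyMeasurable (fun w : EM m × EM m => a w.2 * b (w.2 + ε • w.1) * c w)
      (volume.prod volume) :=
    ((ha.1.comp_snd).mul (aestronglyMeasurable_shift hb.1 ε)).mul hc.aestronglyMeasurable
  rw [integrable_prod_iff hm]
  have hcz (z : EM m) : AEStronglyMeasurable (fun x => c (z, x)) volume :=
    (hc.comp_measurable measurable_prodMk_left).aestronglyMeasurable
  refine ⟨Eventually.of_forall fun z => integrable_shift_section ha hb (hcz z)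
    (fun x => hC _) ε z, ?_⟩
  have hbd : Integrable ((Metric.closedBall (0 : EM m) R).indicator fun _ =>
      C * ((eLpNorm a p volume).toReal * (eLpNorm b q volume).toReal)) volume :=
    (integrable_indicator_iff Metric.isClosed_closedBall.measurableSet).2
      (integrableOn_const (isCompact_closedBall _ _).measure_lt_top.ne)
  refine hbd.mono' (AEStronglyMeasurable.integral_prod_right' hm.norm)
    (Eventually.of_forall fun z => ?_)
  rw [Real.norm_of_nonneg (integral_nonneg fun _ => norm_nonneg _)]
  by_cases hz : z ∈ Metric.closedBall (0 : EM m) R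
  · rw [indicator_of_mem hz, ← eLpNorm_shift hb ε z]
    exact norm_integral_shift_le ha (memLp_shift hb ε z) fun x => hC (z, x)
  · rw [indicator_of_notMem hz]
    have : R < ‖z‖ := by simpa using hz
    simp [hR z _ this]

/-- The limit of the doubled integrals as the shift tends to zero, for coefficients that converge
pointwise and boundedly. -/
lemma tendsto_shift [p.HolderConjugate q] [Fact (1 ≤ q)] (hq : q ≠ ⊤) {a b : EM m → ℂ}
    (ha : MemLp a p volume) (hb : MemLp b q volume) {c : ℝ → EM m × EM m → ℂ}
    {c₀ : EM m × EM m → ℂ} (hc : ∀ ε, StronglyMeasurable (c ε))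
    {C R : ℝ} (hC : ∀ᶠ ε in 𝓝[>] (0 : ℝ), ∀ w, ‖c ε w‖ ≤ C)
    (hR : ∀ ε z x, R < ‖z‖ → c ε (z, x) = 0)
    (hlim : ∀ w, Tendsto (fun ε => c ε w) (𝓝[>] 0) (𝓝 (c₀ w))) :
    Tendsto (fun ε => ∫ z, ∫ x, a x * b (x + ε • z) * c ε (z, x)) (𝓝[>] 0)
      (𝓝 (∫ z, ∫ x, a x * b x * c₀ (z, x))) := by
  have hcz (ε : ℝ) (z : EM m) : AEStronglyMeasurable (fun x => c ε (z, x)) volume :=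
    ((hc ε).comp_measurable measurable_prodMk_left).aestronglyMeasurable
  refine tendsto_integral_filter_of_dominated_convergence
    ((Metric.closedBall (0 : EM m) R).indicator fun _ =>
      C * ((eLpNorm a p volume).toReal * (eLpNorm b q volume).toReal)) ?_ ?_ ?_ ?_
  · refine Eventually.of_forall fun ε => AEStronglyMeasurable.integral_prod_right'
      (f := fun w : EM m × EM m => a w.2 * b (w.2 + ε • w.1) * c ε w) ?_
    exact ((ha.1.comp_snd).mul (aestronglyMeasurable_shift hb.1 ε)).mul
      (hc ε).aestronglyMeasurable
  · filter_upwards [hC] with ε hε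
    refine Eventually.of_forall fun z => ?_
    by_cases hz : z ∈ Metric.closedBall (0 : EM m) R
    · rw [indicator_of_mem hz, ← eLpNorm_shift hb ε z]
      exact (norm_integral_le_integral_norm _).trans
        (norm_integral_shift_le ha (memLp_shift hb ε z) fun x => hε (z, x))
    · rw [indicator_of_notMem hz]
      have : R < ‖z‖ := by simpa using hz
      simp [hR ε z _ this]
  · exact (integrable_indicator_iff Metric.isClosed_closedBall.measurableSet).2
      (integrableOn_const (isCompact_closedBall _ _).measure_lt_top.ne)
  · refine Eventually.of_forall fun z => ?_
    -- the shifted factor converges in `L^q`, and the coefficient converges boundedly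
    have h1 : Tendsto (fun ε => ∫ x, a x * (b (x + ε • z) - b x) * c ε (z, x)) (𝓝[>] 0)
        (𝓝 0) := by
      have h2 := ((tendsto_eLpNorm_shift_sub hq hb z).mono_left
        (nhdsWithin_le_nhds (s := Ioi 0))).const_mul ((eLpNorm a p volume).toReal)
      have h3 := h2.const_mul C
      simp only [mul_zero] at h3
      refine squeeze_zero_norm' ?_ h3
      filter_upwards [hC] with ε hε
      exact (norm_integral_le_integral_norm _).trans
        (norm_integral_shift_le ha ((memLp_shift hb ε z).sub hb) fun x => hε (z, x))
    have h2 : Tendsto (fun ε => ∫ x, a x * b x * c ε (z, x)) (𝓝[>] 0)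
        (𝓝 (∫ x, a x * b x * c₀ (z, x))) := by
      refine tendsto_integral_filter_of_dominated_convergence (fun x => C * ‖a x * b x‖) ?_ ?_ ?_ ?_
      · exact Eventually.of_forall fun ε => ((ha.1.mul hb.1).mul (hcz ε z))
      · filter_upwards [hC] with ε hε
        refine Eventually.of_forall fun x => ?_
        rw [norm_mul, mul_comm]
        exact mul_le_mul_of_nonneg_right (hε _) (norm_nonneg _)
      · exact (ha.integrable_mul hb).norm.const_mul C
      · exact Eventually.of_forall fun x => (hlim (z, x)).const_mul _
    have h3 := h1.add h2
    rw [zero_add] at h3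
    refine h3.congr' ?_
    filter_upwards [hC] with ε hε
    rw [← integral_add]
    · refine integral_congr_ae (Eventually.of_forall fun x => ?_)
      simp only
      ring
    · exact (ha.integrable_mul ((memLp_shift hb ε z).sub hb)).mul_bdd (c := C) (hcz ε z)
        (Eventually.of_forall fun x => hε (z, x))
    · exact (ha.integrable_mul hb).mul_bdd (c := C) (hcz ε z) (Eventually.of_forall fun x => hε (z, x))

lemma integral_shift_scale {F : Type*} [NormedAddCommGroup F] [NormedSpace ℝ F]
    (f : EM m → F) {ε : ℝ} (hε : 0 < ε) (x : EM m) :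
    ∫ y, f y = ε ^ m • ∫ z, f (x + ε • z) := by
  have h1 := Measure.integral_comp_smul volume (fun y => f (x + y)) ε
  rw [h1, integral_add_left_eq_self f x, smul_smul]
  have : ε ^ m * |(ε ^ Module.finrank ℝ (EM m))⁻¹| = 1 := by
    rw [finrank_euclideanSpace, Fintype.card_fin, abs_of_pos (by positivity)]
    exact mul_inv_cancel₀ (by positivity)
  rw [this, one_smul]

end Doubling

/-! ### Commuting the mollifier with the coefficients -/

section Doubling

variable {m : ℕ} {p q : ℝ≥0∞}

/-- The doubled integral `∫∫ a(x) b(x + εz) c(z, x)`. -/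
def shiftInt (a b : EM m → ℂ) (ε : ℝ) (c : EM m × EM m → ℂ) : ℂ :=
  ∫ z, ∫ x, a x * b (x + ε • z) * c (z, x)

lemma exists_bounds_of_hasCompactSupport {c : EM m × EM m → ℂ} (hc : Continuous c)
    (hs : HasCompactSupport c) : ∃ C R : ℝ, (∀ w, ‖c w‖ ≤ C) ∧
      (∀ z x, R < ‖z‖ → c (z, x) = 0) ∧ ∀ z x, R < ‖x‖ → c (z, x) = 0 := by
  obtain ⟨C, hC⟩ := hs.exists_bound_of_continuous hc
  obtain ⟨R, hR⟩ := hs.isCompact.isBounded.exists_norm_le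
  refine ⟨C, R, hC, fun z x hz => ?_, fun z x hx => ?_⟩
  · by_contra h
    exact absurd ((norm_fst_le (z, x)).trans (hR _ (subset_tsupport _ h))) (not_le.2 hz)
  · by_contra h
    exact absurd ((norm_snd_le (z, x)).trans (hR _ (subset_tsupport _ h))) (not_le.2 hx)

lemma shiftInt_add [p.HolderConjugate q] {a b : EM m → ℂ} (ha : MemLp a p volume)
    (hb : MemLp b q volume) (ε : ℝ) {c c' : EM m × EM m → ℂ} (hc : Continuous c)
    (hs : HasCompactSupport c) (hc' : Continuous c') (hs' : HasCompactSupport c') :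
    shiftInt a b ε (c + c') = shiftInt a b ε c + shiftInt a b ε c' := by
  obtain ⟨C, R, hC, hR, -⟩ := exists_bounds_of_hasCompactSupport hc hs
  obtain ⟨C', R', hC', hR', -⟩ := exists_bounds_of_hasCompactSupport hc' hs'
  have h := integrable_shift ha hb hc.stronglyMeasurable hC hR ε
  have h' := integrable_shift ha hb hc'.stronglyMeasurable hC' hR' ε
  unfold shiftInt
  rw [← integral_add h.integral_prod_left h'.integral_prod_left]
  refine integral_congr_ae (Eventually.of_forall fun z => ?_)
  simp only
  rw [← integral_add]
  · refine integral_congr_ae (Eventually.of_forall fun x => ?_)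
    simp only [Pi.add_apply]
    ring
  · exact integrable_shift_section ha hb (hc.comp (by fun_prop : Continuous fun x => (z, x))).aestronglyMeasurable
      (fun x => hC (z, x)) ε z
  · exact integrable_shift_section ha hb (hc'.comp (by fun_prop : Continuous fun x => (z, x))).aestronglyMeasurable
      (fun x => hC' (z, x)) ε z

/-- The integral of a weak equation in `y`, tested with `c((y - x) / ε, x)`, against the factor
`a(x)`, and the same with the roles of `x` and `y` exchanged, are both equal to a doubled integral
by the substitution `y = x + εz`. -/
lemma integral_outer_eq_shiftInt [hpq : p.HolderConjugate q] {a b : EM m → ℂ} (ha : MemLp a p volume)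
    (hb : MemLp b q volume) {ε : ℝ} (hε : 0 < ε) {c : EM m × EM m → ℂ} (hc : Continuous c)
    (hs : HasCompactSupport c) :
    (∫ x, a x * ∫ y, b y * c (ε⁻¹ • (y - x), x) = ε ^ m * shiftInt a b ε c) ∧
    (∫ y, b y * ∫ x, a x * c (ε⁻¹ • (y - x), x) = ε ^ m * shiftInt a b ε c) ∧
    Integrable (fun x => a x * ∫ y, b y * c (ε⁻¹ • (y - x), x)) volume ∧
    Integrable (fun y => b y * ∫ x, a x * c (ε⁻¹ • (y - x), x)) volume := by
  obtain ⟨C, R, hC, hR, hR'⟩ := exists_bounds_of_hasCompactSupport hc hs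
  have h1 : ∫ x, a x * ∫ y, b y * c (ε⁻¹ • (y - x), x) = ε ^ m * shiftInt a b ε c := by
    have hsw := integral_integral_swap (f := fun z x => a x * b (x + ε • z) * c (z, x))
      (integrable_shift ha hb hc.stronglyMeasurable hC hR ε)
    rw [shiftInt, hsw, ← integral_const_mul]
    refine integral_congr_ae (Eventually.of_forall fun x => ?_)
    simp only
    rw [integral_shift_scale _ hε x, Complex.real_smul, mul_left_comm,
      ← integral_const_mul (a x)]
    push_cast
    congr 1
    refine integral_congr_ae (Eventually.of_forall fun z => ?_)
    simp only [add_sub_cancel_left, smul_smul, inv_mul_cancel₀ hε.ne', one_smul]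
    ring
  rw [← h1]
  simp only [← integral_const_mul]
  -- the integrand vanishes for `x` or `y` large, and there `a` and `b` are integrable
  have hp1 : 1 ≤ p := ENNReal.HolderConjugate.one_le p q
  have hq1 : 1 ≤ q := ENNReal.HolderConjugate.one_le q p
  have ha' : Integrable ((Metric.closedBall (0 : EM m) R).indicator a) volume :=
    (integrable_indicator_iff Metric.isClosed_closedBall.measurableSet).2
      ((ha.locallyIntegrable hp1).integrableOn_isCompact (isCompact_closedBall _ _))
  have hb' : Integrable ((Metric.closedBall (0 : EM m) (R + ε * R)).indicator b) volume :=
    (integrable_indicator_iff Metric.isClosed_closedBall.measurableSet).2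
      ((hb.locallyIntegrable hq1).integrableOn_isCompact (isCompact_closedBall _ _))
  have hint : Integrable (Function.uncurry fun x y => a x * (b y * c (ε⁻¹ • (y - x), x)))
      (volume.prod volume) := by
    have := (ha'.mul_prod hb').mul_bdd (c := C)
      (g := fun w : EM m × EM m => c (ε⁻¹ • (w.2 - w.1), w.1))
      (Continuous.aestronglyMeasurable (by fun_prop)) (Eventually.of_forall fun w => hC _)
    refine this.congr (Eventually.of_forall fun w => ?_)
    obtain ⟨x, y⟩ := w
    simp only [Function.uncurry_apply_pair]
    by_cases hx : x ∈ Metric.closedBall (0 : EM m) R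
    · by_cases hy : y ∈ Metric.closedBall (0 : EM m) (R + ε * R)
      · rw [indicator_of_mem hx, indicator_of_mem hy]; ring
      · have h0 : c (ε⁻¹ • (y - x), x) = 0 := by
          apply hR
          have h2 : R + ε * R < ‖y‖ := by simpa using hy
          have h3 : ‖x‖ ≤ R := by simpa using hx
          have h4 : ε * R < ‖y - x‖ := by
            have := norm_sub_norm_le y x
            linarith
          rw [norm_smul, norm_inv, Real.norm_of_nonneg hε.le]
          rw [lt_inv_mul_iff₀ hε]
          exact h4
        rw [h0]; ring
    · have h0 : c (ε⁻¹ • (y - x), x) = 0 := hR' _ _ (by simpa using hx)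
      rw [h0]; ring
  refine ⟨trivial, ?_, hint.integral_prod_left, hint.integral_prod_right.congr
    (Eventually.of_forall fun y => integral_congr_ae (Eventually.of_forall fun x => ?_))⟩
  swap
  · simp only [Function.uncurry_apply_pair]
    ring
  rw [integral_integral_swap hint]
  refine integral_congr_ae (Eventually.of_forall fun y => ?_)
  refine integral_congr_ae (Eventually.of_forall fun x => ?_)
  simp only
  ring

variable {ρ : EM m → ℂ}

lemma integral_linear_mul_fderiv (hρ : ContDiff ℝ 1 ρ) (hs : HasCompactSupport ρ) (l : EM m →L[ℝ] ℂ)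
    (e : EM m) : ∫ z, l z * fderiv ℝ ρ z e = -(l e * ∫ z, ρ z) := by
  have h1 : HasCompactSupport fun z => fderiv ℝ ρ z e := hs.fderiv_apply ℝ e
  have hd : Continuous fun z => fderiv ℝ ρ z e := (hρ.continuous_fderiv one_ne_zero).clm_apply continuous_const
  have := integral_mul_fderiv_eq_neg_fderiv_mul_of_integrable (μ := (volume : Measure (EM m))) (f := l) (g := ρ)
    (v := e) ?_ ?_ ?_ (fun x _ => l.differentiableAt) (fun x _ => hρ.differentiable one_ne_zero x)
  · rw [this]
    simp [integral_const_mul]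
  · simp only [ContinuousLinearMap.fderiv]
    exact (hρ.continuous.integrable_of_hasCompactSupport hs).const_mul _
  · exact (l.continuous.mul hd).integrable_of_hasCompactSupport h1.mul_left
  · exact (l.continuous.mul hρ.continuous).integrable_of_hasCompactSupport hs.mul_left

lemma hasCompactSupport_of_mul {f : EM m → ℂ} {g : EM m → ℂ} (hf : HasCompactSupport f)
    (hg : HasCompactSupport g) {c : EM m × EM m → ℂ}
    (hc : ∀ w, f w.2 = 0 ∨ g w.1 = 0 → c w = 0) : HasCompactSupport c := by
  refine HasCompactSupport.intro (hg.isCompact.prod hf.isCompact) fun w hw => ?_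
  apply hc
  by_contra! h
  exact hw ⟨subset_tsupport _ h.2, subset_tsupport _ h.1⟩

/-- The first variation of the coefficient field contributes nothing in the limit: after an
integration by parts in `z` it is the divergence of the coefficient field. -/
lemma integral_fderiv_coefficient_eq_zero [p.HolderConjugate q] {u v χ : EM m → ℂ}
    (hu : MemLp u p volume) (hv : MemLp v q volume) (hχ : Continuous χ) (hχs : HasCompactSupport χ)
    (hρ : ContDiff ℝ 1 ρ) (hρs : HasCompactSupport ρ) {b : Fin m → EM m → ℂ}
    (hb : ∀ k, ContDiff ℝ 1 (b k))
    (hdiv : ∀ x, χ x ≠ 0 → ∑ k, fderiv ℝ (b k) x (EuclideanSpace.single k 1) = 0) :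
    ∑ k, ∫ z, ∫ x, u x * v x * (χ x * (fderiv ℝ (b k) x z * fderiv ℝ ρ z (EuclideanSpace.single k 1)))
      = 0 := by
  have hcont (k : Fin m) : Continuous fun w : EM m × EM m =>
      χ w.2 * (fderiv ℝ (b k) w.2 w.1 * fderiv ℝ ρ w.1 (EuclideanSpace.single k 1)) := by
    have h1 := ((hb k).continuous_fderiv one_ne_zero)
    have h2 := (hρ.continuous_fderiv one_ne_zero)
    fun_prop
  have hsupp (k : Fin m) : HasCompactSupport fun w : EM m × EM m =>
      χ w.2 * (fderiv ℝ (b k) w.2 w.1 * fderiv ℝ ρ w.1 (EuclideanSpace.single k 1)) := by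
    refine hasCompactSupport_of_mul hχs (hρs.fderiv_apply ℝ (EuclideanSpace.single k 1)) fun w hw => ?_
    rcases hw with h | h <;> simp [h]
  have hint (k : Fin m) : Integrable (fun w : EM m × EM m => u w.2 * v w.2 * (χ w.2 *
      (fderiv ℝ (b k) w.2 w.1 * fderiv ℝ ρ w.1 (EuclideanSpace.single k 1))))
        (volume.prod volume) := by
    obtain ⟨C, R, hC, hR, -⟩ := exists_bounds_of_hasCompactSupport (hcont k) (hsupp k)
    simpa only [zero_smul, add_zero] using
      integrable_shift hu hv (hcont k).stronglyMeasurable hC hR 0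
  have h1 (k : Fin m) : ∫ z, ∫ x, u x * v x *
        (χ x * (fderiv ℝ (b k) x z * fderiv ℝ ρ z (EuclideanSpace.single k 1))) =
      ∫ x, u x * v x * (χ x * -(fderiv ℝ (b k) x (EuclideanSpace.single k 1) * ∫ z, ρ z)) := by
    rw [integral_integral_swap (f := fun z x => u x * v x *
        (χ x * (fderiv ℝ (b k) x z * fderiv ℝ ρ z (EuclideanSpace.single k 1)))) (hint k)]
    refine integral_congr_ae (Eventually.of_forall fun x => ?_)
    simp only
    rw [integral_const_mul, integral_const_mul, integral_linear_mul_fderiv hρ hρs]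
  rw [Finset.sum_congr rfl fun k _ => h1 k, ← integral_finsetSum]
  · rw [← integral_zero (EM m) ℂ (μ := volume)]
    refine integral_congr_ae (Eventually.of_forall fun x => ?_)
    simp only [← Finset.mul_sum, Finset.sum_neg_distrib, ← Finset.sum_mul]
    by_cases hx : χ x = 0
    · simp [hx]
    · simp [hdiv x hx]
  · intro k _
    have hc : Continuous fun x => χ x * -(fderiv ℝ (b k) x (EuclideanSpace.single k 1) * ∫ z, ρ z) := by
      have h1 := ((hb k).continuous_fderiv one_ne_zero)
      fun_prop
    obtain ⟨C, hC⟩ := (HasCompactSupport.mul_right (f := χ) (f' := fun x =>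
      -(fderiv ℝ (b k) x (EuclideanSpace.single k 1) * ∫ z, ρ z)) hχs).exists_bound_of_continuous hc
    have := (hu.integrable_mul hv).mul_bdd (c := C) hc.aestronglyMeasurable (Eventually.of_forall hC)
    exact this

/-- Green's formula for a first-order system with divergence-free coefficients: if `u` solves the
homogeneous weak equation `H1` and `v` solves the adjoint equation with right-hand side `w`, tested
only with functions concentrated near the points of the support of `u`, then `∫ χ u w` reduces to
the term in which the derivative falls on the cutoff `χ`. The weak equations are tested with
`χ(x) ρ((y - x) / ε)` in the variables `x` and `y`, respectively. -/
lemma green_of_doubled_equations [hpq : p.HolderConjugate q] (hq : q ≠ ⊤)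
    {I J : Type*} [Fintype I] [Fintype J]
    {u w : I → EM m → ℂ} {v : J → EM m → ℂ} {χ : EM m → ℂ} {b : I → J → Fin m → EM m → ℂ}
    (hu : ∀ i, MemLp (u i) p volume) (hw : ∀ i, MemLp (w i) q volume)
    (hv : ∀ j, MemLp (v j) q volume) (hχ : ContDiff ℝ 1 χ) (hχs : HasCompactSupport χ)
    (hρ : ContDiff ℝ 1 ρ) (hρs : HasCompactSupport ρ) (hρ1 : ∫ z, ρ z = 1)
    (hb : ∀ i j k, ContDiff ℝ 1 (b i j k)) (hbs : ∀ i j k, HasCompactSupport (b i j k))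
    (hdiv : ∀ i j x, χ x ≠ 0 → ∑ k, fderiv ℝ (b i j k) x (EuclideanSpace.single k 1) = 0)
    (H1 : ∀ᶠ ε : ℝ in 𝓝[>] 0, ∀ j y, ∑ i, ∑ k, ∫ x, u i x * (b i j k x *
      (fderiv ℝ χ x (EuclideanSpace.single k 1) * ρ (ε⁻¹ • (y - x)) -
        χ x * (ε⁻¹ * fderiv ℝ ρ (ε⁻¹ • (y - x)) (EuclideanSpace.single k 1)))) = 0)
    (H2 : ∀ᶠ ε : ℝ in 𝓝[>] 0, ∀ i x, u i x ≠ 0 → ∫ y, w i y * ρ (ε⁻¹ • (y - x)) =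
      ∑ j, ∑ k, ∫ y, v j y * (b i j k y *
        (ε⁻¹ * fderiv ℝ ρ (ε⁻¹ • (y - x)) (EuclideanSpace.single k 1)))) :
    ∑ i, ∫ x, u i x * w i x * χ x = ∑ i, ∑ j, ∑ k, ∫ x, u i x * v j x *
      (b i j k x * fderiv ℝ χ x (EuclideanSpace.single k 1)) := by
  have : Fact (1 ≤ q) := ⟨ENNReal.HolderConjugate.one_le q p⟩
  let e (k : Fin m) : EM m := EuclideanSpace.single k 1
  have hDρ (k : Fin m) : Continuous fun z => fderiv ℝ ρ z (e k) :=
    (hρ.continuous_fderiv one_ne_zero).clm_apply continuous_const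
  have hDχ (k : Fin m) : Continuous fun z => fderiv ℝ χ z (e k) :=
    (hχ.continuous_fderiv one_ne_zero).clm_apply continuous_const
  have hDρs (k : Fin m) : HasCompactSupport fun z => fderiv ℝ ρ z (e k) := hρs.fderiv_apply ℝ _
  have hDχs (k : Fin m) : HasCompactSupport fun z => fderiv ℝ χ z (e k) := hχs.fderiv_apply ℝ _
  have hχc := hχ.continuous
  have hρc := hρ.continuous
  have hbc (i j k) := (hb i j k).continuous
  have hDb (i j k) := (hb i j k).continuous_fderiv one_ne_zero
  let cw : EM m × EM m → ℂ := fun w => χ w.2 * ρ w.1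
  let c2 (i : I) (j : J) (k : Fin m) (ε : ℝ) : EM m × EM m → ℂ := fun w =>
    χ w.2 * (b i j k (w.2 + ε • w.1) * (ε⁻¹ * fderiv ℝ ρ w.1 (e k)))
  let c1 (i : I) (j : J) (k : Fin m) (ε : ℝ) : EM m × EM m → ℂ := fun w =>
    b i j k w.2 * (fderiv ℝ χ w.2 (e k) * ρ w.1 - χ w.2 * (ε⁻¹ * fderiv ℝ ρ w.1 (e k)))
  let d1 (i : I) (j : J) (k : Fin m) : EM m × EM m → ℂ := fun w =>
    χ w.2 * (fderiv ℝ (b i j k) w.2 w.1 * fderiv ℝ ρ w.1 (e k))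
  let d2 (i : I) (j : J) (k : Fin m) : EM m × EM m → ℂ := fun w =>
    b i j k w.2 * fderiv ℝ χ w.2 (e k) * ρ w.1
  have cw_c : Continuous cw := by fun_prop
  have c2_c (i j k ε) : Continuous (c2 i j k ε) := by
    have := hbc i j k
    have := hDρ k
    fun_prop
  have c1_c (i j k ε) : Continuous (c1 i j k ε) := by
    have := hbc i j k
    have := hDρ k
    have := hDχ k
    fun_prop
  have d1_c (i j k) : Continuous (d1 i j k) := by
    have := hDb i j k
    have := hDρ k
    fun_prop
  have d2_c (i j k) : Continuous (d2 i j k) := by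
    have := hbc i j k
    have := hDχ k
    fun_prop
  have cw_s : HasCompactSupport cw :=
    hasCompactSupport_of_mul hχs hρs fun w hw => by rcases hw with h | h <;> simp [cw, h]
  have c2_s (i j k ε) : HasCompactSupport (c2 i j k ε) :=
    hasCompactSupport_of_mul hχs (hDρs k) fun w hw => by rcases hw with h | h <;> simp [c2, h]
  have c1_s (i j k ε) : HasCompactSupport (c1 i j k ε) := by
    refine HasCompactSupport.intro ((hρs.isCompact.union (hDρs k).isCompact).prod
      (hbs i j k).isCompact) fun w hw => ?_
    by_contra h
    refine hw ⟨?_, subset_tsupport _ fun h0 => h (by simp [c1, h0])⟩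
    by_contra hcon
    rw [mem_union, not_or] at hcon
    have h1 : ρ w.1 = 0 := image_eq_zero_of_notMem_tsupport hcon.1
    have h2 : fderiv ℝ ρ w.1 (e k) = 0 :=
      image_eq_zero_of_notMem_tsupport (f := fun z => fderiv ℝ ρ z (e k)) hcon.2
    exact h (by simp [c1, h1, h2])
  have d1_s (i j k) : HasCompactSupport (d1 i j k) :=
    hasCompactSupport_of_mul hχs (hDρs k) fun w hw => by rcases hw with h | h <;> simp [d1, h]
  have d2_s (i j k) : HasCompactSupport (d2 i j k) :=
    hasCompactSupport_of_mul (hDχs k) hρs fun w hw => by rcases hw with h | h <;> simp [d2, h]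
  -- the two weak equations, integrated against the other factor, in the variables `x` and `z`
  have R2 : ∀ᶠ ε : ℝ in 𝓝[>] 0, ∀ i, shiftInt (u i) (w i) ε cw =
      ∑ j, ∑ k, shiftInt (u i) (v j) ε (c2 i j k ε) := by
    filter_upwards [H2, self_mem_nhdsWithin] with ε h hε i
    have hε' : (0 : ℝ) < ε := hε
    have hne : (ε : ℂ) ^ m ≠ 0 := pow_ne_zero _ (by exact_mod_cast hε'.ne')
    have f1 := (integral_outer_eq_shiftInt (hu i) (hw i) hε' cw_c cw_s).1
    have f2 (j k) := integral_outer_eq_shiftInt (hu i) (hv j) hε' (c2_c i j k ε) (c2_s i j k ε)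
    apply mul_left_cancel₀ hne
    rw [← f1, Finset.mul_sum]
    simp only [Finset.mul_sum]
    rw [Finset.sum_congr rfl fun j _ => Finset.sum_congr rfl fun k _ => (f2 j k).1.symm]
    have sw : ∑ j, ∑ k, ∫ x, u i x * ∫ y, v j y * c2 i j k ε (ε⁻¹ • (y - x), x) =
        ∫ x, ∑ j, ∑ k, u i x * ∫ y, v j y * c2 i j k ε (ε⁻¹ • (y - x), x) := by
      rw [integral_finsetSum _ fun j _ => integrable_finsetSum _ fun k _ => (f2 j k).2.2.1]
      refine Finset.sum_congr rfl fun j _ => ?_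
      rw [integral_finsetSum _ fun k _ => (f2 j k).2.2.1]
    rw [sw]
    refine integral_congr_ae (Eventually.of_forall fun x => ?_)
    simp only
    by_cases hx : u i x = 0
    · simp [hx]
    · have e1 : ∫ y, w i y * cw (ε⁻¹ • (y - x), x) = χ x * ∫ y, w i y * ρ (ε⁻¹ • (y - x)) := by
        rw [← integral_const_mul]
        exact integral_congr_ae (Eventually.of_forall fun y => by simp only [cw]; ring)
      rw [e1, h i x hx, Finset.mul_sum, Finset.mul_sum]
      refine Finset.sum_congr rfl fun j _ => ?_
      rw [Finset.mul_sum, Finset.mul_sum]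
      refine Finset.sum_congr rfl fun k _ => ?_
      rw [← integral_const_mul]
      congr 1
      refine integral_congr_ae (Eventually.of_forall fun y => ?_)
      have : x + ε • ε⁻¹ • (y - x) = y := by
        rw [smul_smul, mul_inv_cancel₀ hε'.ne', one_smul]; abel
      simp only [c2, this, e]
      ring
  have R1 : ∀ᶠ ε : ℝ in 𝓝[>] 0, ∀ j, ∑ i, ∑ k, shiftInt (u i) (v j) ε (c1 i j k ε) = 0 := by
    filter_upwards [H1, self_mem_nhdsWithin] with ε h hε j
    have hε' : (0 : ℝ) < ε := hε
    have hne : (ε : ℂ) ^ m ≠ 0 := pow_ne_zero _ (by exact_mod_cast hε'.ne')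
    have f2 (i k) := integral_outer_eq_shiftInt (hu i) (hv j) hε' (c1_c i j k ε) (c1_s i j k ε)
    apply mul_left_cancel₀ hne
    rw [Finset.mul_sum]
    simp only [Finset.mul_sum]
    rw [Finset.sum_congr rfl fun i _ => Finset.sum_congr rfl fun k _ => (f2 i k).2.1.symm]
    have sw : ∑ i, ∑ k, ∫ y, v j y * ∫ x, u i x * c1 i j k ε (ε⁻¹ • (y - x), x) =
        ∫ y, ∑ i, ∑ k, v j y * ∫ x, u i x * c1 i j k ε (ε⁻¹ • (y - x), x) := by
      rw [integral_finsetSum _ fun i _ => integrable_finsetSum _ fun k _ => (f2 i k).2.2.2]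
      refine Finset.sum_congr rfl fun i _ => ?_
      rw [integral_finsetSum _ fun k _ => (f2 i k).2.2.2]
    rw [sw, mul_zero, ← integral_zero (EM m) ℂ (μ := volume)]
    refine integral_congr_ae (Eventually.of_forall fun y => ?_)
    simp only [← Finset.mul_sum]
    have := h j y
    simp only [c1, e]
    rw [this, mul_zero]
  -- adding the two equations, the terms of order `ε⁻¹` combine to a difference quotient of `b`
  have R : ∀ᶠ ε : ℝ in 𝓝[>] 0, ∑ i, shiftInt (u i) (w i) ε cw =
      ∑ i, ∑ j, ∑ k, shiftInt (u i) (v j) ε (c2 i j k ε + c1 i j k ε) := by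
    filter_upwards [R1, R2] with ε h1 h2
    have h3 : ∑ i, ∑ j, ∑ k, shiftInt (u i) (v j) ε (c1 i j k ε) = 0 := by
      rw [Finset.sum_comm]
      exact Finset.sum_eq_zero fun j _ => h1 j
    rw [Finset.sum_congr rfl fun i _ => h2 i]
    simp only [fun i j k => shiftInt_add (hu i) (hv j) ε (c2_c i j k ε) (c2_s i j k ε)
      (c1_c i j k ε) (c1_s i j k ε), Finset.sum_add_distrib, h3, add_zero]
  -- both sides converge as `ε → 0`
  have L1 : Tendsto (fun ε => ∑ i, shiftInt (u i) (w i) ε cw) (𝓝[>] 0)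
      (𝓝 (∑ i, ∫ z, ∫ x, u i x * w i x * cw (z, x))) := by
    obtain ⟨C, R, hC, hR, -⟩ := exists_bounds_of_hasCompactSupport cw_c cw_s
    refine tendsto_finsetSum _ fun i _ => ?_
    exact tendsto_shift hq (hu i) (hw i) (c := fun _ => cw) (fun _ => cw_c.stronglyMeasurable)
      (Eventually.of_forall fun _ => hC) (fun _ => hR) fun w => tendsto_const_nhds
  have L2 : Tendsto (fun ε => ∑ i, ∑ j, ∑ k, shiftInt (u i) (v j) ε (c2 i j k ε + c1 i j k ε))
      (𝓝[>] 0) (𝓝 (∑ i, ∑ j, ∑ k, ∫ z, ∫ x, u i x * v j x *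
        (d1 i j k + d2 i j k) (z, x))) := by
    refine tendsto_finsetSum _ fun i _ => tendsto_finsetSum _ fun j _ => tendsto_finsetSum _ fun k _ => ?_
    obtain ⟨Cχ, hCχ⟩ := hχs.exists_bound_of_continuous hχc
    obtain ⟨Cd, Rd, hCd, hRd, -⟩ := exists_bounds_of_hasCompactSupport (d2_c i j k) (d2_s i j k)
    obtain ⟨Cz, hCz⟩ := HasCompactSupport.exists_bound_of_continuous
      (f := fun z : EM m => (‖z‖ : ℂ) * fderiv ℝ ρ z (e k)) ((hDρs k).mul_left)
      (by have := hDρ k; fun_prop)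
    obtain ⟨Lb, hLb⟩ := (hb i j k).lipschitzWith_of_hasCompactSupport (hbs i j k) one_ne_zero
    obtain ⟨Rρ, hRρ⟩ := (hρs.isCompact.union (hDρs k).isCompact).isBounded.exists_norm_le
    have hvan (z : EM m) (hz : Rρ < ‖z‖) : ρ z = 0 ∧ fderiv ℝ ρ z (e k) = 0 := by
      constructor
      · by_contra h
        exact absurd (hRρ z (Or.inl (subset_tsupport _ h))) (not_le.2 hz)
      · by_contra h
        exact absurd (hRρ z (Or.inr (subset_tsupport _ h))) (not_le.2 hz)
    have heq (ε : ℝ) (w : EM m × EM m) : (c2 i j k ε + c1 i j k ε) w =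
        χ w.2 * (((ε : ℂ)⁻¹ * (b i j k (w.2 + ε • w.1) - b i j k w.2)) * fderiv ℝ ρ w.1 (e k)) +
          d2 i j k w := by
      simp only [c2, c1, d2, Pi.add_apply, Complex.ofReal_inv]
      ring
    refine tendsto_shift hq (hu i) (hv j) (C := Cχ * (Lb * Cz) + Cd) (R := Rρ)
      (fun ε => ((c2_c i j k ε).add (c1_c i j k ε)).stronglyMeasurable) ?_ ?_ ?_
    · filter_upwards [self_mem_nhdsWithin] with ε hε w
      have hε' : (0 : ℝ) < ε := hε
      rw [heq]
      refine (norm_add_le _ _).trans (add_le_add ?_ (hCd w))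
      rw [norm_mul]
      refine mul_le_mul (hCχ _) ?_ (norm_nonneg _) ((norm_nonneg _).trans (hCχ 0))
      rw [norm_mul, norm_mul, norm_inv, Complex.norm_real, Real.norm_of_nonneg hε'.le]
      have h1 : ‖b i j k (w.2 + ε • w.1) - b i j k w.2‖ ≤ Lb * (ε * ‖w.1‖) := by
        have := hLb.norm_sub_le (w.2 + ε • w.1) w.2
        rwa [add_sub_cancel_left, norm_smul, Real.norm_of_nonneg hε'.le] at this
      have h2 := hCz w.1
      rw [norm_mul, Complex.norm_real, norm_norm] at h2
      calc ε⁻¹ * ‖b i j k (w.2 + ε • w.1) - b i j k w.2‖ * ‖fderiv ℝ ρ w.1 (e k)‖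
          ≤ ε⁻¹ * (Lb * (ε * ‖w.1‖)) * ‖fderiv ℝ ρ w.1 (e k)‖ := by gcongr
        _ = Lb * (‖w.1‖ * ‖fderiv ℝ ρ w.1 (e k)‖) := by field_simp
        _ ≤ Lb * Cz := by gcongr
    · intro ε z x hz
      rw [heq]
      simp [d2, (hvan z hz).1, (hvan z hz).2]
    · intro w
      have h1 : Tendsto (fun ε : ℝ => (ε : ℂ)⁻¹ * (b i j k (w.2 + ε • w.1) - b i j k w.2))
          (𝓝[>] 0) (𝓝 (fderiv ℝ (b i j k) w.2 w.1)) := by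
        have := (((hb i j k).differentiable one_ne_zero w.2).hasFDerivAt.hasLineDerivAt
          w.1).tendsto_slope_zero_right
        refine this.congr fun ε => ?_
        simp [Complex.real_smul]
      have h2 := ((h1.mul_const (fderiv ℝ ρ w.1 (e k))).const_mul (χ w.2)).add_const (d2 i j k w)
      exact h2.congr fun ε => (heq ε w).symm
  have hfin := tendsto_nhds_unique (L1.congr' R) L2
  have hl (i) : ∫ z, ∫ x, u i x * w i x * cw (z, x) = ∫ x, u i x * w i x * χ x := by
    have (z : EM m) : ∫ x, u i x * w i x * cw (z, x) = (∫ x, u i x * w i x * χ x) * ρ z := by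
      rw [← integral_mul_const]
      exact integral_congr_ae (Eventually.of_forall fun x => by simp only [cw]; ring)
    simp only [this]
    rw [integral_const_mul, hρ1, mul_one]
  -- the limit of the difference quotient integrates to the divergence of `b`, which vanishes
  have hr (i j) : ∑ k, ∫ z, ∫ x, u i x * v j x * (d1 i j k + d2 i j k) (z, x) =
      ∑ k, ∫ x, u i x * v j x * (b i j k x * fderiv ℝ χ x (e k)) := by
    have h1 := integral_fderiv_coefficient_eq_zero (hu i) (hv j) hχc hχs hρ hρs (hb i j) (hdiv i j)
    have h2 (k) := shiftInt_add (hu i) (hv j) 0 (d1_c i j k) (d1_s i j k) (d2_c i j k) (d2_s i j k)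
    simp only [shiftInt, zero_smul, add_zero] at h2
    rw [Finset.sum_congr rfl fun k _ => h2 k, Finset.sum_add_distrib]
    refine (congrArg (· + _) h1).trans ?_
    rw [zero_add]
    refine Finset.sum_congr rfl fun k _ => ?_
    have (z : EM m) : ∫ x, u i x * v j x * d2 i j k (z, x) =
        (∫ x, u i x * v j x * (b i j k x * fderiv ℝ χ x (e k))) * ρ z := by
      rw [← integral_mul_const]
      exact integral_congr_ae (Eventually.of_forall fun x => by simp only [d2]; ring)
    simp only [this]
    rw [integral_const_mul, hρ1, mul_one]
  simp only [hl, hr] at hfin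
  exact hfin

end Doubling

/-! ### Smoothness of form-valued maps -/

section FormSmooth

variable {m d : ℕ}

/-- A left inverse of `coeffs`. -/
def coeffsInv (m d : ℕ) : ((Fin d → Fin m) → ℂ) →L[ℂ] CForm m d :=
  LinearMap.toContinuousLinearMap
    (LinearMap.exists_leftInverse_of_injective (coeffs m d)
      (LinearMap.ker_eq_bot.2 coeffs_injective)).choose

lemma coeffsInv_coeffs (θ : CForm m d) :
    coeffsInv m d (fun σ => θ (fun j => stdC m (σ j))) = θ :=
  LinearMap.congr_fun (LinearMap.exists_leftInverse_of_injective (coeffs m d)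
      (LinearMap.ker_eq_bot.2 coeffs_injective)).choose_spec θ

/-- The pullback of complex forms under a real linear map, as a continuous linear map. -/
def pullCLM (d : ℕ) (L : EM m →L[ℝ] EX m) : CForm m d →L[ℂ] EM m [⋀^Fin d]→L[ℝ] ℂ :=
  LinearMap.toContinuousLinearMap
    { toFun := pull L
      map_add' := pull_add L
      map_smul' := pull_smul L }

lemma extC_stdC (η : EM m [⋀^Fin d]→L[ℝ] ℂ) (σ : Fin d → Fin m) :
    extC η (fun j => stdC m (σ j)) = η (fun j => stdFrame m (σ j)) := by
  conv_rhs => rw [← pull_extC η, pull_apply]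
  congr 1
  funext j
  ext i
  simp [stdC_fin, stdFrame_fin, inclR_apply, apply_ite Complex.ofReal]

/-- A form depends linearly on its coefficients; smoothness of a family of forms can therefore be
tested on coefficients. -/
lemma form_eq_of_coeffs (η : EM m [⋀^Fin d]→L[ℝ] ℂ) :
    η = pullCLM d (inclR m) (coeffsInv m d fun σ => η (fun j => stdFrame m (σ j))) := by
  conv_lhs => rw [← pull_extC η, ← coeffsInv_coeffs (extC η)]
  simp only [extC_stdC]
  rfl

lemma form_apply_eq_sum (η : EM m [⋀^Fin d]→L[ℝ] ℂ) (v : Fin d → EM m) :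
    η v = ∑ σ : Fin d → Fin m, (∏ j, (v j (σ j) : ℂ)) * η (fun j => stdFrame m (σ j)) := by
  conv_lhs => rw [← pull_extC η, pull_apply, CForm.apply_eq_sum]
  simp only [inclR_apply, extC_stdC]

variable {E : Type*} [NormedAddCommGroup E] [NormedSpace ℝ E] {s : WithTop ℕ∞} {y : E}

lemma contDiffAt_form {f : E → EM m [⋀^Fin d]→L[ℝ] ℂ}
    (h : ∀ σ : Fin d → Fin m, ContDiffAt ℝ s (fun z => f z (fun j => stdFrame m (σ j))) y) :
    ContDiffAt ℝ s f y := by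
  have h1 : f = fun z => ((pullCLM d (inclR m)).restrictScalars ℝ)
      (((coeffsInv m d).restrictScalars ℝ) fun σ => f z (fun j => stdFrame m (σ j))) :=
    funext fun z => form_eq_of_coeffs (f z)
  rw [h1]
  exact (ContinuousLinearMap.contDiff _).contDiffAt.comp y
    ((ContinuousLinearMap.contDiff _).contDiffAt.comp y (contDiffAt_pi.2 h))

lemma contDiffAt_form_apply {f : E → EM m [⋀^Fin d]→L[ℝ] ℂ} (hf : ContDiffAt ℝ s f y)
    {v : Fin d → E → EM m} (hv : ∀ j, ContDiffAt ℝ s (v j) y) :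
    ContDiffAt ℝ s (fun z => f z (fun j => v j z)) y := by
  have h1 : (fun z => f z (fun j => v j z)) = fun z => ∑ σ : Fin d → Fin m,
      (∏ j, (v j z (σ j) : ℂ)) * f z (fun j => stdFrame m (σ j)) :=
    funext fun z => form_apply_eq_sum _ _
  rw [h1]
  refine ContDiffAt.sum fun σ _ => ContDiffAt.mul (contDiffAt_prod fun j _ => ?_) ?_
  · exact Complex.ofRealCLM.contDiff.contDiffAt.comp y
      ((EuclideanSpace.proj (σ j) : EM m →L[ℝ] ℝ).contDiff.contDiffAt.comp y (hv j))
  · exact ((ContinuousAlternatingMap.apply ℝ (EM m) ℂ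
      (fun j => stdFrame m (σ j))).contDiff).contDiffAt.comp y hf

lemma contDiffAt_cform {f : E → CForm m d}
    (h : ∀ σ : Fin d → Fin m, ContDiffAt ℝ s (fun z => f z (fun j => stdC m (σ j))) y) :
    ContDiffAt ℝ s f y := by
  have h1 : f = fun z => ((coeffsInv m d).restrictScalars ℝ) fun σ => f z (fun j => stdC m (σ j)) :=
    funext fun z => (coeffsInv_coeffs (f z)).symm
  rw [h1]
  exact (ContinuousLinearMap.contDiff _).contDiffAt.comp y (contDiffAt_pi.2 h)

end FormSmooth

/-! ### Differential forms in charts -/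

section Charts

variable {m : ℕ} {M : Type*} [TopologicalSpace M] [ChartedSpace (EM m) M]
  {F : Type*} [NormedAddCommGroup F] [NormedSpace ℝ F] {d : ℕ}

variable (m) in
/-- The preferred chart at `x₀`. -/
def chart (x₀ : M) : PartialEquiv M (EM m) := extChartAt 𝓘(ℝ, EM m) x₀

/-- The differential of the preferred chart at `x₀`. -/
def dchart (x₀ x : M) : EM m →L[ℝ] EM m := mfderiv 𝓘(ℝ, EM m) 𝓘(ℝ, EM m) (chart m x₀) x

/-- The differential of the inverse of the preferred chart at `x₀`. -/
def dsymm (x₀ : M) (y : EM m) : EM m →L[ℝ] EM m :=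
  mfderiv 𝓘(ℝ, EM m) 𝓘(ℝ, EM m) (chart m x₀).symm y

lemma inChart_eq (η : DForm (m := m) M d F) (x₀ : M) (y : EM m) :
    inChart η x₀ y = (η ((chart m x₀).symm y)).compContinuousLinearMap (dsymm x₀ y) := rfl

lemma extD_eq (η : DForm (m := m) M d F) (x : M) :
    extD η x = (extDeriv (inChart η x) (chart m x x)).compContinuousLinearMap (dchart x x) := rfl

lemma isOpen_target (x₀ : M) : IsOpen (chart m x₀).target := isOpen_extChartAt_target x₀

lemma isOpen_source (x₀ : M) : IsOpen (chart m x₀).source := isOpen_extChartAt_source x₀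

lemma continuousAt_symm {x₀ : M} {y : EM m} (hy : y ∈ (chart m x₀).target) :
    ContinuousAt (chart m x₀).symm y := continuousAt_extChartAt_symm'' hy

lemma continuousAt_chart {x₀ x : M} (hx : x ∈ (chart m x₀).source) :
    ContinuousAt (chart m x₀) x := continuousAt_extChartAt' hx

lemma eventually_mem_overlap {x₀ x₁ : M} {y : EM m} (hy : y ∈ (chart m x₁).target)
    (hx : (chart m x₁).symm y ∈ (chart m x₀).source) :
    ∀ᶠ z in 𝓝 y, z ∈ (chart m x₁).target ∧ (chart m x₁).symm z ∈ (chart m x₀).source :=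
  Filter.inter_mem ((isOpen_target x₁).mem_nhds hy)
    ((continuousAt_symm hy).preimage_mem_nhds ((isOpen_source x₀).mem_nhds hx))

variable [IsManifold 𝓘(ℝ, EM m) ∞ M]

lemma contMDiffAt_chart {x₀ x : M} (hx : x ∈ (chart m x₀).source) :
    ContMDiffAt 𝓘(ℝ, EM m) 𝓘(ℝ, EM m) ∞ (chart m x₀) x :=
  contMDiffAt_extChartAt' (by simpa [chart] using hx)

lemma contMDiffAt_symm {x₀ : M} {y : EM m} (hy : y ∈ (chart m x₀).target) :
    ContMDiffAt 𝓘(ℝ, EM m) 𝓘(ℝ, EM m) ∞ (chart m x₀).symm y :=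
  (contMDiffOn_extChartAt_symm x₀).contMDiffAt ((isOpen_target x₀).mem_nhds hy)

lemma mdifferentiableAt_chart {x₀ x : M} (hx : x ∈ (chart m x₀).source) :
    MDifferentiableAt 𝓘(ℝ, EM m) 𝓘(ℝ, EM m) (chart m x₀) x :=
  (contMDiffAt_chart hx).mdifferentiableAt (by simp)

lemma mdifferentiableAt_symm {x₀ : M} {y : EM m} (hy : y ∈ (chart m x₀).target) :
    MDifferentiableAt 𝓘(ℝ, EM m) 𝓘(ℝ, EM m) (chart m x₀).symm y :=
  (contMDiffAt_symm hy).mdifferentiableAt (by simp)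

lemma dchart_comp_dsymm {x₀ : M} {y : EM m} (hy : y ∈ (chart m x₀).target) :
    dchart x₀ ((chart m x₀).symm y) ∘L dsymm x₀ y = .id ℝ (EM m) := by
  have h1 := mfderiv_comp (I := 𝓘(ℝ, EM m)) (I' := 𝓘(ℝ, EM m)) (I'' := 𝓘(ℝ, EM m)) y
    (mdifferentiableAt_chart ((chart m x₀).map_target hy)) (mdifferentiableAt_symm hy)
  have h2 : (chart m x₀) ∘ (chart m x₀).symm =ᶠ[𝓝 y] id := by
    filter_upwards [(isOpen_target x₀).mem_nhds hy] with z hz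
    exact (chart m x₀).right_inv hz
  rw [h2.mfderiv_eq, mfderiv_id] at h1
  exact h1.symm

lemma dsymm_comp_dchart {x₀ x : M} (hx : x ∈ (chart m x₀).source) :
    dsymm x₀ (chart m x₀ x) ∘L dchart x₀ x = .id ℝ (EM m) := by
  have h1 := mfderiv_comp (I := 𝓘(ℝ, EM m)) (I' := 𝓘(ℝ, EM m)) (I'' := 𝓘(ℝ, EM m)) x
    (mdifferentiableAt_symm ((chart m x₀).map_source hx)) (mdifferentiableAt_chart hx)
  have h2 : (chart m x₀).symm ∘ (chart m x₀) =ᶠ[𝓝 x] id := by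
    filter_upwards [(isOpen_source x₀).mem_nhds hx] with z hz
    exact (chart m x₀).left_inv hz
  rw [h2.mfderiv_eq, mfderiv_id] at h1
  exact h1.symm

lemma inChart_comp_dchart (η : DForm (m := m) M d F) {x₀ x : M} (hx : x ∈ (chart m x₀).source) :
    (inChart η x₀ (chart m x₀ x)).compContinuousLinearMap (dchart x₀ x) = η x := by
  rw [inChart_eq, (chart m x₀).left_inv hx]
  ext v
  have := fun j => DFunLike.congr_fun (dsymm_comp_dchart hx) (v j)
  simp only [ContinuousLinearMap.comp_apply, ContinuousLinearMap.id_apply] at this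
  simp [Function.comp_def, this]

/-- The change of charts. -/
def trans (x₀ x₁ : M) : EM m → EM m := chart m x₀ ∘ (chart m x₁).symm

lemma contDiffAt_trans {x₀ x₁ : M} {y : EM m} (hy : y ∈ (chart m x₁).target)
    (hx : (chart m x₁).symm y ∈ (chart m x₀).source) : ContDiffAt ℝ ∞ (trans (m := m) x₀ x₁) y :=
  ((contMDiffAt_chart hx).comp y (contMDiffAt_symm hy)).contDiffAt

lemma fderiv_trans {x₀ x₁ : M} {y : EM m} (hy : y ∈ (chart m x₁).target)
    (hx : (chart m x₁).symm y ∈ (chart m x₀).source) :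
    fderiv ℝ (trans (m := m) x₀ x₁) y = dchart x₀ ((chart m x₁).symm y) ∘L dsymm x₁ y := by
  rw [← mfderiv_eq_fderiv]
  exact mfderiv_comp (I := 𝓘(ℝ, EM m)) (I' := 𝓘(ℝ, EM m)) (I'' := 𝓘(ℝ, EM m)) y
    (mdifferentiableAt_chart hx) (mdifferentiableAt_symm hy)

lemma inChart_eq_pullback (η : DForm (m := m) M d F) {x₀ x₁ : M} {y : EM m}
    (hy : y ∈ (chart m x₁).target) (hx : (chart m x₁).symm y ∈ (chart m x₀).source) :
    inChart η x₁ y = (inChart η x₀ (trans x₀ x₁ y)).compContinuousLinearMap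
      (fderiv ℝ (trans (m := m) x₀ x₁) y) := by
  rw [fderiv_trans hy hx, inChart_eq η x₁, ← inChart_comp_dchart η hx]
  rfl

/-- Smoothness of the coefficients does not depend on the chart. -/
lemma contDiffAt_inChart_of_contDiffAt {η : DForm (m := m) M d ℂ} {x₀ x₁ : M} {y : EM m}
    (hy : y ∈ (chart m x₁).target) (hx : (chart m x₁).symm y ∈ (chart m x₀).source)
    (h : ContDiffAt ℝ ∞ (inChart η x₀) (trans x₀ x₁ y)) : ContDiffAt ℝ ∞ (inChart η x₁) y := by
  have h1 : ContDiffAt ℝ ∞ (fun z => (inChart η x₀ (trans x₀ x₁ z)).compContinuousLinearMap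
      (fderiv ℝ (trans (m := m) x₀ x₁) z)) y := by
    have h2 : ContDiffAt ℝ ∞ (fderiv ℝ (trans (m := m) x₀ x₁)) y :=
      (contDiffAt_trans hy hx).fderiv_right (m := ∞) (by simp)
    have h3 : ContDiffAt ℝ ∞ (fun z => inChart η x₀ (trans x₀ x₁ z)) y :=
      h.comp y (contDiffAt_trans hy hx)
    refine contDiffAt_form fun σ => ?_
    exact contDiffAt_form_apply h3 fun j => h2.clm_apply contDiffAt_const
  refine h1.congr_of_eventuallyEq ?_
  filter_upwards [eventually_mem_overlap hy hx] with z hz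
  exact inChart_eq_pullback η hz.1 hz.2

lemma extDeriv_inChart {η : DForm (m := m) M d F} {x₀ x₁ : M} {y : EM m}
    (hy : y ∈ (chart m x₁).target) (hx : (chart m x₁).symm y ∈ (chart m x₀).source)
    (h : ContDiffAt ℝ ∞ (inChart η x₀) (trans x₀ x₁ y)) :
    extDeriv (inChart η x₁) y = (extDeriv (inChart η x₀) (trans x₀ x₁ y)).compContinuousLinearMap
      (fderiv ℝ (trans (m := m) x₀ x₁) y) := by
  have h1 : inChart η x₁ =ᶠ[𝓝 y] fun z => (inChart η x₀ (trans x₀ x₁ z)).compContinuousLinearMap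
      (fderiv ℝ (trans (m := m) x₀ x₁) z) := by
    filter_upwards [eventually_mem_overlap hy hx] with z hz
    exact inChart_eq_pullback η hz.1 hz.2
  rw [h1.extDeriv_eq]
  exact extDeriv_pullback (h.differentiableAt (by simp)) (contDiffAt_trans hy hx) (by
    rw [minSmoothness_of_isRCLikeNormedField]
    exact WithTop.coe_le_coe.2 le_top)

/-- The exterior derivative can be computed in any chart. -/
lemma inChart_extD {η : DForm (m := m) M d F} {x₀ : M} {y : EM m}
    (hy : y ∈ (chart m x₀).target) (h : ContDiffAt ℝ ∞ (inChart η x₀) y) :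
    inChart (extD η) x₀ y = extDeriv (inChart η x₀) y := by
  set x := (chart m x₀).symm y with hxd
  have hx : x ∈ (chart m x₀).source := (chart m x₀).map_target hy
  have hxx : x ∈ (chart m x).source := mem_extChartAt_source x
  have hyx : chart m x x ∈ (chart m x).target := mem_extChartAt_target x
  have e1 : (chart m x).symm (chart m x x) = x := (chart m x).left_inv hxx
  have e2 : trans (m := m) x₀ x (chart m x x) = y := by
    simp only [trans, Function.comp_apply]
    rw [e1]
    exact (chart m x₀).right_inv hy
  rw [inChart_eq, ← hxd, extD_eq, extDeriv_inChart (x₀ := x₀) hyx (by rwa [e1]) (by rwa [e2]), e2,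
    fderiv_trans hyx (by rwa [e1]), e1]
  ext v
  have h3 := fun j => DFunLike.congr_fun (dsymm_comp_dchart hxx) (dsymm x₀ y (v j))
  have h4 := fun j => DFunLike.congr_fun (dchart_comp_dsymm hy) (v j)
  simp only [ContinuousLinearMap.comp_apply, ContinuousLinearMap.id_apply] at h3 h4
  simp [Function.comp_def, h3, h4, x]

end Charts

/-! ### The Leibniz rule and Stokes' theorem in `ℝ^m` -/

section WedgeCalculus

variable {m a b d : ℕ}

/-- The wedge product, evaluated on fixed vectors, as a continuous bilinear map. -/
def wedgeCLM (a b : ℕ) (v : ℕ → EM m) :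
    (EM m [⋀^Fin a]→L[ℝ] ℂ) →L[ℝ] (EM m [⋀^Fin b]→L[ℝ] ℂ) →L[ℝ] ℂ :=
  ((a.factorial : ℂ) * (b.factorial : ℂ))⁻¹ • ∑ σ : Equiv.Perm (Fin (a + b)),
    ((Equiv.Perm.sign σ : ℤ) : ℂ) • (ContinuousLinearMap.mul ℝ ℂ).bilinearComp
      (ContinuousAlternatingMap.apply ℝ (EM m) ℂ (fun i => v (σ (Fin.castAdd b i))))
      (ContinuousAlternatingMap.apply ℝ (EM m) ℂ (fun j => v (σ (Fin.natAdd a j))))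

lemma wedgeCLM_apply (v : ℕ → EM m) (α : EM m [⋀^Fin a]→L[ℝ] ℂ) (β : EM m [⋀^Fin b]→L[ℝ] ℂ) :
    wedgeCLM a b v α β = wedgeEval α β (fun i => v i) := by
  simp [wedgeCLM, wedgeEval, ContinuousLinearMap.bilinearComp_apply]

/-- The wedge product with the `k`-th coordinate covector. -/
def dxWedge (a : ℕ) (k : Fin m) :
    (EM m [⋀^Fin a]→L[ℝ] ℂ) →L[ℝ] (EM m [⋀^Fin (a + 1)]→L[ℝ] ℂ) :=
  (ContinuousAlternatingMap.alternatizeUncurryFinCLM ℝ (EM m) ℂ) ∘L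
    (ContinuousLinearMap.smulRightL ℝ (EM m) (EM m [⋀^Fin a]→L[ℝ] ℂ) (EuclideanSpace.proj k))

open ContinuousAlternatingMap in
lemma dxWedge_apply (k : Fin m) (α : EM m [⋀^Fin a]→L[ℝ] ℂ) :
    dxWedge a k α =
      alternatizeUncurryFin ((EuclideanSpace.proj k : EM m →L[ℝ] ℝ).smulRight α) := rfl

open ContinuousAlternatingMap in
lemma alternatize_smulRight_ofReal (l : EM m →L[ℝ] ℝ) (α : EM m [⋀^Fin a]→L[ℝ] ℂ) :
    alternatizeUncurryFin (l.smulRight α) =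
      alternatizeUncurryFin ((Complex.ofRealCLM ∘L l).smulRight α) := by
  congr 1

lemma wedgeEval_dxWedge (α : EM m [⋀^Fin a]→L[ℝ] ℂ) (β : EM m [⋀^Fin b]→L[ℝ] ℂ) (k : Fin m)
    (v : ℕ → EM m) : wedgeEval α (dxWedge b k β) (fun i => v i) =
      (-1) ^ a * wedgeEval (dxWedge a k α) β (fun i => v i) := by
  rw [dxWedge_apply, dxWedge_apply, alternatize_smulRight_ofReal, alternatize_smulRight_ofReal]
  exact wedgeEval_alternatize_right _ _ _ _

open ContinuousAlternatingMap in
lemma alternatize_eq_sum_dxWedge (l : EM m →L[ℝ] EM m [⋀^Fin a]→L[ℝ] ℂ) :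
    alternatizeUncurryFin l = ∑ k, dxWedge a k (l (EuclideanSpace.single k 1)) := by
  have h : l = ∑ k : Fin m, (EuclideanSpace.proj k : EM m →L[ℝ] ℝ).smulRight
      (l (EuclideanSpace.single k 1)) := by
    ext1 v
    conv_lhs => rw [sum_single v, _root_.map_sum]
    simp
  conv_lhs => rw [h, ← alternatizeUncurryFinCLM_apply, _root_.map_sum]
  rfl

lemma extDeriv_eq_sum (α : EM m → EM m [⋀^Fin a]→L[ℝ] ℂ) (y : EM m) :
    extDeriv α y = ∑ k, dxWedge a k (fderiv ℝ α y (EuclideanSpace.single k 1)) :=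
  alternatize_eq_sum_dxWedge _

/-- The Leibniz rule, in divergence form. -/
lemma wedge_extDeriv_add {α : EM m → EM m [⋀^Fin a]→L[ℝ] ℂ} {β : EM m → EM m [⋀^Fin b]→L[ℝ] ℂ}
    {y : EM m} (hα : DifferentiableAt ℝ α y) (hβ : DifferentiableAt ℝ β y) (v : ℕ → EM m) :
    wedgeEval (extDeriv α y) (β y) (fun i => v i) +
        (-1) ^ a * wedgeEval (α y) (extDeriv β y) (fun i => v i) =
      ∑ k, fderiv ℝ (fun z => wedgeEval (dxWedge a k (α z)) (β z) (fun i => v i)) y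
        (EuclideanSpace.single k 1) := by
  have hs : ((-1 : ℂ) ^ a) * (-1) ^ a = 1 := by rw [← mul_pow]; simp
  have h (k : Fin m) : fderiv ℝ (fun z => wedgeEval (dxWedge a k (α z)) (β z) (fun i => v i)) y
        (EuclideanSpace.single k 1) =
      wedgeEval (dxWedge a k (fderiv ℝ α y (EuclideanSpace.single k 1))) (β y) (fun i => v i) +
      (-1) ^ a * wedgeEval (α y) (dxWedge b k (fderiv ℝ β y (EuclideanSpace.single k 1)))
        (fun i => v i) := by
    simp only [← wedgeCLM_apply]
    have h1 : HasFDerivAt (fun z => dxWedge a k (α z)) (dxWedge a k ∘L fderiv ℝ α y) y :=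
      (dxWedge a k).hasFDerivAt.comp y hα.hasFDerivAt
    rw [((wedgeCLM (a + 1) b v).hasFDerivAt_of_bilinear h1 hβ.hasFDerivAt).fderiv]
    simp only [add_apply, ContinuousLinearMap.precompR_apply,
      ContinuousLinearMap.precompL_apply, ContinuousLinearMap.comp_apply]
    rw [wedgeCLM_apply v (α y), wedgeEval_dxWedge, ← mul_assoc, hs, one_mul, ← wedgeCLM_apply]
    exact add_comm _ _
  rw [Finset.sum_congr rfl fun k _ => h k, Finset.sum_add_distrib, extDeriv_eq_sum, extDeriv_eq_sum,
    ← Finset.mul_sum]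
  simp only [← wedgeCLM_apply, map_sum, sum_apply]

lemma contDiffAt_wedge {E : Type*} [NormedAddCommGroup E] [NormedSpace ℝ E] {s : WithTop ℕ∞}
    {α : E → EM m [⋀^Fin a]→L[ℝ] ℂ} {β : E → EM m [⋀^Fin b]→L[ℝ] ℂ}
    {y : E} (hα : ContDiffAt ℝ s α y) (hβ : ContDiffAt ℝ s β y) (v : ℕ → EM m) :
    ContDiffAt ℝ s (fun z => wedgeEval (α z) (β z) (fun i => v i)) y := by
  simp only [← wedgeCLM_apply]
  exact ((wedgeCLM a b v).contDiff.contDiffAt.comp y hα).clm_apply hβ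

lemma contDiffAt_extDeriv {α : EM m → EM m [⋀^Fin a]→L[ℝ] ℂ} {y : EM m}
    (hα : ContDiffAt ℝ ∞ α y) : ContDiffAt ℝ ∞ (extDeriv α) y := by
  have h : ContDiffAt ℝ ∞ (fderiv ℝ α) y := hα.fderiv_right (m := ∞) (by simp)
  have e : extDeriv α = fun z => ∑ k, dxWedge a k (fderiv ℝ α z (EuclideanSpace.single k 1)) :=
    funext (extDeriv_eq_sum α)
  rw [e]
  exact ContDiffAt.sum fun k _ => (dxWedge a k).contDiff.contDiffAt.comp y
    (h.clm_apply contDiffAt_const)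

lemma contDiff_of_tsupport {E F : Type*} [NormedAddCommGroup E] [NormedSpace ℝ E]
    [NormedAddCommGroup F] [NormedSpace ℝ F] {s : WithTop ℕ∞} {f : E → F}
    (h : ∀ y ∈ tsupport f, ContDiffAt ℝ s f y) : ContDiff ℝ s f := by
  rw [contDiff_iff_contDiffAt]
  intro y
  by_cases hy : y ∈ tsupport f
  · exact h y hy
  · exact contDiffAt_const.congr_of_eventuallyEq (notMem_tsupport_iff_eventuallyEq.1 hy)

lemma integral_fderiv_eq_zero {f : EM m → ℂ} (hf : ContDiff ℝ 1 f) (hs : HasCompactSupport f)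
    (e : EM m) : ∫ y, fderiv ℝ f y e = 0 := by
  have h1 : HasCompactSupport fun z => fderiv ℝ f z e := hs.fderiv_apply ℝ e
  have hd : Continuous fun z => fderiv ℝ f z e :=
    (hf.continuous_fderiv one_ne_zero).clm_apply continuous_const
  have := integral_mul_fderiv_eq_neg_fderiv_mul_of_integrable (μ := (volume : Measure (EM m)))
    (f := fun _ => (1 : ℂ)) (g := f) (v := e) (by simp)
    (by simpa using hd.integrable_of_hasCompactSupport h1)
    (by simpa using hf.continuous.integrable_of_hasCompactSupport hs)
    (fun x _ => differentiableAt_const _) (fun x _ => hf.differentiable one_ne_zero x)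
  simpa using this

lemma wedgeEval_zero_right {T : Type*} [AddCommGroup T] [Module ℝ T] [TopologicalSpace T]
    (α : T [⋀^Fin a]→L[ℝ] ℂ) (v : Fin (a + b) → T) :
    wedgeEval α (0 : T [⋀^Fin b]→L[ℝ] ℂ) v = 0 := by
  simp [wedgeEval]

lemma extDeriv_eq_zero_of_notMem_tsupport {β : EM m → EM m [⋀^Fin b]→L[ℝ] ℂ} {y : EM m}
    (hy : y ∉ tsupport β) : extDeriv β y = 0 := by
  have h1 : β =ᶠ[𝓝 y] fun _ => 0 := notMem_tsupport_iff_eventuallyEq.1 hy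
  rw [h1.extDeriv_eq, extDeriv_eq_sum]
  simp

/-- Stokes' theorem in `ℝ^m` for forms of which one has compact support. -/
lemma integral_wedge_extDeriv {Ω : Set (EM m)} {α : EM m → EM m [⋀^Fin a]→L[ℝ] ℂ}
    {β : EM m → EM m [⋀^Fin b]→L[ℝ] ℂ} (hα : ∀ y ∈ Ω, ContDiffAt ℝ ∞ α y)
    (hβ : ∀ y ∈ Ω, ContDiffAt ℝ ∞ β y) (hs : HasCompactSupport β) (hΩ : tsupport β ⊆ Ω)
    (v : ℕ → EM m) :
    ∫ y, wedgeEval (extDeriv α y) (β y) (fun i => v i) =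
      -((-1) ^ a * ∫ y, wedgeEval (α y) (extDeriv β y) (fun i => v i)) := by
  have hint {c d : ℕ} (α' : EM m → EM m [⋀^Fin c]→L[ℝ] ℂ) (β' : EM m → EM m [⋀^Fin d]→L[ℝ] ℂ)
      (h1 : ∀ y ∈ Ω, ContDiffAt ℝ ∞ α' y) (h2 : ∀ y ∈ Ω, ContDiffAt ℝ ∞ β' y)
      (h3 : ∀ y ∉ tsupport β, β' y = 0) :
      ContDiff ℝ ∞ (fun y => wedgeEval (α' y) (β' y) (fun i => v i)) ∧
      HasCompactSupport (fun y => wedgeEval (α' y) (β' y) (fun i => v i)) := by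
    have hsub : tsupport (fun y => wedgeEval (α' y) (β' y) (fun i => v i)) ⊆ tsupport β := by
      refine closure_minimal (fun y hy => ?_) (isClosed_tsupport β)
      by_contra hcon
      exact hy (by simp only [h3 y hcon, wedgeEval_zero_right])
    refine ⟨contDiff_of_tsupport fun y hy => ?_,
      HasCompactSupport.of_support_subset_isCompact hs ((subset_tsupport _).trans hsub)⟩
    exact contDiffAt_wedge (h1 y (hΩ (hsub hy))) (h2 y (hΩ (hsub hy))) v
  have h0 : ∀ y ∉ tsupport β, β y = 0 := fun y hy => image_eq_zero_of_notMem_tsupport hy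
  obtain ⟨c1, s1⟩ := hint (extDeriv α) β (fun y hy => contDiffAt_extDeriv (hα y hy)) hβ h0
  obtain ⟨c2, s2⟩ := hint α (extDeriv β) hα (fun y hy => contDiffAt_extDeriv (hβ y hy))
    fun y hy => extDeriv_eq_zero_of_notMem_tsupport hy
  have h3 (k : Fin m) := hint (fun y => dxWedge a k (α y)) β
    (fun y hy => (dxWedge a k).contDiff.contDiffAt.comp y (hα y hy)) hβ h0
  have i1 := c1.continuous.integrable_of_hasCompactSupport s1 (μ := volume)
  have i2 := c2.continuous.integrable_of_hasCompactSupport s2 (μ := volume)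
  have key : ∀ y, wedgeEval (extDeriv α y) (β y) (fun i => v i) +
        (-1) ^ a * wedgeEval (α y) (extDeriv β y) (fun i => v i) =
      ∑ k, fderiv ℝ (fun z => wedgeEval (dxWedge a k (α z)) (β z) (fun i => v i)) y
        (EuclideanSpace.single k 1) := by
    intro y
    by_cases hy : y ∈ tsupport β
    · exact wedge_extDeriv_add ((hα y (hΩ hy)).differentiableAt (by simp))
        ((hβ y (hΩ hy)).differentiableAt (by simp)) v
    · have h4 (k : Fin m) : (fun z => wedgeEval (dxWedge a k (α z)) (β z) (fun i => v i)) =ᶠ[𝓝 y]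
          fun _ => 0 := by
        filter_upwards [(isClosed_tsupport β).isOpen_compl.mem_nhds hy] with z hz
        rw [h0 z hz, wedgeEval_zero_right]
      rw [h0 y hy, extDeriv_eq_zero_of_notMem_tsupport hy]
      simp only [wedgeEval_zero_right, (h4 _).fderiv_eq]
      simp
  rw [eq_neg_iff_add_eq_zero, ← integral_const_mul, ← integral_add i1 (i2.const_mul _)]
  simp only [key]
  rw [integral_finsetSum]
  · exact Finset.sum_eq_zero fun k _ => integral_fderiv_eq_zero ((h3 k).1.of_le (by simp)) (h3 k).2 _
  · intro k _
    exact (((h3 k).1.continuous_fderiv (by simp)).clm_apply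
      continuous_const).integrable_of_hasCompactSupport ((h3 k).2.fderiv_apply ℝ _)

end WedgeCalculus

/-! ### Smooth forms and vector fields on a manifold -/

section SmoothCalculus

variable {m d : ℕ} {M : Type*} [TopologicalSpace M] [ChartedSpace (EM m) M]
  [IsManifold 𝓘(ℝ, EM m) ∞ M]

lemma mem_source (x : M) : x ∈ (chart m x).source := mem_extChartAt_source x

lemma chart_mem_target (x : M) : chart m x x ∈ (chart m x).target := mem_extChartAt_target x

lemma smoothForm_iff {η : DForm (m := m) M d ℂ} : SmoothForm η ↔
    ∀ x₀ : M, ∀ y ∈ (chart m x₀).target, ContDiffAt ℝ ∞ (inChart η x₀) y :=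
  ⟨fun h x₀ _ hy => (h x₀).contDiffAt ((isOpen_target x₀).mem_nhds hy),
    fun h x₀ _ hy => (h x₀ _ hy).contDiffWithinAt⟩

/-- Smoothness near a point can be tested in any chart around the point. -/
lemma smoothForm_of_contDiffAt {η : DForm (m := m) M d ℂ}
    (h : ∀ x : M, ∃ x₀ : M, x ∈ (chart m x₀).source ∧
      ContDiffAt ℝ ∞ (inChart η x₀) (chart m x₀ x)) : SmoothForm η := by
  refine smoothForm_iff.2 fun x₁ _ hy => ?_
  obtain ⟨x₀, hx, hd⟩ := h ((chart m x₁).symm _)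
  exact contDiffAt_inChart_of_contDiffAt hy hx hd

lemma SmoothForm.contDiffAt {η : DForm (m := m) M d ℂ} (h : SmoothForm η) {x₀ : M} {y : EM m}
    (hy : y ∈ (chart m x₀).target) : ContDiffAt ℝ ∞ (inChart η x₀) y :=
  smoothForm_iff.1 h x₀ y hy

lemma inChart_extD_of_smooth {η : DForm (m := m) M d ℂ} (h : SmoothForm η) {x₀ : M} {y : EM m}
    (hy : y ∈ (chart m x₀).target) : inChart (extD η) x₀ y = extDeriv (inChart η x₀) y :=
  inChart_extD hy (h.contDiffAt hy)

lemma inChart_extD_eventuallyEq {η : DForm (m := m) M d ℂ} (h : SmoothForm η) {x₀ : M} {y : EM m}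
    (hy : y ∈ (chart m x₀).target) : inChart (extD η) x₀ =ᶠ[𝓝 y] extDeriv (inChart η x₀) := by
  filter_upwards [(isOpen_target x₀).mem_nhds hy] with z hz using inChart_extD_of_smooth h hz

lemma SmoothForm.extD {η : DForm (m := m) M d ℂ} (h : SmoothForm η) : SmoothForm (extD η) :=
  smoothForm_iff.2 fun _ _ hy =>
    (contDiffAt_extDeriv (h.contDiffAt hy)).congr_of_eventuallyEq (inChart_extD_eventuallyEq h hy)

lemma eq_zero_of_inChart {F : Type*} [NormedAddCommGroup F] [NormedSpace ℝ F]
    {η : DForm (m := m) M d F} {x₀ x : M} (hx : x ∈ (chart m x₀).source)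
    (h : inChart η x₀ (chart m x₀ x) = 0) : η x = 0 := by
  rw [← inChart_comp_dchart η hx, h]
  ext v; rfl

lemma extD_extD {η : DForm (m := m) M d ℂ} (h : SmoothForm η) : extD (extD η) = 0 := by
  funext x
  refine eq_zero_of_inChart (mem_source x) ?_
  have hy := chart_mem_target (m := m) x
  rw [inChart_extD_of_smooth h.extD hy, (inChart_extD_eventuallyEq h hy).extDeriv_eq]
  refine extDeriv_extDeriv_apply ?_ (r := ∞) ?_
  · exact h.contDiffAt hy
  · rw [minSmoothness_of_isRCLikeNormedField]
    exact WithTop.coe_le_coe.2 le_top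

lemma inChart_zero {F : Type*} [NormedAddCommGroup F] [NormedSpace ℝ F] (x₀ : M) (y : EM m) :
    inChart (0 : DForm (m := m) M d F) x₀ y = 0 := by
  ext v; rfl

lemma inChart_eventuallyEq {F : Type*} [NormedAddCommGroup F] [NormedSpace ℝ F]
    {η η' : DForm (m := m) M d F} {x₀ : M} {y : EM m} (hy : y ∈ (chart m x₀).target)
    (h : η =ᶠ[𝓝 ((chart m x₀).symm y)] η') : inChart η x₀ =ᶠ[𝓝 y] inChart η' x₀ := by
  filter_upwards [(continuousAt_symm hy).eventually h] with z hz
  rw [inChart_eq, hz, inChart_eq]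

lemma extD_congr {F : Type*} [NormedAddCommGroup F] [NormedSpace ℝ F]
    {η η' : DForm (m := m) M d F} {x : M} (h : η =ᶠ[𝓝 x] η') : extD η x = extD η' x := by
  have hy := chart_mem_target (m := m) x
  rw [extD_eq, extD_eq, (inChart_eventuallyEq hy ?_).extDeriv_eq]
  rwa [(chart m x).left_inv (mem_source x)]

lemma extD_zero : extD (0 : DForm (m := m) M d ℂ) = 0 := by
  funext x
  rw [extD_eq]
  have : inChart (0 : DForm (m := m) M d ℂ) x = fun _ => 0 := funext fun y => inChart_zero x y
  rw [this, extDeriv_eq_sum]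
  ext v
  simp

lemma extD_eq_zero_of_notMem {η : DForm (m := m) M d ℂ} {x : M}
    (hx : x ∉ closure {x | η x ≠ 0}) : extD η x = 0 := by
  have : η =ᶠ[𝓝 x] 0 := by
    filter_upwards [isClosed_closure.isOpen_compl.mem_nhds hx] with z hz
    by_contra hcon
    exact hz (subset_closure hcon)
  rw [extD_congr this, extD_zero]
  rfl

lemma CompactSupportIn.extD {η : DForm (m := m) M d ℂ} {U : Set M} (h : CompactSupportIn η U) :
    CompactSupportIn (extD η) U := by
  have hsub : closure {x | CRLp.extD η x ≠ 0} ⊆ closure {x | η x ≠ 0} := by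
    refine closure_minimal (fun x hx => ?_) isClosed_closure
    by_contra hcon
    exact hx (extD_eq_zero_of_notMem hcon)
  exact ⟨h.1.of_isClosed_subset isClosed_closure hsub, hsub.trans h.2⟩

lemma inChart_add {F : Type*} [NormedAddCommGroup F] [NormedSpace ℝ F]
    (η η' : DForm (m := m) M d F) (x₀ : M) : inChart (η + η') x₀ = inChart η x₀ + inChart η' x₀ := by
  funext y; ext v; rfl

lemma extD_add {η η' : DForm (m := m) M d ℂ} (h : SmoothForm η) (h' : SmoothForm η') :
    extD (η + η') = extD η + extD η' := by
  funext x
  have hy := chart_mem_target (m := m) x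
  rw [Pi.add_apply, extD_eq, extD_eq, extD_eq, inChart_add,
    extDeriv_add ((h.contDiffAt hy).differentiableAt (by simp))
      ((h'.contDiffAt hy).differentiableAt (by simp))]
  ext v; rfl

lemma SmoothForm.add {η η' : DForm (m := m) M d ℂ} (h : SmoothForm η) (h' : SmoothForm η') :
    SmoothForm (η + η') := by
  refine smoothForm_iff.2 fun x₀ y hy => ?_
  rw [inChart_add]
  exact (h.contDiffAt hy).add (h'.contDiffAt hy)

lemma SmoothForm.zero : SmoothForm (0 : DForm (m := m) M d ℂ) := by
  refine smoothForm_iff.2 fun x₀ y hy => ?_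
  rw [show inChart (0 : DForm (m := m) M d ℂ) x₀ = fun _ => 0 from funext fun y => inChart_zero x₀ y]
  exact contDiffAt_const

lemma SmoothForm.sum {ι : Type*} (t : Finset ι) {η : ι → DForm (m := m) M d ℂ}
    (h : ∀ i ∈ t, SmoothForm (η i)) :
    SmoothForm (∑ i ∈ t, η i) ∧ CRLp.extD (∑ i ∈ t, η i) = ∑ i ∈ t, CRLp.extD (η i) := by
  classical
  induction t using Finset.induction_on with
  | empty => simpa using ⟨SmoothForm.zero, extD_zero⟩
  | insert i t hi ih =>
    obtain ⟨h1, h2⟩ := ih fun j hj => h j (Finset.mem_insert_of_mem hj)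
    have h3 := h i (Finset.mem_insert_self i t)
    rw [Finset.sum_insert hi, Finset.sum_insert hi, extD_add h3 h1, h2]
    exact ⟨h3.add h1, rfl⟩

/-- The product of a function and a form. -/
def fmul (χ : M → ℝ) (η : DForm (m := m) M d ℂ) : DForm (m := m) M d ℂ := fun x => (χ x : ℂ) • η x

lemma SmoothForm.fmul {χ : M → ℝ} (hχ : ContMDiff 𝓘(ℝ, EM m) 𝓘(ℝ, ℝ) ∞ χ)
    {η : DForm (m := m) M d ℂ} (h : SmoothForm η) : SmoothForm (fmul χ η) := by
  refine smoothForm_iff.2 fun x₀ y hy => ?_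
  have e : inChart (CRLp.fmul χ η) x₀ = fun y => χ ((chart m x₀).symm y) • inChart η x₀ y := by
    funext y; ext v; simp [inChart_eq, CRLp.fmul]
  rw [e]
  have h1 : ContDiffAt ℝ ∞ (fun y => χ ((chart m x₀).symm y)) y :=
    (ContMDiffAt.comp y hχ.contMDiffAt (contMDiffAt_symm hy)).contDiffAt
  exact h1.smul (h.contDiffAt hy)

variable [T2Space M]

open Classical in
/-- The form on `M` given by a form on the target of a chart, extended by zero. -/
def chartForm (x₀ : M) (β : EM m → EM m [⋀^Fin d]→L[ℝ] ℂ) : DForm (m := m) M d ℂ := fun x =>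
  if x ∈ (chart m x₀).source then (β (chart m x₀ x)).compContinuousLinearMap (dchart x₀ x) else 0

lemma inChart_chartForm {x₀ : M} {y : EM m} (β : EM m → EM m [⋀^Fin d]→L[ℝ] ℂ)
    (hy : y ∈ (chart m x₀).target) : inChart (chartForm x₀ β) x₀ y = β y := by
  rw [inChart_eq, chartForm, if_pos ((chart m x₀).map_target hy), (chart m x₀).right_inv hy]
  ext v
  have := fun j => DFunLike.congr_fun (dchart_comp_dsymm hy) (v j)
  simp only [ContinuousLinearMap.comp_apply, ContinuousLinearMap.id_apply] at this
  simp [Function.comp_def, this]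

lemma isClosed_symm_image {x₀ : M} {K : Set (EM m)} (hK : IsCompact K)
    (h : K ⊆ (chart m x₀).target) : IsCompact ((chart m x₀).symm '' K) ∧
      IsClosed ((chart m x₀).symm '' K) := by
  have : IsCompact ((chart m x₀).symm '' K) := hK.image_of_continuousOn fun y hy =>
    (continuousAt_symm (h hy)).continuousWithinAt
  exact ⟨this, this.isClosed⟩

lemma support_chartForm_subset (x₀ : M) (β : EM m → EM m [⋀^Fin d]→L[ℝ] ℂ) :
    {x | chartForm x₀ β x ≠ 0} ⊆ (chart m x₀).symm '' tsupport β := by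
  intro x hx
  by_cases hs : x ∈ (chart m x₀).source
  · refine ⟨chart m x₀ x, ?_, (chart m x₀).left_inv hs⟩
    by_contra hcon
    refine hx ?_
    rw [chartForm, if_pos hs, image_eq_zero_of_notMem_tsupport hcon]
    ext v; rfl
  · exact absurd (if_neg hs) hx

lemma closure_support_chartForm_subset {x₀ : M} {β : EM m → EM m [⋀^Fin d]→L[ℝ] ℂ}
    (hs : HasCompactSupport β) (h : tsupport β ⊆ (chart m x₀).target) :
    closure {x | chartForm x₀ β x ≠ 0} ⊆ (chart m x₀).symm '' tsupport β :=
  closure_minimal (support_chartForm_subset x₀ β) (isClosed_symm_image hs h).2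

lemma compactSupportIn_chartForm {x₀ : M} {β : EM m → EM m [⋀^Fin d]→L[ℝ] ℂ}
    (hs : HasCompactSupport β) (h : tsupport β ⊆ (chart m x₀).target) {U : Set M}
    (hU : ∀ y ∈ tsupport β, (chart m x₀).symm y ∈ U) : CompactSupportIn (chartForm x₀ β) U := by
  have h1 := closure_support_chartForm_subset hs h
  refine ⟨(isClosed_symm_image hs h).1.of_isClosed_subset isClosed_closure h1, h1.trans ?_⟩
  rintro _ ⟨y, hy, rfl⟩
  exact hU y hy

lemma smoothForm_chartForm {x₀ : M} {β : EM m → EM m [⋀^Fin d]→L[ℝ] ℂ} (hβ : ContDiff ℝ ∞ β)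
    (hs : HasCompactSupport β) (h : tsupport β ⊆ (chart m x₀).target) :
    SmoothForm (chartForm x₀ β) := by
  refine smoothForm_of_contDiffAt fun x => ?_
  by_cases hx : x ∈ (chart m x₀).source
  · refine ⟨x₀, hx, hβ.contDiffAt.congr_of_eventuallyEq ?_⟩
    filter_upwards [(isOpen_target x₀).mem_nhds ((chart m x₀).map_source hx)] with z hz
    exact inChart_chartForm β hz
  · refine ⟨x, mem_source x, ?_⟩
    have h1 : chartForm x₀ β =ᶠ[𝓝 x] 0 := by
      have : x ∉ (chart m x₀).symm '' tsupport β := by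
        rintro ⟨y, hy, rfl⟩
        exact hx ((chart m x₀).map_target (h hy))
      filter_upwards [(isClosed_symm_image hs h).2.isOpen_compl.mem_nhds this] with z hz
      by_contra hcon
      exact hz (support_chartForm_subset x₀ β hcon)
    refine ContDiffAt.congr_of_eventuallyEq (contDiffAt_const (c := 0))
      ((inChart_eventuallyEq (chart_mem_target x) ?_).trans
        (Eventually.of_forall fun y => inChart_zero x y))
    rwa [(chart m x).left_inv (mem_source x)]

/-! ### Vector fields -/

/-- A smooth vector field has smooth components in charts. -/
lemma SmoothField.contDiffAt {V : M → EM m} (hV : SmoothField V) {x₀ : M} {y : EM m}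
    (hy : y ∈ (chart m x₀).target) :
    ContDiffAt ℝ ∞ (fun z => dchart x₀ ((chart m x₀).symm z) (V ((chart m x₀).symm z))) y := by
  have inv : ∀ z ∈ (chart m x₀).target,
      (dsymm x₀ z).inverse = dchart x₀ ((chart m x₀).symm z) := by
    intro z hz
    refine ContinuousLinearMap.inverse_eq ?_ (dchart_comp_dsymm hz)
    have := dsymm_comp_dchart ((chart m x₀).map_target hz)
    rwa [(chart m x₀).right_inv hz] at this
  have hinv : (dsymm x₀ y).IsInvertible := by
    refine ContinuousLinearMap.IsInvertible.of_inverse (g := dchart x₀ ((chart m x₀).symm y))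
      ?_ (dchart_comp_dsymm hy)
    have := dsymm_comp_dchart ((chart m x₀).map_target hy)
    rwa [(chart m x₀).right_inv hy] at this
  have h1 := ContMDiffAt.mpullback_vectorField_preimage (n := ∞) (m := ∞) (V := V)
    (hV.contMDiffAt (x := (chart m x₀).symm y)) (contMDiffAt_symm hy) hinv (by simp)
  refine (contMDiffAt_vectorSpace_iff_contDiffAt.1 h1).congr_of_eventuallyEq ?_
  filter_upwards [(isOpen_target x₀).mem_nhds hy] with z hz
  refine Eq.trans ?_ (VectorField.mpullback_apply (V := V) (x := z)
    (f := (chart m x₀).symm)).symm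
  rw [← inv z hz]
  rfl

open Classical in
/-- The vector field on `M` given by a vector field on the target of a chart, extended by zero. -/
def chartField (x₀ : M) (V : EM m → EM m) : M → EM m := fun x =>
  if x ∈ (chart m x₀).source then dsymm x₀ (chart m x₀ x) (V (chart m x₀ x)) else 0

lemma smoothField_chartField {x₀ : M} {V : EM m → EM m} (hV : ContDiff ℝ ∞ V)
    (hs : HasCompactSupport V) (h : tsupport V ⊆ (chart m x₀).target) :
    SmoothField (chartField x₀ V) := by
  intro x
  by_cases hx : x ∈ (chart m x₀).source
  · have inv : ∀ z ∈ (chart m x₀).source,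
        (dchart (m := m) x₀ z).inverse = dsymm x₀ (chart m x₀ z) := by
      intro z hz
      refine ContinuousLinearMap.inverse_eq ?_ (dsymm_comp_dchart hz)
      have := dchart_comp_dsymm ((chart m x₀).map_source hz)
      rwa [(chart m x₀).left_inv hz] at this
    have hinv : (dchart (m := m) x₀ x).IsInvertible := by
      refine ContinuousLinearMap.IsInvertible.of_inverse (g := dsymm x₀ (chart m x₀ x))
        ?_ (dsymm_comp_dchart hx)
      have := dchart_comp_dsymm ((chart m x₀).map_source hx)
      rwa [(chart m x₀).left_inv hx] at this
    have h1 := ContMDiffAt.mpullback_vectorField_preimage (n := ∞) (m := ∞) (V := V)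
      (contMDiffAt_vectorSpace_iff_contDiffAt.2 hV.contDiffAt) (contMDiffAt_chart hx) hinv (by simp)
    refine ContMDiffAt.congr_of_eventuallyEq h1 ?_
    filter_upwards [(isOpen_source x₀).mem_nhds hx] with z hz
    refine congrArg (fun w : TangentSpace 𝓘(ℝ, EM m) z => (⟨z, w⟩ : TangentBundle 𝓘(ℝ, EM m) M)) ?_
    refine Eq.trans ?_ (VectorField.mpullback_apply (V := V) (x := z) (f := chart m x₀)).symm
    rw [chartField, if_pos hz, ← inv z hz]
    rfl
  · have h1 : (chartField x₀ V) =ᶠ[𝓝 x] 0 := by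
      have : x ∉ (chart m x₀).symm '' tsupport V := by
        rintro ⟨y, hy, rfl⟩
        exact hx ((chart m x₀).map_target (h hy))
      filter_upwards [(isClosed_symm_image hs h).2.isOpen_compl.mem_nhds this] with z hz
      by_cases hzs : z ∈ (chart m x₀).source
      · rw [chartField, if_pos hzs, image_eq_zero_of_notMem_tsupport (f := V), map_zero]
        · rfl
        · intro hcon
          exact hz ⟨_, hcon, (chart m x₀).left_inv hzs⟩
      · rw [chartField, if_neg hzs]
        rfl
    have h2 : ContMDiffAt 𝓘(ℝ, EM m) (𝓘(ℝ, EM m)).tangent ∞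
        (fun x => (⟨x, 0⟩ : TangentBundle 𝓘(ℝ, EM m) M)) x :=
      (Bundle.contMDiff_zeroSection ℝ (TangentSpace 𝓘(ℝ, EM m) : M → Type _)).contMDiffAt
    refine h2.congr_of_eventuallyEq ?_
    filter_upwards [h1] with z hz
    rw [hz]
    rfl

/-- The coefficients of a smooth form are continuous. -/
lemma SmoothForm.continuous_apply {η : DForm (m := m) M d ℂ} (h : SmoothForm η)
    {V : Fin d → M → EM m} (hV : ∀ i, SmoothField (V i)) :
    Continuous fun x => η x fun i => V i x := by
  rw [continuous_iff_continuousAt]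
  intro x
  have hx := mem_source (m := m) x
  have h1 : ContDiffAt ℝ ∞ (fun z => inChart η x z fun i =>
      dchart x ((chart m x).symm z) (V i ((chart m x).symm z))) (chart m x x) :=
    contDiffAt_form_apply (h.contDiffAt (chart_mem_target x)) fun i =>
      (hV i).contDiffAt (chart_mem_target x)
  have h2 := ContinuousAt.comp (f := chart m x) h1.continuousAt (continuousAt_chart hx)
  refine h2.congr ?_
  filter_upwards [(isOpen_source x).mem_nhds hx] with z hz
  simp only [Function.comp_apply]
  rw [(chart m x).left_inv hz]
  exact DFunLike.congr_fun (inChart_comp_dchart η hz) _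

end SmoothCalculus

/-! ### The measure in charts -/

section MeasureCharts

variable {m a b : ℕ} {M : Type*} [TopologicalSpace M] [ChartedSpace (EM m) M]

/-- The standard frame as a family indexed by `Fin m`. -/
abbrev fr (m : ℕ) : Fin m → EM m := fun i => stdFrame m i

lemma topForm_comp (η : EM m [⋀^Fin m]→L[ℝ] ℝ) (A : EM m →L[ℝ] EM m) :
    η.compContinuousLinearMap A (fr m) = LinearMap.det (A : EM m →ₗ[ℝ] EM m) * η (fr m) := by
  let e := (EuclideanSpace.basisFun (Fin m) ℝ).toBasis
  have he : fr m = e := by funext i; simp [e, stdFrame_fin]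
  have h1 := (η.toAlternatingMap).eq_smul_basis_det e
  have h2 : η.compContinuousLinearMap A (fr m) = η.toAlternatingMap (A ∘ e) := by rw [he]; rfl
  have h3 : η (fr m) = η.toAlternatingMap e := by rw [he]; rfl
  rw [h2, h3, h1]
  have h4 := Module.Basis.det_comp_basis e e (A : EM m →ₗ[ℝ] EM m)
  have h5 : e.det (A ∘ e) = LinearMap.det (A : EM m →ₗ[ℝ] EM m) := by
    refine Eq.trans ?_ h4
    rfl
  simp [h5, Module.Basis.det_self]
  ring

lemma topForm_eq_zero {η : EM m [⋀^Fin m]→L[ℝ] ℝ} (h : η (fr m) = 0) : η = 0 := by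
  let e := (EuclideanSpace.basisFun (Fin m) ℝ).toBasis
  have he : fr m = e := by funext i; simp [e, stdFrame_fin]
  have h1 := (η.toAlternatingMap).eq_smul_basis_det e
  have h3 : η (fr m) = η.toAlternatingMap e := by rw [he]; rfl
  rw [← h3, h, zero_smul] at h1
  exact ContinuousAlternatingMap.toAlternatingMap_injective h1

lemma wedgeEval_comp (h : a + b = m) (α : EM m [⋀^Fin a]→L[ℝ] ℂ) (β : EM m [⋀^Fin b]→L[ℝ] ℂ)
    (A : EM m →L[ℝ] EM m) :
    wedgeEval (α.compContinuousLinearMap A) (β.compContinuousLinearMap A)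
        (fun i => stdFrame m i) =
      ((LinearMap.det (A : EM m →ₗ[ℝ] EM m) : ℝ) : ℂ) *
        wedgeEval α β (fun i => stdFrame m i) := by
  rw [← pull_extC α, ← pull_extC β, pull_comp, pull_comp, wedgeEval_pull h, wedgeEval_pull h,
    det_cext_comp]
  ring

variable [IsManifold 𝓘(ℝ, EM m) ∞ M]

lemma det_dsymm_ne_zero {x₀ : M} {y : EM m} (hy : y ∈ (chart m x₀).target) :
    LinearMap.det (dsymm x₀ y : EM m →ₗ[ℝ] EM m) ≠ 0 := by
  have h := congrArg (fun A : EM m →L[ℝ] EM m => LinearMap.det (A : EM m →ₗ[ℝ] EM m))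
    (dchart_comp_dsymm hy)
  simp only [ContinuousLinearMap.toLinearMap_comp, LinearMap.det_comp] at h
  intro h0
  rw [h0, mul_zero] at h
  simp at h

lemma inChart_vol_ne_zero {vol : DForm (m := m) M m ℝ} (hvol : IsVolumeForm vol) {x₀ : M} {y : EM m}
    (hy : y ∈ (chart m x₀).target) : inChart vol x₀ y (fr m) ≠ 0 := by
  rw [inChart_eq, topForm_comp]
  exact mul_ne_zero (det_dsymm_ne_zero hy) fun h => hvol.ne_zero _ (topForm_eq_zero h)

lemma continuousOn_inChart_vol {vol : DForm (m := m) M m ℝ} (hvol : IsVolumeForm vol) (x₀ : M) :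
    ContinuousOn (fun y => inChart vol x₀ y (fr m)) (chart m x₀).target :=
  ((ContinuousAlternatingMap.apply ℝ (EM m) ℝ (fr m)).continuous).comp_continuousOn
    (hvol.smooth x₀).continuousOn

/-- The density of a wedge product can be computed in any chart. -/
lemma wedgeDensity_symm (h : a + b = m) {vol : DForm (m := m) M m ℝ} (hvol : IsVolumeForm vol)
    {x₀ : M} {y : EM m} (hy : y ∈ (chart m x₀).target) (α : DForm (m := m) M a ℂ)
    (β : DForm (m := m) M b ℂ) :
    wedgeDensity vol α β ((chart m x₀).symm y) =
      wedgeEval (inChart α x₀ y) (inChart β x₀ y) (fun i => stdFrame m i) /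
        ((inChart vol x₀ y (fr m) : ℝ) : ℂ) := by
  have hd := det_dsymm_ne_zero hy
  have h1 : vol ((chart m x₀).symm y) (fr m) ≠ 0 :=
    fun h => hvol.ne_zero _ (topForm_eq_zero h)
  rw [inChart_eq, inChart_eq, inChart_eq, wedgeEval_comp h, topForm_comp, wedgeDensity]
  have hd' : ((LinearMap.det (dsymm x₀ y : EM m →ₗ[ℝ] EM m) : ℝ) : ℂ) ≠ 0 := by exact_mod_cast hd
  push_cast
  rw [mul_div_mul_left _ _ hd']

/-- The density of the measure in the preferred chart at `x₀`. -/
def dens (vol : DForm (m := m) M m ℝ) (x₀ : M) (y : EM m) : ℝ := |inChart vol x₀ y (fr m)|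

lemma dens_nonneg (vol : DForm (m := m) M m ℝ) (x₀ : M) (y : EM m) : 0 ≤ dens vol x₀ y := abs_nonneg _

lemma dens_pos {vol : DForm (m := m) M m ℝ} (hvol : IsVolumeForm vol) {x₀ : M} {y : EM m}
    (hy : y ∈ (chart m x₀).target) : 0 < dens vol x₀ y :=
  abs_pos.2 (inChart_vol_ne_zero hvol hy)

lemma continuousOn_dens {vol : DForm (m := m) M m ℝ} (hvol : IsVolumeForm vol) (x₀ : M) :
    ContinuousOn (dens vol x₀) (chart m x₀).target := (continuousOn_inChart_vol hvol x₀).abs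

lemma dens_eq {vol : DForm (m := m) M m ℝ} {x₀ x₁ : M} {y : EM m} (hy : y ∈ (chart m x₁).target)
    (hx : (chart m x₁).symm y ∈ (chart m x₀).source) :
    dens vol x₁ y = |(fderiv ℝ (trans (m := m) x₀ x₁) y).det| * dens vol x₀ (trans x₀ x₁ y) := by
  rw [dens, inChart_eq_pullback vol hy hx, topForm_comp, abs_mul]
  rfl

/-- The Lebesgue measure with the density of the volume form, on the target of a chart. -/
def densMeasure (vol : DForm (m := m) M m ℝ) (x₀ : M) : Measure (EM m) :=
  ((volume : Measure (EM m)).restrict (chart m x₀).target).withDensity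
    fun y => ENNReal.ofReal (dens vol x₀ y)

lemma aemeasurable_dens {vol : DForm (m := m) M m ℝ} (hvol : IsVolumeForm vol) (x₀ : M) :
    AEMeasurable (fun y => ENNReal.ofReal (dens vol x₀ y))
      ((volume : Measure (EM m)).restrict (chart m x₀).target) :=
  ((continuousOn_dens hvol x₀).aemeasurable (isOpen_target x₀).measurableSet).ennreal_ofReal

lemma restrict_target_absolutelyContinuous {vol : DForm (m := m) M m ℝ} (hvol : IsVolumeForm vol)
    (x₀ : M) :
    (volume : Measure (EM m)).restrict (chart m x₀).target ≪ densMeasure vol x₀ := by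
  refine withDensity_absolutelyContinuous' (aemeasurable_dens hvol x₀) ?_
  filter_upwards [ae_restrict_mem (isOpen_target x₀).measurableSet] with y hy
  simpa using dens_pos hvol hy

variable [MeasurableSpace M] [BorelSpace M]

lemma continuousOn_symm (x₀ : M) : ContinuousOn (chart m x₀).symm (chart m x₀).target :=
  fun _ hy => (continuousAt_symm hy).continuousWithinAt

lemma aemeasurable_symm (vol : DForm (m := m) M m ℝ) (x₀ : M) :
    AEMeasurable (chart m x₀).symm (densMeasure vol x₀) :=
  ((continuousOn_symm x₀).aemeasurable (isOpen_target x₀).measurableSet).mono_ac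
    (withDensity_absolutelyContinuous _ _)

lemma chartMeasure_eq (vol : DForm (m := m) M m ℝ) (x₀ : M) :
    chartMeasure vol x₀ = (densMeasure vol x₀).map (chart m x₀).symm := rfl

lemma densMeasure_restrict (vol : DForm (m := m) M m ℝ) (x₀ : M) :
    (densMeasure vol x₀).restrict (chart m x₀).target = densMeasure vol x₀ := by
  rw [densMeasure, restrict_withDensity (isOpen_target x₀).measurableSet, Measure.restrict_restrict
    (isOpen_target x₀).measurableSet, inter_self]

lemma measurableSet_target_inter {x₀ : M} {A : Set M} (hA : MeasurableSet A) :
    MeasurableSet ((chart m x₀).target ∩ (chart m x₀).symm ⁻¹' A) := by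
  have h2 : Measurable (fun y : (chart m x₀).target => (chart m x₀).symm y) :=
    (continuousOn_iff_continuous_domRestrict.1 (continuousOn_symm x₀)).measurable
  have := (MeasurableEmbedding.subtype_coe
    (isOpen_target (m := m) x₀).measurableSet).measurableSet_image.2 (h2 hA)
  convert this using 1
  ext y
  simp [and_comm]

lemma chartMeasure_apply (vol : DForm (m := m) M m ℝ) {x₀ : M} {A : Set M}
    (hA : MeasurableSet A) : chartMeasure vol x₀ A =
      ∫⁻ y in (chart m x₀).target ∩ (chart m x₀).symm ⁻¹' A, ENNReal.ofReal (dens vol x₀ y) := by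
  have h1 := measurableSet_target_inter (m := m) (x₀ := x₀) hA
  rw [chartMeasure_eq, Measure.map_apply_of_aemeasurable (aemeasurable_symm vol x₀) hA,
    ← densMeasure_restrict, Measure.restrict_apply₀', inter_comm, densMeasure, withDensity_apply _ h1,
    Measure.restrict_restrict h1, inter_assoc, inter_comm _ (chart m x₀).target, ← inter_assoc,
    inter_self]
  exact (isOpen_target x₀).measurableSet.nullMeasurableSet

/-- The densities in two charts define the same measure on the overlap, by the change of variables
formula. -/
lemma chartMeasure_le (vol : DForm (m := m) M m ℝ) {x₀ x₁ : M}
    {A : Set M} (hA : MeasurableSet A) (hAs : A ⊆ (chart m x₀).source) :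
    chartMeasure vol x₁ A ≤ chartMeasure vol x₀ A := by
  rw [chartMeasure_apply vol hA, chartMeasure_apply vol hA]
  set S := (chart m x₁).target ∩ (chart m x₁).symm ⁻¹' A with hS
  have hSm : MeasurableSet S := measurableSet_target_inter hA
  have hder : ∀ y ∈ S, HasFDerivWithinAt (trans (m := m) x₀ x₁)
      (fderiv ℝ (trans (m := m) x₀ x₁) y) S y := fun y hy =>
    (((contDiffAt_trans hy.1 (hAs hy.2)).differentiableAt (by simp)).hasFDerivAt).hasFDerivWithinAt
  have hinj : InjOn (trans (m := m) x₀ x₁) S := by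
    intro y hy z hz h
    exact (chart m x₁).symm.injOn hy.1 hz.1 ((chart m x₀).injOn (hAs hy.2) (hAs hz.2) h)
  calc ∫⁻ y in S, ENNReal.ofReal (dens vol x₁ y)
      = ∫⁻ y in S, ENNReal.ofReal |(fderiv ℝ (trans (m := m) x₀ x₁) y).det| *
          ENNReal.ofReal (dens vol x₀ (trans x₀ x₁ y)) := by
        refine setLIntegral_congr_fun hSm fun y hy => ?_
        rw [dens_eq hy.1 (hAs hy.2), ENNReal.ofReal_mul (abs_nonneg _)]
    _ = ∫⁻ y in trans (m := m) x₀ x₁ '' S, ENNReal.ofReal (dens vol x₀ y) :=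
        (lintegral_image_eq_lintegral_abs_det_fderiv_mul volume hSm hder hinj
          fun y => ENNReal.ofReal (dens vol x₀ y)).symm
    _ ≤ _ := by
        refine lintegral_mono_set ?_
        rintro _ ⟨y, hy, rfl⟩
        refine ⟨(chart m x₀).map_source (hAs hy.2), ?_⟩
        simp only [mem_preimage, trans, Function.comp_apply]
        rw [(chart m x₀).left_inv (hAs hy.2)]
        exact hy.2

lemma chartMeasure_restrict (vol : DForm (m := m) M m ℝ) (x₀ : M) :
    (chartMeasure vol x₀).restrict (chart m x₀).source = chartMeasure vol x₀ := by
  rw [chartMeasure_eq, Measure.restrict_map_of_aemeasurable (aemeasurable_symm vol x₀)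
    (isOpen_source x₀).measurableSet, Measure.restrict_eq_self_of_ae_mem]
  rw [← densMeasure_restrict]
  filter_upwards [ae_restrict_mem (isOpen_target x₀).measurableSet] with y hy
  exact (chart m x₀).map_target hy

/-- The measure of the volume form is given on the domain of a chart by the density in the chart. -/
lemma volMeasure_restrict (vol : DForm (m := m) M m ℝ) (x₀ : M) :
    (volMeasure vol).restrict (chart m x₀).source = chartMeasure vol x₀ := by
  have hs := (isOpen_source (m := m) x₀).measurableSet
  refine le_antisymm ?_ ?_
  -- outside the chart a crude upper bound suffices for the supremum of the chart measures
  · have h1 : volMeasure vol ≤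
        chartMeasure vol x₀ + (⊤ : Measure M).restrict (chart m x₀).sourceᶜ := by
      refine iSup_le fun x₁ => Measure.le_iff.2 fun A hA => ?_
      rw [← measure_inter_add_sdiff A hs, Measure.add_apply, Measure.restrict_apply hA]
      refine add_le_add ((chartMeasure_le vol (hA.inter hs) inter_subset_right).trans
        (measure_mono inter_subset_left)) (?_ : _ ≤ (⊤ : Measure M) (A ∩ _))
      exact (le_top : chartMeasure vol x₁ ≤ ⊤) _
    refine Measure.le_iff.2 fun A hA => ?_
    rw [Measure.restrict_apply hA]
    refine (h1 _).trans ?_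
    rw [Measure.add_apply, Measure.restrict_apply (hA.inter hs), inter_assoc, inter_compl_self,
      inter_empty, measure_empty, add_zero]
    exact measure_mono inter_subset_left
  · rw [← chartMeasure_restrict]
    exact Measure.restrict_mono subset_rfl (le_iSup (chartMeasure vol) x₀)

lemma ae_chart {vol : DForm (m := m) M m ℝ} (hvol : IsVolumeForm vol) (x₀ : M) {P : M → Prop}
    (h : ∀ᵐ x ∂volMeasure vol, P x) :
    ∀ᵐ y ∂(volume : Measure (EM m)).restrict (chart m x₀).target, P ((chart m x₀).symm y) := by
  have h1 : ∀ᵐ x ∂chartMeasure vol x₀, P x := by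
    rw [← volMeasure_restrict vol]
    exact ae_restrict_of_ae h
  rw [chartMeasure_eq] at h1
  exact restrict_target_absolutelyContinuous hvol x₀ (ae_of_ae_map (aemeasurable_symm vol x₀) h1)

lemma volMeasure_eq_zero (vol : DForm (m := m) M m ℝ) {x₀ : M} {A : Set M}
    (hA : MeasurableSet A) (hAs : A ⊆ (chart m x₀).source)
    (h : volume ((chart m x₀).target ∩ (chart m x₀).symm ⁻¹' A) = 0) : volMeasure vol A = 0 := by
  rw [← inter_eq_self_of_subset_left hAs, ← Measure.restrict_apply hA, volMeasure_restrict vol,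
    chartMeasure_apply vol hA, Measure.restrict_eq_zero.2 h, lintegral_zero_measure]

/-- The parametrization of the domain of a chart by its target. -/
def param (x₀ : M) : (chart m x₀).target → M := fun y => (chart m x₀).symm y

lemma measurableEmbedding_param (x₀ : M) : MeasurableEmbedding (param (m := m) x₀) := by
  refine (IsOpenEmbedding.of_continuous_injective_isOpenMap ?_ ?_ ?_).measurableEmbedding
  · exact continuousOn_iff_continuous_domRestrict.1 (continuousOn_symm x₀)
  · intro y z h
    exact Subtype.ext ((chart m x₀).symm.injOn y.2 z.2 h)
  · intro O hO
    have h1 : IsOpen ((chart m x₀).source ∩ chart m x₀ ⁻¹' (Subtype.val '' O)) :=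
      ContinuousOn.isOpen_inter_preimage
        (fun x hx => (continuousAt_chart hx).continuousWithinAt) (isOpen_source x₀)
        ((isOpen_target x₀).isOpenMap_subtype_val _ hO)
    convert h1 using 1
    ext x
    constructor
    · rintro ⟨y, hy, rfl⟩
      exact ⟨(chart m x₀).map_target y.2, y, hy, ((chart m x₀).right_inv y.2).symm⟩
    · rintro ⟨hx, y, hy, he⟩
      exact ⟨y, hy, by rw [param, he, (chart m x₀).left_inv hx]⟩

lemma chartMeasure_eq_map_param (vol : DForm (m := m) M m ℝ) (x₀ : M) :
    chartMeasure vol x₀ =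
      ((densMeasure vol x₀).comap (Subtype.val : (chart m x₀).target → EM m)).map (param x₀) := by
  have h1 := (MeasurableEmbedding.subtype_coe
      (isOpen_target (m := m) x₀).measurableSet).map_comap (densMeasure vol x₀)
  rw [Subtype.range_coe, densMeasure_restrict] at h1
  rw [chartMeasure_eq, ← h1, AEMeasurable.map_map_of_aemeasurable]
  · rw [h1]; rfl
  · rw [h1]; exact aemeasurable_symm vol x₀
  · exact measurable_subtype_coe.aemeasurable

variable {E : Type*} [NormedAddCommGroup E] [NormedSpace ℝ E]

/-- Integration in a chart. -/
lemma integral_chart {vol : DForm (m := m) M m ℝ} (hvol : IsVolumeForm vol) {x₀ : M} {h : M → E}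
    (hh : ∀ x ∉ (chart m x₀).source, h x = 0) :
    ∫ x, h x ∂volMeasure vol =
      ∫ y in (chart m x₀).target, dens vol x₀ y • h ((chart m x₀).symm y) := by
  rw [← setIntegral_eq_integral_of_forall_compl_eq_zero hh, volMeasure_restrict vol,
    chartMeasure_eq_map_param, (measurableEmbedding_param x₀).integral_map]
  refine (integral_subtype_comap (isOpen_target x₀).measurableSet
    fun y => h ((chart m x₀).symm y)).trans ?_
  rw [densMeasure_restrict, densMeasure,
    integral_withDensity_eq_integral_toReal_smul₀ (aemeasurable_dens hvol x₀) (by simp)]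
  refine integral_congr_ae (Eventually.of_forall fun y => ?_)
  simp only [ENNReal.toReal_ofReal (dens_nonneg vol x₀ y)]

/-- Local `L^p` bounds pass to charts. -/
lemma memLp_chart {vol : DForm (m := m) M m ℝ} (hvol : IsVolumeForm vol) {x₀ : M} {U : Set M}
    (hU : IsOpen U) {p : ℝ≥0∞} {g : M → E} (hg : MemLp g p ((volMeasure vol).restrict U))
    {K : Set (EM m)} (hK : IsCompact K) (hKt : K ⊆ (chart m x₀).target) :
    MemLp ((K ∩ (chart m x₀).symm ⁻¹' U).indicator fun y => g ((chart m x₀).symm y)) p volume := by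
  have hKU : K ∩ (chart m x₀).symm ⁻¹' U = K ∩ ((chart m x₀).target ∩ (chart m x₀).symm ⁻¹' U) := by
    rw [← inter_assoc, inter_eq_self_of_subset_left hKt]
  have hOm : MeasurableSet ((chart m x₀).target ∩ (chart m x₀).symm ⁻¹' U) :=
    measurableSet_target_inter hU.measurableSet
  have hm : MeasurableSet (K ∩ (chart m x₀).symm ⁻¹' U) := by
    rw [hKU]; exact hK.measurableSet.inter hOm
  rw [memLp_indicator_iff_restrict hm]
  -- the density is bounded below on `K`, so Lebesgue measure on `K` is dominated by the
  -- measure of the volume form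
  obtain ⟨c, hc, hcK⟩ : ∃ c > 0, ∀ y ∈ K, c ≤ dens vol x₀ y := by
    rcases K.eq_empty_or_nonempty with rfl | hne
    · exact ⟨1, one_pos, by simp⟩
    · obtain ⟨z, hz, hmin⟩ := hK.exists_isMinOn hne ((continuousOn_dens hvol x₀).mono hKt)
      exact ⟨_, dens_pos hvol (hKt hz), fun y hy => hmin hy⟩
  have h1 : MemLp g p ((chartMeasure vol x₀).restrict U) := by
    rw [← volMeasure_restrict vol, Measure.restrict_restrict hU.measurableSet, inter_comm,
      ← Measure.restrict_restrict (isOpen_source x₀).measurableSet]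
    exact hg.restrict _
  rw [chartMeasure_eq, Measure.restrict_map_of_aemeasurable (aemeasurable_symm vol x₀)
    hU.measurableSet] at h1
  have h2 := h1.comp_of_map ((aemeasurable_symm vol x₀).mono_measure Measure.restrict_le_self)
  refine h2.of_measure_le_smul (c := (ENNReal.ofReal c)⁻¹) (by simpa using hc) ?_
  refine Measure.le_iff.2 fun A hA => ?_
  rw [Measure.smul_apply, smul_eq_mul, ← ENNReal.div_eq_inv_mul, ENNReal.le_div_iff_mul_le
    (by simp [hc]) (by simp), mul_comm]
  have hKU' : (volume : Measure (EM m)).restrict (K ∩ (chart m x₀).symm ⁻¹' U) ≤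
      (volume.restrict K).restrict ((chart m x₀).target ∩ (chart m x₀).symm ⁻¹' U) := by
    rw [hKU, Measure.restrict_restrict hOm, inter_comm]
  calc ENNReal.ofReal c * volume.restrict (K ∩ (chart m x₀).symm ⁻¹' U) A
      = ∫⁻ y in A ∩ (K ∩ (chart m x₀).symm ⁻¹' U), ENNReal.ofReal c := by
        rw [setLIntegral_const, Measure.restrict_apply hA]
    _ ≤ ∫⁻ y in A ∩ (K ∩ (chart m x₀).symm ⁻¹' U), ENNReal.ofReal (dens vol x₀ y) :=
        setLIntegral_mono_ae' (hA.inter hm)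
          (Eventually.of_forall fun y hy => ENNReal.ofReal_le_ofReal (hcK y hy.2.1))
    _ = densMeasure vol x₀ (A ∩ (K ∩ (chart m x₀).symm ⁻¹' U)) := by
        rw [densMeasure, withDensity_apply _ (hA.inter hm), Measure.restrict_restrict (hA.inter hm),
          inter_eq_self_of_subset_left (fun y hy => hKt hy.2.1 :
            A ∩ (K ∩ (chart m x₀).symm ⁻¹' U) ⊆ (chart m x₀).target)]
    _ ≤ (densMeasure vol x₀).restrict ((chart m x₀).symm ⁻¹' U) A := by
        refine le_trans (measure_mono ?_) (Measure.le_restrict_apply _ _)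
        exact fun y hy => ⟨hy.1, hy.2.2⟩

lemma isLocallyFiniteMeasure_volMeasure {vol : DForm (m := m) M m ℝ} (hvol : IsVolumeForm vol) :
    IsLocallyFiniteMeasure (volMeasure vol) := by
  refine ⟨fun x => ?_⟩
  have hx := mem_source (m := m) x
  have h1 : ∀ᶠ y in 𝓝 (chart m x x), dens vol x y < dens vol x (chart m x x) + 1 :=
    ((continuousOn_dens hvol x).continuousAt
      ((isOpen_target x).mem_nhds (chart_mem_target x))).eventually (gt_mem_nhds (lt_add_one _))
  obtain ⟨r, hr, hb⟩ := Metric.eventually_nhds_iff_ball.1 h1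
  set A := (chart m x).source ∩ chart m x ⁻¹' Metric.ball (chart m x x) r with hA
  have hAo : IsOpen A := ContinuousOn.isOpen_inter_preimage
        (fun x hx => (continuousAt_chart hx).continuousWithinAt) (isOpen_source x)
        Metric.isOpen_ball
  refine ⟨A, hAo.mem_nhds ⟨hx, Metric.mem_ball_self hr⟩, ?_⟩
  rw [show A = A ∩ (chart m x).source from (inter_eq_self_of_subset_left inter_subset_left).symm,
    ← Measure.restrict_apply hAo.measurableSet, volMeasure_restrict vol,
    chartMeasure_apply vol hAo.measurableSet]
  have hsub : (chart m x).target ∩ (chart m x).symm ⁻¹' A ⊆ Metric.ball (chart m x x) r := by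
    rintro y ⟨hy, hyA⟩
    have := hyA.2
    rwa [mem_preimage, (chart m x).right_inv hy] at this
  calc ∫⁻ y in (chart m x).target ∩ (chart m x).symm ⁻¹' A, ENNReal.ofReal (dens vol x y)
      ≤ ∫⁻ y in Metric.ball (chart m x x) r, ENNReal.ofReal (dens vol x y) :=
        lintegral_mono_set hsub
    _ ≤ ∫⁻ _ in Metric.ball (chart m x x) r, ENNReal.ofReal (dens vol x (chart m x x) + 1) :=
        setLIntegral_mono_ae' measurableSet_ball
          (Eventually.of_forall fun y hy => ENNReal.ofReal_le_ofReal (hb y hy).le)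
    _ < ⊤ := by
        rw [setLIntegral_const]
        exact ENNReal.mul_lt_top ENNReal.ofReal_lt_top measure_ball_lt_top

end MeasureCharts

/-! ### Straightening the CR structure in a chart -/

section Completion

variable {n m : ℕ}

/-- A surjective linear map to `ℂ^n` can be completed to an isomorphism by further components. -/
lemma exists_linear_completion (f : EX m →ₗ[ℂ] EX n) (hf : Function.Surjective f) :
    ∃ B : EX m →L[ℂ] EX m, (∀ u (i : Fin m) (h : (i : ℕ) < n), B u i = f u ⟨i, h⟩) ∧
      LinearMap.det (B : EX m →ₗ[ℂ] EX m) ≠ 0 := by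
  have hr := f.finrank_range_add_finrank_ker
  rw [LinearMap.range_eq_top.2 hf, finrank_top] at hr
  simp only [finrank_euclideanSpace_fin] at hr
  obtain ⟨s, hs⟩ := f.exists_rightInverse_of_surjective (LinearMap.range_eq_top.2 hf)
  have hs' (z : EX n) : f (s z) = z := LinearMap.congr_fun hs z
  -- the further components are coordinates of the projection to the kernel
  let e : f.ker ≃ₗ[ℂ] (Fin (m - n) → ℂ) := LinearEquiv.ofFinrankEq _ _ (by simp; omega)
  let P : EX m →ₗ[ℂ] f.ker :=
    LinearMap.codRestrict f.ker (LinearMap.id - s ∘ₗ f) fun u => by simp [hs']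
  let B : EX m →ₗ[ℂ] EX m :=
    { toFun := fun u => WithLp.toLp 2 fun i =>
        if h : (i : ℕ) < n then f u ⟨i, h⟩ else e (P u) ⟨i - n, by omega⟩
      map_add' := fun u v => by
        ext i
        by_cases h : (i : ℕ) < n <;> simp [h]
      map_smul' := fun c u => by
        ext i
        by_cases h : (i : ℕ) < n <;> simp [h] }
  refine ⟨LinearMap.toContinuousLinearMap B, fun u i h => by simp [B, h], ?_⟩
  have hker : B.ker = ⊥ := by
    refine LinearMap.ker_eq_bot'.2 fun u hu => ?_
    have h1 : f u = 0 := by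
      ext i
      have := congrArg (fun z : EX m => z ⟨i, by omega⟩) hu
      simpa [B] using this
    have h2 : e (P u) = 0 := by
      funext i
      have := congrArg (fun z : EX m => z ⟨i + n, by omega⟩) hu
      simpa [B] using this
    have h3 : P u = 0 := by simpa using h2
    have h4 := congrArg Subtype.val h3
    simpa [P, h1] using h4
  exact ((LinearMap.isUnit_iff_ker_eq_bot B).2 hker).map LinearMap.det |>.ne_zero

/-- The complex linear extension, as a continuous map. -/
def cextCLM (m : ℕ) : (EM m →L[ℝ] EX m) →L[ℝ] (EX m →L[ℂ] EX m) :=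
  LinearMap.toContinuousLinearMap
    { toFun := cext
      map_add' := fun L L' => by
        ext1 u
        simp [cext_apply, Finset.sum_add_distrib]
      map_smul' := fun c L => by
        ext1 u
        simp only [cext_apply, RingHom.id_apply, smul_apply, Finset.smul_sum]
        exact Finset.sum_congr rfl fun i _ => smul_comm _ _ _ }

lemma cextCLM_apply (L : EM m →L[ℝ] EX m) : cextCLM m L = cext L := rfl

/-- The inverse of the complexified differential, and its smooth dependence. -/
lemma inverse_cext {L : EM m →L[ℝ] EX m}
    (h : LinearMap.det (cext L : EX m →ₗ[ℂ] EX m) ≠ 0) :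
    (∀ u, (cext L).inverse (cext L u) = u) ∧ (∀ u, cext L ((cext L).inverse u) = u) ∧
      ContDiffAt ℝ ∞ (fun Z : EX m →L[ℂ] EX m => Z.inverse) (cext L) := by
  let e : EX m ≃L[ℂ] EX m :=
    (LinearMap.equivOfDetNeZero (cext L : EX m →ₗ[ℂ] EX m) h).toContinuousLinearEquiv
  have he : (e : EX m →L[ℂ] EX m) = cext L := by ext1 u; rfl
  rw [← he, ContinuousLinearMap.inverse_equiv]
  exact ⟨fun u => e.symm_apply_apply u, fun u => e.apply_symm_apply u,
    (contDiffAt_map_inverse e).restrict_scalars ℝ⟩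

end Completion

section Holomorphic

variable {n : ℕ} {X : Type*} [TopologicalSpace X] [ChartedSpace (EX n) X]
  [IsManifold 𝓘(ℂ, EX n) ω X]

/-- A complex manifold is a smooth real manifold. -/
lemma isManifold_real : IsManifold 𝓘(ℝ, EX n) ∞ X := by
  refine isManifold_of_contDiffOn _ _ _ fun e e' he he' => ?_
  have h1 := (contDiffGroupoid ω 𝓘(ℂ, EX n)).compatible he he'
  rw [contDiffGroupoid, mem_groupoid_of_pregroupoid] at h1
  exact ((h1.1 : ContDiffOn ℂ ω _ _).restrict_scalars ℝ).of_le le_top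

/-- The differential of a chart of a complex manifold, in the real sense, is complex linear and
injective. -/
lemma mfderiv_chart_complex {p₀ p : X} (hp : p ∈ (extChartAt 𝓘(ℝ, EX n) p₀).source) :
    ∃ L : EX n →L[ℂ] EX n, Function.Injective L ∧
      HasMFDerivAt 𝓘(ℝ, EX n) 𝓘(ℝ, EX n) (extChartAt 𝓘(ℝ, EX n) p₀) p (L.restrictScalars ℝ) := by
  have : IsManifold 𝓘(ℂ, EX n) 1 X := IsManifold.of_le (n := ω) le_top
  have hp' : p ∈ (extChartAt 𝓘(ℂ, EX n) p₀).source := hp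
  have h1 : MDifferentiableAt 𝓘(ℂ, EX n) 𝓘(ℂ, EX n) (extChartAt 𝓘(ℂ, EX n) p₀) p :=
    (contMDiffAt_extChartAt' (n := 1) (by simpa using hp')).mdifferentiableAt one_ne_zero
  have h2 := isInvertible_mfderiv_extChartAt hp'
  refine ⟨mfderiv 𝓘(ℂ, EX n) 𝓘(ℂ, EX n) (extChartAt 𝓘(ℂ, EX n) p₀) p, h2.injective, ?_⟩
  exact ⟨h1.hasMFDerivAt.1, h1.hasMFDerivAt.2.restrictScalars ℝ⟩

end Holomorphic

section Straighten

variable {n m k : ℕ} {X : Type*} [TopologicalSpace X] [ChartedSpace (EX n) X]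
  [IsManifold 𝓘(ℂ, EX n) ω X] {M : Type*} [TopologicalSpace M] [ChartedSpace (EM m) M]
  [IsManifold 𝓘(ℝ, EM m) ∞ M]

/-- The immersion in charts. -/
def imm (ι : M → X) (x₀ : M) : EM m → EX n :=
  extChartAt 𝓘(ℝ, EX n) (ι x₀) ∘ ι ∘ (chart m x₀).symm

lemma contMDiff_of_cr {ι : M → X} (hM : IsGenericCR (n := n) (m := m) k ι) :
    ContMDiff 𝓘(ℝ, EM m) 𝓘(ℝ, EX n) ∞ ι := hM.embedding.contMDiff

lemma contDiffAt_imm {ι : M → X} (hM : IsGenericCR (n := n) (m := m) k ι) {x₀ : M} {y : EM m}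
    (hy : y ∈ (chart m x₀).target)
    (hs : ι ((chart m x₀).symm y) ∈ (extChartAt 𝓘(ℝ, EX n) (ι x₀)).source) :
    ContDiffAt ℝ ∞ (imm (n := n) ι x₀) y := by
  have : IsManifold 𝓘(ℝ, EX n) ∞ X := isManifold_real
  have h1 : ContMDiffAt 𝓘(ℝ, EX n) 𝓘(ℝ, EX n) ∞ (extChartAt 𝓘(ℝ, EX n) (ι x₀))
      (ι ((chart m x₀).symm y)) := contMDiffAt_extChartAt' (by simpa using hs)
  exact (h1.comp y (ContMDiffAt.comp y (contMDiff_of_cr hM).contMDiffAt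
    (contMDiffAt_symm hy))).contDiffAt

/-- The CR structure in terms of the immersion in charts. -/
lemma mem_H01_iff {ι : M → X} (hM : IsGenericCR (n := n) (m := m) k ι) {x₀ : M} {y : EM m}
    (hy : y ∈ (chart m x₀).target)
    (hs : ι ((chart m x₀).symm y) ∈ (extChartAt 𝓘(ℝ, EX n) (ι x₀)).source) (w : EM m × EM m) :
    w ∈ H01 (n := n) ι ((chart m x₀).symm y) ↔
      (fderiv ℝ (imm (n := n) ι x₀) y ∘L dchart x₀ ((chart m x₀).symm y)) w.2 =
        Complex.I • (fderiv ℝ (imm (n := n) ι x₀) y ∘L dchart x₀ ((chart m x₀).symm y)) w.1 := by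
  obtain ⟨L, hL, hd⟩ := mfderiv_chart_complex hs
  set x := (chart m x₀).symm y with hx
  have hxs : x ∈ (chart m x₀).source := (chart m x₀).map_target hy
  have h1 : HasMFDerivAt 𝓘(ℝ, EM m) 𝓘(ℝ, EX n) ι x (dmap (n := n) ι x) :=
    ((contMDiff_of_cr hM).mdifferentiable (by simp) x).hasMFDerivAt
  have h2 : HasMFDerivAt 𝓘(ℝ, EM m) 𝓘(ℝ, EM m) (chart m x₀).symm y (dsymm x₀ y) :=
    (mdifferentiableAt_symm hy).hasMFDerivAt
  have h3 : HasMFDerivAt 𝓘(ℝ, EM m) 𝓘(ℝ, EX n) (ι ∘ (chart m x₀).symm) y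
    (dmap (n := n) ι x ∘L dsymm x₀ y) := HasMFDerivAt.comp y h1 h2
  have h4 : HasMFDerivAt 𝓘(ℝ, EM m) 𝓘(ℝ, EX n) (imm (n := n) ι x₀) y
    (L.restrictScalars ℝ ∘L (dmap (n := n) ι x ∘L dsymm x₀ y)) := HasMFDerivAt.comp y hd h3
  have h5 : fderiv ℝ (imm (n := n) ι x₀) y =
      L.restrictScalars ℝ ∘L (dmap (n := n) ι x ∘L dsymm x₀ y) := by
    rw [← mfderiv_eq_fderiv]; exact h4.mfderiv
  have h6 (v : EM m) : (fderiv ℝ (imm (n := n) ι x₀) y ∘L dchart x₀ x) v = L (dmap (n := n) ι x v) := by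
    have := DFunLike.congr_fun (dsymm_comp_dchart hxs) v
    rw [hx, (chart m x₀).right_inv hy] at this
    simp only [ContinuousLinearMap.comp_apply, ContinuousLinearMap.id_apply] at this
    rw [h5]
    simp only [ContinuousLinearMap.comp_apply, ContinuousLinearMap.coe_restrictScalars']
    rw [hx, this]
  rw [h6, h6, ← map_smul]
  exact hL.eq_iff.symm

/-- Genericity: the complexified differential of the immersion is onto. -/
lemma exists_surjective {ι : M → X} (hM : IsGenericCR (n := n) (m := m) k ι) (x₀ : M) :
    ∃ f : EX m →ₗ[ℂ] EX n, Function.Surjective f ∧ ∀ v : EM m,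
      f (inclR m v) = fderiv ℝ (imm (n := n) ι x₀) (chart m x₀ x₀) v := by
  set y := chart m x₀ x₀ with hyd
  have hy : y ∈ (chart m x₀).target := chart_mem_target x₀
  have hxy : (chart m x₀).symm y = x₀ := (chart m x₀).left_inv (mem_source x₀)
  set B₀ := fderiv ℝ (imm (n := n) ι x₀) y
  let f : EX m →ₗ[ℂ] EX n := ∑ i : Fin m,
    ((EuclideanSpace.proj i : EX m →L[ℂ] ℂ) : EX m →ₗ[ℂ] ℂ).smulRight
      (B₀ (EuclideanSpace.single i 1))
  have hf (v : EM m) : f (inclR m v) = B₀ v := by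
    conv_rhs => rw [sum_single v]
    simp [f, inclR_apply]
  have hj (w : EM m × EM m) : f (join w) = B₀ w.1 + Complex.I • B₀ w.2 := by
    have : join w = inclR m w.1 + Complex.I • inclR m w.2 := by
      ext i; simp [join, inclR_apply]
    rw [this, map_add, map_smul, hf, hf]
  refine ⟨f, fun z => ?_, hf⟩
  set A : EM m →L[ℝ] EX n := B₀ ∘L dchart x₀ x₀ with hA
  -- the kernel of `R` is `H_{0,1} M`, whose dimension is known by genericity, so that `R` is
  -- surjective by a dimension count; a real vector pair `w` is sent to `-i f(join w)`
  let R : EM m × EM m →ₗ[ℝ] EX n :=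
    (A : EM m →ₗ[ℝ] EX n) ∘ₗ LinearMap.snd ℝ (EM m) (EM m) -
      Complex.I • ((A : EM m →ₗ[ℝ] EX n) ∘ₗ LinearMap.fst ℝ (EM m) (EM m))
  have hker : R.ker = H01 (n := n) ι x₀ := by
    ext w
    have h1 := mem_H01_iff hM hy (by rw [hxy]; exact mem_extChartAt_source _) w
    rw [hxy] at h1
    rw [h1, LinearMap.mem_ker]
    exact sub_eq_zero
  have hr := R.finrank_range_add_finrank_ker
  rw [hker, hM.generic x₀, Module.finrank_prod] at hr
  have hk := hM.codim
  have hk' := hM.codim_le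
  have hX : Module.finrank ℝ (EX n) = 2 * n := by
    rw [← Module.finrank_mul_finrank ℝ ℂ, Complex.finrank_real_complex]
    simp
  have hsurj : Function.Surjective R := by
    rw [← LinearMap.range_eq_top]
    refine Submodule.eq_top_of_finrank_eq ?_
    rw [hX]
    simp only [finrank_euclideanSpace_fin] at hr
    omega
  obtain ⟨w, hw⟩ := hsurj (-(Complex.I • z))
  refine ⟨join (dchart x₀ x₀ w.1, dchart x₀ x₀ w.2), ?_⟩
  rw [hj]
  have h2 : A w.2 - Complex.I • A w.1 = -(Complex.I • z) := hw
  have h3 : A w.1 + Complex.I • A w.2 = Complex.I • (A w.2 - Complex.I • A w.1) := by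
    rw [smul_sub, smul_smul, Complex.I_mul_I, neg_one_smul]
    abel
  refine Eq.trans h3 ?_
  rw [h2, smul_neg, smul_smul, Complex.I_mul_I, neg_one_smul, neg_neg]

variable (n) in
/-- A neighbourhood `Ω` of `x₀` in the preferred chart with a smooth map `Φ` to `ℂ^m` whose first
`n` components are holomorphic coordinates of `X`, such that the complexified differential of `Φ` is
an isomorphism. It carries `H_{0,1} M` to the constant subspace `H0 n m`. The volume form has the
constant sign `sgn` on `Ω`, and the directions in a ball around `v` point from the closure of `D`
into `D`. -/
structure LocalModel (ι : M → X) (vol : DForm (m := m) M m ℝ) (D : Set M) (x₀ : M) where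
  Ω : Set (EM m)
  isOpen : IsOpen Ω
  subset : Ω ⊆ (chart m x₀).target
  mem : chart m x₀ x₀ ∈ Ω
  Φ : EM m → EX m
  smooth : ∀ y ∈ Ω, ContDiffAt ℝ ∞ Φ y
  det_ne_zero : ∀ y ∈ Ω, LinearMap.det (cext (fderiv ℝ Φ y) : EX m →ₗ[ℂ] EX m) ≠ 0
  mem_H01 : ∀ y ∈ Ω, ∀ w : EM m × EM m, w ∈ H01 (n := n) ι ((chart m x₀).symm y) ↔
    cext (fderiv ℝ Φ y ∘L dchart x₀ ((chart m x₀).symm y)) (join w) ∈ H0 n m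
  sgn : ℝ
  sgn_mul_self : sgn * sgn = 1
  dens_eq : ∀ y ∈ Ω, dens vol x₀ y = sgn * inChart vol x₀ y (fr m)
  v : EM m
  δ : ℝ
  δ_pos : 0 < δ
  cone : ∀ y ∈ Ω, (chart m x₀).symm y ∈ closure D → ∀ t : ℝ, 0 < t → ∀ v' ∈ Metric.ball v δ,
    y + t • v' ∈ Ω → (chart m x₀).symm (y + t • v') ∈ D

/-- Near every point the complexified tangent bundle can be straightened together with its
CR structure. -/
lemma exists_straightening {ι : M → X} (hM : IsGenericCR (n := n) (m := m) k ι) (x₀ : M) :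
    ∃ Φ : EM m → EX m, ∀ᶠ y in 𝓝 (chart m x₀ x₀), ContDiffAt ℝ ∞ Φ y ∧
      LinearMap.det (cext (fderiv ℝ Φ y) : EX m →ₗ[ℂ] EX m) ≠ 0 ∧
      ∀ w : EM m × EM m, w ∈ H01 (n := n) ι ((chart m x₀).symm y) ↔
        cext (fderiv ℝ Φ y ∘L dchart x₀ ((chart m x₀).symm y)) (join w) ∈ H0 n m := by
  obtain ⟨f, hf, hfi⟩ := exists_surjective hM x₀
  obtain ⟨B, hB, hdet⟩ := exists_linear_completion f hf
  have hnm : n ≤ m := by have := hM.codim; have := hM.codim_le; omega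
  -- `Φ` consists of the immersion, in the first `n` components, and of linear functions that
  -- complete its differential at the centre to an isomorphism; the condition on the determinant
  -- is open
  let P : EX n →L[ℝ] EX m := LinearMap.toContinuousLinearMap
    { toFun := fun z => WithLp.toLp 2 fun i => if h : (i : ℕ) < n then z ⟨i, h⟩ else 0
      map_add' := fun u v => by
        ext i
        by_cases h : (i : ℕ) < n <;> simp [h]
      map_smul' := fun c u => by
        ext i
        by_cases h : (i : ℕ) < n <;> simp [h] }
  let Q : EX m →L[ℝ] EX m := LinearMap.toContinuousLinearMap
    { toFun := fun z => WithLp.toLp 2 fun i => if (i : ℕ) < n then 0 else z i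
      map_add' := fun u v => by
        ext i
        by_cases h : (i : ℕ) < n <;> simp [h]
      map_smul' := fun c u => by
        ext i
        by_cases h : (i : ℕ) < n <;> simp [h] }
  have hP (z : EX n) (i : Fin m) : P z i = if h : (i : ℕ) < n then z ⟨i, h⟩ else 0 := rfl
  have hQ (z : EX m) (i : Fin m) : Q z i = if (i : ℕ) < n then 0 else z i := rfl
  let C : EM m →L[ℝ] EX m := Q ∘L (B.restrictScalars ℝ ∘L inclR m)
  let Φ : EM m → EX m := fun y => P (imm (n := n) ι x₀ y) + C y
  have hy₀ := chart_mem_target (m := m) x₀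
  have hxy : (chart m x₀).symm (chart m x₀ x₀) = x₀ := (chart m x₀).left_inv (mem_source x₀)
  have hfd (y : EM m) (hd : ContDiffAt ℝ ∞ (imm (n := n) ι x₀) y) :
      fderiv ℝ Φ y = P ∘L fderiv ℝ (imm (n := n) ι x₀) y + C := by
    have h1 : HasFDerivAt (fun y => P (imm (n := n) ι x₀ y))
        (P ∘L fderiv ℝ (imm (n := n) ι x₀) y) y :=
      P.hasFDerivAt.comp y (hd.differentiableAt (by simp)).hasFDerivAt
    exact (h1.add C.hasFDerivAt).fderiv
  have hsm (y : EM m) (hd : ContDiffAt ℝ ∞ (imm (n := n) ι x₀) y) : ContDiffAt ℝ ∞ Φ y :=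
    (P.contDiff.contDiffAt.comp y hd).add C.contDiff.contDiffAt
  have hev : ∀ᶠ y in 𝓝 (chart m x₀ x₀), y ∈ (chart m x₀).target ∧
      ι ((chart m x₀).symm y) ∈ (extChartAt 𝓘(ℝ, EX n) (ι x₀)).source := by
    refine Filter.inter_mem ((isOpen_target x₀).mem_nhds hy₀) ?_
    have h1 : ContinuousAt (fun y => ι ((chart m x₀).symm y)) (chart m x₀ x₀) :=
      ContinuousAt.comp (contMDiff_of_cr hM).continuous.continuousAt (continuousAt_symm hy₀)
    refine h1.preimage_mem_nhds ((isOpen_extChartAt_source (ι x₀)).mem_nhds ?_)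
    rw [hxy]
    exact mem_extChartAt_source _
  have hd₀ := contDiffAt_imm hM hev.self_of_nhds.1 hev.self_of_nhds.2
  have hBc : cext (fderiv ℝ Φ (chart m x₀ x₀)) = B := by
    have hi (v : EM m) : fderiv ℝ Φ (chart m x₀ x₀) v = B (inclR m v) := by
      rw [hfd _ hd₀]
      ext i
      simp only [add_apply, ContinuousLinearMap.comp_apply, PiLp.add_apply, hP, C, hQ]
      by_cases h : (i : ℕ) < n
      · simp only [h, dif_pos, if_pos, add_zero]
        rw [hB _ i h, hfi]
      · simp [h]
    ext1 u
    rw [cext_apply]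
    simp only [hi, ← map_smul, ← map_sum]
    congr 1
    ext i
    simp [inclR_apply, apply_ite Complex.ofReal]
  have hdet' : ∀ᶠ y in 𝓝 (chart m x₀ x₀),
      LinearMap.det (cext (fderiv ℝ Φ y) : EX m →ₗ[ℂ] EX m) ≠ 0 := by
    have h1 : ContinuousAt (fun y => (cextCLM m (fderiv ℝ Φ y)).det) (chart m x₀ x₀) := by
      have h2 : ContinuousAt (fderiv ℝ Φ) (chart m x₀ x₀) :=
        ((hsm _ hd₀).fderiv_right (m := ∞) (by simp)).continuousAt
      exact ContinuousLinearMap.continuous_det.continuousAt.comp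
        ((cextCLM m).continuous.continuousAt.comp h2)
    refine h1.eventually_ne ?_
    rw [cextCLM_apply, hBc]
    exact hdet
  refine ⟨Φ, ?_⟩
  filter_upwards [hev, hdet'] with y hy hyd
  have hd := contDiffAt_imm hM hy.1 hy.2
  refine ⟨hsm y hd, hyd, fun w => ?_⟩
  rw [mem_H01_iff hM hy.1 hy.2, cext_join]
  have hfst (a : EM m) (i : Fin m) (h : (i : ℕ) < n) :
      (fderiv ℝ Φ y ∘L dchart x₀ ((chart m x₀).symm y)) a i =
        (fderiv ℝ (imm (n := n) ι x₀) y ∘L dchart x₀ ((chart m x₀).symm y)) a ⟨i, h⟩ := by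
    rw [ContinuousLinearMap.comp_apply, hfd y hd]
    simp [hP, C, hQ, h]
  set A := fderiv ℝ (imm (n := n) ι x₀) y ∘L dchart x₀ ((chart m x₀).symm y)
  have key : A w.2 = Complex.I • A w.1 ↔ A w.1 + Complex.I • A w.2 = 0 := by
    constructor
    · intro h
      rw [h, smul_smul, Complex.I_mul_I, neg_one_smul, add_neg_cancel]
    · intro h
      have h2 := congrArg (fun z => Complex.I • z) h
      simp only [smul_add, smul_smul, Complex.I_mul_I, neg_one_smul, smul_zero] at h2
      rw [← sub_eq_add_neg, sub_eq_zero] at h2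
      exact h2.symm
  rw [key]
  constructor
  · intro h i hi
    rw [PiLp.add_apply, PiLp.smul_apply, hfst _ i hi, hfst _ i hi]
    exact congrArg (fun z : EX n => z ⟨i, hi⟩) h
  · intro h
    ext i
    have := h ⟨i, by omega⟩ i.2
    rw [PiLp.add_apply, PiLp.smul_apply, hfst _ _ i.2, hfst _ _ i.2] at this
    exact this

/-- A domain with smooth boundary has the uniform cone property. -/
lemma exists_cone {D : Set M} (hD : IsSmoothDomain (m := m) D) (x₀ : M) :
    ∃ (v : EM m) (δ r : ℝ), 0 < δ ∧ 0 < r ∧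
      Metric.ball (chart m x₀ x₀) r ⊆ (chart m x₀).target ∧
      ∀ y ∈ Metric.ball (chart m x₀ x₀) r, (chart m x₀).symm y ∈ closure D → ∀ t : ℝ, 0 < t →
        ∀ v' ∈ Metric.ball v δ, y + t • v' ∈ Metric.ball (chart m x₀ x₀) r →
          (chart m x₀).symm (y + t • v') ∈ D := by
  set y₀ := chart m x₀ x₀
  have hy₀ : y₀ ∈ (chart m x₀).target := chart_mem_target x₀
  have hxy : (chart m x₀).symm y₀ = x₀ := (chart m x₀).left_inv (mem_source x₀)
  have hnhds {S : Set M} (hS : S ∈ 𝓝 x₀) : ∀ᶠ y in 𝓝 y₀, (chart m x₀).symm y ∈ S :=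
    (continuousAt_symm hy₀).eventually (by rwa [hxy])
  have hnt : ∀ᶠ y in 𝓝 y₀, y ∈ (chart m x₀).target := (isOpen_target x₀).mem_nhds hy₀
  -- in the interior and in the exterior of `D` every direction serves on a small ball
  by_cases h1 : x₀ ∈ D
  · obtain ⟨r, hr, hb⟩ := Metric.eventually_nhds_iff_ball.1 (hnt.and (hnhds (hD.isOpen.mem_nhds h1)))
    exact ⟨0, 1, r, one_pos, hr, fun y hy => (hb y hy).1,
      fun _ _ _ _ _ _ _ hz => (hb _ hz).2⟩
  by_cases h2 : x₀ ∈ closure D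
  swap
  · obtain ⟨r, hr, hb⟩ := Metric.eventually_nhds_iff_ball.1
      (hnt.and (hnhds (isClosed_closure.isOpen_compl.mem_nhds h2)))
    exact ⟨0, 1, r, one_pos, hr, fun y hy => (hb y hy).1,
      fun y hy hyD => absurd hyD (hb y hy).2⟩
  -- at a boundary point, `v` is a direction in which the defining function `ρ` decreases; the same
  -- then holds for nearby directions at nearby points
  obtain ⟨U, ρ, hU, hxU, hρ, hdρ, hDU⟩ := hD.smooth_boundary x₀
    ⟨h2, by rwa [hD.isOpen.interior_eq]⟩
  let ρ' : EM m → ℝ := ρ ∘ (chart m x₀).symm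
  have hρ' : ∀ y ∈ (chart m x₀).target, (chart m x₀).symm y ∈ U → ContDiffAt ℝ ∞ ρ' y := by
    intro y hy hyU
    exact ((hρ.contMDiffAt (hU.mem_nhds hyU)).comp y (contMDiffAt_symm hy)).contDiffAt
  have hd₀ := hρ' y₀ hy₀ (by rwa [hxy])
  have hne : fderiv ℝ ρ' y₀ ≠ 0 := by
    intro h0
    refine hdρ ?_
    have e1 : mfderiv 𝓘(ℝ, EM m) 𝓘(ℝ, ℝ) (ρ' ∘ chart m x₀) x₀ = 0 := by
      have h3 := mfderiv_comp (I := 𝓘(ℝ, EM m)) (I' := 𝓘(ℝ, EM m)) (I'' := 𝓘(ℝ, ℝ)) x₀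
        (f := chart m x₀) (g := ρ') ((hd₀.differentiableAt (by simp)).mdifferentiableAt)
        (mdifferentiableAt_chart (mem_source (m := m) x₀))
      have h4 : mfderiv 𝓘(ℝ, EM m) 𝓘(ℝ, ℝ) ρ' (chart m x₀ x₀) = 0 := by
        rw [mfderiv_eq_fderiv]; exact h0
      refine h3.trans ?_
      rw [h4]
      ext v; rfl
    have e2 : ρ' ∘ chart m x₀ =ᶠ[𝓝 x₀] ρ := by
      filter_upwards [(isOpen_source x₀).mem_nhds (mem_source (m := m) x₀)] with z hz
      simp only [ρ', Function.comp_apply]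
      rw [(chart m x₀).left_inv hz]
    have e3 : HasMFDerivAt 𝓘(ℝ, EM m) 𝓘(ℝ, ℝ) (ρ' ∘ chart m x₀) x₀ 0 := by
      have h3 : MDifferentiableAt 𝓘(ℝ, EM m) 𝓘(ℝ, ℝ) (ρ' ∘ chart m x₀) x₀ :=
        MDifferentiableAt.comp x₀ ((hd₀.differentiableAt (by simp)).mdifferentiableAt)
          (mdifferentiableAt_chart (mem_source (m := m) x₀))
      have := h3.hasMFDerivAt
      rwa [e1] at this
    exact (e3.congr_of_eventuallyEq e2.symm).mfderiv
  obtain ⟨v, hv⟩ : ∃ v, fderiv ℝ ρ' y₀ v < 0 := by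
    by_contra! hcon
    refine hne (ContinuousLinearMap.ext fun v => le_antisymm ?_ (hcon v))
    have := hcon (-v)
    rw [map_neg] at this
    simpa using this
  have hcont : ContinuousAt (fun w : EM m × EM m => fderiv ℝ ρ' w.1 w.2) (y₀, v) := by
    have h3 : ContinuousAt (fderiv ℝ ρ') y₀ :=
      (hd₀.fderiv_right (m := ∞) (by simp)).continuousAt
    exact (h3.comp (x := (y₀, v)) continuousAt_fst).clm_apply continuousAt_snd
  obtain ⟨δ, hδ, hb⟩ := Metric.eventually_nhds_iff_ball.1 (hcont.eventually (gt_mem_nhds hv))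
  obtain ⟨r, hr, hb'⟩ := Metric.eventually_nhds_iff_ball.1
    ((hnt.and (hnhds (hU.mem_nhds hxU))).and (Metric.ball_mem_nhds y₀ hδ))
  refine ⟨v, δ, r, hδ, hr, fun y hy => (hb' y hy).1.1, fun y hy hyD t ht v' hv' hyt => ?_⟩
  have hle : ρ' y ≤ 0 := by
    have hc : ContinuousAt ρ ((chart m x₀).symm y) :=
      (hρ.contMDiffAt (hU.mem_nhds (hb' y hy).1.2)).continuousAt
    have hfr : ∃ᶠ z in 𝓝 ((chart m x₀).symm y), z ∈ D := mem_closure_iff_frequently.1 hyD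
    by_contra! hcon
    refine hfr ?_
    filter_upwards [hc.eventually (lt_mem_nhds hcon), hU.mem_nhds (hb' y hy).1.2] with z hz hzU hzD
    have : z ∈ {y | ρ y < 0} ∩ U := hDU ▸ ⟨hzD, hzU⟩
    exact absurd this.1 (not_lt.2 hz.le)
  have hseg : ∀ s ∈ Icc (0 : ℝ) t, y + s • v' ∈ Metric.ball y₀ r := by
    intro s hs
    have hmem := (convex_ball y₀ r) hy hyt (a := 1 - s / t) (b := s / t)
      (by rw [sub_nonneg]; exact (div_le_one ht).2 hs.2) (div_nonneg hs.1 ht.le) (by ring)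
    convert hmem using 1
    rw [smul_add, smul_smul, div_mul_cancel₀ _ ht.ne', ← add_assoc, ← add_smul]
    simp
  have hanti : StrictAntiOn (fun s : ℝ => ρ' (y + s • v')) (Icc 0 t) := by
    have hder : ∀ s ∈ Icc (0 : ℝ) t, HasDerivAt (fun s : ℝ => ρ' (y + s • v'))
        (fderiv ℝ ρ' (y + s • v') v') s := by
      intro s hs
      have h3 := hb' _ (hseg s hs)
      have h4 : HasDerivAt (fun s : ℝ => y + s • v') v' s := by
        simpa using ((hasDerivAt_id s).smul_const v').const_add y
      exact ((hρ' _ h3.1.1 h3.1.2).differentiableAt (by simp)).hasFDerivAt.comp_hasDerivAt s h4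
    refine strictAntiOn_of_deriv_neg (convex_Icc 0 t)
      (fun s hs => (hder s hs).continuousAt.continuousWithinAt) fun s hs => ?_
    have hs' := interior_subset hs
    rw [(hder s hs').deriv]
    refine hb (y + s • v', v') ?_
    rw [← ball_prod_same]
    exact ⟨(hb' _ (hseg s hs')).2, hv'⟩
  have hlt : ρ' (y + t • v') < 0 := by
    have := hanti (left_mem_Icc.2 ht.le) (right_mem_Icc.2 ht.le) ht
    simp only [zero_smul, add_zero] at this
    exact this.trans_le hle
  have : (chart m x₀).symm (y + t • v') ∈ D ∩ U := by
    rw [hDU]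
    exact ⟨hlt, (hb' _ hyt).1.2⟩
  exact this.1

/-- Every point has a local model. -/
lemma exists_localModel {ι : M → X} (hM : IsGenericCR (n := n) (m := m) k ι)
    {vol : DForm (m := m) M m ℝ} (hvol : IsVolumeForm vol) {D : Set M}
    (hD : IsSmoothDomain (m := m) D) (x₀ : M) : Nonempty (LocalModel n ι vol D x₀) := by
  obtain ⟨Φ, hΦ⟩ := exists_straightening hM x₀
  obtain ⟨v, δ, r, hδ, hr, hbt, hcone⟩ := exists_cone hD x₀
  have hy₀ := chart_mem_target (m := m) x₀
  have hvc : ContinuousAt (fun y => inChart vol x₀ y (fr m)) (chart m x₀ x₀) :=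
    (continuousOn_inChart_vol hvol x₀).continuousAt ((isOpen_target x₀).mem_nhds hy₀)
  obtain ⟨sgn, hs, hsv⟩ : ∃ sgn : ℝ, sgn * sgn = 1 ∧ ∀ᶠ y in 𝓝 (chart m x₀ x₀),
      dens vol x₀ y = sgn * inChart vol x₀ y (fr m) := by
    rcases lt_or_gt_of_ne (inChart_vol_ne_zero hvol hy₀) with h | h
    · refine ⟨-1, by norm_num, ?_⟩
      filter_upwards [hvc.eventually (gt_mem_nhds h)] with y hy
      rw [dens, abs_of_neg hy, neg_one_mul]
    · refine ⟨1, by norm_num, ?_⟩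
      filter_upwards [hvc.eventually (lt_mem_nhds h)] with y hy
      rw [dens, abs_of_pos hy, one_mul]
  obtain ⟨r', hr', hb⟩ := Metric.eventually_nhds_iff_ball.1
    ((hΦ.and hsv).and (Metric.ball_mem_nhds _ hr))
  exact ⟨{
    Ω := Metric.ball (chart m x₀ x₀) r'
    isOpen := Metric.isOpen_ball
    subset := fun y hy => hbt (hb y hy).2
    mem := Metric.mem_ball_self hr'
    Φ := Φ
    smooth := fun y hy => (hb y hy).1.1.1
    det_ne_zero := fun y hy => (hb y hy).1.1.2.1
    mem_H01 := fun y hy => (hb y hy).1.1.2.2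
    sgn := sgn
    sgn_mul_self := hs
    dens_eq := fun y hy => (hb y hy).1.2
    v := v
    δ := δ
    δ_pos := hδ
    cone := fun y hy hyD t ht v' hv' hyt =>
      hcone y (hb y hy).2 hyD t ht v' hv' (hb _ hyt).2 }⟩

end Straighten

/-! ### Forms in a straightened chart -/

section Coordinates

variable {n m d : ℕ}

/-- A finite spanning family of a subspace, with coordinate functionals that are defined on the
whole space. -/
lemma exists_coordinates {V : Type*} [AddCommGroup V] [Module ℂ V] [FiniteDimensional ℂ V]
    (S : Submodule ℂ V) : ∃ (K : ℕ) (b : Fin K → V) (c : Fin K → V →ₗ[ℂ] ℂ),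
      (∀ j, b j ∈ S) ∧ ∀ θ ∈ S, ∑ j, c j θ • b j = θ := by
  obtain ⟨g, hg⟩ := S.subtype.exists_leftInverse_of_injective S.ker_subtype
  refine ⟨_, fun j => Module.finBasis ℂ S j, fun j => (Module.finBasis ℂ S).coord j ∘ₗ g,
    fun j => (Module.finBasis ℂ S j).2, fun θ hθ => ?_⟩
  have h2 := LinearMap.congr_fun hg ⟨θ, hθ⟩
  have h3 := congrArg Subtype.val ((Module.finBasis ℂ S).sum_repr ⟨θ, hθ⟩)
  simp only [Submodule.coe_sum, Submodule.coe_smul] at h3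
  refine Eq.trans (Finset.sum_congr rfl fun j _ => ?_) h3
  simp only [LinearMap.comp_apply, Submodule.subtype_apply, LinearMap.id_apply] at h2
  simp only [LinearMap.comp_apply, h2]
  rfl

variable (m d) in
/-- The index set of a family of forms that spans `Fil n t`. -/
abbrev FilIdx (n t : ℕ) : Type := Fin (exists_coordinates (Fil (m := m) (d := d) n t)).choose

/-- A finite family of forms that spans `Fil n t`. -/
def filBasis (n t : ℕ) (j : FilIdx m d n t) : CForm m d :=
  (exists_coordinates (Fil (m := m) (d := d) n t)).choose_spec.choose j

/-- Coordinates with respect to `filBasis`, extended to all forms. -/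
def filCoord (n t : ℕ) (j : FilIdx m d n t) : CForm m d →ₗ[ℂ] ℂ :=
  (exists_coordinates (Fil (m := m) (d := d) n t)).choose_spec.choose_spec.choose j

lemma filBasis_mem (n t : ℕ) (j : FilIdx m d n t) : filBasis n t j ∈ Fil (m := m) (d := d) n t :=
  (exists_coordinates (Fil (m := m) (d := d) n t)).choose_spec.choose_spec.choose_spec.1 j

lemma sum_filCoord {n t : ℕ} {θ : CForm m d} (hθ : θ ∈ Fil n t) :
    ∑ j, filCoord n t j θ • filBasis n t j = θ :=
  (exists_coordinates (Fil (m := m) (d := d) n t)).choose_spec.choose_spec.choose_spec.2 θ hθ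

open ContinuousAlternatingMap in
/-- The exterior derivative of the product of a function and a form. -/
lemma extDeriv_mul {c : EM m → ℂ} {β : EM m → EM m [⋀^Fin d]→L[ℝ] ℂ} {y : EM m}
    (hc : DifferentiableAt ℝ c y) (hβ : DifferentiableAt ℝ β y) :
    extDeriv (fun z => c z • β z) y =
      alternatizeUncurryFin ((fderiv ℝ c y).smulRight (β y)) + c y • extDeriv β y := by
  have h1 : fderiv ℝ (fun z => c z • β z) y = c y • fderiv ℝ β y + (fderiv ℝ c y).smulRight (β y) :=
    (hc.hasFDerivAt.smul hβ.hasFDerivAt).fderiv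
  have h2 : alternatizeUncurryFin (c y • fderiv ℝ β y) = c y • alternatizeUncurryFin (fderiv ℝ β y) := by
    ext v
    simp [alternatizeUncurryFin_apply, Finset.mul_sum]
  rw [extDeriv, h1]
  refine (alternatizeUncurryFin_add _ _).trans ?_
  rw [h2]
  exact add_comm _ _

open ContinuousAlternatingMap in
lemma extDeriv_mul_of_closed {c : EM m → ℂ} {β : EM m → EM m [⋀^Fin d]→L[ℝ] ℂ} {y : EM m}
    (hc : DifferentiableAt ℝ c y) (hβ : DifferentiableAt ℝ β y) (h0 : extDeriv β y = 0) :
    extDeriv (fun z => c z • β z) y =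
      ∑ k, fderiv ℝ c y (EuclideanSpace.single k 1) • dxWedge d k (β y) := by
  rw [extDeriv_mul hc hβ, h0, smul_zero, add_zero, alternatize_eq_sum_dxWedge]
  refine Finset.sum_congr rfl fun k _ => ?_
  ext v
  simp [dxWedge_apply, alternatizeUncurryFin_apply, Finset.mul_sum, mul_left_comm]

/-- A smooth function that is `1` near a compact set and supported in a given neighbourhood. -/
lemma exists_cutoff {K Ω : Set (EM m)} (hK : IsCompact K) (hΩ : IsOpen Ω) (h : K ⊆ Ω) :
    ∃ η : EM m → ℝ, ContDiff ℝ ∞ η ∧ HasCompactSupport η ∧ tsupport η ⊆ Ω ∧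
      ∀ᶠ x in 𝓝ˢ K, η x = 1 := by
  obtain ⟨K', hK', h1, h2⟩ := exists_compact_between hK hΩ h
  obtain ⟨f, hf1, hf0, -⟩ := exists_contMDiffMap_one_nhds_of_subset_interior 𝓘(ℝ, EM m)
    (n := (⊤ : ℕ∞)) hK.isClosed h1
  have hsub : tsupport f ⊆ K' := closure_minimal
    (fun x hx => by by_contra hcon; exact hx (hf0 x hcon)) hK'.isClosed
  exact ⟨f, f.contMDiff.contDiff, hK'.of_isClosed_subset (isClosed_tsupport _) hsub,
    hsub.trans h2, hf1⟩

end Coordinates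

namespace LocalModel

variable {n m k d : ℕ} {X : Type*} [TopologicalSpace X] [ChartedSpace (EX n) X]
  {M : Type*} [TopologicalSpace M] [ChartedSpace (EM m) M]
  [IsManifold 𝓘(ℝ, EM m) ∞ M]
  {ι : M → X} {vol : DForm (m := m) M m ℝ} {D : Set M} {x₀ : M} (N : LocalModel n ι vol D x₀)

/-- The pullback of a constant form to the chart. -/
def frame (θ : CForm m d) (y : EM m) : EM m [⋀^Fin d]→L[ℝ] ℂ := pull (fderiv ℝ N.Φ y) θ

/-- The straightened coefficients of a form. -/
def coord (η : DForm (m := m) M d ℂ) (y : EM m) : CForm m d :=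
  tri (cext (fderiv ℝ N.Φ y)).inverse (inChart η x₀ y)

lemma frame_coord (η : DForm (m := m) M d ℂ) {y : EM m} (hy : y ∈ N.Ω) :
    N.frame (N.coord η y) y = inChart η x₀ y :=
  pull_tri (inverse_cext (N.det_ne_zero y hy)).1 _

lemma coord_eq {η : DForm (m := m) M d ℂ} {y : EM m} (hy : y ∈ N.Ω) {θ : CForm m d}
    (h : inChart η x₀ y = N.frame θ y) : N.coord η y = θ := by
  rw [coord, h]
  exact tri_pull (inverse_cext (N.det_ne_zero y hy)).2.1 _

lemma contDiffAt_fderiv {y : EM m} (hy : y ∈ N.Ω) : ContDiffAt ℝ ∞ (fderiv ℝ N.Φ) y :=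
  (N.smooth y hy).fderiv_right (m := ∞) (by simp)

lemma contDiffAt_frame (θ : CForm m d) {y : EM m} (hy : y ∈ N.Ω) :
    ContDiffAt ℝ ∞ (N.frame θ) y := by
  refine contDiffAt_form fun σ => ?_
  have h1 : (fun z => N.frame θ z fun j => stdFrame m (σ j)) = fun z =>
      ∑ τ : Fin d → Fin m, (∏ j, fderiv ℝ N.Φ z (stdFrame m (σ j)) (τ j)) *
        θ (fun j => stdC m (τ j)) := funext fun z => by
    rw [frame, pull_apply, CForm.apply_eq_sum]
  rw [h1]
  refine ContDiffAt.sum fun τ _ => ContDiffAt.mul (contDiffAt_prod fun j _ => ?_) contDiffAt_const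
  exact (((EuclideanSpace.proj (τ j) : EX m →L[ℂ] ℂ).restrictScalars ℝ).contDiff).contDiffAt.comp y
    ((N.contDiffAt_fderiv hy).clm_apply contDiffAt_const)

/-- A member of the frame is closed, being the pullback of a constant form. -/
lemma extDeriv_frame (θ : CForm m d) {y : EM m} (hy : y ∈ N.Ω) : extDeriv (N.frame θ) y = 0 := by
  have h : extDeriv (fun z => ((fun _ : EX m => realForm θ) (N.Φ z)).compContinuousLinearMap
      (fderiv ℝ N.Φ z)) y = _ := extDeriv_pullback (r := ∞) (differentiableAt_const _) (N.smooth y hy) (by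
      rw [minSmoothness_of_isRCLikeNormedField]
      exact WithTop.coe_le_coe.2 le_top)
  refine Eq.trans h ?_
  have : extDeriv (fun _ : EX m => realForm θ) (N.Φ y) = 0 := by
    ext v
    simp [extDeriv, ContinuousAlternatingMap.alternatizeUncurryFin_apply]
  rw [this]
  ext v
  rfl

lemma symm_dchart {y : EM m} (hy : y ∈ N.Ω) (η : DForm (m := m) M d ℂ) :
    η ((chart m x₀).symm y) =
      pull (fderiv ℝ N.Φ y ∘L dchart x₀ ((chart m x₀).symm y)) (N.coord η y) := by
  have h1 := inChart_comp_dchart η ((chart m x₀).map_target (N.subset hy))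
  rw [(chart m x₀).right_inv (N.subset hy), ← N.frame_coord η hy] at h1
  rw [← h1]
  rfl

lemma det_dchart_ne_zero {y : EM m} (hy : y ∈ N.Ω) :
    LinearMap.det (cext (fderiv ℝ N.Φ y ∘L dchart x₀ ((chart m x₀).symm y)) :
      EX m →ₗ[ℂ] EX m) ≠ 0 := by
  rw [det_cext_comp]
  refine mul_ne_zero (N.det_ne_zero y hy) ?_
  have h := congrArg (fun A : EM m →L[ℝ] EM m => LinearMap.det (A : EM m →ₗ[ℝ] EM m))
    (dchart_comp_dsymm (N.subset hy))
  simp only [ContinuousLinearMap.toLinearMap_comp, LinearMap.det_comp] at h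
  intro h0
  have h0' : LinearMap.det (dchart (m := m) x₀ ((chart m x₀).symm y) : EM m →ₗ[ℝ] EM m) = 0 := by
    exact_mod_cast h0
  rw [h0', zero_mul] at h
  simp at h

/-- The bidegree condition is the constant condition `Fil` on the straightened coefficients. -/
lemma mem_bidegree_iff {r q : ℕ} {y : EM m} (hy : y ∈ N.Ω) (η : DForm (m := m) M (r + q) ℂ) :
    η ((chart m x₀).symm y) ∈ bidegree (n := n) ι ((chart m x₀).symm y) r q ↔
      N.coord η y ∈ Fil n q := by
  have hH : ∀ w, w ∈ (SetLike.coe (H01 (n := n) ι ((chart m x₀).symm y))) ↔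
      cext (fderiv ℝ N.Φ y ∘L dchart x₀ ((chart m x₀).symm y)) (join w) ∈ H0 n m :=
    fun w => N.mem_H01 y hy w
  have key := mem_Fil_iff_cEval (n := n)
    (fun u => ⟨_, (inverse_cext (N.det_dchart_ne_zero hy)).2.1 u⟩) hH (N.coord η y) q
  rw [← N.symm_dchart hy] at key
  exact key

/-- The real and imaginary parts of the vectors of the straightened frame. -/
def vec (y : EM m) (i : ℕ) (s : Bool) : EM m :=
  if s then (split ((cext (fderiv ℝ N.Φ y)).inverse (stdC m i))).2
  else (split ((cext (fderiv ℝ N.Φ y)).inverse (stdC m i))).1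

lemma contDiffAt_vec (i : ℕ) (s : Bool) {y : EM m} (hy : y ∈ N.Ω) :
    ContDiffAt ℝ ∞ (fun z => N.vec z i s) y := by
  have h1 : ContDiffAt ℝ ∞ (fun z => (cext (fderiv ℝ N.Φ z)).inverse) y := by
    have h2 : ContDiffAt ℝ ∞ (fun z => cext (fderiv ℝ N.Φ z)) y :=
      (cextCLM m).contDiff.contDiffAt.comp y (N.contDiffAt_fderiv hy)
    exact ContDiffAt.comp (f := fun z => cext (fderiv ℝ N.Φ z)) y
      (inverse_cext (N.det_ne_zero y hy)).2.2 h2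
  have h3 : ContDiffAt ℝ ∞ (fun z => (cext (fderiv ℝ N.Φ z)).inverse (stdC m i)) y :=
    ((ContinuousLinearMap.apply ℂ (EX m) (stdC m i)).restrictScalars
      ℝ).contDiff.contDiffAt.comp y h1
  let re : EX m →L[ℝ] EM m := LinearMap.toContinuousLinearMap
    { toFun := fun u => (split u).1
      map_add' := fun u v => by ext j; simp [split]
      map_smul' := fun c u => by ext j; simp [split] }
  let im : EX m →L[ℝ] EM m := LinearMap.toContinuousLinearMap
    { toFun := fun u => (split u).2
      map_add' := fun u v => by ext j; simp [split]
      map_smul' := fun c u => by ext j; simp [split] }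
  cases s
  · exact re.contDiff.contDiffAt.comp y h3
  · exact im.contDiff.contDiffAt.comp y h3

/-- The coefficients are values of the form on smooth fields, which makes their regularity a
consequence of that of the form. -/
lemma coord_apply (η : DForm (m := m) M d ℂ) (y : EM m) (σ : Fin d → Fin m) :
    N.coord η y (fun j => stdC m (σ j)) = ∑ s : Finset (Fin d),
      Complex.I ^ s.card * inChart η x₀ y (fun j => N.vec y (σ j) (decide (j ∈ s))) := by
  rw [coord, tri_apply]
  refine Finset.sum_congr rfl fun s _ => ?_
  congr 2
  funext j
  by_cases hj : j ∈ s <;> simp [vec, hj]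

lemma contDiffAt_coord {η : DForm (m := m) M d ℂ} {y : EM m} (hy : y ∈ N.Ω)
    (h : ContDiffAt ℝ ∞ (inChart η x₀) y) : ContDiffAt ℝ ∞ (N.coord η) y := by
  refine contDiffAt_cform fun σ => ?_
  simp only [N.coord_apply]
  exact ContDiffAt.sum fun s _ => contDiffAt_const.mul
    (contDiffAt_form_apply h fun j => N.contDiffAt_vec _ _ hy)

open ContinuousAlternatingMap in
/-- The exterior derivative of a form with coefficients in `Fil n t`. -/
lemma coord_extD_mem {t : ℕ} {η : DForm (m := m) M d ℂ} {y : EM m} (hy : y ∈ N.Ω)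
    (hs : ContDiffAt ℝ ∞ (inChart η x₀) y) (h : ∀ z ∈ N.Ω, N.coord η z ∈ Fil n t) :
    N.coord (extD η) y ∈ Fil n (t + 1) := by
  -- in the closed frame only the coefficients are differentiated, and this adds one covector
  have e1 : inChart η x₀ =ᶠ[𝓝 y] ∑ j, fun z =>
      filCoord n t j (N.coord η z) • N.frame (filBasis n t j) z := by
    filter_upwards [N.isOpen.mem_nhds hy] with z hz
    rw [← N.frame_coord η hz]
    conv_lhs => rw [← sum_filCoord (h z hz)]
    rw [Finset.sum_apply]
    exact _root_.map_sum (pullCLM d (fderiv ℝ N.Φ z)) _ _ |>.trans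
      (Finset.sum_congr rfl fun j _ => map_smul _ _ _)
  have hc (j) : DifferentiableAt ℝ (fun z => filCoord n t j (N.coord η z)) y := by
    have h1 : ContDiffAt ℝ ∞ (fun z => filCoord n t j (N.coord η z)) y :=
      (((LinearMap.toContinuousLinearMap (filCoord n t j)).restrictScalars
        ℝ).contDiff.contDiffAt).comp y (N.contDiffAt_coord hy hs)
    exact h1.differentiableAt (by simp)
  have hf (j) : DifferentiableAt ℝ (N.frame (filBasis (m := m) (d := d) n t j)) y :=
    (N.contDiffAt_frame _ hy).differentiableAt (by simp)
  have hZ := (inverse_cext (N.det_ne_zero y hy)).1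
  choose l hl using fun j => exists_covector hZ (fderiv ℝ (fun z => filCoord n t j (N.coord η z)) y)
  have e2 : inChart (extD η) x₀ y = N.frame (∑ j, wedge1 (l j) (filBasis n t j)) y := by
    rw [inChart_extD (N.subset hy) hs, e1.extDeriv_eq, extDeriv_eq_sum, fderiv_sum
      (fun j _ => show DifferentiableAt ℝ (fun z => filCoord n t j (N.coord η z) •
        N.frame (filBasis n t j) z) y from (hc j).smul (hf j))]
    simp only [_root_.sum_apply, _root_.map_sum]
    rw [Finset.sum_comm]
    refine Eq.trans (Finset.sum_congr rfl fun j _ => ?_)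
      (_root_.map_sum (pullCLM (d + 1) (fderiv ℝ N.Φ y)) _ _).symm
    rw [← extDeriv_eq_sum, extDeriv_mul (hc j) (hf j), N.extDeriv_frame _ hy, smul_zero, add_zero,
      hl j]
    exact pull_wedge1 _ _ _
  rw [N.coord_eq hy e2]
  exact Submodule.sum_mem _ fun j _ => wedge1_mem_Fil _ (filBasis_mem n t j)

end LocalModel

section Frames

variable {n m k d : ℕ} {X : Type*} [TopologicalSpace X] [ChartedSpace (EX n) X]
  {M : Type*} [TopologicalSpace M] [ChartedSpace (EM m) M]
  [IsManifold 𝓘(ℝ, EM m) ∞ M] [T2Space M] [MeasurableSpace M] [BorelSpace M]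
  {ι : M → X} {vol : DForm (m := m) M m ℝ} {D : Set M} {x₀ : M}

/-! ### Frames adapted to the CR structure -/

lemma continuousAt_of_symm {F : Type*} [TopologicalSpace F] {h : M → F} {x : M}
    (hx : x ∈ (chart m x₀).source)
    (hc : ContinuousAt (fun y => h ((chart m x₀).symm y)) (chart m x₀ x)) : ContinuousAt h x := by
  refine (ContinuousAt.comp (f := chart m x₀) hc (continuousAt_chart hx)).congr ?_
  filter_upwards [(isOpen_source x₀).mem_nhds hx] with z hz
  simp only [Function.comp_apply, (chart m x₀).left_inv hz]

lemma memLp_top_of_continuousOn {μ : Measure M} {A : Set M} (hA : IsCompact A) {h : M → ℂ}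
    (hc : ContinuousOn h A) : MemLp h ⊤ (μ.restrict A) := by
  obtain ⟨C, hC⟩ := hA.exists_bound_of_continuousOn hc
  exact memLp_top_of_bound (hc.aestronglyMeasurable hA.measurableSet) C
    ((ae_restrict_mem hA.measurableSet).mono hC)

/-- The coefficients of a form with respect to the frame `L`. -/
def frameCoord (L : M → EM m →L[ℝ] EX m) (η : DForm (m := m) M d ℂ) (x : M) : CForm m d :=
  tri (cext (L x)).inverse (η x)

/-- The density of the standard volume form of `ℂ^m` with respect to `vol`. -/
def frameDens (vol : DForm (m := m) M m ℝ) (L : M → EM m →L[ℝ] EX m) (x : M) : ℂ :=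
  LinearMap.det (cext (L x) : EX m →ₗ[ℂ] EX m) / ((vol x (fr m) : ℝ) : ℂ)

variable (n ι vol) in
/-- A measurable frame of the complexified cotangent bundle over `A`, adapted to the CR structure,
that is bounded above and below with respect to smooth fields and forms. The frame consists of the
components of `L x`, extended complex linearly. -/
structure IsFrameOn (A : Set M) (L : M → EM m →L[ℝ] EX m) : Prop where
  measurableSet : MeasurableSet A
  det_ne_zero : ∀ x ∈ A, LinearMap.det (cext (L x) : EX m →ₗ[ℂ] EX m) ≠ 0
  mem_H01 : ∀ x ∈ A, ∀ w : EM m × EM m, w ∈ H01 (n := n) ι x ↔ cext (L x) (join w) ∈ H0 n m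
  memLp_top : ∀ V : M → EM m, SmoothField V → ∀ i, MemLp (fun x => L x (V x) i) ⊤
    ((volMeasure vol).restrict A)
  memLp_coord : ∀ (p : ℝ≥0∞) (U : Set M), MeasurableSet U → ∀ (d : ℕ) (η : DForm (m := m) M d ℂ),
    (∀ V : Fin d → M → EM m, (∀ i, SmoothField (V i)) →
      MemLp (fun x => η x (fun i => V i x)) p ((volMeasure vol).restrict U)) →
    ∀ σ : Fin d → Fin m, MemLp (fun x => frameCoord L η x (fun j => stdC m (σ j))) p
      ((volMeasure vol).restrict (A ∩ U))
  memLp_dens : MemLp (frameDens vol L) ⊤ ((volMeasure vol).restrict A)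
  memLp_dens_inv : MemLp (fun x => (frameDens vol L x)⁻¹) ⊤ ((volMeasure vol).restrict A)

lemma MemLp.piecewise_restrict {μ : Measure M} {A B U : Set M} (hA : MeasurableSet A)
    {p : ℝ≥0∞} {f g h : M → ℂ}
    (hf : MemLp f p (μ.restrict (A ∩ U))) (hg : MemLp g p (μ.restrict (B ∩ U)))
    (h1 : ∀ x ∈ A, h x = f x) (h2 : ∀ x ∉ A, h x = g x) :
    MemLp h p (μ.restrict ((A ∪ B) ∩ U)) := by
  classical
  have e : h = A.piecewise f g := by
    funext x
    by_cases hx : x ∈ A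
    · rw [piecewise_eq_of_mem _ _ _ hx, h1 x hx]
    · rw [piecewise_eq_of_notMem _ _ _ hx, h2 x hx]
  rw [e]
  refine MemLp.piecewise hA (hf.mono_measure ?_) (hg.mono_measure ?_)
  · rw [Measure.restrict_restrict hA]
    exact Measure.restrict_mono_set _ fun x hx => ⟨hx.1, hx.2.2⟩
  · rw [Measure.restrict_restrict hA.compl]
    exact Measure.restrict_mono_set _ fun x hx => ⟨hx.2.1.resolve_left hx.1, hx.2.2⟩

/-- Frames need not be continuous, so that two of them can be glued along a measurable set. -/
lemma IsFrameOn.union {A B : Set M} {L L' : M → EM m →L[ℝ] EX m}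
    (h : IsFrameOn n ι vol A L) (h' : IsFrameOn n ι vol B L') :
    ∃ L'', IsFrameOn n ι vol (A ∪ B) L'' := by
  classical
  have e1 : ∀ x ∈ A, A.piecewise L L' x = L x := fun x hx => piecewise_eq_of_mem _ _ _ hx
  have e2 : ∀ x ∉ A, A.piecewise L L' x = L' x := fun x hx => piecewise_eq_of_notMem _ _ _ hx
  have key {p : ℝ≥0∞} {f g w : M → ℂ}
      (hf : MemLp f p ((volMeasure vol).restrict A)) (hg : MemLp g p ((volMeasure vol).restrict B))
      (h1 : ∀ x ∈ A, w x = f x) (h2 : ∀ x ∉ A, w x = g x) :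
      MemLp w p ((volMeasure vol).restrict (A ∪ B)) := by
    have := MemLp.piecewise_restrict h.measurableSet (U := univ)
      (by rwa [inter_univ]) (by rwa [inter_univ]) h1 h2
    rwa [inter_univ] at this
  refine ⟨A.piecewise L L', h.measurableSet.union h'.measurableSet, fun x hx => ?_, fun x hx => ?_,
    fun V hV i => ?_, fun p U hU d η hη σ => ?_, ?_, ?_⟩
  · by_cases hA : x ∈ A
    · rw [e1 x hA]; exact h.det_ne_zero x hA
    · rw [e2 x hA]; exact h'.det_ne_zero x (hx.resolve_left hA)
  · by_cases hA : x ∈ A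
    · rw [e1 x hA]; exact h.mem_H01 x hA
    · rw [e2 x hA]; exact h'.mem_H01 x (hx.resolve_left hA)
  · exact key (h.memLp_top V hV i) (h'.memLp_top V hV i) (fun x hx => by rw [e1 x hx])
      fun x hx => by rw [e2 x hx]
  · exact MemLp.piecewise_restrict h.measurableSet (h.memLp_coord p U hU d η hη σ)
      (h'.memLp_coord p U hU d η hη σ) (fun x hx => by rw [frameCoord, e1 x hx, frameCoord])
      fun x hx => by rw [frameCoord, e2 x hx, frameCoord]
  · exact key h.memLp_dens h'.memLp_dens (fun x hx => by rw [frameDens, e1 x hx, frameDens])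
      fun x hx => by rw [frameDens, e2 x hx, frameDens]
  · exact key h.memLp_dens_inv h'.memLp_dens_inv
      (fun x hx => by rw [frameDens, e1 x hx, frameDens])
      fun x hx => by rw [frameDens, e2 x hx, frameDens]

namespace LocalModel

variable (N : LocalModel n ι vol D x₀)

/-- The frame of a local model. -/
def L (x : M) : EM m →L[ℝ] EX m := fderiv ℝ N.Φ (chart m x₀ x) ∘L dchart x₀ x

lemma mem_source_of_mem {K : Set (EM m)} (hK : K ⊆ N.Ω) {x : M} (hx : x ∈ (chart m x₀).symm '' K) :
    x ∈ (chart m x₀).source ∧ chart m x₀ x ∈ K := by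
  obtain ⟨y, hy, rfl⟩ := hx
  have := N.subset (hK hy)
  exact ⟨(chart m x₀).map_target this, by rwa [(chart m x₀).right_inv this]⟩

lemma frameCoord_eq (η : DForm (m := m) M d ℂ) {x : M} (hx : x ∈ (chart m x₀).source)
    (hy : chart m x₀ x ∈ N.Ω) : frameCoord N.L η x = N.coord η (chart m x₀ x) := by
  have h1 := N.symm_dchart hy η
  have h2 := N.det_dchart_ne_zero hy
  rw [(chart m x₀).left_inv hx] at h1 h2
  rw [frameCoord, h1]
  exact tri_pull (inverse_cext h2).2.1 _

lemma frameDens_eq (hvol : IsVolumeForm vol) {x : M} (hx : x ∈ (chart m x₀).source) :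
    frameDens vol N.L x = LinearMap.det (cext (fderiv ℝ N.Φ (chart m x₀ x)) : EX m →ₗ[ℂ] EX m) /
      ((inChart vol x₀ (chart m x₀ x) (fr m) : ℝ) : ℂ) := by
  have h0 : vol x (fr m) ≠ 0 := fun h => hvol.ne_zero _ (topForm_eq_zero h)
  rw [frameDens, L, det_cext_comp, ← inChart_comp_dchart vol hx, topForm_comp]
  rw [← inChart_comp_dchart vol hx, topForm_comp] at h0
  have h1 := left_ne_zero_of_mul h0
  have h2 := right_ne_zero_of_mul h0
  have h3 : ((LinearMap.det (dchart (m := m) x₀ x : EM m →ₗ[ℝ] EM m) : ℝ) : ℂ) ≠ 0 := by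
    exact_mod_cast h1
  push_cast
  rw [mul_comm, mul_div_mul_left _ _ h3]

/-- The coefficients of a form on a compact set are linear combinations of its values on smooth
fields. -/
lemma exists_fields {K : Set (EM m)} (hK : IsCompact K) (hKΩ : K ⊆ N.Ω) :
    ∃ V : ℕ → Bool → M → EM m, (∀ i s, SmoothField (V i s)) ∧
      ∀ (d : ℕ) (η : DForm (m := m) M d ℂ), ∀ y ∈ K, ∀ σ : Fin d → Fin m,
        N.coord η y (fun j => stdC m (σ j)) = ∑ s : Finset (Fin d), Complex.I ^ s.card *
          η ((chart m x₀).symm y) (fun j => V (σ j) (decide (j ∈ s)) ((chart m x₀).symm y)) := by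
  obtain ⟨c, hc, hcs, hct, hc1⟩ := exists_cutoff hK N.isOpen hKΩ
  have hts (i s) : tsupport (fun y => c y • N.vec y i s) ⊆ tsupport c :=
    closure_mono fun y hy hc => hy (by simp [hc])
  refine ⟨fun i s => chartField x₀ fun y => c y • N.vec y i s, fun i s => ?_, fun d η y hy σ => ?_⟩
  · refine smoothField_chartField ?_ hcs.smul_right (((hts i s).trans hct).trans N.subset)
    exact contDiff_of_tsupport fun y hy =>
      hc.contDiffAt.smul (N.contDiffAt_vec i s (hct (hts i s hy)))
  · rw [N.coord_apply]
    refine Finset.sum_congr rfl fun s _ => ?_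
    have ht := N.subset (hKΩ hy)
    have h1 : c y = 1 := (subset_of_mem_nhdsSet hc1) hy
    rw [inChart_eq]
    simp only [chartField, if_pos ((chart m x₀).map_target ht), (chart m x₀).right_inv ht, h1,
      one_smul]
    rfl

/-- The frame of a local model is bounded above and below over a compact set. -/
lemma isFrameOn (hvol : IsVolumeForm vol) {K : Set (EM m)} (hK : IsCompact K) (hKΩ : K ⊆ N.Ω) :
    IsFrameOn n ι vol ((chart m x₀).symm '' K) N.L := by
  have hA := isClosed_symm_image hK (hKΩ.trans N.subset)
  have hcont {h : M → ℂ} (hc : ∀ y ∈ K, ContinuousAt (fun y => h ((chart m x₀).symm y)) y) :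
      MemLp h ⊤ ((volMeasure vol).restrict ((chart m x₀).symm '' K)) :=
    memLp_top_of_continuousOn hA.1 fun x hx =>
      (continuousAt_of_symm (N.mem_source_of_mem hKΩ hx).1
        (hc _ (N.mem_source_of_mem hKΩ hx).2)).continuousWithinAt
  have hdet : ∀ y ∈ K, ContinuousAt (fun y => frameDens vol N.L ((chart m x₀).symm y)) y ∧
      frameDens vol N.L ((chart m x₀).symm y) ≠ 0 := by
    intro y hy
    have hyt := N.subset (hKΩ hy)
    have e : ∀ z ∈ (chart m x₀).target, frameDens vol N.L ((chart m x₀).symm z) =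
        LinearMap.det (cext (fderiv ℝ N.Φ z) : EX m →ₗ[ℂ] EX m) /
          ((inChart vol x₀ z (fr m) : ℝ) : ℂ) := fun z hz => by
      rw [N.frameDens_eq hvol ((chart m x₀).map_target hz), (chart m x₀).right_inv hz]
    have hv : ((inChart vol x₀ y (fr m) : ℝ) : ℂ) ≠ 0 := by
      exact_mod_cast inChart_vol_ne_zero hvol hyt
    refine ⟨?_, ?_⟩
    · have h1 : ContinuousAt (fun z => LinearMap.det (cext (fderiv ℝ N.Φ z) : EX m →ₗ[ℂ] EX m)) y :=
        ContinuousAt.comp (g := fun A : EX m →L[ℂ] EX m => A.det)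
          (ContinuousLinearMap.continuous_det.continuousAt)
          ((cextCLM m).continuous.continuousAt.comp (N.contDiffAt_fderiv (hKΩ hy)).continuousAt)
      have h2 : ContinuousAt (fun z => ((inChart vol x₀ z (fr m) : ℝ) : ℂ)) y :=
        Complex.continuous_ofReal.continuousAt.comp
          ((continuousOn_inChart_vol hvol x₀).continuousAt ((isOpen_target x₀).mem_nhds hyt))
      refine (h1.div h2 hv).congr ?_
      filter_upwards [(isOpen_target x₀).mem_nhds hyt] with z hz
      exact (e z hz).symm
    · rw [e y hyt]
      exact div_ne_zero (N.det_ne_zero y (hKΩ hy)) hv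
  refine ⟨hA.2.measurableSet, ?_, ?_, fun V hV i => hcont fun y hy => ?_,
    fun p U hU d η hη σ => ?_, hcont fun y hy => (hdet y hy).1,
    hcont fun y hy => (hdet y hy).1.inv₀ (hdet y hy).2⟩
  · rintro _ ⟨y, hy, rfl⟩
    have := N.det_dchart_ne_zero (hKΩ hy)
    rwa [L, (chart m x₀).right_inv (N.subset (hKΩ hy))]
  · rintro _ ⟨y, hy, rfl⟩ w
    have := N.mem_H01 y (hKΩ hy) w
    rwa [L, (chart m x₀).right_inv (N.subset (hKΩ hy))]
  · have hyt := N.subset (hKΩ hy)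
    have h1 : ContinuousAt (fun z => fderiv ℝ N.Φ z
        (dchart x₀ ((chart m x₀).symm z) (V ((chart m x₀).symm z)))) y :=
      (N.contDiffAt_fderiv (hKΩ hy)).continuousAt.clm_apply (hV.contDiffAt hyt).continuousAt
    have h2 : ContinuousAt (fun z => fderiv ℝ N.Φ z
        (dchart x₀ ((chart m x₀).symm z) (V ((chart m x₀).symm z))) i) y :=
      (EuclideanSpace.proj i : EX m →L[ℂ] ℂ).continuous.continuousAt.comp h1
    refine h2.congr ?_
    filter_upwards [(isOpen_target x₀).mem_nhds hyt] with z hz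
    rw [L, (chart m x₀).right_inv hz]
    rfl
  · obtain ⟨V, hV, hc⟩ := N.exists_fields hK hKΩ
    have h1 : MemLp (fun x => ∑ s : Finset (Fin d), Complex.I ^ s.card *
        η x (fun j => V (σ j) (decide (j ∈ s)) x)) p
        ((volMeasure vol).restrict ((chart m x₀).symm '' K ∩ U)) := by
      refine memLp_finsetSum _ fun s _ => ((hη _ fun j => hV _ _).const_mul _).mono_measure ?_
      exact Measure.restrict_mono inter_subset_right le_rfl
    refine (memLp_congr_ae ?_).2 h1
    filter_upwards [ae_restrict_mem (hA.2.measurableSet.inter hU)] with x hx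
    obtain ⟨hs, hy⟩ := N.mem_source_of_mem hKΩ hx.1
    rw [N.frameCoord_eq η hs (hKΩ hy), hc d η _ hy, (chart m x₀).left_inv hs]

/-- The coefficients in the chart of a form with `L^p` coefficients. -/
lemma memLp_coord (hvol : IsVolumeForm vol) {K : Set (EM m)} (hK : IsCompact K) (hKΩ : K ⊆ N.Ω)
    {U : Set M} (hU : IsOpen U) {p : ℝ≥0∞} {η : DForm (m := m) M d ℂ}
    (hη : ∀ V : Fin d → M → EM m, (∀ i, SmoothField (V i)) →
      MemLp (fun x => η x (fun i => V i x)) p ((volMeasure vol).restrict U))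
    (l : CForm m d →ₗ[ℂ] ℂ) :
    MemLp ((K ∩ (chart m x₀).symm ⁻¹' U).indicator fun y => l (N.coord η y)) p volume := by
  have hA := (isClosed_symm_image hK (hKΩ.trans N.subset)).2.measurableSet
  have hF := N.isFrameOn hvol hK hKΩ
  have h1 : MemLp (((chart m x₀).symm '' K).indicator fun x => l (frameCoord N.L η x)) p
      ((volMeasure vol).restrict U) := by
    rw [memLp_indicator_iff_restrict hA, Measure.restrict_restrict hA]
    have e : (fun x => l (frameCoord N.L η x)) = fun x => ∑ σ : Fin d → Fin m,
        frameCoord N.L η x (fun j => stdC m (σ j)) * l (coeffsInv m d (Pi.single σ 1)) := by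
      funext x
      conv_lhs => rw [← coeffsInv_coeffs (frameCoord N.L η x), pi_eq_sum_univ' (fun σ : Fin d → Fin m =>
        frameCoord N.L η x fun j => stdC m (σ j))]
      rw [_root_.map_sum, _root_.map_sum]
      refine Finset.sum_congr rfl fun σ _ => ?_
      rw [map_smul, map_smul, smul_eq_mul]
    rw [e]
    exact memLp_finsetSum _ fun σ _ => (hF.memLp_coord p U hU.measurableSet d η hη σ).mul_const _
  refine (memLp_congr_ae (Eventually.of_forall fun y => ?_)).2
    (memLp_chart hvol hU h1 hK (hKΩ.trans N.subset))
  by_cases hy : y ∈ K ∩ (chart m x₀).symm ⁻¹' U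
  · have hyt := N.subset (hKΩ hy.1)
    simp only [indicator_of_mem hy, indicator_of_mem (mem_image_of_mem (chart m x₀).symm hy.1)]
    rw [N.frameCoord_eq η ((chart m x₀).map_target hyt) (by
      rw [(chart m x₀).right_inv hyt]; exact hKΩ hy.1), (chart m x₀).right_inv hyt]
  · simp only [indicator_of_notMem hy]

end LocalModel

variable [IsManifold 𝓘(ℂ, EX n) ω X]

/-- Over a compact set there is an adapted frame. -/
lemma exists_isFrameOn (hM : IsGenericCR (n := n) (m := m) k ι) (hvol : IsVolumeForm vol)
    (hD : IsSmoothDomain (m := m) D) {S : Set M} (hS : IsCompact S) :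
    ∃ A L, S ⊆ A ∧ IsFrameOn n ι vol A L := by
  refine hS.induction_on (p := fun S => ∃ A L, S ⊆ A ∧ IsFrameOn n ι vol A L) ?_ ?_ ?_ ?_
  · refine ⟨∅, 0, Subset.rfl, .empty, by simp, by simp, ?_, ?_, ?_, ?_⟩ <;> simp
  · rintro s t hst ⟨A, L, h1, h2⟩
    exact ⟨A, L, hst.trans h1, h2⟩
  · rintro s t ⟨A, L, h1, h2⟩ ⟨B, L', h1', h2'⟩
    obtain ⟨L'', h⟩ := h2.union h2'
    exact ⟨A ∪ B, L'', union_subset_union h1 h1', h⟩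
  · intro x _
    obtain ⟨N⟩ := exists_localModel hM hvol hD x
    obtain ⟨K, hK, hxK, hKΩ⟩ := exists_compact_subset N.isOpen N.mem
    refine ⟨(chart m x).symm '' K, mem_nhdsWithin_of_mem_nhds ?_, _, _, Subset.rfl,
      N.isFrameOn hvol hK hKΩ⟩
    have hx := mem_source (m := m) x
    filter_upwards [(continuousAt_chart hx).preimage_mem_nhds (mem_interior_iff_mem_nhds.1 hxK),
      (isOpen_source x).mem_nhds hx] with z hz hzs
    exact ⟨_, hz, (chart m x).left_inv hzs⟩

/-- The exterior derivative raises the second degree by one. -/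
lemma extD_mem_bidegree (hM : IsGenericCR (n := n) (m := m) k ι) (hvol : IsVolumeForm vol)
    (hD : IsSmoothDomain (m := m) D) {r q : ℕ} {φ : DForm (m := m) M (r + q) ℂ} (hφ : SmoothForm φ)
    (h : ∀ x, φ x ∈ bidegree (n := n) ι x r q) (x : M) :
    extD φ x ∈ bidegree (n := n) ι x r (q + 1) := by
  obtain ⟨N⟩ := exists_localModel hM hvol hD x
  have h1 := N.coord_extD_mem N.mem (hφ.contDiffAt (chart_mem_target x))
    fun z hz => (N.mem_bidegree_iff hz φ).1 (h _)
  have h2 := (N.mem_bidegree_iff (r := r) (q := q + 1) N.mem (extD φ)).2 h1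
  rwa [(chart m x).left_inv (mem_source x)] at h2

end Frames

section ChartTest

variable {n m k a b d : ℕ} {X : Type*} [TopologicalSpace X] [ChartedSpace (EX n) X]
  {M : Type*} [TopologicalSpace M] [ChartedSpace (EM m) M]
  [IsManifold 𝓘(ℝ, EM m) ∞ M] [T2Space M] [MeasurableSpace M] [BorelSpace M]
  {ι : M → X} {vol : DForm (m := m) M m ℝ} {D : Set M} {x₀ : M}

lemma wedgeEval_smul_right {T : Type*} [AddCommGroup T] [Module ℝ T] [TopologicalSpace T]
    (α : T [⋀^Fin a]→L[ℝ] ℂ) (c : ℂ) (β : T [⋀^Fin b]→L[ℝ] ℂ) (v : Fin (a + b) → T) :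
    wedgeEval α (c • β) v = c * wedgeEval α β v := by
  simp only [wedgeEval, ContinuousAlternatingMap.smul_apply, smul_eq_mul, mul_left_comm _ c,
    ← Finset.mul_sum]

lemma wedgeEval_sum_right {J : Type*} (t : Finset J) (α : EM m [⋀^Fin a]→L[ℝ] ℂ)
    (β : J → EM m [⋀^Fin b]→L[ℝ] ℂ) (v : ℕ → EM m) :
    wedgeEval α (∑ j ∈ t, β j) (fun i => v i) = ∑ j ∈ t, wedgeEval α (β j) (fun i => v i) := by
  simp only [← wedgeCLM_apply, _root_.map_sum]

lemma wedgeEval_sum {J : Type*} (t : Finset J) (α : J → EM m [⋀^Fin a]→L[ℝ] ℂ)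
    (β : EM m [⋀^Fin b]→L[ℝ] ℂ) (v : ℕ → EM m) :
    wedgeEval (∑ j ∈ t, α j) β (fun i => v i) = ∑ j ∈ t, wedgeEval (α j) β (fun i => v i) := by
  simp only [← wedgeCLM_apply, _root_.map_sum, _root_.sum_apply]

/-! ### The weak equations in a straightened chart -/

namespace LocalModel

variable (N : LocalModel n ι vol D x₀)

/-- An integral over the manifold, computed in the chart. -/
lemma integral_wedgeDensity (h : a + b = m) (hvol : IsVolumeForm vol) (α : DForm (m := m) M a ℂ)
    (β : DForm (m := m) M b ℂ) (c : M → ℂ)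
    (hc : ∀ x ∉ (chart m x₀).symm '' N.Ω, c x * wedgeDensity vol α β x = 0) :
    ∫ x, c x * wedgeDensity vol α β x ∂volMeasure vol =
      N.sgn * ∫ y in N.Ω, c ((chart m x₀).symm y) *
        wedgeEval (inChart α x₀ y) (inChart β x₀ y) (fun i => stdFrame m i) := by
  have hzero : ∀ y ∈ (chart m x₀).target \ N.Ω, c ((chart m x₀).symm y) *
      wedgeDensity vol α β ((chart m x₀).symm y) = 0 := by
    rintro y ⟨hy, hyΩ⟩
    refine hc _ ?_
    rintro ⟨z, hz, hzy⟩
    have := (chart m x₀).symm.injOn (N.subset hz) hy hzy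
    exact hyΩ (this ▸ hz)
  rw [integral_chart hvol (x₀ := x₀), ← integral_const_mul,
    setIntegral_eq_of_subset_of_forall_sdiff_eq_zero (isOpen_target x₀).measurableSet N.subset]
  · refine setIntegral_congr_fun N.isOpen.measurableSet fun y hy => ?_
    have hv := inChart_vol_ne_zero hvol (N.subset hy)
    have hv' : ((inChart vol x₀ y (fr m) : ℝ) : ℂ) ≠ 0 := by exact_mod_cast hv
    simp only [wedgeDensity_symm h hvol (N.subset hy), N.dens_eq y hy, Complex.real_smul]
    push_cast
    field_simp
  · intro y hy
    rw [hzero y hy, smul_zero]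
  · intro x hx
    refine hc x ?_
    rintro ⟨y, hy, rfl⟩
    exact hx ((chart m x₀).map_target (N.subset hy))

/-- The test form with coefficient `c` in the frame of the local model. -/
def testForm (c : EM m → ℂ) (θ : CForm m d) : DForm (m := m) M d ℂ :=
  chartForm x₀ fun y => c y • N.frame θ y

variable {c : EM m → ℂ} (hc : ContDiff ℝ ∞ c) (hcs : HasCompactSupport c) (hcΩ : tsupport c ⊆ N.Ω)
  (θ : CForm m d)

lemma tsupport_smul_frame_subset (c : EM m → ℂ) (θ : CForm m d) :
    tsupport (fun y => c y • N.frame θ y) ⊆ tsupport c :=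
  closure_mono fun y hy h => hy (by
    simp only [h]
    exact zero_smul ℂ (N.frame θ y))

lemma smoothForm_testForm (hc : ContDiff ℝ ∞ c) (hcs : HasCompactSupport c)
    (hcΩ : tsupport c ⊆ N.Ω) : SmoothForm (N.testForm c θ) := by
  have hs := N.tsupport_smul_frame_subset c θ
  refine smoothForm_chartForm ?_ (hcs.of_isClosed_subset (isClosed_tsupport _) hs)
    ((hs.trans hcΩ).trans N.subset)
  exact contDiff_of_tsupport fun y hy =>
    hc.contDiffAt.smul (N.contDiffAt_frame θ (hcΩ (hs hy)))

lemma compactSupportIn_testForm (hcs : HasCompactSupport c) (hcΩ : tsupport c ⊆ N.Ω) {U : Set M}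
    (hU : ∀ y ∈ tsupport c, (chart m x₀).symm y ∈ U) : CompactSupportIn (N.testForm c θ) U := by
  have hs := N.tsupport_smul_frame_subset c θ
  exact compactSupportIn_chartForm (hcs.of_isClosed_subset (isClosed_tsupport _) hs)
    ((hs.trans hcΩ).trans N.subset) fun y hy => hU y (hs hy)

lemma inChart_testForm {y : EM m} (hy : y ∈ N.Ω) (c : EM m → ℂ) :
    inChart (N.testForm c θ) x₀ y = c y • N.frame θ y := inChart_chartForm _ (N.subset hy)

lemma testForm_eq_zero {x : M} (hcΩ : tsupport c ⊆ N.Ω)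
    (hx : x ∉ (chart m x₀).symm '' N.Ω) : N.testForm c θ x = 0 := by
  by_contra hne
  obtain ⟨y, hy, rfl⟩ := support_chartForm_subset x₀ _ hne
  exact hx ⟨y, hcΩ (N.tsupport_smul_frame_subset c θ hy), rfl⟩

lemma extD_testForm_eq_zero {x : M} (hcs : HasCompactSupport c) (hcΩ : tsupport c ⊆ N.Ω)
    (hx : x ∉ (chart m x₀).symm '' N.Ω) : extD (N.testForm c θ) x = 0 := by
  have hs := N.tsupport_smul_frame_subset c θ
  refine extD_eq_zero_of_notMem fun hx' => ?_
  obtain ⟨y, hy, rfl⟩ := closure_support_chartForm_subset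
    (hcs.of_isClosed_subset (isClosed_tsupport _) hs) ((hs.trans hcΩ).trans N.subset) hx'
  exact hx ⟨y, hcΩ (hs hy), rfl⟩

lemma inChart_extD_testForm (hc : ContDiff ℝ ∞ c) {y : EM m} (hy : y ∈ N.Ω) :
    inChart (extD (N.testForm c θ)) x₀ y =
      ∑ k, fderiv ℝ c y (EuclideanSpace.single k 1) • dxWedge d k (N.frame θ y) := by
  have hE : inChart (N.testForm c θ) x₀ =ᶠ[𝓝 y] fun z => c z • N.frame θ z := by
    filter_upwards [N.isOpen.mem_nhds hy] with z hz using N.inChart_testForm θ hz c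
  have hd := N.contDiffAt_frame θ hy
  rw [inChart_extD (N.subset hy) ((hc.contDiffAt.smul hd).congr_of_eventuallyEq hE), hE.extDeriv_eq]
  exact extDeriv_mul_of_closed (hc.contDiffAt.differentiableAt (by simp))
    (hd.differentiableAt (by simp)) (N.extDeriv_frame θ hy)

lemma testForm_mem_bidegree {r q : ℕ} {θ : CForm m (r + q)} (hθ : θ ∈ Fil n q)
    (hcΩ : tsupport c ⊆ N.Ω) (x : M) : N.testForm c θ x ∈ bidegree (n := n) ι x r q := by
  by_cases hx : x ∈ (chart m x₀).symm '' N.Ω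
  · obtain ⟨y, hy, rfl⟩ := hx
    rw [N.mem_bidegree_iff hy, N.coord_eq hy (θ := c y • θ)]
    · exact Submodule.smul_mem _ _ hθ
    · rw [N.inChart_testForm θ hy c, frame, frame, pull_smul]
  · rw [N.testForm_eq_zero θ hcΩ hx]
    exact Submodule.zero_mem _

/-- The weak equation, tested in the chart with a multiple of a member of the frame. -/
lemma weakDbar_chart (hvol : IsVolumeForm vol) {U : Set M} {r q r' q' : ℕ} (hr : r + r' = n)
    (hq : q + q' + 1 + k = n) (hm : m + k = 2 * n)
    {g : DForm (m := m) M (r + q) ℂ} {f : DForm (m := m) M (r + (q + 1)) ℂ}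
    (h : WeakDbar (n := n) k ι vol U g f) {θ : CForm m (r' + q')} (hθ : θ ∈ Fil n q')
    (hc : ContDiff ℝ ∞ c) (hcs : HasCompactSupport c) (hcΩ : tsupport c ⊆ N.Ω)
    (hU : ∀ y ∈ tsupport c, (chart m x₀).symm y ∈ U) :
    ∫ y in N.Ω, c y * wedgeEval (inChart f x₀ y) (N.frame θ y) (fun i => stdFrame m i) =
      (-1) ^ (r + q + 1) * ∫ y in N.Ω, ∑ k, fderiv ℝ c y (EuclideanSpace.single k 1) *
        wedgeEval (inChart g x₀ y) (dxWedge (r' + q') k (N.frame θ y))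
          (fun i => stdFrame m i) := by
  have h3 := (h r' q' hr hq (N.testForm c θ) (N.smoothForm_testForm θ hc hcs hcΩ)
    (N.testForm_mem_bidegree hθ hcΩ) (N.compactSupportIn_testForm θ hcs hcΩ hU)).2.2
  have e1 := N.integral_wedgeDensity (by omega) hvol f (N.testForm c θ) (fun _ => 1)
    fun x hx => by simp [wedgeDensity, N.testForm_eq_zero θ hcΩ hx, wedgeEval_zero_right]
  have e2 := N.integral_wedgeDensity (b := r' + q' + 1) (by omega) hvol g (extD (N.testForm c θ))
    (fun _ => 1)
    fun x hx => by simp [wedgeDensity, N.extD_testForm_eq_zero θ hcs hcΩ hx, wedgeEval_zero_right]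
  simp only [one_mul] at e1 e2
  rw [wedgeIntegral, wedgeIntegral, e1, e2] at h3
  have hs : (N.sgn : ℂ) * N.sgn = 1 := by exact_mod_cast N.sgn_mul_self
  have h4 := congrArg (fun z => (N.sgn : ℂ) * z) h3
  simp only [← mul_assoc, mul_comm _ ((-1 : ℂ) ^ (r + q + 1)), hs, one_mul] at h4
  simp only [mul_assoc, hs, one_mul] at h4
  refine Eq.trans ?_ (h4.trans ?_)
  · refine setIntegral_congr_fun N.isOpen.measurableSet fun y hy => ?_
    simp only [N.inChart_testForm θ hy c, wedgeEval_smul_right]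
  · congr 1
    refine setIntegral_congr_fun N.isOpen.measurableSet fun y hy => ?_
    simp only [N.inChart_extD_testForm θ hc hy, ← wedgeEval_smul_right]
    exact wedgeEval_sum_right _ _ _ _

end LocalModel

end ChartTest

section LocalGreen

variable {n m k a b d : ℕ} {X : Type*} [TopologicalSpace X] [ChartedSpace (EX n) X]
  {M : Type*} [TopologicalSpace M] [ChartedSpace (EM m) M]
  [IsManifold 𝓘(ℝ, EM m) ∞ M] [T2Space M] [MeasurableSpace M] [BorelSpace M]
  {ι : M → X} {vol : DForm (m := m) M m ℝ} {D : Set M} {x₀ : M}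

/-! ### The local Green formula -/

lemma wedgeEval_add_right {T : Type*} [AddCommGroup T] [Module ℝ T] [TopologicalSpace T]
    (α : T [⋀^Fin a]→L[ℝ] ℂ) (β β' : T [⋀^Fin b]→L[ℝ] ℂ) (v : Fin (a + b) → T) :
    wedgeEval α (β + β') v = wedgeEval α β v + wedgeEval α β' v := by
  simp only [wedgeEval, ContinuousAlternatingMap.add_apply, mul_add, Finset.sum_add_distrib]

/-- The wedge product with a fixed form as a linear functional. -/
def wedgeStdHom (α : CForm m a) : CForm m b →ₗ[ℂ] ℂ where
  toFun := wedgeStd α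
  map_add' β β' := wedgeEval_add_right (realForm α) (realForm β) (realForm β') fun i => stdC m i
  map_smul' c β := wedgeEval_smul_right (realForm α) c (realForm β) fun i => stdC m i

open ContinuousAlternatingMap in
lemma dxWedge_smul (l : Fin m) (c : ℂ) (α : EM m [⋀^Fin a]→L[ℝ] ℂ) :
    dxWedge a l (c • α) = c • dxWedge a l α := by
  ext v
  simp only [dxWedge_apply, alternatizeUncurryFin_apply, ContinuousLinearMap.smulRight_apply,
    ContinuousAlternatingMap.smul_apply, Finset.smul_sum]
  refine Finset.sum_congr rfl fun i _ => ?_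
  rw [smul_comm c, smul_comm c]

lemma memLp_mul_continuous {q : ℝ≥0∞} {g h : EM m → ℂ} (hg : MemLp g q volume) (hh : Continuous h)
    (hs : HasCompactSupport h) : MemLp (fun y => g y * h y) q volume :=
  MemLp.mul' (p := q) (q := ⊤) (hh.memLp_of_hasCompactSupport hs) hg

lemma setIntegral_eq_sum {J : Type*} [Fintype J] {Ω : Set (EM m)} (hΩ : MeasurableSet Ω)
    {F : EM m → ℂ} {G : J → EM m → ℂ} (hG : ∀ j, Integrable (G j))
    (h : ∀ᵐ y, Ω.indicator F y = ∑ j, G j y) : ∫ y in Ω, F y = ∑ j, ∫ y, G j y := by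
  rw [← integral_indicator hΩ, integral_congr_ae h, integral_finsetSum _ fun j _ => hG j]

lemma continuous_of_tsupport {f : EM m → ℂ} (h : ∀ y ∈ tsupport f, ContinuousAt f y) :
    Continuous f := by
  rw [continuous_iff_continuousAt]
  intro y
  by_cases hy : y ∈ tsupport f
  · exact h y hy
  · exact continuousAt_const.congr (notMem_tsupport_iff_eventuallyEq.1 hy).symm

/-- A mollifier supported in the directions of a given ball. -/
lemma exists_mollifier (v : EM m) {δ : ℝ} (hδ : 0 < δ) : ∃ ρ : EM m → ℝ, ContDiff ℝ ∞ ρ ∧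
    HasCompactSupport ρ ∧ tsupport ρ ⊆ Metric.ball v δ ∧ ∫ z, ρ z = 1 := by
  let φ : ContDiffBump v := ⟨δ / 4, δ / 2, by positivity, by linarith⟩
  refine ⟨φ.normed volume, φ.contDiff_normed, φ.hasCompactSupport_normed, ?_, φ.integral_normed⟩
  rw [φ.tsupport_normed_eq]
  exact Metric.closedBall_subset_ball (by show δ / 2 < δ; linarith)

lemma fderiv_shift {ρ : EM m → ℂ} (hρ : Differentiable ℝ ρ) (ε : ℝ) (x y e : EM m) :
    fderiv ℝ (fun z => ρ (ε⁻¹ • (z - x))) y e = (ε⁻¹ : ℝ) * fderiv ℝ ρ (ε⁻¹ • (y - x)) e := by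
  have h1 : HasFDerivAt (fun z : EM m => ε⁻¹ • (z - x)) (ε⁻¹ • ContinuousLinearMap.id ℝ (EM m)) y :=
    ((hasFDerivAt_id y).sub_const x).const_smul ε⁻¹
  have h2 := ((hρ (ε⁻¹ • (y - x))).hasFDerivAt.comp y h1).fderiv
  refine (DFunLike.congr_fun h2 e).trans ?_
  simp

lemma fderiv_shift_neg {ρ : EM m → ℂ} (hρ : Differentiable ℝ ρ) (ε : ℝ) (x y e : EM m) :
    fderiv ℝ (fun z => ρ (ε⁻¹ • (y - z))) x e = -((ε⁻¹ : ℝ) * fderiv ℝ ρ (ε⁻¹ • (y - x)) e) := by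
  have h1 : HasFDerivAt (fun z : EM m => ε⁻¹ • (y - z)) (ε⁻¹ • -ContinuousLinearMap.id ℝ (EM m)) x :=
    ((hasFDerivAt_id x).const_sub y).const_smul ε⁻¹
  have h2 := ((hρ (ε⁻¹ • (y - x))).hasFDerivAt.comp x h1).fderiv
  refine (DFunLike.congr_fun h2 e).trans ?_
  simp

namespace LocalModel

variable (N : LocalModel n ι vol D x₀)

/-- A form of type `(r, q)` in the closed frame of the local model. -/
lemma inChart_eq_sum {r q : ℕ} {y : EM m} (hy : y ∈ N.Ω) {η : DForm (m := m) M (r + q) ℂ}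
    (h : η ((chart m x₀).symm y) ∈ bidegree (n := n) ι ((chart m x₀).symm y) r q) :
    inChart η x₀ y = ∑ j, filCoord n q j (N.coord η y) • N.frame (filBasis n q j) y := by
  rw [← N.frame_coord η hy]
  conv_lhs => rw [← sum_filCoord ((N.mem_bidegree_iff hy η).1 h)]
  exact (_root_.map_sum (pullCLM (r + q) (fderiv ℝ N.Φ y)) _ _).trans
    (Finset.sum_congr rfl fun j _ => map_smul _ _ _)

lemma ae_mem_Ω (hvol : IsVolumeForm vol) {P : M → Prop} (h : ∀ᵐ x ∂volMeasure vol, P x) :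
    ∀ᵐ y : EM m, y ∈ N.Ω → P ((chart m x₀).symm y) := by
  have h1 := (ae_restrict_iff' (isOpen_target x₀).measurableSet).1 (ae_chart hvol x₀ h)
  filter_upwards [h1] with y hy hyΩ using hy (N.subset hyΩ)

/-- The coefficients `θ ∧ dx_k ∧ θ'` of the operator have vanishing divergence. -/
lemma divergence_eq_zero (θ : CForm m a) (θ' : CForm m b) {y : EM m} (hy : y ∈ N.Ω) :
    ∑ k, fderiv ℝ (fun z => wedgeEval (N.frame θ z) (dxWedge b k (N.frame θ' z))
      (fun i => stdFrame m i)) y (EuclideanSpace.single k 1) = 0 := by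
  have h1 := wedge_extDeriv_add ((N.contDiffAt_frame θ hy).differentiableAt (by simp))
    ((N.contDiffAt_frame θ' hy).differentiableAt (by simp)) (stdFrame m)
  rw [N.extDeriv_frame θ hy, N.extDeriv_frame θ' hy, wedgeEval_zero, wedgeEval_zero_right, mul_zero,
    add_zero] at h1
  have h2 (k : Fin m) : (fun z => wedgeEval (N.frame θ z) (dxWedge b k (N.frame θ' z))
      (fun i => stdFrame m i)) = fun z => (-1 : ℂ) ^ a * wedgeEval (dxWedge a k (N.frame θ z))
        (N.frame θ' z) (fun i => stdFrame m i) := funext fun z => wedgeEval_dxWedge _ _ _ _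
  simp only [h2]
  have h3 (k : Fin m) : fderiv ℝ (fun z => (-1 : ℂ) ^ a * wedgeEval (dxWedge a k (N.frame θ z))
        (N.frame θ' z) (fun i => stdFrame m i)) y (EuclideanSpace.single k 1) = (-1 : ℂ) ^ a *
      fderiv ℝ (fun z => wedgeEval (dxWedge a k (N.frame θ z))
        (N.frame θ' z) (fun i => stdFrame m i)) y (EuclideanSpace.single k 1) := by
    have hd : ContDiffAt ℝ ∞ (fun z => wedgeEval (dxWedge a k (N.frame θ z))
        (N.frame θ' z) (fun i => stdFrame m i)) y :=
      contDiffAt_wedge ((dxWedge a k).contDiff.contDiffAt.comp y (N.contDiffAt_frame θ hy))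
        (N.contDiffAt_frame θ' hy) _
    rw [fderiv_const_mul (hd.differentiableAt (by simp))]
    simp
  simp only [h3]
  rw [← Finset.mul_sum, ← h1, mul_zero]

/-- The coefficients of a form, cut off to the part of a compact set that lies over a set. -/
def cutCoord (K : Set (EM m)) (U : Set M) (t : ℕ) (η : DForm (m := m) M d ℂ)
    (j : FilIdx m d n t) : EM m → ℂ :=
  (K ∩ (chart m x₀).symm ⁻¹' U).indicator fun y => filCoord n t j (N.coord η y)

/-- The coefficient `θ ∧ β`, cut off to the part of a compact set that lies over a set. -/
def cutWedge (K : Set (EM m)) (U : Set M) (θ : CForm m a) (β : DForm (m := m) M b ℂ) : EM m → ℂ :=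
  (K ∩ (chart m x₀).symm ⁻¹' U).indicator fun y =>
    wedgeEval (N.frame θ y) (inChart β x₀ y) (fun i => stdFrame m i)

/-- The coefficients `θ ∧ dx_l ∧ θ'` of the operator, with a cutoff function. -/
def opCoef (η : EM m → ℝ) (θ : CForm m a) (θ' : CForm m b) (l : Fin m) (y : EM m) : ℂ :=
  η y * wedgeEval (N.frame θ y) (dxWedge b l (N.frame θ' y)) (fun i => stdFrame m i)

variable {η : EM m → ℝ} (hη : ContDiff ℝ ∞ η) (hηs : HasCompactSupport η) (hηΩ : tsupport η ⊆ N.Ω)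

lemma tsupport_ofReal_mul_subset (η : EM m → ℝ) (g : EM m → ℂ) :
    tsupport (fun y => (η y : ℂ) * g y) ⊆ tsupport η :=
  closure_mono fun y hy h => hy (by simp [h])

lemma contDiff_opCoef (hη : ContDiff ℝ ∞ η) (hηΩ : tsupport η ⊆ N.Ω) (θ : CForm m a)
    (θ' : CForm m b) (l : Fin m) : ContDiff ℝ ∞ (N.opCoef η θ θ' l) :=
  contDiff_of_tsupport fun y hy => by
    have hyΩ : y ∈ N.Ω := hηΩ (tsupport_ofReal_mul_subset η _ hy)
    exact (Complex.ofRealCLM.contDiff.comp hη).contDiffAt.mul (contDiffAt_wedge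
      (N.contDiffAt_frame _ hyΩ)
      ((dxWedge b l).contDiff.contDiffAt.comp y (N.contDiffAt_frame _ hyΩ)) _)

lemma hasCompactSupport_opCoef (hηs : HasCompactSupport η) (θ : CForm m a)
    (θ' : CForm m b) (l : Fin m) : HasCompactSupport (N.opCoef η θ θ' l) :=
  hηs.of_isClosed_subset (isClosed_tsupport _) (tsupport_ofReal_mul_subset η _)

/-- The coefficients of a form with `L^p` coefficients on `M`, cut off to the closure of `D`. -/
lemma memLp_cutCoord_closure (hvol : IsVolumeForm vol) {K : Set (EM m)} (hK : IsCompact K)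
    (hKΩ : K ⊆ N.Ω) {p : ℝ≥0∞} {f : DForm (m := m) M d ℂ}
    (hf : ∀ V : Fin d → M → EM m, (∀ i, SmoothField (V i)) →
      MemLp (fun x => f x (fun i => V i x)) p (volMeasure vol)) (t : ℕ) (j : FilIdx m d n t) :
    MemLp (N.cutCoord K (closure D) t f j) p volume := by
  have h1 := N.memLp_coord hvol hK hKΩ isOpen_univ (η := f) (p := p) (by simpa using hf)
    (filCoord n t j)
  simp only [preimage_univ, inter_univ] at h1
  have hS : MeasurableSet ((chart m x₀).target ∩ (chart m x₀).symm ⁻¹' closure D) :=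
    measurableSet_target_inter isClosed_closure.measurableSet
  have h2 := h1.indicator hS
  rw [indicator_indicator] at h2
  have e : K ∩ (chart m x₀).symm ⁻¹' closure D =
      (chart m x₀).target ∩ (chart m x₀).symm ⁻¹' closure D ∩ K := by
    ext y
    exact ⟨fun h => ⟨⟨N.subset (hKΩ h.1), h.2⟩, h.1⟩, fun h => ⟨h.2, h.1.2⟩⟩
  rw [cutCoord, e]
  exact h2

lemma continuousAt_det {y : EM m} (hy : y ∈ N.Ω) : ContinuousAt
    (fun y => LinearMap.det (cext (fderiv ℝ N.Φ y) : EX m →ₗ[ℂ] EX m)) y :=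
  ContinuousAt.comp (g := fun A : EX m →L[ℂ] EX m => A.det)
    (ContinuousLinearMap.continuous_det.continuousAt)
    ((cextCLM m).continuous.continuousAt.comp (N.contDiffAt_fderiv hy).continuousAt)

/-- In the straightened frame the wedge product is a bounded function times a linear functional of
the coefficients. -/
lemma memLp_cutWedge (h : a + b = m) (hvol : IsVolumeForm vol) {K : Set (EM m)} (hK : IsCompact K)
    (hKΩ : K ⊆ N.Ω) {U : Set M} (hU : IsOpen U) {q : ℝ≥0∞} {φ : DForm (m := m) M b ℂ}
    (hφ : ∀ V : Fin b → M → EM m, (∀ i, SmoothField (V i)) →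
      MemLp (fun x => φ x (fun i => V i x)) q ((volMeasure vol).restrict U)) (θ : CForm m a) :
    MemLp (N.cutWedge K U θ φ) q volume := by
  obtain ⟨η, hη, hηs, hηΩ, hη1⟩ := exists_cutoff hK N.isOpen hKΩ
  have h1 := N.memLp_coord hvol hK hKΩ hU hφ (wedgeStdHom θ)
  have h2 : Continuous fun y => (η y : ℂ) *
      LinearMap.det (cext (fderiv ℝ N.Φ y) : EX m →ₗ[ℂ] EX m) := by
    refine continuous_of_tsupport fun y hy => ?_
    have hyΩ : y ∈ N.Ω := hηΩ (tsupport_ofReal_mul_subset η _ hy)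
    exact (Complex.continuous_ofReal.comp hη.continuous).continuousAt.mul (N.continuousAt_det hyΩ)
  have h3 := memLp_mul_continuous h1 h2
    (hηs.of_isClosed_subset (isClosed_tsupport _) (tsupport_ofReal_mul_subset η _))
  refine (memLp_congr_ae (Eventually.of_forall fun y => ?_)).2 h3
  by_cases hy : y ∈ K ∩ (chart m x₀).symm ⁻¹' U
  · have hη1 : η y = 1 := subset_of_mem_nhdsSet hη1 hy.1
    simp only [cutWedge, indicator_of_mem hy, hη1]
    rw [← N.frame_coord φ (hKΩ hy.1), frame, frame, wedgeEval_pull h, Complex.ofReal_one, one_mul,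
      mul_comm]
    rfl
  · simp only [cutWedge, indicator_of_notMem hy, zero_mul]

lemma inChart_eq_zero {f : DForm (m := m) M d ℂ} {y : EM m} (h : f ((chart m x₀).symm y) = 0) :
    inChart f x₀ y = 0 := by
  rw [inChart_eq, h]
  ext v
  rfl

section Cutoff

variable {r s r' t : ℕ}

/-- The equation `∂̄_b f = 0`, tested with `c θ'`, in coordinates. -/
lemma sum_closed_eq_zero {p q : ℝ≥0∞} [hpq : p.HolderConjugate q] (hvol : IsVolumeForm vol) (hr : r + r' = n)
    (hst : s + 1 + t + 1 + k = n) (hm : m + k = 2 * n) {f : DForm (m := m) M (r + (s + 1)) ℂ}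
    (hf : ∀ V : Fin (r + (s + 1)) → M → EM m, (∀ i, SmoothField (V i)) →
      MemLp (fun x => f x (fun i => V i x)) p (volMeasure vol))
    (hfb : ∀ᵐ x ∂volMeasure vol, f x ∈ bidegree (n := n) ι x r (s + 1))
    (hfD : ∀ᵐ x ∂volMeasure vol, x ∉ closure D → f x = 0)
    (hf0 : WeakDbar (n := n) k ι vol univ f 0) {θ' : CForm m (r' + t)} (hθ' : θ' ∈ Fil n t)
    {K : Set (EM m)} (hK : IsCompact K) (hKΩ : K ⊆ N.Ω) (hη : ContDiff ℝ ∞ η)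
    (hηs : HasCompactSupport η) (hηΩ : tsupport η ⊆ N.Ω) (hη1 : ∀ y ∈ K, η y = 1)
    {c : EM m → ℂ} (hc : ContDiff ℝ ∞ c) (hcK : tsupport c ⊆ K) :
    ∑ i, ∑ l, ∫ y, N.cutCoord K (closure D) (s + 1) f i y * (N.opCoef η (filBasis n (s + 1) i) θ' l y *
      fderiv ℝ c y (EuclideanSpace.single l 1)) = 0 := by
  have hcs : HasCompactSupport c := hK.of_isClosed_subset (isClosed_tsupport _) hcK
  have h1 := N.weakDbar_chart hvol hr hst hm hf0 hθ' hc hcs (hcK.trans hKΩ) fun y _ => mem_univ _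
  have hdc (l : Fin m) : Continuous fun y => fderiv ℝ c y (EuclideanSpace.single l 1) :=
    (hc.continuous_fderiv (by simp)).clm_apply continuous_const
  have hz : ∀ y, inChart (0 : DForm (m := m) M (r + (s + 1 + 1)) ℂ) x₀ y = 0 := inChart_zero x₀
  simp only [hz, wedgeEval_zero, mul_zero, integral_zero] at h1
  have h2 := (mul_eq_zero.1 h1.symm).resolve_left (pow_ne_zero _ (by norm_num))
  rw [← Fintype.sum_prod_type', ← h2]
  refine (setIntegral_eq_sum N.isOpen.measurableSet (fun j => ?_) ?_).symm
  · have h3 : Continuous fun y => N.opCoef η (filBasis n (s + 1) j.1) θ' j.2 y *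
        fderiv ℝ c y (EuclideanSpace.single j.2 1) :=
      (N.contDiff_opCoef hη hηΩ _ _ _).continuous.mul (hdc _)
    exact MemLp.integrable_mul (N.memLp_cutCoord_closure hvol hK hKΩ hf _ _)
      (q := q) (h3.memLp_of_hasCompactSupport (N.hasCompactSupport_opCoef hηs _ _ _).mul_right)
  · filter_upwards [N.ae_mem_Ω hvol (hfb.and hfD)] with y hy
    have hzero : ∀ y ∉ K, ∀ l : Fin m, fderiv ℝ c y (EuclideanSpace.single l 1) = 0 := by
      intro y hy l
      rw [fderiv_of_notMem_tsupport (𝕜 := ℝ) fun h => hy (hcK h)]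
      rfl
    rw [Fintype.sum_prod_type, Finset.sum_comm]
    by_cases hyK : y ∈ K
    · obtain ⟨hb, hcl⟩ := hy (hKΩ hyK)
      rw [indicator_of_mem (hKΩ hyK)]
      by_cases hyD : y ∈ (chart m x₀).symm ⁻¹' closure D
      · simp only [cutCoord, indicator_of_mem (mem_inter hyK hyD), opCoef, hη1 y hyK,
          Complex.ofReal_one, one_mul]
        refine Finset.sum_congr rfl fun l _ => ?_
        rw [N.inChart_eq_sum (hKΩ hyK) hb, wedgeEval_sum, Finset.mul_sum]
        refine Finset.sum_congr rfl fun i _ => ?_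
        rw [wedgeEval_smul]
        ring
      · simp only [cutCoord, indicator_of_notMem (fun h => hyD (mem_of_mem_inter_right h)), zero_mul,
          inChart_eq_zero (hcl hyD), wedgeEval_zero, mul_zero, Finset.sum_const_zero]
    · classical rw [indicator_apply]
      simp only [hzero y hyK, zero_mul, mul_zero, Finset.sum_const_zero, ite_self]

/-- The equation `∂̄_b ψ = φ`, tested with `c θ`, in coordinates. -/
lemma integral_cutWedge_eq {p q : ℝ≥0∞} [hpq : p.HolderConjugate q] (hvol : IsVolumeForm vol) (hDo : IsOpen D) (hr : r + r' = n)
    (hst : s + 1 + t + 1 + k = n) (hm : m + k = 2 * n) {ψ : DForm (m := m) M (r' + t) ℂ}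
    {φ : DForm (m := m) M (r' + (t + 1)) ℂ}
    (hψ : ∀ V : Fin (r' + t) → M → EM m, (∀ i, SmoothField (V i)) →
      MemLp (fun x => ψ x (fun i => V i x)) q ((volMeasure vol).restrict D))
    (hψb : ∀ᵐ x ∂(volMeasure vol).restrict D, ψ x ∈ bidegree (n := n) ι x r' t)
    (hψφ : WeakDbar (n := n) k ι vol D ψ φ) {θ : CForm m (r + (s + 1))} (hθ : θ ∈ Fil n (s + 1))
    {K : Set (EM m)} (hK : IsCompact K) (hKΩ : K ⊆ N.Ω) (hη : ContDiff ℝ ∞ η)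
    (hηs : HasCompactSupport η) (hηΩ : tsupport η ⊆ N.Ω) (hη1 : ∀ y ∈ K, η y = 1)
    {c : EM m → ℂ} (hc : ContDiff ℝ ∞ c) (hcK : tsupport c ⊆ K)
    (hcD : ∀ y ∈ tsupport c, (chart m x₀).symm y ∈ D) :
    ∫ y, N.cutWedge K D θ φ y * c y = ∑ j, ∑ l, ∫ y, -N.cutCoord K D t ψ j y *
      (N.opCoef η θ (filBasis n t j) l y * fderiv ℝ c y (EuclideanSpace.single l 1)) := by
  have hcs : HasCompactSupport c := hK.of_isClosed_subset (isClosed_tsupport _) hcK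
  have h1 := N.weakDbar_chart hvol (by omega) (by omega) hm hψφ hθ hc hcs (hcK.trans hKΩ) hcD
  -- the sign `c₀ = ±1` of the exchange of the two factors cancels in the end
  obtain ⟨c₀, hc₀, hcomm⟩ := exists_wedgeEval_comm (r' + (t + 1)) (r + (s + 1))
  have hdc (l : Fin m) : Continuous fun y => fderiv ℝ c y (EuclideanSpace.single l 1) :=
    (hc.continuous_fderiv (by simp)).clm_apply continuous_const
  have e1 : ∫ y in N.Ω, c y * wedgeEval (inChart φ x₀ y) (N.frame θ y) (fun i => stdFrame m i) =
      c₀ * ∫ y, N.cutWedge K D θ φ y * c y := by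
    rw [← integral_const_mul, ← integral_indicator N.isOpen.measurableSet]
    refine integral_congr_ae (Eventually.of_forall fun y => ?_)
    by_cases hy : y ∈ tsupport c
    · simp only [indicator_of_mem (hKΩ (hcK hy)), cutWedge,
        indicator_of_mem (show y ∈ K ∩ (chart m x₀).symm ⁻¹' D from ⟨hcK hy, hcD y hy⟩)]
      rw [hcomm]
      ring
    · simp [image_eq_zero_of_notMem_tsupport hy]
  have e2 : (-1) ^ (r' + t + 1) * ∫ y in N.Ω, ∑ l, fderiv ℝ c y (EuclideanSpace.single l 1) *
        wedgeEval (inChart ψ x₀ y) (dxWedge (r + (s + 1)) l (N.frame θ y)) (fun i => stdFrame m i) =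
      c₀ * ∑ j, ∑ l, ∫ y, -N.cutCoord K D t ψ j y *
        (N.opCoef η θ (filBasis n t j) l y * fderiv ℝ c y (EuclideanSpace.single l 1)) := by
    rw [← Fintype.sum_prod_type', ← integral_const_mul, Finset.mul_sum]
    simp only [← integral_const_mul]
    refine setIntegral_eq_sum N.isOpen.measurableSet (fun j => ?_) ?_
    · have h3 : Continuous fun y => N.opCoef η θ (filBasis n t j.1) j.2 y *
          fderiv ℝ c y (EuclideanSpace.single j.2 1) :=
        (N.contDiff_opCoef hη hηΩ _ _ _).continuous.mul (hdc _)
      exact (MemLp.integrable_mul (N.memLp_coord hvol hK hKΩ hDo hψ (filCoord n t j.1)).neg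
        (q := p) (h3.memLp_of_hasCompactSupport
          (N.hasCompactSupport_opCoef hηs _ _ _).mul_right)).const_mul _
    · filter_upwards [N.ae_mem_Ω hvol ((ae_restrict_iff' hDo.measurableSet).1 hψb)] with y hy
      rw [Fintype.sum_prod_type, Finset.sum_comm]
      by_cases hyc : y ∈ tsupport c
      · have hyK := hcK hyc
        rw [indicator_of_mem (hKΩ hyK), Finset.mul_sum]
        simp only [cutCoord, indicator_of_mem (show y ∈ K ∩ (chart m x₀).symm ⁻¹' D from
          ⟨hyK, hcD y hyc⟩), opCoef, hη1 y hyK, Complex.ofReal_one, one_mul]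
        refine Finset.sum_congr rfl fun l _ => ?_
        rw [N.inChart_eq_sum (hKΩ hyK) (hy (hKΩ hyK) (hcD y hyc)), wedgeEval_sum, Finset.mul_sum,
          Finset.mul_sum]
        refine Finset.sum_congr rfl fun j _ => ?_
        have h4 := hcomm (dxWedge (r' + t) l (N.frame (filBasis n t j) y)) (N.frame θ y) (stdFrame m)
        have h5 : wedgeEval (N.frame (filBasis n t j) y) (dxWedge (r + (s + 1)) l (N.frame θ y))
            (fun i => stdFrame m i) = (-1) ^ (r' + t) * (c₀ * wedgeEval (N.frame θ y)
              (dxWedge (r' + t) l (N.frame (filBasis n t j) y)) (fun i => stdFrame m i)) := by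
          rw [wedgeEval_dxWedge]
          exact congrArg _ h4
        rw [wedgeEval_smul, h5]
        have h6 : ((-1 : ℂ) ^ (r' + t)) * (-1) ^ (r' + t) = 1 := by
          rw [← mul_pow]; simp
        rw [pow_succ]
        linear_combination (-(fderiv ℝ c y (EuclideanSpace.single l 1) *
          filCoord n t j (N.coord ψ y) * (c₀ * wedgeEval (N.frame θ y)
              (dxWedge (r' + t) l (N.frame (filBasis n t j) y)) (fun i => stdFrame m i)))) * h6
      · have hzero : fderiv ℝ c y = 0 := fderiv_of_notMem_tsupport (𝕜 := ℝ) hyc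
        simp [hzero]
  rw [e1, e2] at h1
  have h7 := congrArg (fun z => c₀ * z) h1
  simpa only [← mul_assoc, hc₀, one_mul] using h7

end Cutoff

/-- The local Green formula. The two weak equations are doubled and the mollifier points into `D`,
so that no regularity of the forms is needed. -/
lemma green {p q : ℝ≥0∞} [hpq : p.HolderConjugate q] (hqt : q ≠ ⊤) (hvol : IsVolumeForm vol)
    (hDo : IsOpen D) {r s r' t : ℕ} (hr : r + r' = n) (hst : s + 1 + t + 1 + k = n)
    (hm : m + k = 2 * n)
    {f : DForm (m := m) M (r + (s + 1)) ℂ} {ψ : DForm (m := m) M (r' + t) ℂ}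
    {φ : DForm (m := m) M (r' + (t + 1)) ℂ}
    (hf : ∀ V : Fin (r + (s + 1)) → M → EM m, (∀ i, SmoothField (V i)) →
      MemLp (fun x => f x (fun i => V i x)) p (volMeasure vol))
    (hfb : ∀ᵐ x ∂volMeasure vol, f x ∈ bidegree (n := n) ι x r (s + 1))
    (hfD : ∀ᵐ x ∂volMeasure vol, x ∉ closure D → f x = 0)
    (hψ : ∀ V : Fin (r' + t) → M → EM m, (∀ i, SmoothField (V i)) →
      MemLp (fun x => ψ x (fun i => V i x)) q ((volMeasure vol).restrict D))
    (hψb : ∀ᵐ x ∂(volMeasure vol).restrict D, ψ x ∈ bidegree (n := n) ι x r' t)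
    (hφ : ∀ V : Fin (r' + (t + 1)) → M → EM m, (∀ i, SmoothField (V i)) →
      MemLp (fun x => φ x (fun i => V i x)) q ((volMeasure vol).restrict D))
    (hf0 : WeakDbar (n := n) k ι vol univ f 0) (hψφ : WeakDbar (n := n) k ι vol D ψ φ)
    {χ : EM m → ℂ} (hχ : ContDiff ℝ ∞ χ) (hχs : HasCompactSupport χ) (hχΩ : tsupport χ ⊆ N.Ω) :
    ∫ y in N.Ω, D.indicator (1 : M → ℂ) ((chart m x₀).symm y) * (χ y *
        wedgeEval (inChart f x₀ y) (inChart φ x₀ y) (fun i => stdFrame m i)) =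
      -∫ y in N.Ω, D.indicator (1 : M → ℂ) ((chart m x₀).symm y) *
        ∑ l, fderiv ℝ χ y (EuclideanSpace.single l 1) * wedgeEval (inChart f x₀ y)
          (dxWedge (r' + t) l (inChart ψ x₀ y)) (fun i => stdFrame m i) := by
  have hK : IsCompact (tsupport χ) := hχs
  -- `η` cuts off the coefficients of the operator; it is one near `K'`, a neighbourhood of the
  -- support of `χ`
  obtain ⟨K', hK', hKK', hK'Ω⟩ := exists_compact_between hK N.isOpen hχΩ
  obtain ⟨η, hη, hηs, hηΩ, hη1⟩ := exists_cutoff hK' N.isOpen hK'Ω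
  obtain ⟨ρ₀, hρ₀, hρ₀s, hρ₀v, hρ₀1⟩ := exists_mollifier N.v N.δ_pos
  obtain ⟨ρ, hρ, hρs, hρv, hρ1⟩ : ∃ ρ : EM m → ℂ, ContDiff ℝ ∞ ρ ∧ HasCompactSupport ρ ∧
      tsupport ρ ⊆ Metric.ball N.v N.δ ∧ ∫ z, ρ z = 1 := by
    refine ⟨fun y => (ρ₀ y : ℂ), Complex.ofRealCLM.contDiff.comp hρ₀,
      hρ₀s.comp_left (g := Complex.ofReal) Complex.ofReal_zero, ?_, ?_⟩
    · exact (tsupport_comp_subset Complex.ofReal_zero ρ₀).trans hρ₀v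
    · exact integral_ofReal.trans (by rw [hρ₀1]; exact Complex.ofReal_one)
  have hη1' : ∀ y ∈ K', η y = 1 := fun y hy => subset_of_mem_nhdsSet hη1 hy
  have hKK : tsupport χ ⊆ K' := hKK'.trans interior_subset
  have hρd : Differentiable ℝ ρ := hρ.differentiable (by simp)
  have hdχ (l : Fin m) : Continuous fun y => fderiv ℝ χ y (EuclideanSpace.single l 1) :=
    (hχ.continuous_fderiv (by simp)).clm_apply continuous_const
  have hdχs (l : Fin m) : HasCompactSupport fun y => fderiv ℝ χ y (EuclideanSpace.single l 1) :=
    hχs.fderiv_apply ℝ _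
  have hu (i) := N.memLp_cutCoord_closure hvol hK hχΩ hf (s + 1) i
  have hv (j) : MemLp (fun y => -N.cutCoord K' D t ψ j y) q volume :=
    (N.memLp_coord hvol hK' hK'Ω hDo hψ (filCoord n t j)).neg
  have hw (i : FilIdx m (r + (s + 1)) n (s + 1)) :=
    N.memLp_cutWedge (by omega) hvol hK' hK'Ω hDo hφ (filBasis n (s + 1) i)
  have main := green_of_doubled_equations (p := p) hqt hu hw hv (hχ.of_le (by simp)) hχs
    (hρ.of_le (by simp)) hρs hρ1
    (b := fun i j l => N.opCoef η (filBasis n (s + 1) i) (filBasis n t j) l)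
    (fun i j l => (N.contDiff_opCoef hη hηΩ _ _ _).of_le (by simp))
    (fun i j l => N.hasCompactSupport_opCoef hηs _ _ _) ?_ ?_ ?_
  rotate_left
  -- the divergence of the coefficients near the support of `χ`
  · intro i j x hx
    have hxK : x ∈ K' := hKK (subset_tsupport _ hx)
    have h1 (l) : N.opCoef η (filBasis n (s + 1) i) (filBasis n t j) l =ᶠ[𝓝 x]
        fun y => wedgeEval (N.frame (filBasis (m := m) (d := r + (s + 1)) n (s + 1) i) y)
          (dxWedge (r' + t) l (N.frame (filBasis n t j) y)) (fun i => stdFrame m i) := by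
      filter_upwards [hη1.filter_mono (nhds_le_nhdsSet hxK)] with y hy
      simp [opCoef, hy]
    simp only [(h1 _).fderiv_eq]
    exact N.divergence_eq_zero _ _ (hK'Ω hxK)
  -- the equation for `f`, tested with `χ(x) ρ((y - x) / ε)` as a function of `x`
  · refine Eventually.of_forall fun ε j y => ?_
    have hρy : ContDiff ℝ ∞ fun z => ρ (ε⁻¹ • (y - z)) :=
      hρ.comp (by fun_prop)
    have h1 := N.sum_closed_eq_zero (q := q) hvol hr hst hm hf hfb hfD hf0 (filBasis_mem n t j) hK hχΩ
      hη hηs hηΩ (fun y hy => hη1' y (hKK hy)) (hχ.mul hρy) (tsupport_mul_subset_left)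
    refine Eq.trans ?_ h1
    refine Finset.sum_congr rfl fun i _ => Finset.sum_congr rfl fun l _ =>
      integral_congr_ae (Eventually.of_forall fun x => ?_)
    have h2 : fderiv ℝ (fun z => χ z * ρ (ε⁻¹ • (y - z))) x (EuclideanSpace.single l 1) =
        χ x * -((ε⁻¹ : ℝ) * fderiv ℝ ρ (ε⁻¹ • (y - x)) (EuclideanSpace.single l 1)) +
          ρ (ε⁻¹ • (y - x)) * fderiv ℝ χ x (EuclideanSpace.single l 1) := by
      rw [fderiv_fun_mul (hχ.differentiable (by simp) x) (hρy.differentiable (by simp) x)]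
      simp [fderiv_shift_neg hρd]
    simp only [h2]
    ring
  -- the equation for `ψ`, tested with `ρ((y - x) / ε)` as a function of `y`: its support lies
  -- in `D` by the cone property, since `x` is in the closure of `D` and `(y - x) / ε` near `v`
  · obtain ⟨η₀, hη₀, hthick⟩ := hK.exists_thickening_subset_open isOpen_interior hKK'
    have hlim : Tendsto (fun ε : ℝ => ε * (‖N.v‖ + N.δ)) (𝓝[>] 0) (𝓝 0) := by
      have : Tendsto (fun ε : ℝ => ε * (‖N.v‖ + N.δ)) (𝓝 0) (𝓝 (0 * (‖N.v‖ + N.δ))) :=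
        tendsto_id.mul_const _
      rw [zero_mul] at this
      exact this.mono_left nhdsWithin_le_nhds
    filter_upwards [self_mem_nhdsWithin, hlim.eventually (gt_mem_nhds hη₀)] with ε hε hεη i x hx
    have hε : (0 : ℝ) < ε := hε
    have hxS : x ∈ tsupport χ ∩ (chart m x₀).symm ⁻¹' closure D := by
      by_contra hcon
      exact hx (indicator_of_notMem hcon _)
    have hρx : ContDiff ℝ ∞ fun z => ρ (ε⁻¹ • (z - x)) :=
      hρ.comp (by fun_prop)
    have hsub : ∀ y ∈ tsupport (fun z => ρ (ε⁻¹ • (z - x))),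
        ∃ v' ∈ Metric.ball N.v N.δ, y = x + ε • v' := by
      intro y hy
      have h1 : ε⁻¹ • (y - x) ∈ tsupport ρ := by
        have hcl : IsClosed {y : EM m | ε⁻¹ • (y - x) ∈ tsupport ρ} :=
          (isClosed_tsupport ρ).preimage (by fun_prop)
        exact closure_minimal (t := {y : EM m | ε⁻¹ • (y - x) ∈ tsupport ρ})
          (fun z hz => subset_tsupport ρ hz) hcl hy
      refine ⟨_, hρv h1, ?_⟩
      rw [smul_inv_smul₀ hε.ne']
      abel
    have hK'' : tsupport (fun z => ρ (ε⁻¹ • (z - x))) ⊆ K' := by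
      intro y hy
      obtain ⟨v', hv', rfl⟩ := hsub y hy
      refine interior_subset (hthick (Metric.mem_thickening_iff.2 ⟨x, hxS.1, ?_⟩))
      rw [dist_eq_norm, add_sub_cancel_left, norm_smul, Real.norm_of_nonneg hε.le]
      refine lt_of_le_of_lt (mul_le_mul_of_nonneg_left ?_ hε.le) hεη
      rw [Metric.mem_ball, dist_eq_norm] at hv'
      calc ‖v'‖ = ‖N.v + (v' - N.v)‖ := by rw [add_sub_cancel]
        _ ≤ ‖N.v‖ + ‖v' - N.v‖ := norm_add_le _ _
        _ ≤ ‖N.v‖ + N.δ := by linarith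
    have h1 := N.integral_cutWedge_eq (p := p) hvol hDo hr hst hm hψ hψb hψφ
      (filBasis_mem (d := r + (s + 1)) n (s + 1) i) hK' hK'Ω hη hηs hηΩ hη1' hρx hK'' fun y hy => by
        obtain ⟨v', hv', rfl⟩ := hsub y hy
        exact N.cone x (hχΩ hxS.1) hxS.2 ε hε v' hv' (hK'Ω (hK'' hy))
    simpa only [fderiv_shift hρd] using h1
  -- both sides of the doubled formula are written in the coefficients
  · refine Eq.trans (Eq.trans (setIntegral_eq_sum N.isOpen.measurableSet (fun i => ?_) ?_) main) ?_
    · exact (MemLp.integrable_mul (hu i) (memLp_mul_continuous (hw i) hχ.continuous hχs)).congr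
        (Eventually.of_forall fun y => (mul_assoc _ _ _).symm)
    · filter_upwards [N.ae_mem_Ω hvol hfb] with y hy
      by_cases hyK : y ∈ tsupport χ
      · rw [indicator_of_mem (hχΩ hyK)]
        by_cases hyD : y ∈ (chart m x₀).symm ⁻¹' D
        · have hyD' : y ∈ (chart m x₀).symm ⁻¹' closure D := subset_closure hyD
          have hyD'' : (chart m x₀).symm y ∈ D := hyD
          simp only [cutCoord, cutWedge, indicator_of_mem (mem_inter (hKK hyK) hyD),
            indicator_of_mem (mem_inter hyK hyD'), indicator_of_mem hyD'', Pi.one_apply, one_mul]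
          rw [N.inChart_eq_sum (hχΩ hyK) (hy (hχΩ hyK)), wedgeEval_sum, Finset.mul_sum]
          refine Finset.sum_congr rfl fun i _ => ?_
          rw [wedgeEval_smul]
          ring
        · have hyD'' : (chart m x₀).symm y ∉ D := hyD
          simp only [cutWedge, indicator_of_notMem (fun h => hyD (mem_of_mem_inter_right h)),
            indicator_of_notMem hyD'', zero_mul, mul_zero, Finset.sum_const_zero]
      · classical rw [indicator_apply]
        simp only [image_eq_zero_of_notMem_tsupport hyK, zero_mul, mul_zero,
          Finset.sum_const_zero, ite_self]
    · rw [← integral_neg]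
      simp only [← Fintype.sum_prod_type']
      refine (setIntegral_eq_sum N.isOpen.measurableSet (fun j => ?_) ?_).symm
      · have h3 : Continuous fun y => N.opCoef η (filBasis n (s + 1) j.1) (filBasis n t j.2.1) j.2.2 y *
            fderiv ℝ χ y (EuclideanSpace.single j.2.2 1) :=
          (N.contDiff_opCoef hη hηΩ _ _ _).continuous.mul (hdχ _)
        exact (MemLp.integrable_mul (hu j.1) (memLp_mul_continuous (hv j.2.1) h3
          (hdχs _).mul_left)).congr (Eventually.of_forall fun y => (mul_assoc _ _ _).symm)
      · filter_upwards [N.ae_mem_Ω hvol hfb,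
          N.ae_mem_Ω hvol ((ae_restrict_iff' hDo.measurableSet).1 hψb)] with y hy hyψ
        simp only [Fintype.sum_prod_type]
        by_cases hyK : y ∈ tsupport χ
        · rw [indicator_of_mem (hχΩ hyK)]
          by_cases hyD : y ∈ (chart m x₀).symm ⁻¹' D
          · have hyD' : y ∈ (chart m x₀).symm ⁻¹' closure D := subset_closure hyD
            have hyD'' : (chart m x₀).symm y ∈ D := hyD
            simp only [cutCoord, indicator_of_mem (mem_inter (hKK hyK) hyD), opCoef,
              hη1' y (hKK hyK), Complex.ofReal_one, one_mul,
              indicator_of_mem (mem_inter hyK hyD'), indicator_of_mem hyD'', Pi.one_apply]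
            have h4 (l : Fin m) : wedgeEval (inChart f x₀ y) (dxWedge (r' + t) l (inChart ψ x₀ y))
                (fun i => stdFrame m i) = ∑ i, ∑ j, filCoord n (s + 1) i (N.coord f y) *
                  (filCoord n t j (N.coord ψ y) * wedgeEval (N.frame (filBasis n (s + 1) i) y)
                    (dxWedge (r' + t) l (N.frame (filBasis n t j) y)) (fun i => stdFrame m i)) := by
              rw [N.inChart_eq_sum (hχΩ hyK) (hy (hχΩ hyK)), wedgeEval_sum]
              refine Finset.sum_congr rfl fun i _ => ?_
              rw [wedgeEval_smul, N.inChart_eq_sum (hχΩ hyK) (hyψ (hχΩ hyK) hyD'')]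
              rw [_root_.map_sum, ← Finset.mul_sum]
              congr 1
              refine (wedgeEval_sum_right _ _ _ _).trans (Finset.sum_congr rfl fun j _ => ?_)
              rw [dxWedge_smul, wedgeEval_smul_right]
            simp only [h4, Finset.mul_sum]
            rw [Finset.sum_comm, ← Finset.sum_neg_distrib]
            refine Finset.sum_congr rfl fun i _ => ?_
            rw [Finset.sum_comm, ← Finset.sum_neg_distrib]
            refine Finset.sum_congr rfl fun j _ => ?_
            rw [← Finset.sum_neg_distrib]
            refine Finset.sum_congr rfl fun l _ => ?_
            ring
          · have hyD'' : (chart m x₀).symm y ∉ D := hyD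
            simp only [cutCoord, indicator_of_notMem (fun h => hyD (mem_of_mem_inter_right h)),
              indicator_of_notMem hyD'', zero_mul, mul_zero, neg_zero, Finset.sum_const_zero]
        · have hzero : fderiv ℝ χ y = 0 := fderiv_of_notMem_tsupport (𝕜 := ℝ) hyK
          classical rw [indicator_apply]
          simp [hzero]

end LocalModel

end LocalGreen

section Global

variable {n m k a b d : ℕ} {X : Type*} [TopologicalSpace X] [ChartedSpace (EX n) X]
  {M : Type*} [TopologicalSpace M] [ChartedSpace (EM m) M]
  [IsManifold 𝓘(ℝ, EM m) ∞ M] [T2Space M]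

/-! ### Partitions of unity -/

/-- A finite smooth partition of unity near a compact set, with compact supports. -/
lemma exists_partition [SigmaCompactSpace M] {K : Set M} (hK : IsCompact K) {U : M → Set M}
    (hU : ∀ x, IsOpen (U x) ∧ x ∈ U x) :
    ∃ (J : Finset M) (χ : J → M → ℝ), (∀ i, ContMDiff 𝓘(ℝ, EM m) 𝓘(ℝ, ℝ) ∞ (χ i) ∧
      HasCompactSupport (χ i) ∧ tsupport (χ i) ⊆ U i) ∧ ∀ x ∈ K, ∑ i, χ i x = 1 := by
  have : LocallyCompactSpace M := ChartedSpace.locallyCompactSpace (EM m) M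
  choose C hC hxC hCU using fun x => exists_compact_subset (hU x).1 (hU x).2
  obtain ⟨J, hJ⟩ := hK.elim_finite_subcover (fun x => interior (C x)) (fun x => isOpen_interior)
    fun x _ => mem_iUnion.2 ⟨x, hxC x⟩
  obtain ⟨f, hf⟩ := SmoothPartitionOfUnity.exists_isSubordinate 𝓘(ℝ, EM m) hK.isClosed
    (fun i : J => interior (C i)) (fun i => isOpen_interior) (hJ.trans (by
      intro x hx
      obtain ⟨i, hi, hx⟩ := mem_iUnion₂.1 hx
      exact mem_iUnion.2 ⟨⟨i, hi⟩, hx⟩))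
  have hsub (i : J) : tsupport (f i) ⊆ C i := (hf i).trans interior_subset
  refine ⟨J, fun i => f i, fun i => ⟨(f i).contMDiff,
    (hC i).of_isClosed_subset (isClosed_tsupport _) (hsub i), (hsub i).trans (hCU i)⟩,
    fun x hx => ?_⟩
  rw [← finsum_eq_sum_of_fintype]
  exact f.sum_eq_one hx

/-! ### The wedge product with the differential of a function -/

/-- The differential of a function. -/
def dfun (χ : M → ℝ) (x : M) : EM m →L[ℝ] ℝ := mfderiv 𝓘(ℝ, EM m) 𝓘(ℝ, ℝ) χ x

/-- The form `dχ ∧ ψ`. -/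
def dWedge (χ : M → ℝ) (ψ : DForm (m := m) M b ℂ) : DForm (m := m) M (b + 1) ℂ := fun x =>
  ContinuousAlternatingMap.alternatizeUncurryFin
    ((dfun χ x).smulRight (ψ x))

open ContinuousAlternatingMap in
lemma dWedge_apply (χ : M → ℝ) (ψ : DForm (m := m) M b ℂ) (x : M) (v : Fin (b + 1) → EM m) :
    dWedge χ ψ x v = ∑ i : Fin (b + 1), (-1) ^ (i : ℕ) *
      ((dfun χ x (v i) : ℂ) * ψ x (i.removeNth v)) := by
  simp [dWedge, alternatizeUncurryFin_apply]

lemma fderiv_comp_symm {χ : M → ℝ} (hχ : ContMDiff 𝓘(ℝ, EM m) 𝓘(ℝ, ℝ) ∞ χ) {x₀ : M} {y : EM m}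
    (hy : y ∈ (chart m x₀).target) : fderiv ℝ (fun z => χ ((chart m x₀).symm z)) y =
      dfun χ ((chart m x₀).symm y) ∘L dsymm x₀ y := by
  rw [← mfderiv_eq_fderiv]
  exact mfderiv_comp (I := 𝓘(ℝ, EM m)) (I' := 𝓘(ℝ, EM m)) (I'' := 𝓘(ℝ, ℝ)) y
    (hχ.mdifferentiable (by simp) _) (mdifferentiableAt_symm hy)

lemma contDiffAt_comp_symm {χ : M → ℝ} (hχ : ContMDiff 𝓘(ℝ, EM m) 𝓘(ℝ, ℝ) ∞ χ) {x₀ : M} {y : EM m}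
    (hy : y ∈ (chart m x₀).target) : ContDiffAt ℝ ∞ (fun z => χ ((chart m x₀).symm z)) y :=
  (ContMDiffAt.comp y hχ.contMDiffAt (contMDiffAt_symm hy)).contDiffAt

open ContinuousAlternatingMap in
/-- The form `dχ ∧ ψ` in a chart; this is the term of the local Green formula in which the
derivative falls on the cutoff. -/
lemma inChart_dWedge {χ : M → ℝ} (hχ : ContMDiff 𝓘(ℝ, EM m) 𝓘(ℝ, ℝ) ∞ χ)
    (ψ : DForm (m := m) M b ℂ) {x₀ : M} {y : EM m} (hy : y ∈ (chart m x₀).target) :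
    inChart (dWedge χ ψ) x₀ y = ∑ l, (fderiv ℝ (fun z => χ ((chart m x₀).symm z)) y
      (EuclideanSpace.single l 1) : ℂ) • dxWedge b l (inChart ψ x₀ y) := by
  have h1 : inChart (dWedge χ ψ) x₀ y = alternatizeUncurryFin
      ((fderiv ℝ (fun z => χ ((chart m x₀).symm z)) y).smulRight (inChart ψ x₀ y)) := by
    rw [fderiv_comp_symm hχ hy]
    ext v
    rw [inChart_eq, compContinuousLinearMap_apply, dWedge_apply, alternatizeUncurryFin_apply]
    refine Finset.sum_congr rfl fun i _ => ?_
    rw [ContinuousLinearMap.smulRight_apply, ContinuousAlternatingMap.smul_apply, inChart_eq,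
      compContinuousLinearMap_apply, zsmul_eq_mul, Complex.real_smul]
    push_cast
    rfl
  rw [h1, alternatize_eq_sum_dxWedge]
  refine Finset.sum_congr rfl fun l _ => ?_
  rw [ContinuousLinearMap.smulRight_apply]
  refine (map_smul (dxWedge b l) _ _).trans ?_
  ext v
  simp

/-- For a partition of unity the terms `dχ ∧ ψ` add up to zero. -/
lemma sum_dWedge_eq_zero {J : Type*} [Fintype J] {χ : J → M → ℝ}
    (hχ : ∀ i, ContMDiff 𝓘(ℝ, EM m) 𝓘(ℝ, ℝ) ∞ (χ i)) {D : Set M} (hD : IsOpen D)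
    (h1 : ∀ x ∈ D, ∑ i, χ i x = 1) (ψ : DForm (m := m) M b ℂ) {x : M} (hx : x ∈ D) :
    ∑ i, dWedge (χ i) ψ x = 0 := by
  have h2 : HasMFDerivAt 𝓘(ℝ, EM m) 𝓘(ℝ, ℝ) (fun y => ∑ i, χ i y) x
      (∑ i, dfun (m := m) (χ i) x) := by
    have h (i : J) : HasMFDerivAt 𝓘(ℝ, EM m) 𝓘(ℝ, ℝ) (χ i) x (dfun (m := m) (χ i) x) :=
      ((hχ i).mdifferentiable (by simp) x).hasMFDerivAt
    classical
    have hs (t : Finset J) : HasMFDerivAt 𝓘(ℝ, EM m) 𝓘(ℝ, ℝ) (fun y => ∑ i ∈ t, χ i y) x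
        (∑ i ∈ t, dfun (m := m) (χ i) x) := by
      induction t using Finset.induction_on with
      | empty => exact hasMFDerivAt_const (0 : ℝ) x
      | insert i t hi ih =>
        have h3 : HasMFDerivAt 𝓘(ℝ, EM m) 𝓘(ℝ, ℝ) (fun y => ∑ i ∈ insert i t, χ i y) x
            (dfun (m := m) (χ i) x + ∑ i ∈ t, dfun (m := m) (χ i) x) :=
          ((h i).add ih).congr_of_eventuallyEq (Eventually.of_forall fun y => Finset.sum_insert hi)
        have h4 := Finset.sum_insert (f := fun i => dfun (m := m) (χ i) x) hi
        exact Eq.mpr (congrArg (fun A : EM m →L[ℝ] ℝ => HasMFDerivAt 𝓘(ℝ, EM m) 𝓘(ℝ, ℝ)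
          (fun y => ∑ i ∈ insert i t, χ i y) x A) h4) h3
    exact hs _
  have h3 : HasMFDerivAt 𝓘(ℝ, EM m) 𝓘(ℝ, ℝ) (fun y => ∑ i, χ i y) x (0 : EM m →L[ℝ] ℝ) := by
    refine (hasMFDerivAt_const (1 : ℝ) x).congr_of_eventuallyEq ?_
    filter_upwards [hD.mem_nhds hx] with z hz using h1 z hz
  have h4 : ∑ i, dfun (m := m) (χ i) x = 0 := by
    exact hasMFDerivAt_unique h2 h3
  ext v
  rw [ContinuousAlternatingMap.sum_apply]
  simp only [dWedge_apply]
  rw [Finset.sum_comm]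
  refine Finset.sum_eq_zero fun j _ => ?_
  rw [← Finset.mul_sum, ← Finset.sum_mul]
  have h5 := DFunLike.congr_fun h4 (v j)
  rw [_root_.sum_apply] at h5
  rw [← Complex.ofReal_sum, h5]
  simp

variable [MeasurableSpace M] [BorelSpace M]
  {ι : M → X} {vol : DForm (m := m) M m ℝ} {D : Set M} {x₀ : M}

lemma continuous_mfderiv_apply {χ : M → ℝ} (hχ : ContMDiff 𝓘(ℝ, EM m) 𝓘(ℝ, ℝ) ∞ χ) {V : M → EM m}
    (hV : SmoothField V) :
    Continuous fun x => dfun χ x (V x) := by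
  rw [continuous_iff_continuousAt]
  intro x
  have hy := chart_mem_target (m := m) x
  refine continuousAt_of_symm (mem_source (m := m) x) ?_
  have h1 : ContinuousAt (fun y => fderiv ℝ (fun z => χ ((chart m x).symm z)) y
      (dchart x ((chart m x).symm y) (V ((chart m x).symm y)))) (chart m x x) :=
    ((contDiffAt_comp_symm hχ hy).fderiv_right (m := 0) (by simp)).continuousAt.clm_apply
      (hV.contDiffAt hy).continuousAt
  refine h1.congr ?_
  filter_upwards [(isOpen_target x).mem_nhds hy] with z hz
  rw [fderiv_comp_symm hχ hz, ContinuousLinearMap.comp_apply]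
  have h2 := DFunLike.congr_fun (dsymm_comp_dchart ((chart m x).map_target hz))
    (V ((chart m x).symm z))
  rw [ContinuousLinearMap.comp_apply, (chart m x).right_inv hz] at h2
  exact congrArg _ h2

lemma memLp_dWedge {χ : M → ℝ} (hχ : ContMDiff 𝓘(ℝ, EM m) 𝓘(ℝ, ℝ) ∞ χ) {U : Set M}
    (hU : IsCompact (closure U)) {p : ℝ≥0∞} {ψ : DForm (m := m) M b ℂ}
    (hψ : ∀ V : Fin b → M → EM m, (∀ i, SmoothField (V i)) →
      MemLp (fun x => ψ x (fun i => V i x)) p ((volMeasure vol).restrict U))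
    (V : Fin (b + 1) → M → EM m) (hV : ∀ i, SmoothField (V i)) :
    MemLp (fun x => dWedge χ ψ x (fun i => V i x)) p ((volMeasure vol).restrict U) := by
  simp only [dWedge_apply]
  refine memLp_finsetSum _ fun i _ => MemLp.const_mul ?_ _
  refine MemLp.mul' (p := ⊤) (q := p) (hψ _ fun j => hV (i.succAbove j)) ?_
  exact (memLp_top_of_continuousOn (μ := volMeasure vol) hU (Complex.continuous_ofReal.comp
    (continuous_mfderiv_apply hχ (hV i))).continuousOn).mono_measure
      (Measure.restrict_mono_set _ subset_closure)

/-! ### Integrability -/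

/-- The wedge product of two forms in terms of their coefficients in a frame. -/
lemma IsFrameOn.wedgeDensity_eq (h : a + b = m) {A : Set M} {L : M → EM m →L[ℝ] EX m}
    (hF : IsFrameOn n ι vol A L) (α : DForm (m := m) M a ℂ) (β : DForm (m := m) M b ℂ) {x : M}
    (hx : x ∈ A) : wedgeDensity vol α β x =
      frameDens vol L x * wedgeStd (frameCoord L α x) (frameCoord L β x) := by
  have hZ := (inverse_cext (hF.det_ne_zero x hx)).1
  have h1 : α x = pull (L x) (frameCoord L α x) := (pull_tri hZ _).symm
  have h2 : β x = pull (L x) (frameCoord L β x) := (pull_tri hZ _).symm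
  rw [wedgeDensity, frameDens]
  conv_lhs => rw [h1, h2, wedgeEval_pull h]
  ring

/-- Forms from which a form is recovered by its coefficients, see `sum_monoForm`. -/
def monoForm (m d : ℕ) (σ : Fin d → Fin m) : CForm m d := coeffsInv m d (Pi.single σ 1)

lemma sum_monoForm (θ : CForm m d) :
    ∑ σ : Fin d → Fin m, θ (fun j => stdC m (σ j)) • monoForm m d σ = θ := by
  conv_rhs => rw [← coeffsInv_coeffs θ, pi_eq_sum_univ' (fun σ : Fin d → Fin m =>
    θ fun j => stdC m (σ j))]
  rw [_root_.map_sum]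
  exact Finset.sum_congr rfl fun σ _ => (map_smul _ _ _).symm

lemma wedgeStd_eq_sum (α : CForm m a) (β : CForm m b) : wedgeStd α β =
    ∑ σ : Fin a → Fin m, ∑ τ : Fin b → Fin m, α (fun j => stdC m (σ j)) *
      (β (fun j => stdC m (τ j)) * wedgeStd (monoForm m a σ) (monoForm m b τ)) := by
  have h1 : ∀ (J : Finset (Fin a → Fin m)) (c : (Fin a → Fin m) → ℂ) (θ : (Fin a → Fin m) → CForm m a)
      (β : CForm m b), wedgeStd (∑ σ ∈ J, c σ • θ σ) β = ∑ σ ∈ J, c σ * wedgeStd (θ σ) β := by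
    intro J c θ β
    let f : CForm m a →ₗ[ℂ] ℂ :=
      { toFun := fun θ => wedgeStd θ β
        map_add' := fun θ θ' => wedgeEval_add (realForm θ) (realForm θ') (realForm β) _
        map_smul' := fun c θ => wedgeEval_smul (realForm θ) (realForm β) _ c }
    exact (_root_.map_sum f _ _).trans (Finset.sum_congr rfl fun σ _ => map_smul f _ _)
  conv_lhs => rw [← sum_monoForm α, h1]
  refine Finset.sum_congr rfl fun σ _ => ?_
  rw [← Finset.mul_sum]
  congr 1
  conv_lhs => rw [← sum_monoForm β]
  exact (_root_.map_sum (wedgeStdHom (monoForm m a σ)) _ _).trans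
    (Finset.sum_congr rfl fun τ _ => map_smul (wedgeStdHom (monoForm m a σ)) _ _)

/-- Hölder's inequality for forms. -/
lemma IsFrameOn.integrableOn (h : a + b = m) {A U : Set M} (hU : MeasurableSet U) (hUA : U ⊆ A)
    {L : M → EM m →L[ℝ] EX m} (hF : IsFrameOn n ι vol A L) {p q : ℝ≥0∞} [p.HolderConjugate q]
    {α : DForm (m := m) M a ℂ} {β : DForm (m := m) M b ℂ}
    (hα : ∀ V : Fin a → M → EM m, (∀ i, SmoothField (V i)) →
      MemLp (fun x => α x (fun i => V i x)) p ((volMeasure vol).restrict U))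
    (hβ : ∀ V : Fin b → M → EM m, (∀ i, SmoothField (V i)) →
      MemLp (fun x => β x (fun i => V i x)) q ((volMeasure vol).restrict U)) :
    IntegrableOn (wedgeDensity vol α β) U (volMeasure vol) := by
  have hAU : A ∩ U = U := inter_eq_self_of_subset_right hUA
  have h1 := hF.memLp_coord p U hU a α hα
  have h2 := hF.memLp_coord q U hU b β hβ
  rw [hAU] at h1 h2
  have h3 : Integrable (fun x => wedgeStd (frameCoord L α x) (frameCoord L β x))
      ((volMeasure vol).restrict U) := by
    rw [funext fun x => wedgeStd_eq_sum (frameCoord L α x) (frameCoord L β x)]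
    refine integrable_finsetSum _ fun σ _ => integrable_finsetSum _ fun τ _ => ?_
    exact MemLp.integrable_mul (h1 σ) ((h2 τ).mul_const _)
  have h4 : MemLp (fun x => frameDens vol L x * wedgeStd (frameCoord L α x) (frameCoord L β x)) 1
      ((volMeasure vol).restrict U) :=
    MemLp.mul' (p := ⊤) (q := 1) (memLp_one_iff_integrable.2 h3)
      (hF.memLp_dens.mono_measure (Measure.restrict_mono_set _ hUA))
  refine (memLp_one_iff_integrable.1 h4).congr ?_
  filter_upwards [ae_restrict_mem hU] with x hx
  exact (hF.wedgeDensity_eq h α β (hUA hx)).symm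

/-! ### The global Green formula -/

namespace LocalModel

variable (N : LocalModel n ι vol D x₀)

/-- The domain of a local model, as a subset of the manifold. -/
def dom : Set M := (chart m x₀).source ∩ chart m x₀ ⁻¹' N.Ω

lemma isOpen_dom : IsOpen N.dom :=
  ContinuousOn.isOpen_inter_preimage (fun _ hx => (continuousAt_chart hx).continuousWithinAt)
    (isOpen_source x₀) N.isOpen

lemma mem_dom : x₀ ∈ N.dom := ⟨mem_source x₀, N.mem⟩

lemma notMem_dom {x : M} (hx : x ∉ (chart m x₀).symm '' N.Ω) : x ∉ N.dom := fun h =>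
  hx ⟨_, h.2, (chart m x₀).left_inv h.1⟩

lemma isCompact_chart_image {C : Set M} (hC : IsCompact C) (h : C ⊆ N.dom) :
    IsCompact (chart m x₀ '' C) ∧ chart m x₀ '' C ⊆ N.Ω :=
  ⟨hC.image_of_continuousOn fun _ hx => (continuousAt_chart (h hx).1).continuousWithinAt,
    image_subset_iff.2 fun _ hx => (h hx).2⟩

/-- A function with compact support in the domain of the local model, in the chart. -/
lemma exists_inChart_function {χ : M → ℝ} (hχ : ContMDiff 𝓘(ℝ, EM m) 𝓘(ℝ, ℝ) ∞ χ)
    (hs : HasCompactSupport χ) (hsN : tsupport χ ⊆ N.dom) :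
    ∃ c : EM m → ℂ, ContDiff ℝ ∞ c ∧ HasCompactSupport c ∧ tsupport c ⊆ N.Ω ∧
      ∀ y ∈ N.Ω, c y = χ ((chart m x₀).symm y) ∧ ∀ e, fderiv ℝ c y e =
        fderiv ℝ (fun z => χ ((chart m x₀).symm z)) y e := by
  classical
  obtain ⟨hC, hCΩ⟩ := N.isCompact_chart_image hs hsN
  let c : EM m → ℂ := fun y => if y ∈ N.Ω then (χ ((chart m x₀).symm y) : ℂ) else 0
  have hsub : tsupport c ⊆ chart m x₀ '' tsupport χ := by
    refine closure_minimal (fun y hy => ?_) hC.isClosed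
    have hyΩ : y ∈ N.Ω := by
      by_contra hcon
      exact hy (if_neg hcon)
    refine ⟨(chart m x₀).symm y, subset_tsupport _ fun h => hy ?_,
      (chart m x₀).right_inv (N.subset hyΩ)⟩
    simp [c, h]
  have he : ∀ y ∈ N.Ω, c =ᶠ[𝓝 y] fun z => (χ ((chart m x₀).symm z) : ℂ) := by
    intro y hy
    filter_upwards [N.isOpen.mem_nhds hy] with z hz using if_pos hz
  refine ⟨c, contDiff_of_tsupport fun y hy => ?_, hC.of_isClosed_subset (isClosed_tsupport _) hsub,
    hsub.trans hCΩ, fun y hy => ⟨if_pos hy, fun e => ?_⟩⟩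
  · have hyΩ := hCΩ (hsub hy)
    exact (Complex.ofRealCLM.contDiff.contDiffAt.comp y
      (contDiffAt_comp_symm hχ (N.subset hyΩ))).congr_of_eventuallyEq (he y hyΩ)
  · rw [(he y hy).fderiv_eq]
    have h1 := ((contDiffAt_comp_symm hχ (N.subset hy)).differentiableAt
      (by simp)).hasFDerivAt
    exact DFunLike.congr_fun (Complex.ofRealCLM.hasFDerivAt.comp y h1).fderiv e

end LocalModel

section Cutoff

variable {p q : ℝ≥0∞} [hpq : p.HolderConjugate q]

/-- The Green formula for a form with a cutoff function. -/
lemma green_cutoff (hqt : q ≠ ⊤) (hvol : IsVolumeForm vol)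
    (N : LocalModel n ι vol D x₀)
    (hDo : IsOpen D) {r s r' t : ℕ} (hr : r + r' = n) (hst : s + 1 + t + 1 + k = n)
    (hm : m + k = 2 * n)
    {f : DForm (m := m) M (r + (s + 1)) ℂ} {ψ : DForm (m := m) M (r' + t) ℂ}
    {φ : DForm (m := m) M (r' + (t + 1)) ℂ}
    (hf : ∀ V : Fin (r + (s + 1)) → M → EM m, (∀ i, SmoothField (V i)) →
      MemLp (fun x => f x (fun i => V i x)) p (volMeasure vol))
    (hfb : ∀ᵐ x ∂volMeasure vol, f x ∈ bidegree (n := n) ι x r (s + 1))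
    (hfD : ∀ᵐ x ∂volMeasure vol, x ∉ closure D → f x = 0)
    (hψ : ∀ V : Fin (r' + t) → M → EM m, (∀ i, SmoothField (V i)) →
      MemLp (fun x => ψ x (fun i => V i x)) q ((volMeasure vol).restrict D))
    (hψb : ∀ᵐ x ∂(volMeasure vol).restrict D, ψ x ∈ bidegree (n := n) ι x r' t)
    (hφ : ∀ V : Fin (r' + (t + 1)) → M → EM m, (∀ i, SmoothField (V i)) →
      MemLp (fun x => φ x (fun i => V i x)) q ((volMeasure vol).restrict D))
    (hf0 : WeakDbar (n := n) k ι vol univ f 0) (hψφ : WeakDbar (n := n) k ι vol D ψ φ)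
    {χ : M → ℝ} (hχ : ContMDiff 𝓘(ℝ, EM m) 𝓘(ℝ, ℝ) ∞ χ)
    (hs : HasCompactSupport χ) (hsN : tsupport χ ⊆ N.dom) :
    ∫ x in D, χ x * wedgeDensity vol f φ x ∂volMeasure vol =
      -∫ x in D, wedgeDensity vol f (dWedge χ ψ) x ∂volMeasure vol := by
  obtain ⟨c, hc, hcs, hcΩ, hcy⟩ := N.exists_inChart_function hχ hs hsN
  have h1 := N.green hqt hvol hDo hr hst hm hf hfb hfD hψ hψb hφ hf0 hψφ hc hcs hcΩ
  have hdz : ∀ x ∉ N.dom, dWedge χ ψ x = 0 := by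
    intro x hx
    have hx' : x ∉ tsupport χ := fun h => hx (hsN h)
    have h2 : dfun (m := m) χ x = 0 := by
      have h3 : HasMFDerivAt 𝓘(ℝ, EM m) 𝓘(ℝ, ℝ) χ x (0 : EM m →L[ℝ] ℝ) :=
        (hasMFDerivAt_const (0 : ℝ) x).congr_of_eventuallyEq
          (notMem_tsupport_iff_eventuallyEq.1 hx')
      exact h3.mfderiv
    ext v
    rw [dWedge_apply]
    refine Finset.sum_eq_zero fun i _ => ?_
    rw [h2]
    simp
  have e1 := N.integral_wedgeDensity (by omega) hvol f φ (fun x => D.indicator 1 x * χ x)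
    fun x hx => by
      rw [image_eq_zero_of_notMem_tsupport fun h => N.notMem_dom hx (hsN h)]
      simp
  have e2 := N.integral_wedgeDensity (b := r' + t + 1) (by omega) hvol f (dWedge χ ψ)
    (fun x => D.indicator 1 x)
    fun x hx => by rw [wedgeDensity, hdz x (N.notMem_dom hx), wedgeEval_zero_right]; simp
  have e3 (g : M → ℂ) : ∫ x in D, g x ∂volMeasure vol =
      ∫ x, D.indicator 1 x * g x ∂volMeasure vol := by
    rw [← integral_indicator hDo.measurableSet]
    refine integral_congr_ae (Eventually.of_forall fun x => ?_)
    by_cases hx : x ∈ D <;> simp [hx]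
  rw [e3, e3, e2]
  simp only [← mul_assoc]
  rw [e1, ← mul_neg]
  congr 1
  refine Eq.trans ?_ (h1.trans (congrArg _ ?_))
  · refine setIntegral_congr_fun N.isOpen.measurableSet fun y hy => ?_
    simp only [(hcy y hy).1]
    ring
  · refine setIntegral_congr_fun N.isOpen.measurableSet fun y hy => ?_
    simp only [(hcy y hy).2]
    rw [inChart_dWedge hχ ψ (N.subset hy)]
    congr 1
    simp only [← wedgeEval_smul_right]
    exact (wedgeEval_sum_right _ _ _ _).symm

variable [IsManifold 𝓘(ℂ, EX n) ω X]

/-- A closed form with support in the closure of `D` is orthogonal to the exact forms on `D`. -/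
lemma integral_wedge_exact_eq_zero [SigmaCompactSpace M] (hM : IsGenericCR (n := n) (m := m) k ι)
    (hvol : IsVolumeForm vol) (hD : IsSmoothDomain (m := m) D) (hqt : q ≠ ⊤)
    {r s r' t : ℕ} (hr : r + r' = n) (hst : s + 1 + t + 1 + k = n)
    {f : DForm (m := m) M (r + (s + 1)) ℂ} {ψ : DForm (m := m) M (r' + t) ℂ}
    {φ : DForm (m := m) M (r' + (t + 1)) ℂ}
    (hf : ∀ V : Fin (r + (s + 1)) → M → EM m, (∀ i, SmoothField (V i)) →
      MemLp (fun x => f x (fun i => V i x)) p (volMeasure vol))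
    (hfb : ∀ᵐ x ∂volMeasure vol, f x ∈ bidegree (n := n) ι x r (s + 1))
    (hfD : ∀ᵐ x ∂volMeasure vol, x ∉ closure D → f x = 0)
    (hψ : ∀ V : Fin (r' + t) → M → EM m, (∀ i, SmoothField (V i)) →
      MemLp (fun x => ψ x (fun i => V i x)) q ((volMeasure vol).restrict D))
    (hψb : ∀ᵐ x ∂(volMeasure vol).restrict D, ψ x ∈ bidegree (n := n) ι x r' t)
    (hφ : ∀ V : Fin (r' + (t + 1)) → M → EM m, (∀ i, SmoothField (V i)) →
      MemLp (fun x => φ x (fun i => V i x)) q ((volMeasure vol).restrict D))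
    (hf0 : WeakDbar (n := n) k ι vol univ f 0) (hψφ : WeakDbar (n := n) k ι vol D ψ φ) :
    ∫ x in D, wedgeDensity vol f φ x ∂volMeasure vol = 0 := by
  have hm := hM.codim
  have hDo := hD.isOpen
  have N := fun x => exists_localModel hM hvol hD x
  obtain ⟨J, χ, hχ, hχ1⟩ := exists_partition (m := m) hD.isCompact_closure (U := fun x => (N x).some.dom)
    fun x => ⟨(N x).some.isOpen_dom, (N x).some.mem_dom⟩
  obtain ⟨A, L, hA, hF⟩ := exists_isFrameOn hM hvol hD hD.isCompact_closure
  have hDA : D ⊆ A := subset_closure.trans hA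
  have hfr : ∀ V : Fin (r + (s + 1)) → M → EM m, (∀ i, SmoothField (V i)) →
      MemLp (fun x => f x (fun i => V i x)) p ((volMeasure vol).restrict D) :=
    fun V hV => (hf V hV).restrict D
  have i1 := hF.integrableOn (by omega) hDo.measurableSet hDA hfr hφ
  have i2 (i) := hF.integrableOn (b := r' + t + 1) (by omega) hDo.measurableSet hDA hfr
    (memLp_dWedge (hχ i).1 hD.isCompact_closure hψ)
  have h1 (i : J) := green_cutoff hqt hvol (N i).some hDo hr hst hm hf hfb hfD hψ hψb hφ hf0 hψφ
    (hχ i).1 (hχ i).2.1 (hχ i).2.2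
  have i3 (i) : IntegrableOn (fun x => (χ i x : ℂ) * wedgeDensity vol f φ x) D (volMeasure vol) := by
    have h2 : MemLp (fun x => (χ i x : ℂ)) ⊤ ((volMeasure vol).restrict D) :=
      (memLp_top_of_continuousOn (μ := volMeasure vol) hD.isCompact_closure
        (Complex.continuous_ofReal.comp (hχ i).1.continuous).continuousOn).mono_measure
          (Measure.restrict_mono_set _ subset_closure)
    exact memLp_one_iff_integrable.1 (MemLp.mul' (p := ⊤) (q := 1) (memLp_one_iff_integrable.2 i1) h2)
  calc ∫ x in D, wedgeDensity vol f φ x ∂volMeasure vol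
      = ∫ x in D, ∑ i, (χ i x : ℂ) * wedgeDensity vol f φ x ∂volMeasure vol := by
        refine setIntegral_congr_fun hDo.measurableSet fun x hx => ?_
        rw [← Finset.sum_mul, ← Complex.ofReal_sum, hχ1 x (subset_closure hx), Complex.ofReal_one,
          one_mul]
    _ = ∑ i, ∫ x in D, (χ i x : ℂ) * wedgeDensity vol f φ x ∂volMeasure vol :=
        integral_finsetSum _ fun i _ => i3 i
    _ = -∫ x in D, ∑ i, wedgeDensity vol f (dWedge (χ i) ψ) x ∂volMeasure vol := by
        rw [integral_finsetSum _ fun i _ => i2 i, ← Finset.sum_neg_distrib]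
        exact Finset.sum_congr rfl fun i _ => h1 i
    _ = 0 := by
        rw [neg_eq_zero]
        refine setIntegral_eq_zero_of_forall_eq_zero fun x hx => ?_
        simp only [wedgeDensity]
        rw [← Finset.sum_div, ← wedgeEval_sum_right, sum_dWedge_eq_zero (fun i => (hχ i).1) hDo
          (fun x hx => hχ1 x (subset_closure hx)) ψ hx, wedgeEval_zero_right, zero_div]

end Cutoff

end Global

section Stokes

variable {n m k a b d : ℕ} {X : Type*} [TopologicalSpace X] [ChartedSpace (EX n) X]
  {M : Type*} [TopologicalSpace M] [ChartedSpace (EM m) M]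
  [IsManifold 𝓘(ℝ, EM m) ∞ M] [T2Space M] [MeasurableSpace M] [BorelSpace M]
  {ι : M → X} {vol : DForm (m := m) M m ℝ} {D : Set M} {x₀ : M}

/-! ### Stokes' theorem -/

lemma continuous_wedgeDensity (h : a + b = m) (hvol : IsVolumeForm vol) {α : DForm (m := m) M a ℂ}
    {β : DForm (m := m) M b ℂ} (hα : SmoothForm α) (hβ : SmoothForm β) :
    Continuous (wedgeDensity vol α β) := by
  rw [continuous_iff_continuousAt]
  intro x
  have hy := chart_mem_target (m := m) x
  refine continuousAt_of_symm (mem_source (m := m) x) ?_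
  have h1 : ContinuousAt (fun y => wedgeEval (inChart α x y) (inChart β x y)
      (fun i => stdFrame m i) / ((inChart vol x y (fr m) : ℝ) : ℂ)) (chart m x x) := by
    refine (contDiffAt_wedge (hα.contDiffAt hy) (hβ.contDiffAt hy) _).continuousAt.div ?_ ?_
    · exact Complex.continuous_ofReal.continuousAt.comp
        ((continuousOn_inChart_vol hvol x).continuousAt ((isOpen_target x).mem_nhds hy))
    · exact_mod_cast inChart_vol_ne_zero hvol hy
  refine h1.congr ?_
  filter_upwards [(isOpen_target x).mem_nhds hy] with y hy
  exact (wedgeDensity_symm h hvol hy α β).symm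

lemma wedgeDensity_eq_zero_right {α : DForm (m := m) M a ℂ} {β : DForm (m := m) M b ℂ} {x : M}
    (h : β x = 0) : wedgeDensity vol α β x = 0 := by
  rw [wedgeDensity, h, wedgeEval_zero_right, zero_div]

lemma wedgeIntegrable_of_smooth (h : a + b = m) (hvol : IsVolumeForm vol)
    {α : DForm (m := m) M a ℂ} {β : DForm (m := m) M b ℂ} (hα : SmoothForm α) (hβ : SmoothForm β)
    {U : Set M} (hs : CompactSupportIn β U) : WedgeIntegrable vol α β := by
  have := isLocallyFiniteMeasure_volMeasure (vol := vol) hvol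
  refine (continuous_wedgeDensity h hvol hα hβ).integrable_of_hasCompactSupport ?_
  refine HasCompactSupport.of_support_subset_isCompact hs.1 fun x hx => subset_closure fun h0 => ?_
  exact hx (wedgeDensity_eq_zero_right h0)

/-- Stokes' theorem for a form supported in the domain of a local model. -/
lemma LocalModel.stokes (N : LocalModel n ι vol D x₀) (h : a + (b + 1) = m) (hvol : IsVolumeForm vol)
    {α : DForm (m := m) M a ℂ} {β : DForm (m := m) M b ℂ} (hα : SmoothForm α) (hβ : SmoothForm β)
    (hs : CompactSupportIn β N.dom) :
    wedgeIntegral vol (extD α) β = -((-1) ^ a * wedgeIntegral vol α (extD β)) := by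
  classical
  obtain ⟨hC, hCΩ⟩ := N.isCompact_chart_image hs.1 hs.2
  let c : EM m → EM m [⋀^Fin b]→L[ℝ] ℂ := fun y => if y ∈ N.Ω then inChart β x₀ y else 0
  have hsub : tsupport c ⊆ chart m x₀ '' closure {x | β x ≠ 0} := by
    refine closure_minimal (fun y hy => ?_) hC.isClosed
    have hyΩ : y ∈ N.Ω := by
      by_contra hcon
      exact hy (if_neg hcon)
    refine ⟨(chart m x₀).symm y, subset_closure fun h => hy ?_,
      (chart m x₀).right_inv (N.subset hyΩ)⟩
    exact (if_pos hyΩ).trans (inChart_eq_zero h)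
  have he : ∀ y ∈ N.Ω, c =ᶠ[𝓝 y] inChart β x₀ := by
    intro y hy
    filter_upwards [N.isOpen.mem_nhds hy] with z hz using if_pos hz
  have h1 := integral_wedge_extDeriv (Ω := N.Ω) (α := inChart α x₀) (β := c)
    (fun y hy => hα.contDiffAt (N.subset hy))
    (fun y hy => (hβ.contDiffAt (N.subset hy)).congr_of_eventuallyEq (he y hy))
    (hC.of_isClosed_subset (isClosed_tsupport _) hsub) (hsub.trans hCΩ) (stdFrame m)
  have hz : ∀ x ∉ (chart m x₀).symm '' N.Ω, x ∉ closure {x | β x ≠ 0} :=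
    fun x hx hx' => N.notMem_dom hx (hs.2 hx')
  have e1 := N.integral_wedgeDensity (a := a + 1) (by omega) hvol (extD α) β (fun _ => 1)
    fun x hx => by
      rw [wedgeDensity_eq_zero_right, mul_zero]
      by_contra h0
      exact hz x hx (subset_closure h0)
  have e2 := N.integral_wedgeDensity (by omega) hvol α (extD β) (fun _ => 1)
    fun x hx => by rw [wedgeDensity_eq_zero_right (extD_eq_zero_of_notMem (hz x hx)), mul_zero]
  simp only [one_mul] at e1 e2
  have hoff : ∀ y ∉ N.Ω, y ∉ tsupport c := fun y hy hy' => hy (hCΩ (hsub hy'))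
  rw [wedgeIntegral, wedgeIntegral, e1, e2]
  have e3 : ∫ y in N.Ω, wedgeEval (inChart (extD α) x₀ y) (inChart β x₀ y) (fun i => stdFrame m i) =
      ∫ y, wedgeEval (extDeriv (inChart α x₀) y) (c y) (fun i => stdFrame m i) := by
    refine Eq.trans ?_ (setIntegral_eq_integral_of_forall_compl_eq_zero (s := N.Ω) ?_)
    · refine setIntegral_congr_fun N.isOpen.measurableSet fun y hy => ?_
      simp only [inChart_extD_of_smooth hα (N.subset hy), (he y hy).eq_of_nhds]
    · intro y hy
      rw [image_eq_zero_of_notMem_tsupport (hoff y hy), wedgeEval_zero_right]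
  have e4 : ∫ y in N.Ω, wedgeEval (inChart α x₀ y) (inChart (extD β) x₀ y) (fun i => stdFrame m i) =
      ∫ y, wedgeEval (inChart α x₀ y) (extDeriv c y) (fun i => stdFrame m i) := by
    refine Eq.trans ?_ (setIntegral_eq_integral_of_forall_compl_eq_zero (s := N.Ω) ?_)
    · refine setIntegral_congr_fun N.isOpen.measurableSet fun y hy => ?_
      simp only [inChart_extD_of_smooth hβ (N.subset hy), (he y hy).extDeriv_eq]
    · intro y hy
      rw [extDeriv_eq_zero_of_notMem_tsupport (hoff y hy), wedgeEval_zero_right]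
  rw [e3, e4, h1]
  ring

lemma wedgeDensity_sum_right {J : Type*} [Fintype J] (α : DForm (m := m) M a ℂ)
    (β : J → DForm (m := m) M b ℂ) :
    wedgeDensity vol α (∑ i, β i) = fun x => ∑ i, wedgeDensity vol α (β i) x := by
  funext x
  simp only [wedgeDensity]
  rw [← Finset.sum_div, ← wedgeEval_sum_right, Finset.sum_apply]

lemma compactSupportIn_fmul {χ : M → ℝ} (hs : HasCompactSupport χ) {U : Set M}
    (hU : tsupport χ ⊆ U) (β : DForm (m := m) M b ℂ) : CompactSupportIn (fmul χ β) U := by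
  have h1 : closure {x | fmul χ β x ≠ 0} ⊆ tsupport χ :=
    closure_mono fun x hx h => hx (by
      rw [fmul, h, Complex.ofReal_zero]
      exact zero_smul ℂ (β x))
  exact ⟨hs.of_isClosed_subset isClosed_closure h1, h1.trans hU⟩

variable [IsManifold 𝓘(ℂ, EX n) ω X]

/-- Stokes' theorem. -/
lemma stokes [SigmaCompactSpace M] (hM : IsGenericCR (n := n) (m := m) k ι) (hvol : IsVolumeForm vol)
    (hD : IsSmoothDomain (m := m) D) (h : a + (b + 1) = m) {α : DForm (m := m) M a ℂ}
    {β : DForm (m := m) M b ℂ} (hα : SmoothForm α) (hβ : SmoothForm β) {U : Set M}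
    (hs : CompactSupportIn β U) :
    wedgeIntegral vol (extD α) β = -((-1) ^ a * wedgeIntegral vol α (extD β)) := by
  have N := fun x => exists_localModel hM hvol hD x
  obtain ⟨J, χ, hχ, hχ1⟩ := exists_partition (m := m) hs.1 (U := fun x => (N x).some.dom)
    fun x => ⟨(N x).some.isOpen_dom, (N x).some.mem_dom⟩
  have hβi (i : J) : SmoothForm (fmul (χ i) β) := hβ.fmul (hχ i).1
  have hsi (i : J) : CompactSupportIn (fmul (χ i) β) (N i).some.dom :=
    compactSupportIn_fmul (hχ i).2.1 (hχ i).2.2 β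
  have hsum : β = ∑ i, fmul (χ i) β := by
    funext x
    rw [Finset.sum_apply]
    by_cases hx : β x = 0
    · simp [fmul, hx]
    · simp only [fmul]
      rw [← Finset.sum_smul, ← Complex.ofReal_sum, hχ1 x (subset_closure hx), Complex.ofReal_one,
        one_smul]
  have hext : extD β = ∑ i, extD (fmul (χ i) β) := by
    conv_lhs => rw [hsum]
    exact (SmoothForm.sum Finset.univ fun i _ => hβi i).2
  have i1 (i : J) := wedgeIntegrable_of_smooth (a := a + 1) (by omega) hvol hα.extD (hβi i) (hsi i)
  have i2 (i : J) := wedgeIntegrable_of_smooth (by omega) hvol hα (hβi i).extD (hsi i).extD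
  have h1 (i : J) := (N i).some.stokes h hvol hα (hβi i) (hsi i)
  rw [wedgeIntegral, wedgeIntegral, hext]
  conv_lhs => rw [hsum]
  rw [wedgeDensity_sum_right, wedgeDensity_sum_right, integral_finsetSum _ fun i _ => i1 i,
    integral_finsetSum _ fun i _ => i2 i, Finset.mul_sum, ← Finset.sum_neg_distrib]
  exact Finset.sum_congr rfl fun i _ => h1 i

open scoped Pointwise in
/-- The boundary of `D` is a null set: in the chart, its translates in the direction that points
into `D` are disjoint. -/
lemma volMeasure_frontier (hM : IsGenericCR (n := n) (m := m) k ι) (hvol : IsVolumeForm vol)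
    (hD : IsSmoothDomain (m := m) D) : volMeasure vol (frontier D) = 0 := by
  have hc : IsCompact (frontier D) :=
    hD.isCompact_closure.of_isClosed_subset isClosed_frontier frontier_subset_closure
  refine hc.measure_zero_of_nhdsWithin fun x _ => ?_
  obtain ⟨N⟩ := exists_localModel hM hvol hD x
  obtain ⟨K, hK, hxK, hKΩ⟩ := exists_compact_subset N.isOpen N.mem
  have hKc := isClosed_symm_image hK (hKΩ.trans N.subset)
  have hx := mem_source (m := m) x
  refine ⟨(chart m x).symm '' K ∩ frontier D, ?_, ?_⟩
  · refine inter_mem (mem_nhdsWithin_of_mem_nhds ?_) self_mem_nhdsWithin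
    filter_upwards [(continuousAt_chart hx).preimage_mem_nhds (mem_interior_iff_mem_nhds.1 hxK),
      (isOpen_source x).mem_nhds hx] with z hz hzs
    exact ⟨_, hz, (chart m x).left_inv hzs⟩
  have hmeas : MeasurableSet ((chart m x).symm '' K ∩ frontier D) :=
    hKc.2.measurableSet.inter isClosed_frontier.measurableSet
  refine volMeasure_eq_zero vol hmeas (fun z hz => (N.mem_source_of_mem hKΩ hz.1).1) ?_
  set E := (chart m x).target ∩ (chart m x).symm ⁻¹' ((chart m x).symm '' K ∩ frontier D) with hE
  have hEK : E ⊆ K := by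
    rintro y ⟨hyt, ⟨z, hz, hzy⟩, -⟩
    rwa [← (chart m x).symm.injOn (N.subset (hKΩ hz)) hyt hzy]
  have hdisj : ∀ y ∈ E, ∀ t : ℝ, 0 < t → y + t • N.v ∉ E := by
    intro y hy t ht hyt
    have h1 := N.cone y (hKΩ (hEK hy)) (frontier_subset_closure hy.2.2) t ht N.v
      (Metric.mem_ball_self N.δ_pos) (hKΩ (hEK hyt))
    have h2 : (chart m x).symm (y + t • N.v) ∈ frontier D := hyt.2.2
    rw [hD.isOpen.frontier_eq] at h2
    exact h2.2 h1
  refine Measure.addHaar_eq_zero_of_disjoint_translates volume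
    (fun j : ℕ => ((j : ℝ) + 1)⁻¹ • N.v) ?_ ?_ (measurableSet_target_inter hmeas)
  · refine (isBounded_iff_forall_norm_le).2 ⟨‖N.v‖, ?_⟩
    rintro _ ⟨j, rfl⟩
    rw [norm_smul, Real.norm_of_nonneg (by positivity)]
    refine mul_le_of_le_one_left (norm_nonneg _) (inv_le_one_of_one_le₀ ?_)
    linarith [(Nat.cast_nonneg j : (0 : ℝ) ≤ j)]
  · have key : ∀ i j : ℕ, i < j → Disjoint (({((i : ℝ) + 1)⁻¹ • N.v} : Set (EM m)) + E)
        (({((j : ℝ) + 1)⁻¹ • N.v} : Set (EM m)) + E) := by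
      intro i j hij
      rw [Set.disjoint_left]
      rintro z hz hz'
      rw [Set.singleton_add] at hz hz'
      obtain ⟨y, hy, rfl⟩ := hz
      obtain ⟨y', hy', he⟩ := hz'
      have hlt : ((j : ℝ) + 1)⁻¹ < ((i : ℝ) + 1)⁻¹ := by
        have : (i : ℝ) < j := by exact_mod_cast hij
        exact inv_strictAnti₀ (by positivity) (by linarith)
      refine hdisj y hy (((i : ℝ) + 1)⁻¹ - ((j : ℝ) + 1)⁻¹) (sub_pos.2 hlt) ?_
      have : y + (((i : ℝ) + 1)⁻¹ - ((j : ℝ) + 1)⁻¹) • N.v = y' := by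
        simp only at he
        rw [sub_smul]
        have h3 : y' = ((i : ℝ) + 1)⁻¹ • N.v + y - ((j : ℝ) + 1)⁻¹ • N.v := by
          rw [← he]; abel
        rw [h3]; abel
      rwa [this]
    intro i j hij
    rcases lt_or_gt_of_ne hij with h | h
    · exact key i j h
    · exact (key j i h).symm

end Stokes

section Riesz

/-! ### Functionals on `L^p` -/

variable {Ω : Type*} [MeasurableSpace Ω] {μ : Measure Ω} [IsFiniteMeasure μ] {p q : ℝ≥0∞}

open scoped symmDiff in
/-- Countable additivity of the indicators in `L^p`, for `p` finite. -/
lemma hasSum_indicatorConstLp [Fact (1 ≤ p)] (hp : p ≠ ⊤) {f : ℕ → Set Ω}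
    (hf : ∀ i, MeasurableSet (f i)) (hd : Pairwise (Function.onFun Disjoint f)) (c : ℂ) :
    HasSum (fun i => indicatorConstLp p (hf i) (measure_ne_top μ _) c)
      (indicatorConstLp p (MeasurableSet.iUnion hf) (measure_ne_top μ _) c) := by
  classical
  have hF (F : Finset ℕ) : MeasurableSet (⋃ i ∈ F, f i) := F.measurableSet_biUnion fun i _ => hf i
  have hsum (F : Finset ℕ) : ∑ i ∈ F, indicatorConstLp p (hf i) (measure_ne_top μ _) c =
      indicatorConstLp p (hF F) (measure_ne_top μ _) c := by
    induction F using Finset.induction_on with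
    | empty => simp
    | insert a s ha ih =>
      rw [Finset.sum_insert ha, ih]
      have h1 : Disjoint (f a) (⋃ i ∈ s, f i) := by
        rw [disjoint_iUnion₂_right]
        exact fun i hi => hd fun h => ha (h ▸ hi)
      rw [← indicatorConstLp_disjoint_union (hf a) (hF s) (measure_ne_top μ _) (measure_ne_top μ _) h1]
      congr 1
      simp
  rw [HasSum, SummationFilter.unconditional_filter]
  simp only [hsum]
  refine tendsto_indicatorConstLp_set hp ?_
  have h1 := tendsto_measure_iInter_atTop (μ := μ) (s := fun F : Finset ℕ => (⋃ i, f i) \ ⋃ i ∈ F, f i)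
    (fun F => ((MeasurableSet.iUnion hf).diff (hF F)).nullMeasurableSet)
    (fun F G hFG => sdiff_subset_sdiff_right (biUnion_subset_biUnion_left hFG)) ⟨∅, measure_ne_top μ _⟩
  have h2 : ⋂ F : Finset ℕ, ((⋃ i, f i) \ ⋃ i ∈ F, f i) = ∅ := by
    refine eq_empty_of_forall_notMem fun x hx => ?_
    rw [mem_iInter] at hx
    obtain ⟨i, hi⟩ := mem_iUnion.1 (hx ∅).1
    exact (hx {i}).2 (mem_biUnion (Finset.mem_singleton_self i) hi)
  rw [h2, measure_empty] at h1
  refine h1.congr fun F => ?_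
  rw [Set.symmDiff_def, sdiff_eq_empty.2 (iUnion₂_subset fun i _ => subset_iUnion f i), empty_union]
  rfl

/-- The complex measure given by a continuous functional on `L^p`. -/
def measureOfFunctional [Fact (1 ≤ p)] (hp : p ≠ ⊤) (T : Lp ℂ p μ →L[ℂ] ℂ) : ComplexMeasure Ω where
  measureOf' s := open scoped Classical in
    if h : MeasurableSet s then T (indicatorConstLp p h (measure_ne_top μ s) 1) else 0
  empty' := by
    rw [dif_pos MeasurableSet.empty, indicatorConstLp_empty, map_zero]
  not_measurable' s hs := dif_neg hs
  m_iUnion' f hf hd := by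
    simp only [hf, MeasurableSet.iUnion hf, dif_pos]
    exact (hasSum_indicatorConstLp hp hf hd 1).mapL T

lemma measureOfFunctional_apply [Fact (1 ≤ p)] (hp : p ≠ ⊤) (T : Lp ℂ p μ →L[ℂ] ℂ) {s : Set Ω}
    (hs : MeasurableSet s) :
    measureOfFunctional hp T s = T (indicatorConstLp p hs (measure_ne_top μ s) 1) := dif_pos hs

/-- The Radon–Nikodym density of a functional represents it on indicators. -/
lemma exists_density [Fact (1 ≤ p)] (hp : p ≠ ⊤) (T : Lp ℂ p μ →L[ℂ] ℂ) :
    ∃ g : Ω → ℂ, Measurable g ∧ Integrable g μ ∧ ∀ s (hs : MeasurableSet s),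
      T (indicatorConstLp p hs (measure_ne_top μ s) 1) = ∫ x in s, g x ∂μ := by
  set c := measureOfFunctional hp T with hc
  have h0 : ∀ s, MeasurableSet s → μ s = 0 → c s = 0 := by
    intro s hs h
    rw [hc, measureOfFunctional_apply hp T hs]
    convert map_zero T
    rw [← norm_eq_zero, norm_indicatorConstLp (zero_lt_one.trans_le (Fact.out : 1 ≤ p)).ne' hp,
      measureReal_def, h, ENNReal.toReal_zero, Real.zero_rpow, mul_zero]
    rw [one_div]
    exact inv_ne_zero (ENNReal.toReal_ne_zero.2
      ⟨(zero_lt_one.trans_le (Fact.out : 1 ≤ p)).ne', hp⟩)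
  have hre : c.re ≪ᵥ μ.toENNRealVectorMeasure := by
    refine VectorMeasure.AbsolutelyContinuous.mk fun s hs h => ?_
    rw [Measure.toENNRealVectorMeasure_apply_measurable hs] at h
    have : c.re s = (c s).re := rfl
    rw [this, h0 s hs h, Complex.zero_re]
  have him : c.im ≪ᵥ μ.toENNRealVectorMeasure := by
    refine VectorMeasure.AbsolutelyContinuous.mk fun s hs h => ?_
    rw [Measure.toENNRealVectorMeasure_apply_measurable hs] at h
    have : c.im s = (c s).im := rfl
    rw [this, h0 s hs h, Complex.zero_im]
  have hi := c.integrable_rnDeriv μ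
  refine ⟨c.rnDeriv μ, ?_, hi, fun s hs => ?_⟩
  · exact measurable_of_re_im (𝕜 := ℂ) (SignedMeasure.measurable_rnDeriv _ _)
      (SignedMeasure.measurable_rnDeriv _ _)
  · rw [← measureOfFunctional_apply hp T hs, ← hc]
    apply Complex.ext
    · have h1 := congrArg (fun v => v s) (SignedMeasure.withDensityᵥ_rnDeriv_eq c.re μ hre)
      rw [withDensityᵥ_apply (SignedMeasure.integrable_rnDeriv _ _) hs] at h1
      rw [← RCLike.re_eq_complex_re, ← integral_re hi.integrableOn]
      exact h1.symm
    · have h1 := congrArg (fun v => v s) (SignedMeasure.withDensityᵥ_rnDeriv_eq c.im μ him)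
      rw [withDensityᵥ_apply (SignedMeasure.integrable_rnDeriv _ _) hs] at h1
      rw [← RCLike.im_eq_complex_im, ← integral_im hi.integrableOn]
      exact h1.symm

/-- Functionals on `L^p` are determined by their values on indicators. -/
lemma functional_ext [Fact (1 ≤ p)] (hp : p ≠ ⊤) {S T : Lp ℂ p μ →L[ℂ] ℂ}
    (h : ∀ s (hs : MeasurableSet s), S (indicatorConstLp p hs (measure_ne_top μ s) 1) =
      T (indicatorConstLp p hs (measure_ne_top μ s) 1)) : S = T := by
  refine ContinuousLinearMap.ext fun u => ?_
  refine Lp.induction hp (fun u => S u = T u) ?_ ?_ (isClosed_eq S.continuous T.continuous) u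
  · intro c s hs hμs
    have : (Lp.simpleFunc.indicatorConst p hs hμs.ne c : Lp ℂ p μ) =
        c • indicatorConstLp p hs (measure_ne_top μ s) 1 := by
      rw [Lp.simpleFunc.coe_indicatorConst]
      refine Lp.ext ?_
      filter_upwards [Lp.coeFn_smul c (indicatorConstLp (μ := μ) p hs (measure_ne_top μ s) (1 : ℂ)),
        indicatorConstLp_coeFn (μ := μ) (p := p) (hs := hs) (hμs := hμs.ne) (c := c),
        indicatorConstLp_coeFn (μ := μ) (p := p) (hs := hs) (hμs := measure_ne_top μ s)
          (c := (1 : ℂ))] with x h1 h2 h3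
      rw [h1, h2, Pi.smul_apply, h3, smul_eq_mul]
      by_cases hx : x ∈ s
      · rw [indicator_of_mem hx, indicator_of_mem hx, mul_one]
      · rw [indicator_of_notMem hx, indicator_of_notMem hx, mul_zero]
    rw [this, map_smul, map_smul, h s hs]
  · intro f g hf hg _ h1 h2
    rw [map_add, map_add, h1, h2]

lemma memLp_indicator_of_bounded {g : Ω → ℂ} (hg : Measurable g) (N : ℝ) :
    MemLp ({x | ‖g x‖ ≤ N}.indicator g) q μ := by
  refine MemLp.of_bound ((hg.indicator (measurableSet_le hg.norm measurable_const)).aestronglyMeasurable)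
    (max N 0) (Eventually.of_forall fun x => ?_)
  by_cases hx : x ∈ {x | ‖g x‖ ≤ N}
  · rw [indicator_of_mem hx]; exact le_max_of_le_left hx
  · rw [indicator_of_notMem hx, norm_zero]; exact le_max_right _ _

/-- If `J ≤ C J ^ (1/p)` then `J ^ (1/q) ≤ C`. -/
lemma rpow_le_of_le_mul_rpow {P Q : ℝ} (h : P.HolderConjugate Q) {J C : ℝ≥0∞} (hJ : J ≠ ⊤)
    (hle : J ≤ C * J ^ (1 / P)) : J ^ (1 / Q) ≤ C := by
  rcases eq_or_ne J 0 with rfl | h0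
  · rw [ENNReal.zero_rpow_of_pos (one_div_pos.2 h.symm.pos)]; exact zero_le
  have h1 : J ^ (1 / P) ≠ 0 := by simp [ENNReal.rpow_eq_zero_iff, h0, hJ]
  have h2 : J ^ (1 / P) ≠ ⊤ := ENNReal.rpow_ne_top_of_nonneg (one_div_nonneg.2 h.nonneg) hJ
  rw [← ENNReal.mul_le_mul_iff_left h1 h2, ← ENNReal.rpow_add _ _ h0 hJ]
  have : 1 / Q + 1 / P = 1 := by
    rw [one_div, one_div]; exact h.symm.inv_add_inv_eq_one
  rwa [this, ENNReal.rpow_one]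

/-- The Riesz representation of the functionals on `L^p` of a finite measure. -/
lemma exists_riesz [Fact (1 ≤ p)] [hpq : p.HolderConjugate q] (hp : p ≠ ⊤) (hq : q ≠ ⊤)
    (T : Lp ℂ p μ →L[ℂ] ℂ) :
    ∃ g : Ω → ℂ, MemLp g q μ ∧ ∀ u : Lp ℂ p μ, T u = ∫ x, u x * g x ∂μ := by
  have hq1 : Fact (1 ≤ q) := ⟨ENNReal.HolderConjugate.one_le q p⟩
  obtain ⟨g, hgm, hgi, hg⟩ := exists_density hp T
  have hp1 : 1 < p := (ENNReal.HolderConjugate.lt_top_iff_one_lt q p).1 hq.lt_top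
  have hPQ : p.toReal.HolderConjugate q.toReal :=
    ENNReal.HolderConjugate.toReal (by
      rw [← ENNReal.toReal_one]; exact (ENNReal.toReal_lt_toReal ENNReal.one_ne_top hp).2 hp1)
  set P := p.toReal
  set Q := q.toReal
  -- the density `g` is truncated where it exceeds `N`; as the truncation is in `L^q`, it represents
  -- the functional `u ↦ T (1_A u)`
  let A : ℕ → Set Ω := fun N => {x | ‖g x‖ ≤ N}
  have hA (N) : MeasurableSet (A N) := measurableSet_le hgm.norm measurable_const
  have hmem (N : ℕ) : MemLp ((A N).indicator g) q μ := memLp_indicator_of_bounded hgm N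
  have hT (N : ℕ) (φ : Ω → ℂ) (hφ : MemLp φ p μ) :
      T ((hφ.indicator (hA N)).toLp) = ∫ x, (A N).indicator g x * φ x ∂μ := by
    let B := (ContinuousLinearMap.mul ℂ ℂ).holderL μ ⊤ p p
      (indicatorConstLp ⊤ (hA N) (measure_ne_top μ _) 1)
    have hB (u : Lp ℂ p μ) : B u =ᵐ[μ] (A N).indicator u := by
      filter_upwards [(ContinuousLinearMap.mul ℂ ℂ).coeFn_holder
        (indicatorConstLp ⊤ (hA N) (measure_ne_top μ _) (1 : ℂ)) u (r := p),
        indicatorConstLp_coeFn (μ := μ) (p := ⊤) (hs := hA N) (hμs := measure_ne_top μ _)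
          (c := (1 : ℂ))] with x h1 h2
      refine h1.trans ?_
      rw [h2, ContinuousLinearMap.mul_apply']
      by_cases hx : x ∈ A N
      · rw [indicator_of_mem hx, indicator_of_mem hx, one_mul]
      · rw [indicator_of_notMem hx, indicator_of_notMem hx, zero_mul]
    have hT1 : T ∘L B = (ContinuousLinearMap.mul ℂ ℂ).lpPairing μ q p (hmem N).toLp := by
      refine functional_ext hp fun s hs => ?_
      rw [ContinuousLinearMap.lpPairing_eq_integral, ContinuousLinearMap.comp_apply]
      have e1 : B (indicatorConstLp p hs (measure_ne_top μ s) 1) =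
          indicatorConstLp p ((hA N).inter hs) (measure_ne_top μ _) 1 := by
        refine Lp.ext ((hB _).trans ?_)
        filter_upwards [indicatorConstLp_coeFn (μ := μ) (p := p) (hs := hs)
          (hμs := measure_ne_top μ _) (c := (1 : ℂ)), indicatorConstLp_coeFn (μ := μ) (p := p)
          (hs := (hA N).inter hs) (hμs := measure_ne_top μ _) (c := (1 : ℂ))] with x h1 h2
        rw [h2, ← indicator_indicator]
        simp only [Set.indicator_apply, h1]
      rw [e1, hg, ← integral_indicator ((hA N).inter hs)]
      refine integral_congr_ae ?_
      filter_upwards [(hmem N).coeFn_toLp, indicatorConstLp_coeFn (μ := μ) (p := p) (hs := hs)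
          (hμs := measure_ne_top μ _) (c := (1 : ℂ))] with x h1 h2
      rw [h1, h2, ContinuousLinearMap.mul_apply', inter_comm, ← indicator_indicator]
      by_cases hx : x ∈ s
      · rw [indicator_of_mem hx, indicator_of_mem hx, mul_one]
      · rw [indicator_of_notMem hx, indicator_of_notMem hx, mul_zero]
    have h1 := congrArg (fun S => S hφ.toLp) hT1
    rw [ContinuousLinearMap.comp_apply, ContinuousLinearMap.lpPairing_eq_integral] at h1
    have e2 : B hφ.toLp = (hφ.indicator (hA N)).toLp := by
      refine Lp.ext ((hB _).trans ?_)
      filter_upwards [hφ.coeFn_toLp, (hφ.indicator (hA N)).coeFn_toLp] with x h1 h2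
      rw [h2]
      simp only [Set.indicator_apply, h1]
    rw [← e2, h1]
    refine integral_congr_ae ?_
    filter_upwards [hφ.coeFn_toLp, (hmem N).coeFn_toLp] with x h1 h2
    rw [h1, h2, ContinuousLinearMap.mul_apply']
  have hP0 : p ≠ 0 := (zero_lt_one.trans hp1).ne'
  have hq0 : q ≠ 0 := (zero_lt_one.trans_le hq1.out).ne'
  -- the `L^q` norm of the truncation `h` is tested with `φ = |h|^(Q-2) h̄`, for which Hölder's
  -- inequality is an equality
  have hbound (N : ℕ) : eLpNorm ((A N).indicator g) q μ ≤ ‖T‖ₑ := by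
    set h := (A N).indicator g with hh
    have hhm : Measurable h := hgm.indicator (hA N)
    let φ : Ω → ℂ := fun x => ((‖h x‖ ^ (Q - 2) : ℝ) : ℂ) * star (h x)
    have hφm : Measurable φ :=
      (Complex.measurable_ofReal.comp (hhm.norm.pow_const _)).mul (continuous_star.measurable.comp hhm)
    have hφe (x) : ‖φ x‖ₑ = ‖h x‖ₑ ^ (Q - 1) := by
      rcases eq_or_ne (h x) 0 with h0 | h0
      · simp only [φ, h0, star_zero, mul_zero, enorm_zero]
        rw [ENNReal.zero_rpow_of_pos hPQ.symm.sub_one_pos]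
      · rw [← ofReal_norm, ← ofReal_norm,
          ENNReal.ofReal_rpow_of_pos (norm_pos_iff.2 h0)]
        congr 1
        simp only [φ, norm_mul, norm_star, Complex.norm_real]
        rw [Real.norm_of_nonneg (Real.rpow_nonneg (norm_nonneg _) _)]
        conv_lhs => rw [← Real.rpow_one ‖h x‖, ← Real.rpow_mul (norm_nonneg _), one_mul]
        rw [← Real.rpow_add (norm_pos_iff.2 h0)]
        congr 1; ring
    have hφh (x) : h x * φ x = ((‖h x‖ ^ Q : ℝ) : ℂ) := by
      rcases eq_or_ne (h x) 0 with h0 | h0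
      · rw [h0, zero_mul, norm_zero, Real.zero_rpow hPQ.symm.pos.ne', Complex.ofReal_zero]
      · have e : h x * star (h x) = ((‖h x‖ ^ (2 : ℝ) : ℝ) : ℂ) := by
          rw [Complex.star_def, Complex.mul_conj, Complex.normSq_eq_norm_sq, Real.rpow_two]
        simp only [φ]
        rw [mul_left_comm, e, ← Complex.ofReal_mul, ← Real.rpow_add (norm_pos_iff.2 h0)]
        congr 2; ring
    have hJ := eLpNorm_eq_lintegral_rpow_enorm_toReal hq0 hq (f := h) (μ := μ)
    set J := ∫⁻ x, ‖h x‖ₑ ^ Q ∂μ with hJdef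
    have hJt : J ≠ ⊤ := (lintegral_rpow_enorm_lt_top_of_eLpNorm_lt_top hq0 hq (hmem N).2).ne
    have hφn : eLpNorm φ p μ = J ^ (1 / P) := by
      rw [eLpNorm_eq_lintegral_rpow_enorm_toReal hP0 hp]
      congr 1
      refine lintegral_congr fun x => ?_
      rw [hφe, ← ENNReal.rpow_mul]
      congr 1
      exact hPQ.symm.sub_one_mul_conj
    have hφ : MemLp φ p μ := by
      refine ⟨hφm.aestronglyMeasurable, ?_⟩
      rw [hφn]
      exact (ENNReal.rpow_ne_top_of_nonneg (one_div_nonneg.2 hPQ.nonneg) hJt).lt_top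
    have h1 := hT N φ hφ
    have e1 : (A N).indicator φ = φ := by
      refine indicator_eq_self.2 fun x hx => ?_
      by_contra hxA
      refine hx ?_
      simp only [φ, hh, indicator_of_notMem hxA, star_zero, mul_zero]
    have e2 : ‖∫ x, h x * φ x ∂μ‖ₑ = J := by
      simp only [hφh]
      rw [integral_complex_ofReal, ← ofReal_norm, Complex.norm_real,
        Real.norm_of_nonneg (integral_nonneg fun x => Real.rpow_nonneg (norm_nonneg _) _),
        ofReal_integral_eq_lintegral_ofReal]
      · refine lintegral_congr fun x => ?_
        rw [← ofReal_norm, ENNReal.ofReal_rpow_of_nonneg (norm_nonneg _) hPQ.symm.nonneg]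
      · exact (hmem N).integrable_norm_rpow hq0 hq
      · exact Eventually.of_forall fun x => Real.rpow_nonneg (norm_nonneg _) _
    rw [hJ]
    refine rpow_le_of_le_mul_rpow hPQ hJt ?_
    rw [← hφn, ← e2, ← h1]
    refine (T.le_opENorm _).trans ?_
    rw [Lp.enorm_toLp, e1]
  -- the bound is uniform in `N`, so that `g` is in `L^q` by Fatou's lemma
  have hgq : MemLp g q μ := by
    refine ⟨hgm.aestronglyMeasurable, ?_⟩
    refine (Lp.eLpNorm_lim_le_liminf_eLpNorm (f := fun N => (A N).indicator g)
      (fun N => (hmem N).1) g (Eventually.of_forall fun x => ?_)).trans_lt ?_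
    · obtain ⟨N₀, hN₀⟩ := exists_nat_ge ‖g x‖
      refine tendsto_const_nhds.congr' ?_
      filter_upwards [eventually_ge_atTop N₀] with N hN
      exact (indicator_of_mem (show x ∈ A N from hN₀.trans (by exact_mod_cast hN)) g).symm
    · refine (liminf_le_of_frequently_le' (Frequently.of_forall hbound)).trans_lt ?_
      exact enorm_lt_top
  refine ⟨g, hgq, fun u => ?_⟩
  have hT2 : T = (ContinuousLinearMap.mul ℂ ℂ).lpPairing μ q p hgq.toLp := by
    refine functional_ext hp fun s hs => ?_
    rw [hg, ContinuousLinearMap.lpPairing_eq_integral, ← integral_indicator hs]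
    refine integral_congr_ae ?_
    filter_upwards [hgq.coeFn_toLp, indicatorConstLp_coeFn (μ := μ) (p := p) (hs := hs)
      (hμs := measure_ne_top μ _) (c := (1 : ℂ))] with x h1 h2
    rw [h1, h2, ContinuousLinearMap.mul_apply']
    by_cases hx : x ∈ s
    · rw [indicator_of_mem hx, indicator_of_mem hx, mul_one]
    · rw [indicator_of_notMem hx, indicator_of_notMem hx, mul_zero]
  rw [hT2, ContinuousLinearMap.lpPairing_eq_integral]
  refine integral_congr_ae ?_
  filter_upwards [hgq.coeFn_toLp] with x h1
  rw [h1, ContinuousLinearMap.mul_apply', mul_comm]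

end Riesz

section Functional

/-! ### Duality for closed relations -/

/-- If the closed relation `G` has closed range, a functional `S` that vanishes on its kernel is the
pullback of a functional on the target. This combines the open mapping theorem with the
Hahn–Banach theorem. -/
lemma exists_functional_of_isClosed_range {E F : Type*} [NormedAddCommGroup E] [NormedSpace ℂ E]
    [CompleteSpace E] [NormedAddCommGroup F] [NormedSpace ℂ F] [CompleteSpace F]
    (G : Submodule ℂ (E × F)) (hG : IsClosed (G : Set (E × F)))
    (hR : IsClosed {v : F | ∃ u, (u, v) ∈ G}) (S : E →L[ℂ] ℂ)
    (hS : ∀ u, (u, (0 : F)) ∈ G → S u = 0) :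
    ∃ T : F →L[ℂ] ℂ, ∀ u v, (u, v) ∈ G → T v = S u := by
  let R : Submodule ℂ F := G.map (LinearMap.snd ℂ E F)
  have hRmem (v : F) : v ∈ R ↔ ∃ u, (u, v) ∈ G := by
    constructor
    · rintro ⟨⟨u, w⟩, h, rfl⟩; exact ⟨u, h⟩
    · rintro ⟨u, h⟩; exact ⟨(u, v), h, rfl⟩
  have hRc : IsClosed (R : Set F) := by
    convert hR using 1
    ext v; exact hRmem v
  have : CompleteSpace G := hG.completeSpace_coe
  have : CompleteSpace R := hRc.completeSpace_coe
  let π : G →L[ℂ] R := ((ContinuousLinearMap.snd ℂ E F).comp G.subtypeL).codRestrict R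
    fun x => ⟨x.1, x.2, rfl⟩
  have hπ : Function.Surjective π := by
    rintro ⟨v, hv⟩
    obtain ⟨u, hu⟩ := (hRmem v).1 hv
    exact ⟨⟨(u, v), hu⟩, rfl⟩
  let S' : G →L[ℂ] ℂ := S.comp ((ContinuousLinearMap.fst ℂ E F).comp G.subtypeL)
  have hker (x y : G) (h : π x = π y) : S' x = S' y := by
    rw [← sub_eq_zero, ← map_sub]
    refine hS _ ?_
    have h2 : (x - y : G).1.2 = 0 := by
      have := congrArg Subtype.val (show π (x - y) = 0 by rw [map_sub, h, sub_self])
      exact this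
    have h3 := (x - y).2
    rwa [show ((x - y : G) : E × F) = ((x - y : G).1.1, 0) from Prod.ext rfl h2] at h3
  -- the functional is transported by a linear section `σ`, and it is bounded since by the open
  -- mapping theorem there is also a preimage of controlled norm, on which it has the same value
  obtain ⟨C, -, hC⟩ := π.exists_preimage_norm_le hπ
  obtain ⟨σ, hσ⟩ := (π : G →ₗ[ℂ] R).exists_rightInverse_of_surjective (LinearMap.range_eq_top.2 hπ)
  have hσ' (v : R) : π (σ v) = v := congrArg (fun l => l v) hσ
  let T₀ : R →L[ℂ] ℂ := ((S' : G →ₗ[ℂ] ℂ).comp σ).mkContinuous (‖S'‖ * C) fun v => by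
    obtain ⟨x, hx, hxn⟩ := hC v
    have : ((S' : G →ₗ[ℂ] ℂ).comp σ) v = S' x := hker _ _ ((hσ' v).trans hx.symm)
    rw [this, mul_assoc]
    exact (S'.le_opNorm x).trans (mul_le_mul_of_nonneg_left hxn (norm_nonneg _))
  obtain ⟨T, hT, -⟩ := exists_extension_norm_eq R T₀
  refine ⟨T, fun u v h => ?_⟩
  have h1 := hT ⟨v, (hRmem v).2 ⟨u, h⟩⟩
  refine h1.trans ?_
  exact hker (σ ⟨v, (hRmem v).2 ⟨u, h⟩⟩) ⟨(u, v), h⟩ (hσ' _)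

variable {Ω J : Type*} [MeasurableSpace Ω] [Fintype J] {μ : Measure Ω} {p q : ℝ≥0∞}

/-- Integration against `L^p` functions is a functional on the tuples of `L^q` functions. -/
lemma exists_pairing [Fact (1 ≤ q)] [hpq : p.HolderConjugate q] {h : J → Ω → ℂ}
    (hh : ∀ j, MemLp (h j) p μ) :
    ∃ Φ : (J → Lp ℂ q μ) →L[ℂ] ℂ, ∀ u, Φ u = ∫ x, ∑ j, u j x * h j x ∂μ := by
  have hp1 : Fact (1 ≤ p) := ⟨ENNReal.HolderConjugate.one_le p q⟩
  refine ⟨∑ j, ((ContinuousLinearMap.mul ℂ ℂ).lpPairing μ p q (hh j).toLp).comp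
    (ContinuousLinearMap.proj (R := ℂ) (φ := fun _ : J => Lp ℂ q μ) j), fun u => ?_⟩
  have e (j : J) : (fun x => u j x * h j x) =ᵐ[μ] fun x =>
      ContinuousLinearMap.mul ℂ ℂ ((hh j).toLp (h j) x) (u j x) := by
    filter_upwards [(hh j).coeFn_toLp] with x hx
    rw [hx, ContinuousLinearMap.mul_apply', mul_comm]
  rw [integral_finsetSum, _root_.sum_apply]
  · refine Finset.sum_congr rfl fun j _ => ?_
    rw [ContinuousLinearMap.comp_apply, ContinuousLinearMap.lpPairing_eq_integral]
    exact (integral_congr_ae (e j)).symm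
  · intro j _
    exact (Lp.memLp (u j)).integrable_mul (hh j)

/-- Linear combinations with bounded coefficients are continuous on tuples of `L^q` functions. -/
lemma exists_multiplier [Fact (1 ≤ q)] {h : J → Ω → ℂ} (hh : ∀ j, MemLp (h j) ⊤ μ) :
    ∃ S : (J → Lp ℂ q μ) →L[ℂ] Lp ℂ q μ, ∀ u, S u =ᵐ[μ] fun x => ∑ j, u j x * h j x := by
  refine ⟨∑ j, ((ContinuousLinearMap.mul ℂ ℂ).holderL μ ⊤ q q (hh j).toLp).comp
    (ContinuousLinearMap.proj (R := ℂ) (φ := fun _ : J => Lp ℂ q μ) j), fun u => ?_⟩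
  rw [_root_.sum_apply]
  refine (Lp.coeFn_finsetSum _ _).trans ?_
  have e (j : J) := (ContinuousLinearMap.mul ℂ ℂ).coeFn_holder (hh j).toLp (u j) (r := q)
  have h1 : ∀ᵐ x ∂μ, ∀ j, (hh j).toLp (h j) x = h j x :=
    ae_all_iff.2 fun j => (hh j).coeFn_toLp
  filter_upwards [ae_all_iff.2 e, h1] with x hx hx1
  rw [Finset.sum_apply]
  refine Finset.sum_congr rfl fun j _ => ?_
  refine (hx j).trans ?_
  rw [hx1 j, ContinuousLinearMap.mul_apply', mul_comm]

/-- The Riesz representation for tuples of `L^q` functions. -/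
lemma exists_riesz_pi [IsFiniteMeasure μ] [Fact (1 ≤ q)] [hpq : p.HolderConjugate q] (hp : p ≠ ⊤)
    (hq : q ≠ ⊤) (T : (J → Lp ℂ q μ) →L[ℂ] ℂ) :
    ∃ l : J → Ω → ℂ, (∀ j, MemLp (l j) p μ) ∧ ∀ u, T u = ∫ x, ∑ j, u j x * l j x ∂μ := by
  classical
  have h (j : J) := exists_riesz (p := q) (q := p) hq hp
    (T.comp (ContinuousLinearMap.single ℂ (fun _ : J => Lp ℂ q μ) j))
  choose l hl hTl using h
  refine ⟨l, hl, fun u => ?_⟩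
  have hi (j : J) : Integrable (fun x => u j x * l j x) μ := (Lp.memLp (u j)).integrable_mul (hl j)
  rw [integral_finsetSum _ fun j _ => hi j]
  conv_lhs => rw [← Finset.univ_sum_single u, map_sum]
  exact Finset.sum_congr rfl fun j _ => hTl j (u j)

end Functional

section CoefForm

variable {n m k a b d : ℕ} {X : Type*} [TopologicalSpace X] [ChartedSpace (EX n) X]
  {M : Type*} [TopologicalSpace M] [ChartedSpace (EM m) M]
  [IsManifold 𝓘(ℝ, EM m) ∞ M] [T2Space M] [MeasurableSpace M] [BorelSpace M]
  {ι : M → X} {vol : DForm (m := m) M m ℝ} {D A U : Set M} {L : M → EM m →L[ℝ] EX m}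
  {J : Type*} [Fintype J] {p q : ℝ≥0∞}

/-! ### Forms given by coefficients in a frame -/

/-- The form with the coefficients `u j` with respect to the pullbacks of the constant forms `θ j`
under the frame `L`. -/
def coefForm (L : M → EM m →L[ℝ] EX m) (θ : J → CForm m d) (u : J → M → ℂ) :
    DForm (m := m) M d ℂ := fun x => pull (L x) (∑ j, u j x • θ j)

lemma coefForm_apply (θ : J → CForm m d) (u : J → M → ℂ) (x : M) (v : Fin d → EM m) :
    coefForm L θ u x v = ∑ j, u j x * θ j (fun i => L x (v i)) := by
  rw [coefForm, pull_apply, ContinuousAlternatingMap.sum_apply]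
  rfl

lemma coefForm_eq_sum (θ : J → CForm m d) (u : J → M → ℂ) (x : M) :
    coefForm L θ u x = ∑ j, u j x • pull (L x) (θ j) := by
  ext v
  rw [coefForm_apply, ContinuousAlternatingMap.sum_apply]
  rfl

lemma IsFrameOn.memLp_eval (hF : IsFrameOn n ι vol A L) (θ : CForm m d) {V : Fin d → M → EM m}
    (hV : ∀ i, SmoothField (V i)) :
    MemLp (fun x => θ fun i => L x (V i x)) ⊤ ((volMeasure vol).restrict A) := by
  have e : (fun x => θ fun i => L x (V i x)) = fun x => ∑ σ : Fin d → Fin m,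
      (∏ i, L x (V i x) (σ i)) * θ (fun i => stdC m (σ i)) := by
    funext x; exact θ.apply_eq_sum _
  rw [e]
  refine memLp_finsetSum _ fun σ _ => MemLp.mul_const ?_ _
  have : (fun x => ∏ i, L x (V i x) (σ i)) = ∏ i, fun x => L x (V i x) (σ i) := by
    funext x; rw [Finset.prod_apply]
  rw [this]
  refine Finset.prod_induction _ (fun h => MemLp h ⊤ ((volMeasure vol).restrict A)) ?_ ?_ ?_
  · intro f g hf hg
    exact hg.mul hf
  · exact memLp_top_const 1
  · intro i _
    exact hF.memLp_top (V i) (hV i) (σ i)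

/-- A form has `L^p` coefficients with respect to smooth fields if it has `L^p` coefficients with
respect to the frame. -/
lemma IsFrameOn.memLp_coefForm (hF : IsFrameOn n ι vol A L) (hUA : U ⊆ A) (θ : J → CForm m d)
    {u : J → M → ℂ} (hu : ∀ j, MemLp (u j) p ((volMeasure vol).restrict U)) {V : Fin d → M → EM m}
    (hV : ∀ i, SmoothField (V i)) :
    MemLp (fun x => coefForm L θ u x fun i => V i x) p ((volMeasure vol).restrict U) := by
  simp only [coefForm_apply]
  refine memLp_finsetSum _ fun j _ => ?_
  exact ((hF.memLp_eval (θ j) hV).mono_measure (Measure.restrict_mono hUA le_rfl)).mul (hu j)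

lemma IsFrameOn.cext_inverse (hF : IsFrameOn n ι vol A L) {x : M} (hx : x ∈ A) (v : EX m) :
    (cext (L x)).inverse (cext (L x) v) = v ∧ cext (L x) ((cext (L x)).inverse v) = v :=
  ⟨(inverse_cext (hF.det_ne_zero x hx)).1 v, (inverse_cext (hF.det_ne_zero x hx)).2.1 v⟩

lemma IsFrameOn.pull_frameCoord (hF : IsFrameOn n ι vol A L) {x : M} (hx : x ∈ A)
    (η : DForm (m := m) M d ℂ) : pull (L x) (frameCoord L η x) = η x :=
  pull_tri (fun u => (hF.cext_inverse hx u).1) (η x)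

lemma IsFrameOn.frameCoord_coefForm (hF : IsFrameOn n ι vol A L) {x : M} (hx : x ∈ A)
    (θ : J → CForm m d) (u : J → M → ℂ) : frameCoord L (coefForm L θ u) x = ∑ j, u j x • θ j :=
  tri_pull (fun u => (hF.cext_inverse hx u).2) _

lemma IsFrameOn.pull_mem_bidegree_iff (hF : IsFrameOn n ι vol A L) {x : M} (hx : x ∈ A) {r q : ℕ}
    (θ : CForm m (r + q)) : pull (L x) θ ∈ bidegree (n := n) ι x r q ↔ θ ∈ Fil n q :=
  mem_Fil_iff_cEval (fun v => ⟨_, (hF.cext_inverse hx v).2⟩) (H := {w | w ∈ H01 (n := n) ι x})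
    (fun w => hF.mem_H01 x hx w) θ q

/-- In a frame the bidegree condition is the constant condition `Fil`. -/
lemma IsFrameOn.mem_bidegree_iff (hF : IsFrameOn n ι vol A L) {x : M} (hx : x ∈ A) {r q : ℕ}
    (η : DForm (m := m) M (r + q) ℂ) :
    η x ∈ bidegree (n := n) ι x r q ↔ frameCoord L η x ∈ Fil n q := by
  rw [← hF.pull_mem_bidegree_iff hx, hF.pull_frameCoord hx]

/-- A form with `L^p` coefficients with respect to smooth fields has `L^p` coefficients with respect
to the frame. -/
lemma IsFrameOn.memLp_functional (hF : IsFrameOn n ι vol A L) (hU : MeasurableSet U) (hUA : U ⊆ A)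
    {η : DForm (m := m) M d ℂ} (hη : ∀ V : Fin d → M → EM m, (∀ i, SmoothField (V i)) →
      MemLp (fun x => η x fun i => V i x) p ((volMeasure vol).restrict U)) (c : CForm m d →ₗ[ℂ] ℂ) :
    MemLp (fun x => c (frameCoord L η x)) p ((volMeasure vol).restrict U) := by
  have e : (fun x => c (frameCoord L η x)) = fun x => ∑ σ : Fin d → Fin m,
      frameCoord L η x (fun j => stdC m (σ j)) * c (monoForm m d σ) := by
    funext x
    conv_lhs => rw [← sum_monoForm (frameCoord L η x), _root_.map_sum]
    simp only [map_smul, smul_eq_mul]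
  rw [e]
  refine memLp_finsetSum _ fun σ _ => MemLp.mul_const ?_ _
  have := hF.memLp_coord p U hU d η hη σ
  rwa [inter_eq_right.2 hUA] at this

lemma IsFrameOn.memLp_wedgeDensity_pull (h : a + b = m) (hF : IsFrameOn n ι vol A L)
    (hU : MeasurableSet U) (hUA : U ⊆ A) (θ : CForm m a) {β : DForm (m := m) M b ℂ}
    (hβ : ∀ V : Fin b → M → EM m, (∀ i, SmoothField (V i)) →
      MemLp (fun x => β x fun i => V i x) p ((volMeasure vol).restrict U)) :
    MemLp (wedgeDensity vol (fun x => pull (L x) θ) β) p ((volMeasure vol).restrict U) := by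
  have h1 := (hF.memLp_functional hU hUA hβ (wedgeStdHom θ)).mul (r := p)
    (hF.memLp_dens.mono_measure (Measure.restrict_mono hUA le_rfl))
  refine (memLp_congr_ae ?_).2 h1
  filter_upwards [ae_restrict_mem hU] with x hx
  rw [hF.wedgeDensity_eq h _ _ (hUA hx)]
  congr 2
  exact tri_pull (fun u => (hF.cext_inverse (hUA hx) u).2) _

lemma wedgeDensity_coefForm (θ : J → CForm m a) (u : J → M → ℂ) (β : DForm (m := m) M b ℂ) (x : M) :
    wedgeDensity vol (coefForm L θ u) β x =
      ∑ j, u j x * wedgeDensity vol (fun x => pull (L x) (θ j)) β x := by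
  simp only [wedgeDensity, coefForm_eq_sum]
  rw [wedgeEval_sum, Finset.sum_div]
  refine Finset.sum_congr rfl fun j _ => ?_
  rw [wedgeEval_smul, mul_div_assoc]

end CoefForm

section Relation

variable {n m k a b d : ℕ} {X : Type*} [TopologicalSpace X] [ChartedSpace (EX n) X]
  {M : Type*} [TopologicalSpace M] [ChartedSpace (EM m) M]
  [IsManifold 𝓘(ℝ, EM m) ∞ M] [T2Space M] [MeasurableSpace M] [BorelSpace M]
  {ι : M → X} {vol : DForm (m := m) M m ℝ} {D A U : Set M} {L : M → EM m →L[ℝ] EX m}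
  {J : Type*} [Fintype J] {p q : ℝ≥0∞}

/-! ### The weak operator as a closed relation -/

/-- Forms with `L^p` coefficients on `U`. -/
abbrev LpCoef (vol : DForm (m := m) M m ℝ) (U : Set M) (p : ℝ≥0∞) (η : DForm (m := m) M d ℂ) : Prop :=
  ∀ V : Fin d → M → EM m, (∀ i, SmoothField (V i)) →
    MemLp (fun x => η x fun i => V i x) p ((volMeasure vol).restrict U)

lemma isFiniteMeasure_restrict (hvol : IsVolumeForm vol) {C : Set M} (hC : IsCompact C) (hUC : U ⊆ C) :
    IsFiniteMeasure ((volMeasure vol).restrict U) := by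
  have := isLocallyFiniteMeasure_volMeasure (vol := vol) hvol
  refine ⟨?_⟩
  rw [Measure.restrict_apply_univ]
  exact (measure_mono hUC).trans_lt hC.measure_lt_top

lemma SmoothForm.lpCoef (hvol : IsVolumeForm vol) {C : Set M} (hC : IsCompact C) (hUC : U ⊆ C)
    {φ : DForm (m := m) M d ℂ} (hφ : SmoothForm φ) : LpCoef vol U p φ := by
  intro V hV
  have := isFiniteMeasure_restrict hvol hC hUC
  exact ((memLp_top_of_continuousOn hC (hφ.continuous_apply hV).continuousOn).mono_measure
    (Measure.restrict_mono hUC le_rfl)).mono_exponent le_top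

lemma wedgeDensity_eq_zero_of_notMem {φ : DForm (m := m) M b ℂ} (hs : CompactSupportIn φ U)
    (α : DForm (m := m) M a ℂ) {x : M} (hx : x ∉ U) : wedgeDensity vol α φ x = 0 := by
  refine wedgeDensity_eq_zero_right ?_
  by_contra h
  exact hx (hs.2 (subset_closure h))

lemma wedgeIntegral_eq_setIntegral {φ : DForm (m := m) M b ℂ} (hs : CompactSupportIn φ U)
    (α : DForm (m := m) M a ℂ) :
    wedgeIntegral vol α φ = ∫ x in U, wedgeDensity vol α φ x ∂volMeasure vol :=
  (setIntegral_eq_integral_of_forall_compl_eq_zero fun _ hx =>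
    wedgeDensity_eq_zero_of_notMem hs α hx).symm

lemma wedgeIntegrable_iff {φ : DForm (m := m) M b ℂ} (hs : CompactSupportIn φ U)
    (α : DForm (m := m) M a ℂ) :
    WedgeIntegrable vol α φ ↔ IntegrableOn (wedgeDensity vol α φ) U (volMeasure vol) := by
  refine (integrableOn_iff_integrable_of_support_subset fun x hx => ?_).symm
  by_contra h
  exact hx (wedgeDensity_eq_zero_of_notMem hs α h)

lemma wedgeDensity_congr {α α' : DForm (m := m) M a ℂ} {μ : Measure M} (h : α =ᵐ[μ] α')
    (β : DForm (m := m) M b ℂ) : wedgeDensity vol α β =ᵐ[μ] wedgeDensity vol α' β := by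
  filter_upwards [h] with x hx
  rw [wedgeDensity, wedgeDensity, hx]

lemma WeakDbar.congr {r s : ℕ} {g g' : DForm (m := m) M (r + s) ℂ}
    {f f' : DForm (m := m) M (r + (s + 1)) ℂ} (h : WeakDbar (n := n) k ι vol U g f)
    (hg : g =ᵐ[(volMeasure vol).restrict U] g') (hf : f =ᵐ[(volMeasure vol).restrict U] f') :
    WeakDbar (n := n) k ι vol U g' f' := by
  intro r' q' hr hq φ hφ hφb hφs
  obtain ⟨h1, h2, h3⟩ := h r' q' hr hq φ hφ hφb hφs
  rw [wedgeIntegrable_iff hφs] at h1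
  rw [wedgeIntegrable_iff hφs.extD] at h2
  rw [wedgeIntegral_eq_setIntegral hφs, wedgeIntegral_eq_setIntegral hφs.extD] at h3
  rw [wedgeIntegrable_iff hφs, wedgeIntegrable_iff hφs.extD, wedgeIntegral_eq_setIntegral hφs,
    wedgeIntegral_eq_setIntegral hφs.extD]
  have e1 := wedgeDensity_congr (vol := vol) hf φ
  have e2 := wedgeDensity_congr (vol := vol) hg (extD φ)
  exact ⟨h1.congr e1, h2.congr e2, by rw [← integral_congr_ae e1, ← integral_congr_ae e2, h3]⟩

variable [IsManifold 𝓘(ℂ, EX n) ω X]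

/-- `∂̄_b` of `∂̄_b` is zero in the weak sense. -/
lemma WeakDbar.weakDbar_zero (hM : IsGenericCR (n := n) (m := m) k ι) (hvol : IsVolumeForm vol)
    (hD : IsSmoothDomain (m := m) D) {r s : ℕ} {g : DForm (m := m) M (r + s) ℂ}
    {f : DForm (m := m) M (r + (s + 1)) ℂ} (h : WeakDbar (n := n) k ι vol U g f) :
    WeakDbar (n := n) k ι vol U f 0 := by
  intro r' q' hr hq φ hφ hφb hφs
  obtain ⟨h1, h2, h3⟩ := h r' (q' + 1) hr (by omega) (extD φ) hφ.extD
    (extD_mem_bidegree hM hvol hD hφ hφb) hφs.extD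
  refine ⟨?_, h1, ?_⟩
  · rw [WedgeIntegrable, wedgeDensity_zero]; exact integrable_zero _ _ _
  · have e0 : wedgeIntegral vol g (extD (extD φ)) = 0 := by
      rw [extD_extD hφ, wedgeIntegral]
      refine integral_eq_zero_of_ae (Eventually.of_forall fun x => ?_)
      exact wedgeDensity_eq_zero_right rfl
    have e1 : wedgeIntegral vol f (extD φ) = 0 := by
      refine h3.trans ?_
      rw [show (extD (extD φ) : DForm (m := m) M (r' + (q' + 1) + 1) ℂ) = extD (extD φ) from rfl]
      rw [e0, mul_zero]
    rw [wedgeIntegral, wedgeDensity_zero, e1, mul_zero]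
    exact integral_zero _ _

/-- On smooth forms the weak operator is the exterior derivative. -/
lemma weakDbar_extD [SigmaCompactSpace M] (hM : IsGenericCR (n := n) (m := m) k ι)
    (hvol : IsVolumeForm vol) (hD : IsSmoothDomain (m := m) D) {r s : ℕ}
    {φ : DForm (m := m) M (r + s) ℂ} (hφ : SmoothForm φ) :
    WeakDbar (n := n) k ι vol U φ (extD φ) := by
  intro r' q' hr hq ψ hψ _ hψs
  have hm := hM.codim
  refine ⟨wedgeIntegrable_of_smooth (a := r + s + 1) (by omega) hvol hφ.extD hψ hψs,
    wedgeIntegrable_of_smooth (by omega) hvol hφ hψ.extD hψs.extD, ?_⟩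
  refine (stokes hM hvol hD (by omega) hφ hψ hψs).trans ?_
  rw [pow_succ]
  ring

/-- For forms with `L^q` coefficients on a relatively compact set the integrability conditions in the
definition of the weak operator hold by Hölder's inequality. -/
lemma weakDbar_iff (hM : IsGenericCR (n := n) (m := m) k ι) (hvol : IsVolumeForm vol)
    (hF : IsFrameOn n ι vol A L) (hU : MeasurableSet U) (hUA : U ⊆ A) {C : Set M} (hC : IsCompact C)
    (hUC : U ⊆ C) [hpq : p.HolderConjugate q] {r s : ℕ} {g : DForm (m := m) M (r + s) ℂ}
    {f : DForm (m := m) M (r + (s + 1)) ℂ} (hg : LpCoef vol U q g) (hf : LpCoef vol U q f) :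
    WeakDbar (n := n) k ι vol U g f ↔ ∀ r' q' : ℕ, r + r' = n → s + q' + 1 + k = n →
      ∀ φ : DForm (m := m) M (r' + q') ℂ, SmoothForm φ →
        (∀ x, φ x ∈ bidegree (n := n) ι x r' q') → CompactSupportIn φ U →
          ∫ x in U, wedgeDensity vol f φ x ∂volMeasure vol =
            (-1) ^ (r + s + 1) * ∫ x in U, wedgeDensity vol g (extD φ) x ∂volMeasure vol := by
  have hm := hM.codim
  have hqp : q.HolderConjugate p := inferInstance
  constructor
  · intro h r' q' hr hq φ hφ hφb hφs
    rw [← wedgeIntegral_eq_setIntegral hφs, ← wedgeIntegral_eq_setIntegral hφs.extD]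
    exact (h r' q' hr hq φ hφ hφb hφs).2.2
  · intro h r' q' hr hq φ hφ hφb hφs
    rw [wedgeIntegrable_iff hφs, wedgeIntegrable_iff hφs.extD, wedgeIntegral_eq_setIntegral hφs,
      wedgeIntegral_eq_setIntegral hφs.extD]
    exact ⟨hF.integrableOn (by omega) hU hUA hf (hφ.lpCoef (p := p) hvol hC hUC),
      hF.integrableOn (by omega) hU hUA hg (hφ.extD.lpCoef (p := p) hvol hC hUC),
      h r' q' hr hq φ hφ hφb hφs⟩

/-- The weak operator between spaces of `L^q` coefficients is a closed linear relation. -/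
lemma exists_closed_relation (hM : IsGenericCR (n := n) (m := m) k ι) (hvol : IsVolumeForm vol)
    (hF : IsFrameOn n ι vol A L) (hU : MeasurableSet U) (hUA : U ⊆ A) {C : Set M} (hC : IsCompact C)
    (hUC : U ⊆ C) [hpq : p.HolderConjugate q] [Fact (1 ≤ q)] {r s : ℕ} {I : Type*} [Fintype I]
    (θ : J → CForm m (r + s)) (θ' : I → CForm m (r + (s + 1))) :
    ∃ G : Submodule ℂ ((J → Lp ℂ q ((volMeasure vol).restrict U)) ×
        (I → Lp ℂ q ((volMeasure vol).restrict U))), IsClosed {x | x ∈ G} ∧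
      ∀ u v, (u, v) ∈ G ↔ WeakDbar (n := n) k ι vol U (coefForm L θ fun j => u j)
        (coefForm L θ' fun i => v i) := by
  have hm := hM.codim
  set μ := (volMeasure vol).restrict U with hμ
  -- the set of the functionals given by the test forms
  let S : Set (((J → Lp ℂ q μ) × (I → Lp ℂ q μ)) →L[ℂ] ℂ) := {Ψ | ∃ r' q' : ℕ, r + r' = n ∧
    s + q' + 1 + k = n ∧ ∃ φ : DForm (m := m) M (r' + q') ℂ, SmoothForm φ ∧
      (∀ x, φ x ∈ bidegree (n := n) ι x r' q') ∧ CompactSupportIn φ U ∧ ∀ u v, Ψ (u, v) =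
        ∫ x in U, wedgeDensity vol (coefForm L θ' fun i => v i) φ x ∂volMeasure vol -
          (-1) ^ (r + s + 1) *
            ∫ x in U, wedgeDensity vol (coefForm L θ fun j => u j) (extD φ) x ∂volMeasure vol}
  let G : Submodule ℂ ((J → Lp ℂ q μ) × (I → Lp ℂ q μ)) :=
    ⨅ Ψ ∈ S, LinearMap.ker (Ψ : ((J → Lp ℂ q μ) × (I → Lp ℂ q μ)) →ₗ[ℂ] ℂ)
  have hG (x) : x ∈ G ↔ ∀ Ψ ∈ S, Ψ x = 0 := by
    simp only [G, Submodule.mem_iInf]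
    rfl
  refine ⟨G, ?_, fun u v => ?_⟩
  · have : {x | x ∈ G} = ⋂ Ψ ∈ S, {x | Ψ x = 0} := by
      ext x
      rw [mem_ofPred_eq, hG, mem_iInter₂]
      rfl
    rw [this]
    exact isClosed_biInter fun Ψ _ => isClosed_eq Ψ.continuous continuous_const
  · rw [hG, weakDbar_iff (p := p) hM hvol hF hU hUA hC hUC
      (fun V hV => hF.memLp_coefForm hUA θ (fun j => Lp.memLp (u j)) hV)
      (fun V hV => hF.memLp_coefForm hUA θ' (fun j => Lp.memLp (v j)) hV)]
    constructor
    · intro h r' q' hr hq φ hφ hφb hφs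
      have hφp := hφ.lpCoef (p := p) hvol hC hUC
      have hφp' := hφ.extD.lpCoef (p := p) hvol hC hUC
      obtain ⟨Φ₁, hΦ₁⟩ := exists_pairing (μ := μ) (p := p) (q := q)
        (h := fun i => wedgeDensity vol (fun x => pull (L x) (θ' i)) φ)
        fun i => hF.memLp_wedgeDensity_pull (by omega) hU hUA (θ' i) hφp
      obtain ⟨Φ₂, hΦ₂⟩ := exists_pairing (μ := μ) (p := p) (q := q)
        (h := fun j => wedgeDensity vol (fun x => pull (L x) (θ j)) (extD φ))
        fun j => hF.memLp_wedgeDensity_pull (by omega) hU hUA (θ j) hφp'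
      let Ψ := Φ₁.comp (ContinuousLinearMap.snd ℂ (J → Lp ℂ q μ) (I → Lp ℂ q μ)) -
        ((-1 : ℂ) ^ (r + s + 1)) • Φ₂.comp (ContinuousLinearMap.fst ℂ (J → Lp ℂ q μ) (I → Lp ℂ q μ))
      have hΨ (u : J → Lp ℂ q μ) (v : I → Lp ℂ q μ) : Ψ (u, v) =
          ∫ x in U, wedgeDensity vol (coefForm L θ' fun i => v i) φ x ∂volMeasure vol -
          (-1) ^ (r + s + 1) *
            ∫ x in U, wedgeDensity vol (coefForm L θ fun j => u j) (extD φ) x ∂volMeasure vol := by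
        have e : Ψ (u, v) = Φ₁ v - (-1) ^ (r + s + 1) * Φ₂ u := rfl
        rw [e, hΦ₁, hΦ₂]
        simp only [wedgeDensity_coefForm, hμ]
      have := h Ψ ⟨r', q', hr, hq, φ, hφ, hφb, hφs, hΨ⟩
      rw [hΨ] at this
      exact sub_eq_zero.1 this
    · rintro h Ψ ⟨r', q', hr, hq, φ, hφ, hφb, hφs, hΨ⟩
      rw [hΨ]
      exact sub_eq_zero.2 (h r' q' hr hq φ hφ hφb hφs)

end Relation

/-! ### The perfect pairing of complementary degrees -/

section Pairing

variable {m a b : ℕ}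

/-- The wedge product as a bilinear pairing. -/
def wedgeStdBilin (m a b : ℕ) : CForm m a →ₗ[ℂ] CForm m b →ₗ[ℂ] ℂ :=
  LinearMap.mk₂ ℂ wedgeStd
    (fun α α' β => wedgeEval_add (realForm α) (realForm α') (realForm β) fun i => stdC m i)
    (fun c α β => wedgeEval_smul (realForm α) (realForm β) (fun i => stdC m i) c)
    (fun α β β' => (wedgeStdHom α).map_add β β') (fun c α β => (wedgeStdHom α).map_smul c β)

lemma eq_zero_of_wedgeStd (h : a + b = m) (α : CForm m a) (hα : ∀ β : CForm m b, wedgeStd α β = 0) :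
    α = 0 := by
  by_contra h0
  have : ∃ σ : Fin a → Fin m, Function.Injective σ ∧ α (fun j => stdC m (σ j)) ≠ 0 := by
    by_contra hcon
    push Not at hcon
    exact h0 (CForm.ext_std fun σ hσ => hcon σ hσ)
  obtain ⟨σ, hσ, hne⟩ := this
  obtain ⟨β, -, hβ⟩ := exists_wedgeStd_ne_zero (n := m) b a m h α σ hσ
    ((Set.ncard_le_card _).trans (by simp)) hne
  exact hβ (hα β)

/-- The wedge product of complementary degrees is a perfect pairing. -/
lemma exists_wedgeStd_eq (h : a + b = m) (c : CForm m b →ₗ[ℂ] ℂ) :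
    ∃ τ : CForm m a, ∀ β, wedgeStd τ β = c β := by
  have hinj {a b : ℕ} (h : a + b = m) : Function.Injective (wedgeStdBilin m a b) := by
    rw [← LinearMap.ker_eq_bot, LinearMap.ker_eq_bot']
    intro α hα
    exact eq_zero_of_wedgeStd h α fun β => congrArg (fun l => l β) hα
  have h1 := LinearMap.finrank_le_finrank_of_injective (hinj h)
  have h2 := LinearMap.finrank_le_finrank_of_injective (hinj ((add_comm b a).trans h))
  have e1 : Module.finrank ℂ (CForm m b →ₗ[ℂ] ℂ) = Module.finrank ℂ (CForm m b) :=
    Subspace.dual_finrank_eq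
  have e2 : Module.finrank ℂ (CForm m a →ₗ[ℂ] ℂ) = Module.finrank ℂ (CForm m a) :=
    Subspace.dual_finrank_eq
  have h3 : Function.Surjective (wedgeStdBilin m a b) :=
    (LinearMap.injective_iff_surjective_of_finrank_eq_finrank (by omega)).1 (hinj h)
  obtain ⟨τ, hτ⟩ := h3 c
  exact ⟨τ, fun β => congrArg (fun l => l β) hτ⟩

end Pairing

/-! ### Closed range -/

section Range

variable {n m k a b d : ℕ} {X : Type*} [TopologicalSpace X] [ChartedSpace (EX n) X]
  {M : Type*} [TopologicalSpace M] [ChartedSpace (EM m) M]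
  [IsManifold 𝓘(ℝ, EM m) ∞ M] [T2Space M] [MeasurableSpace M] [BorelSpace M]
  {ι : M → X} {vol : DForm (m := m) M m ℝ} {D A U : Set M} {L : M → EM m →L[ℝ] EX m}
  {J : Type*} [Fintype J]

/-- Every `L^q` form of type `(r, s)` is given by `L^q` coefficients with respect to `filBasis`. -/
lemma exists_coefForm_eq {q : ℝ≥0∞} (hF : IsFrameOn n ι vol A L) (hU : MeasurableSet U)
    (hUA : U ⊆ A) {r s : ℕ} {η : DForm (m := m) M (r + s) ℂ} (hη : LpCoef vol U q η)
    (hηb : ∀ᵐ x ∂(volMeasure vol).restrict U, η x ∈ bidegree (n := n) ι x r s) :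
    ∃ u : FilIdx m (r + s) n s → Lp ℂ q ((volMeasure vol).restrict U),
      (∀ j, u j =ᵐ[(volMeasure vol).restrict U] fun x => filCoord n s j (frameCoord L η x)) ∧
      coefForm L (filBasis n s) (fun j => u j) =ᵐ[(volMeasure vol).restrict U] η := by
  refine ⟨fun j => (hF.memLp_functional hU hUA hη (filCoord n s j)).toLp, fun j =>
    MemLp.coeFn_toLp _, ?_⟩
  have h1 : ∀ᵐ x ∂(volMeasure vol).restrict U, ∀ j,
      (hF.memLp_functional hU hUA hη (filCoord n s j)).toLp _ x =
        filCoord n s j (frameCoord L η x) := ae_all_iff.2 fun j => MemLp.coeFn_toLp _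
  filter_upwards [hηb, h1, ae_restrict_mem hU] with x hx hx1 hxU
  rw [hF.mem_bidegree_iff (hUA hxU)] at hx
  rw [coefForm]
  simp only [hx1]
  rw [sum_filCoord hx, hF.pull_frameCoord (hUA hxU)]

lemma coefForm_mem_LpForms {p : ℝ} (hF : IsFrameOn n ι vol A L) (hU : MeasurableSet U) (hUA : U ⊆ A)
    {r s : ℕ} {θ : J → CForm m (r + s)} (hθ : ∀ j, θ j ∈ Fil n s) {u : J → M → ℂ}
    (hu : ∀ j, MemLp (u j) (ENNReal.ofReal p) ((volMeasure vol).restrict U)) :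
    coefForm L θ u ∈ LpForms (n := n) ι vol U univ p r s := by
  refine ⟨fun V hV => hF.memLp_coefForm hUA θ hu hV, ?_,
    Eventually.of_forall fun x hx => absurd (mem_univ x) hx⟩
  filter_upwards [ae_restrict_mem hU] with x hx
  exact (hF.pull_mem_bidegree_iff (hUA hx) _).2
    (Submodule.sum_mem _ fun j _ => Submodule.smul_mem _ _ (hθ j))

/-- The form with given `L^p` coefficients depends continuously on the coefficients. -/
lemma continuous_coefForm {p : ℝ} [Fact (1 ≤ ENNReal.ofReal p)] (hF : IsFrameOn n ι vol A L)
    (hU : MeasurableSet U) (hUA : U ⊆ A) {r s : ℕ} {θ : J → CForm m (r + s)}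
    (hθ : ∀ j, θ j ∈ Fil n s) :
    @Continuous (J → Lp ℂ (ENNReal.ofReal p) ((volMeasure vol).restrict U)) _ _
      (lpTopology (n := n) ι vol U univ p r s)
      fun u => ⟨coefForm L θ fun j => u j,
        coefForm_mem_LpForms hF hU hUA hθ fun j => Lp.memLp (u j)⟩ := by
  refine continuous_iInf_rng.2 fun V => continuous_iInf_rng.2 fun f₀ => continuous_induced_rng.2 ?_
  obtain ⟨S, hS⟩ := exists_multiplier (μ := (volMeasure vol).restrict U) (q := ENNReal.ofReal p)
    (h := fun j x => θ j fun i => L x (V.1 i x))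
    fun j => (hF.memLp_eval (θ j) V.2).mono_measure (Measure.restrict_mono hUA le_rfl)
  have hf := f₀.2.1 V.1 V.2
  have e (u : J → Lp ℂ (ENNReal.ofReal p) ((volMeasure vol).restrict U)) :
      eLpNorm (fun x => (coefForm L θ (fun j => u j) x -
        (f₀ : DForm (m := m) M (r + s) ℂ) x) (fun i => V.1 i x)) (ENNReal.ofReal p)
          ((volMeasure vol).restrict U) = ‖S u - hf.toLp‖ₑ := by
    rw [Lp.enorm_def]
    refine eLpNorm_congr_ae ?_
    filter_upwards [hS u, hf.coeFn_toLp, Lp.coeFn_sub (S u) hf.toLp] with x h1 h2 h3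
    rw [h3, Pi.sub_apply, h1, h2, ContinuousAlternatingMap.sub_apply, coefForm_apply]
  have hc : Continuous fun u : J → Lp ℂ (ENNReal.ofReal p) ((volMeasure vol).restrict U) =>
      ‖S u - hf.toLp‖ₑ := (S.continuous.sub continuous_const).enorm
  exact hc.congr fun u => (e u).symm

lemma coefForm_zero_ae {q : ℝ≥0∞} {μ : Measure M} (θ : J → CForm m d) :
    coefForm L θ (fun j => ((0 : J → Lp ℂ q μ) j : M → ℂ)) =ᵐ[μ] 0 := by
  have h : ∀ᵐ x ∂μ, ∀ j : J, ((0 : J → Lp ℂ q μ) j : M → ℂ) x = 0 :=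
    ae_all_iff.2 fun j => Lp.coeFn_zero _ _ _
  filter_upwards [h] with x hx
  rw [coefForm_eq_sum]
  simp only [hx]
  exact Finset.sum_eq_zero fun j _ => zero_smul ℂ _

variable [IsManifold 𝓘(ℂ, EX n) ω X]

/-- If the cohomology is Hausdorff, the weak operator has closed range. -/
lemma isClosed_range (hM : IsGenericCR (n := n) (m := m) k ι) (hvol : IsVolumeForm vol)
    (hD : IsSmoothDomain (m := m) D) (hF : IsFrameOn n ι vol A L) (hDA : D ⊆ A) {p p' : ℝ}
    [hpq : (ENNReal.ofReal p).HolderConjugate (ENNReal.ofReal p')]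
    [Fact (1 ≤ ENNReal.ofReal p')] {r s : ℕ}
    (hH : HLpHausdorff (n := n) k ι vol D p' r (s + 1)) :
    IsClosed {v : FilIdx m (r + (s + 1)) n (s + 1) →
      Lp ℂ (ENNReal.ofReal p') ((volMeasure vol).restrict D) |
      ∃ u : FilIdx m (r + s) n s → Lp ℂ (ENNReal.ofReal p') ((volMeasure vol).restrict D),
        WeakDbar (n := n) k ι vol D (coefForm L (filBasis n s) fun j => u j)
          (coefForm L (filBasis n (s + 1)) fun j => v j)} := by
  set μ := (volMeasure vol).restrict D with hμ
  set q := ENNReal.ofReal p' with hq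
  let F := FilIdx m (r + (s + 1)) n (s + 1) → Lp ℂ q μ
  have hDm : MeasurableSet D := hD.isOpen.measurableSet
  -- the closed forms are a closed subspace
  have hcl : IsClosed {v : F | WeakDbar (n := n) k ι vol D
      (coefForm L (filBasis n (s + 1)) fun j => v j) 0} := by
    obtain ⟨G, hG, hGm⟩ := exists_closed_relation (q := q) (p := ENNReal.ofReal p)
      (I := Fin 0) hM hvol hF hDm hDA hD.isCompact_closure subset_closure
      (filBasis n (s + 1) : FilIdx m (r + (s + 1)) n (s + 1) → CForm m (r + (s + 1))) Fin.elim0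
    have hc : Continuous fun v : F => (v, (0 : Fin 0 → Lp ℂ q μ)) := by fun_prop
    convert hG.preimage hc using 1
    ext v
    refine Iff.trans ?_ (hGm v 0).symm
    exact ⟨fun h => h.congr (ae_eq_refl _) (coefForm_zero_ae _).symm,
      fun h => h.congr (ae_eq_refl _) (coefForm_zero_ae _)⟩
  let form (v : F) : LpForms (n := n) ι vol D univ p' r (s + 1) :=
    ⟨coefForm L (filBasis n (s + 1)) fun j => v j,
        coefForm_mem_LpForms hF hDm hDA (filBasis_mem n (s + 1)) fun j => Lp.memLp (v j)⟩
  let jmap : {v : F | WeakDbar (n := n) k ι vol D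
      (coefForm L (filBasis n (s + 1)) fun j => v j) 0} →
      LpClosed (n := n) k ι vol D univ p' r (s + 1) := fun v => ⟨form v.1, v.2⟩
  -- the exact forms among them are the preimage of zero in the cohomology, where points are closed
  have hE : IsClosed {v : {v : F | WeakDbar (n := n) k ι vol D
      (coefForm L (filBasis n (s + 1)) fun j => v j) 0} |
      form v.1 ∈ LpExact (n := n) k ι vol D univ p' r (s + 1)} := by
    let τ : TopologicalSpace (LpClosed (n := n) k ι vol D univ p' r (s + 1)) :=
      TopologicalSpace.induced Subtype.val (lpTopology (n := n) ι vol D univ p' r (s + 1))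
    let τ' : TopologicalSpace (LpCohomology (n := n) k ι vol D univ p' r (s + 1)) :=
      TopologicalSpace.coinduced (QuotientAddGroup.mk) τ
    have h0 : IsClosed[τ'] ({0} : Set (LpCohomology (n := n) k ι vol D univ p' r (s + 1))) :=
      @isClosed_singleton _ τ' (@T2Space.t1Space _ τ' hH) 0
    rw [isClosed_coinduced] at h0
    have hj : @Continuous _ _ _ τ jmap := by
      refine continuous_induced_rng.2 ?_
      have hform : @Continuous _ _ _ (lpTopology (n := n) ι vol D univ p' r (s + 1)) form :=
        continuous_coefForm hF hDm hDA (filBasis_mem n (s + 1))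
      exact @Continuous.comp _ F _ _ _ (lpTopology (n := n) ι vol D univ p' r (s + 1))
        Subtype.val form hform continuous_subtype_val
    convert @IsClosed.preimage _ _ _ τ _ hj _ h0 using 1
    ext v
    refine Iff.trans ?_ (QuotientAddGroup.eq_zero_iff (jmap v)).symm
    rfl
  convert hcl.isClosedEmbedding_subtypeVal.isClosedMap _ hE using 1
  ext v
  constructor
  · rintro ⟨u, hu⟩
    exact ⟨⟨v, hu.weakDbar_zero hM hvol hD⟩, ⟨_, coefForm_mem_LpForms hF hDm hDA
      (filBasis_mem n s) fun j => Lp.memLp (u j), hu⟩, rfl⟩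
  · rintro ⟨⟨v', hv'⟩, ⟨ψ, hψ, hw⟩, rfl⟩
    obtain ⟨u, -, hu⟩ := exists_coefForm_eq hF hDm hDA hψ.1 hψ.2.1
    exact ⟨u, hw.congr hu.symm (ae_eq_refl _)⟩

end Range

/-! ### Solution of the equation -/

section Solution

variable {n m k : ℕ} {X : Type*} [TopologicalSpace X] [ChartedSpace (EX n) X]
  {M : Type*} [TopologicalSpace M] [ChartedSpace (EM m) M]
  [IsManifold 𝓘(ℝ, EM m) ∞ M] [T2Space M] [MeasurableSpace M] [BorelSpace M]
  {ι : M → X} {vol : DForm (m := m) M m ℝ} {D A U : Set M} {L : M → EM m →L[ℝ] EX m}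
  {J : Type*} [Fintype J]

lemma wedgeDensity_comm (a b : ℕ) (vol : DForm (m := m) M m ℝ) : ∃ ε : ℂ,
    ∀ (α : DForm (m := m) M a ℂ) (β : DForm (m := m) M b ℂ) (x : M),
      wedgeDensity vol α β x = ε * wedgeDensity vol β α x := by
  obtain ⟨ε, -, h⟩ := exists_wedgeEval_comm a b
  refine ⟨ε, fun α β x => ?_⟩
  rw [wedgeDensity, wedgeDensity, h (α x) (β x) (stdFrame m), mul_div_assoc]

lemma mem_LpExact_of_subsingleton {S : Set M} {p : ℝ} {r q : ℕ}
    (h : Subsingleton (LpCohomology (n := n) k ι vol U S p r q))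
    (f : LpForms (n := n) ι vol U S p r q)
    (hf : WeakDbar (n := n) k ι vol U (f : DForm (m := m) M (r + q) ℂ) 0) :
    f ∈ LpExact (n := n) k ι vol U S p r q := by
  have h1 := (QuotientAddGroup.eq_zero_iff (N := (LpExact (n := n) k ι vol U S p r q).addSubgroupOf
    (LpClosed (n := n) k ι vol U S p r q)) (⟨f, hf⟩ : LpClosed (n := n) k ι vol U S p r q)).1
    (Subsingleton.elim _ _)
  exact h1

lemma subsingleton_of_forall_mem_LpExact {S : Set M} {p : ℝ} {r q : ℕ}
    (h : ∀ f : LpForms (n := n) ι vol U S p r q,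
      WeakDbar (n := n) k ι vol U (f : DForm (m := m) M (r + q) ℂ) 0 →
        f ∈ LpExact (n := n) k ι vol U S p r q) :
    Subsingleton (LpCohomology (n := n) k ι vol U S p r q) := by
  have h0 (x : LpCohomology (n := n) k ι vol U S p r q) : x = 0 := by
    obtain ⟨y, rfl⟩ := QuotientAddGroup.mk_surjective x
    exact (QuotientAddGroup.eq_zero_iff y).2 (h y.1 y.2)
  exact ⟨fun x y => (h0 x).trans (h0 y).symm⟩

lemma Fil_mono {d t : ℕ} {θ : CForm m d} (h : θ ∈ Fil n t) : θ ∈ Fil n (t + 1) :=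
  fun v hv => h v (by omega)

variable [IsManifold 𝓘(ℂ, EX n) ω X]

/-- The orthogonality of closed forms supported in the closure of `D` and exact forms on `D`. In
second degree zero the only exact form is zero. -/
lemma setIntegral_wedge_eq_zero_of_mem_LpExact [SigmaCompactSpace M]
    (hM : IsGenericCR (n := n) (m := m) k ι) (hvol : IsVolumeForm vol)
    (hD : IsSmoothDomain (m := m) D) {p p' : ℝ}
    [hpq : (ENNReal.ofReal p).HolderConjugate (ENNReal.ofReal p')] {r r' s a : ℕ}
    (hr : r + r' = n) (hs : s + 1 + a + k = n) {f : DForm (m := m) M (r + (s + 1)) ℂ}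
    (hfp : ∀ V : Fin (r + (s + 1)) → M → EM m, (∀ i, SmoothField (V i)) →
      MemLp (fun x => f x fun i => V i x) (ENNReal.ofReal p) (volMeasure vol))
    (hfb : ∀ᵐ x ∂volMeasure vol, f x ∈ bidegree (n := n) ι x r (s + 1))
    (hfs : ∀ᵐ x ∂volMeasure vol, x ∉ closure D → f x = 0)
    (hf0 : WeakDbar (n := n) k ι vol univ f 0) {φ : LpForms (n := n) ι vol D univ p' r' a}
    (hφ : φ ∈ LpExact (n := n) k ι vol D univ p' r' a) :
    ∫ x in D, wedgeDensity vol f (φ : DForm (m := m) M (r' + a) ℂ) x ∂volMeasure vol = 0 := by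
  cases a with
  | zero =>
    refine integral_eq_zero_of_ae ?_
    have h : ∀ᵐ x ∂(volMeasure vol).restrict D, (φ : DForm (m := m) M (r' + 0) ℂ) x = 0 := hφ
    filter_upwards [h] with x hx using wedgeDensity_eq_zero_right hx
  | succ t =>
    obtain ⟨ψ, hψ, hψφ⟩ := hφ
    exact integral_wedge_exact_eq_zero hM hvol hD ENNReal.ofReal_ne_top hr (by omega) hfp hfb hfs
      hψ.1 hψ.2.1 φ.2.1 hf0 hψφ

/-- The functional `∂̄_b u ↦ ∫ f ∧ u` on the range of the weak operator, extended to all forms. -/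
lemma exists_functional [SigmaCompactSpace M] (hM : IsGenericCR (n := n) (m := m) k ι)
    (hvol : IsVolumeForm vol) (hD : IsSmoothDomain (m := m) D) {p p' : ℝ}
    [hpq : (ENNReal.ofReal p).HolderConjugate (ENNReal.ofReal p')] [Fact (1 ≤ ENNReal.ofReal p')]
    (hF : IsFrameOn n ι vol A L) (hDA : D ⊆ A) {r r' s a : ℕ}
    (hr : r + r' = n) (hs : s + 1 + a + k = n)
    (hH : HLpHausdorff (n := n) k ι vol D p' r' (a + 1))
    (hV : Subsingleton (HLp (n := n) k ι vol D p' r' a)) {f : DForm (m := m) M (r + (s + 1)) ℂ}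
    (hfp : ∀ V : Fin (r + (s + 1)) → M → EM m, (∀ i, SmoothField (V i)) →
      MemLp (fun x => f x fun i => V i x) (ENNReal.ofReal p) (volMeasure vol))
    (hfb : ∀ᵐ x ∂volMeasure vol, f x ∈ bidegree (n := n) ι x r (s + 1))
    (hfs : ∀ᵐ x ∂volMeasure vol, x ∉ closure D → f x = 0)
    (hf0 : WeakDbar (n := n) k ι vol univ f 0) :
    ∃ T : (FilIdx m (r' + (a + 1)) n (a + 1) →
        Lp ℂ (ENNReal.ofReal p') ((volMeasure vol).restrict D)) →L[ℂ] ℂ,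
      ∀ (u : FilIdx m (r' + a) n a → Lp ℂ (ENNReal.ofReal p') ((volMeasure vol).restrict D)) v,
        WeakDbar (n := n) k ι vol D (coefForm L (filBasis n a) fun j => u j)
          (coefForm L (filBasis n (a + 1)) fun j => v j) →
        T v = ∫ x in D, wedgeDensity vol f (coefForm L (filBasis n a) fun j => u j) x
          ∂volMeasure vol := by
  have hm := hM.codim
  have hDm : MeasurableSet D := hD.isOpen.measurableSet
  have hfD : LpCoef vol D (ENNReal.ofReal p) f := fun V hV => (hfp V hV).restrict D
  set μ := (volMeasure vol).restrict D with hμ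
  obtain ⟨G, hG, hGm⟩ := exists_closed_relation (q := ENNReal.ofReal p') (p := ENNReal.ofReal p)
    hM hvol hF hDm hDA hD.isCompact_closure subset_closure
    (filBasis n a : FilIdx m (r' + a) n a → CForm m (r' + a))
    (filBasis n (a + 1) : FilIdx m (r' + (a + 1)) n (a + 1) → CForm m (r' + (a + 1)))
  have hR := isClosed_range hM hvol hD hF hDA (p := p) hH
  simp only [← hGm] at hR
  obtain ⟨ε, hε⟩ := wedgeDensity_comm (r + (s + 1)) (r' + a) vol
  obtain ⟨Φ, hΦ⟩ := exists_pairing (μ := μ) (p := ENNReal.ofReal p) (q := ENNReal.ofReal p')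
    (h := fun j : FilIdx m (r' + a) n a =>
      wedgeDensity vol (fun x => pull (L x) (filBasis n a j)) f)
    fun j => hF.memLp_wedgeDensity_pull (by omega) hDm hDA _ hfD
  have hS (u : FilIdx m (r' + a) n a → Lp ℂ (ENNReal.ofReal p') μ) : (ε • Φ) u =
      ∫ x in D, wedgeDensity vol f (coefForm L (filBasis n a) fun j => u j) x ∂volMeasure vol := by
    have e : (ε • Φ) u = ε * Φ u := rfl
    rw [e, hΦ, ← integral_const_mul]
    refine integral_congr_ae (Eventually.of_forall fun x => ?_)
    simp only
    rw [hε, wedgeDensity_coefForm]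
  have hker (u : FilIdx m (r' + a) n a → Lp ℂ (ENNReal.ofReal p') μ) (hu : (u, 0) ∈ G) :
      (ε • Φ) u = 0 := by
    rw [hGm] at hu
    have hu0 : WeakDbar (n := n) k ι vol D (coefForm L (filBasis n a) fun j => u j) 0 :=
      hu.congr (ae_eq_refl _) (coefForm_zero_ae _)
    let φ : LpForms (n := n) ι vol D univ p' r' a := ⟨coefForm L (filBasis n a) fun j => u j,
      coefForm_mem_LpForms hF hDm hDA (filBasis_mem n a) fun j => Lp.memLp (u j)⟩
    have hφ : φ ∈ LpExact (n := n) k ι vol D univ p' r' a := mem_LpExact_of_subsingleton hV φ hu0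
    have h0 := setIntegral_wedge_eq_zero_of_mem_LpExact hM hvol hD hr hs hfp hfb hfs hf0 hφ
    exact (hS u).trans h0
  obtain ⟨T, hT⟩ := exists_functional_of_isClosed_range G hG hR (ε • Φ) hker
  refine ⟨T, fun u v huv => ?_⟩
  rw [hT u v ((hGm u v).2 huv), hS]

/-- A form of type `(r', a + 1)` with at most `a` antiholomorphic arguments represents zero, and a
functional that vanishes on all such forms has densities that vanish on them pointwise. -/
lemma ae_sum_filCoord_eq_zero (hM : IsGenericCR (n := n) (m := m) k ι)
    (hvol : IsVolumeForm vol) (hD : IsSmoothDomain (m := m) D) {p p' : ℝ}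
    [hpq : (ENNReal.ofReal p).HolderConjugate (ENNReal.ofReal p')] [Fact (1 ≤ ENNReal.ofReal p')]
    (hF : IsFrameOn n ι vol A L) (hDA : D ⊆ A) {r' a : ℕ}
    {T : (FilIdx m (r' + (a + 1)) n (a + 1) →
        Lp ℂ (ENNReal.ofReal p') ((volMeasure vol).restrict D)) →L[ℂ] ℂ}
    (hT : ∀ v, WeakDbar (n := n) k ι vol D (0 : DForm (m := m) M (r' + a) ℂ)
      (coefForm L (filBasis n (a + 1)) fun j => v j) → T v = 0)
    {l : FilIdx m (r' + (a + 1)) n (a + 1) → M → ℂ}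
    (hl : ∀ j, MemLp (l j) (ENNReal.ofReal p) ((volMeasure vol).restrict D))
    (hTl : ∀ v, T v = ∫ x in D, ∑ j, v j x * l j x ∂volMeasure vol)
    (i : FilIdx m (r' + (a + 1)) n a) : ∀ᵐ x ∂(volMeasure vol).restrict D,
      ∑ j, filCoord n (a + 1) j (filBasis n a i) * l j x = 0 := by
  have hm := hM.codim
  have hDm : MeasurableSet D := hD.isOpen.measurableSet
  have hp1 : 1 ≤ ENNReal.ofReal p := ENNReal.HolderConjugate.one_le _ (ENNReal.ofReal p')
  have hfin : IsFiniteMeasure ((volMeasure vol).restrict D) :=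
    isFiniteMeasure_restrict hvol hD.isCompact_closure subset_closure
  set μ := (volMeasure vol).restrict D with hμ
  set β : CForm m (r' + (a + 1)) := filBasis n a i with hβ
  have hβF : β ∈ Fil n a := filBasis_mem n a i
  have hli (j) : Integrable (fun x => filCoord n (a + 1) j β * l j x) μ :=
    ((hl j).integrable hp1).const_mul _
  refine (integrable_finsetSum _ fun j _ => hli j).ae_eq_zero_of_forall_setIntegral_eq_zero
    fun E hE _ => ?_
  let w : Lp ℂ (ENNReal.ofReal p') μ := indicatorConstLp _ hE (measure_ne_top μ E) 1
  let v : FilIdx m (r' + (a + 1)) n (a + 1) → Lp ℂ (ENNReal.ofReal p') μ :=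
    fun j => filCoord n (a + 1) j β • w
  have hv : ∀ᵐ x ∂μ, ∀ j, v j x = filCoord n (a + 1) j β * E.indicator (fun _ => (1 : ℂ)) x := by
    refine ae_all_iff.2 fun j => ?_
    filter_upwards [Lp.coeFn_smul (filCoord n (a + 1) j β) w,
      indicatorConstLp_coeFn (μ := μ) (p := ENNReal.ofReal p') (hs := hE)
        (hμs := measure_ne_top μ _) (c := (1 : ℂ))] with x h1 h2
    refine h1.trans ?_
    rw [Pi.smul_apply, smul_eq_mul, h2]
  have hmem : WeakDbar (n := n) k ι vol D (0 : DForm (m := m) M (r' + a) ℂ)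
      (coefForm L (filBasis n (a + 1)) fun j => v j) := by
    rw [weakDbar_iff (p := ENNReal.ofReal p) (q := ENNReal.ofReal p') hM hvol hF hDm hDA
      hD.isCompact_closure subset_closure (fun V hV => MemLp.zero')
      (fun V hV => hF.memLp_coefForm hDA _ (fun j => Lp.memLp _) hV)]
    intro r'' q' hr' hq' φ hφ hφb hφs
    have e1 : ∫ x in D, wedgeDensity vol (coefForm L (filBasis n (a + 1)) fun j => v j) φ x
        ∂volMeasure vol = 0 := by
      refine integral_eq_zero_of_ae ?_
      filter_upwards [hv, ae_restrict_mem hDm] with x hx hxD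
      rw [hF.wedgeDensity_eq (by omega) _ _ (hDA hxD), hF.frameCoord_coefForm (hDA hxD)]
      have h1 : ∑ j, v j x • filBasis n (a + 1) j = E.indicator (fun _ => (1 : ℂ)) x • β := by
        conv_rhs => rw [← sum_filCoord (Fil_mono hβF), Finset.smul_sum]
        refine Finset.sum_congr rfl fun j _ => ?_
        rw [hx j, mul_comm, mul_smul]
      rw [h1, wedgeStd_eq_zero (n := n) (s := a) (t := q') (by omega) (by omega)
        (Submodule.smul_mem _ _ hβF) ((hF.mem_bidegree_iff (hDA hxD) φ).1 (hφb x)), mul_zero]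
      rfl
    rw [e1, wedgeDensity_zero]
    simp
  have h0 := hT v hmem
  rw [hTl] at h0
  rw [← integral_indicator hE]
  refine Eq.trans (integral_congr_ae ?_) h0
  filter_upwards [hv] with x hx
  by_cases hxE : x ∈ E
  · rw [indicator_of_mem hxE]
    refine Finset.sum_congr rfl fun j _ => ?_
    rw [hx j, indicator_of_mem hxE, mul_one]
  · rw [indicator_of_notMem hxE]
    refine (Finset.sum_eq_zero fun j _ => ?_).symm
    rw [hx j, indicator_of_notMem hxE, mul_zero, zero_mul]

/-- The form of bidegree `(r, s)` that represents a functional with given densities. -/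
lemma exists_form_of_density (hvol : IsVolumeForm vol) (hU : MeasurableSet U)
    (hF : IsFrameOn n ι vol A L) (hUA : U ⊆ A) {p : ℝ≥0∞} {r r' s a : ℕ}
    (hdeg : (r + s) + (r' + (a + 1)) = m) (hsa : m ≤ n + (a + s + 1))
    {l : FilIdx m (r' + (a + 1)) n (a + 1) → M → ℂ}
    (hl : ∀ j, MemLp (l j) p ((volMeasure vol).restrict U))
    (hlz : ∀ i : FilIdx m (r' + (a + 1)) n a, ∀ᵐ x ∂(volMeasure vol).restrict U,
      ∑ j, filCoord n (a + 1) j (filBasis n a i) * l j x = 0) :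
    ∃ g : DForm (m := m) M (r + s) ℂ, LpCoef vol U p g ∧
      (∀ᵐ x ∂(volMeasure vol).restrict U, g x ∈ bidegree (n := n) ι x r s) ∧
      ∀ x ∈ U, ∀ β : DForm (m := m) M (r' + (a + 1)) ℂ, wedgeDensity vol g β x =
        ∑ j, filCoord n (a + 1) j (frameCoord L β x) * l j x := by
  choose τ hτ using fun j : FilIdx m (r' + (a + 1)) n (a + 1) =>
    exists_wedgeStd_eq hdeg (filCoord n (a + 1) j)
  let c : FilIdx m (r' + (a + 1)) n (a + 1) → M → ℂ := fun j x => (frameDens vol L x)⁻¹ * l j x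
  have hc (j) : MemLp (c j) p ((volMeasure vol).restrict U) :=
    (hl j).mul (hF.memLp_dens_inv.mono_measure (Measure.restrict_mono hUA le_rfl))
  have hwedge (x : M) (β : CForm m (r' + (a + 1))) : wedgeStd (∑ j, c j x • τ j) β =
      (frameDens vol L x)⁻¹ * ∑ j, filCoord n (a + 1) j β * l j x := by
    have e : wedgeStd (∑ j, c j x • τ j) β = wedgeStdBilin m _ _ (∑ j, c j x • τ j) β := rfl
    rw [e, _root_.map_sum, LinearMap.sum_apply, Finset.mul_sum]
    refine Finset.sum_congr rfl fun j _ => ?_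
    have e' : wedgeStdBilin m _ _ (c j x • τ j) β = c j x * wedgeStd (τ j) β := by
      rw [map_smul]; rfl
    rw [e', hτ]
    simp only [c]
    ring
  refine ⟨coefForm L τ c, fun V hV => hF.memLp_coefForm hUA τ hc hV, ?_, fun x hx β => ?_⟩
  · filter_upwards [ae_all_iff.2 hlz, ae_restrict_mem hU] with x hx hxU
    refine (hF.pull_mem_bidegree_iff (hUA hxU) _).2
      (mem_Fil_of_wedgeStd_eq_zero (t := a) hdeg hsa _ fun β hβ => ?_)
    rw [hwedge]
    have h2 : ∑ j, filCoord n (a + 1) j β * l j x = 0 := by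
      have e : ∑ j, filCoord n (a + 1) j β * l j x = ∑ i, filCoord n a i β *
          ∑ j, filCoord n (a + 1) j (filBasis n a i) * l j x := by
        conv_lhs => rw [← sum_filCoord hβ]
        simp only [_root_.map_sum, map_smul, smul_eq_mul, Finset.sum_mul, Finset.mul_sum]
        rw [Finset.sum_comm]
        simp only [mul_assoc]
      rw [e]
      exact Finset.sum_eq_zero fun i _ => by rw [hx i, mul_zero]
    rw [h2, mul_zero]
  · have hκ : frameDens vol L x ≠ 0 := by
      refine div_ne_zero (hF.det_ne_zero x (hUA hx)) ?_
      exact_mod_cast fun h => hvol.ne_zero _ (topForm_eq_zero h)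
    rw [hF.wedgeDensity_eq hdeg _ _ (hUA hx), hF.frameCoord_coefForm (hUA hx), hwedge,
      mul_inv_cancel_left₀ hκ]

/-- The solution of `∂̄_b g = f` with support in the closure of `D`: the form `g` represents the
functional `∂̄_b u ↦ ∫ f ∧ u` on `D` and is extended by zero. -/
theorem exists_weakDbar_eq [SigmaCompactSpace M] (hM : IsGenericCR (n := n) (m := m) k ι)
    (hvol : IsVolumeForm vol) (hD : IsSmoothDomain (m := m) D) {p p' : ℝ}
    [hpq : (ENNReal.ofReal p).HolderConjugate (ENNReal.ofReal p')] {r r' s a : ℕ}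
    (hr : r + r' = n) (hs : s + 1 + a + k = n)
    (hH : HLpHausdorff (n := n) k ι vol D p' r' (a + 1))
    (hV : Subsingleton (HLp (n := n) k ι vol D p' r' a)) {f : DForm (m := m) M (r + (s + 1)) ℂ}
    (hf : f ∈ LpForms (n := n) ι vol univ (closure D) p r (s + 1))
    (hf0 : WeakDbar (n := n) k ι vol univ f 0) :
    ∃ g ∈ LpForms (n := n) ι vol univ (closure D) p r s, WeakDbar (n := n) k ι vol univ g f := by
  have hm := hM.codim
  have hDm : MeasurableSet D := hD.isOpen.measurableSet
  obtain ⟨A, L, hA, hF⟩ := exists_isFrameOn (n := n) (k := k) hM hvol hD hD.isCompact_closure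
  have hDA : D ⊆ A := subset_closure.trans hA
  have hqp : (ENNReal.ofReal p').HolderConjugate (ENNReal.ofReal p) := inferInstance
  have hp1 : Fact (1 ≤ ENNReal.ofReal p) := ⟨ENNReal.HolderConjugate.one_le _ (ENNReal.ofReal p')⟩
  have hq1 : Fact (1 ≤ ENNReal.ofReal p') := ⟨ENNReal.HolderConjugate.one_le _ (ENNReal.ofReal p)⟩
  have hfin : IsFiniteMeasure ((volMeasure vol).restrict D) :=
    isFiniteMeasure_restrict hvol hD.isCompact_closure subset_closure
  set μ := (volMeasure vol).restrict D with hμ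
  obtain ⟨hfp, hfb, hfs⟩ := hf
  rw [Measure.restrict_univ] at hfp hfb hfs
  have hfD : LpCoef vol D (ENNReal.ofReal p) f := fun V hV => (hfp V hV).restrict D
  -- the form `f` vanishes almost everywhere outside `D`, as the boundary is a null set
  have hfout : ∀ᵐ x ∂volMeasure vol, x ∉ D → f x = 0 := by
    have h1 : ∀ᵐ x ∂volMeasure vol, x ∉ frontier D :=
      measure_eq_zero_iff_ae_notMem.1 (volMeasure_frontier hM hvol hD)
    filter_upwards [hfs, h1] with x hx hx1 hxD
    refine hx fun hc => hx1 ?_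
    rw [hD.isOpen.frontier_eq]
    exact ⟨hc, hxD⟩
  obtain ⟨T, hT⟩ := exists_functional hM hvol hD hF hDA hr hs hH hV hfp hfb hfs hf0
  obtain ⟨l, hl, hTl⟩ := exists_riesz_pi (p := ENNReal.ofReal p) ENNReal.ofReal_ne_top
    ENNReal.ofReal_ne_top T
  have hlz := ae_sum_filCoord_eq_zero hM hvol hD hF hDA (fun v hv => by
    rw [hT 0 v (hv.congr (coefForm_zero_ae _).symm (ae_eq_refl _))]
    refine integral_eq_zero_of_ae ?_
    filter_upwards [coefForm_zero_ae (L := L) (filBasis n a)] with x hx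
    exact wedgeDensity_eq_zero_right hx) hl hTl
  have hdeg : (r + s) + (r' + (a + 1)) = m := by omega
  -- the sign is the one in the definition of the weak operator
  obtain ⟨g₀, hgp, hgb, hg₀⟩ := exists_form_of_density (s := s) (r := r) (a := a)
    (l := fun j x => (-1) ^ (r + s + 1) * l j x) hvol hDm hF hDA hdeg (by omega)
    (fun j => (hl j).const_mul _) fun i => by
      filter_upwards [hlz i] with x hx
      simp only [mul_left_comm _ ((-1 : ℂ) ^ (r + s + 1)), ← Finset.mul_sum]
      rw [hx, mul_zero]
  refine ⟨D.indicator g₀, ⟨fun V hV => ?_, ?_, Eventually.of_forall fun x hx =>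
    indicator_of_notMem (fun h => hx (subset_closure h)) _⟩, ?_⟩
  · rw [Measure.restrict_univ]
    have e : (fun x => D.indicator g₀ x fun i => V i x) = D.indicator fun x => g₀ x fun i => V i x := by
      funext x
      by_cases hx : x ∈ D
      · rw [indicator_of_mem hx, indicator_of_mem hx]
      · rw [indicator_of_notMem hx, indicator_of_notMem hx]
        rfl
    rw [e, memLp_indicator_iff_restrict hDm]
    exact hgp V hV
  · rw [Measure.restrict_univ]
    filter_upwards [(ae_restrict_iff' hDm).1 hgb] with x hx
    by_cases hxD : x ∈ D
    · rw [indicator_of_mem hxD]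
      exact hx hxD
    · rw [indicator_of_notMem hxD]
      exact Submodule.zero_mem _
  · intro r'' q' hr' hq' φ hφ hφb hφs
    obtain rfl : r'' = r' := by omega
    obtain rfl : q' = a := by omega
    have hφp := hφ.lpCoef (U := D) (p := ENNReal.ofReal p') hvol hD.isCompact_closure subset_closure
    have hφp' := hφ.extD.lpCoef (U := D) (p := ENNReal.ofReal p') hvol hD.isCompact_closure
      subset_closure
    have ef : wedgeDensity vol f φ =ᵐ[volMeasure vol] D.indicator (wedgeDensity vol f φ) := by
      filter_upwards [hfout] with x hx
      by_cases hxD : x ∈ D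
      · rw [indicator_of_mem hxD]
      · rw [indicator_of_notMem hxD, wedgeDensity, hx hxD, wedgeEval_zero, zero_div]
    have eg : wedgeDensity vol (D.indicator g₀) (extD φ) =
        D.indicator (wedgeDensity vol g₀ (extD φ)) := by
      funext x
      by_cases hxD : x ∈ D
      · rw [indicator_of_mem hxD, wedgeDensity, indicator_of_mem hxD, wedgeDensity]
      · rw [indicator_of_notMem hxD, wedgeDensity, indicator_of_notMem hxD, wedgeEval_zero, zero_div]
    -- restricted to `D`, the smooth test form `φ` and its exterior derivative belong to the weak
    -- operator on `D`, so that the value of `T` on the latter is `∫ f ∧ φ`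
    obtain ⟨u, -, hu⟩ := exists_coefForm_eq (n := n) (ι := ι) hF hDm hDA hφp
      (Eventually.of_forall hφb)
    obtain ⟨v, hv, hv'⟩ := exists_coefForm_eq (n := n) (ι := ι) (r := r'') (s := q' + 1) hF hDm hDA
      hφp' (Eventually.of_forall (extD_mem_bidegree hM hvol hD hφ hφb))
    have key := hT u v ((weakDbar_extD hM hvol hD hφ).congr hu.symm hv'.symm)
    refine ⟨?_, ?_, ?_⟩
    · rw [WedgeIntegrable, integrable_congr ef, integrable_indicator_iff hDm]
      exact hF.integrableOn (by omega) hDm hDA hfD hφp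
    · rw [WedgeIntegrable, eg, integrable_indicator_iff hDm]
      exact hF.integrableOn hdeg hDm hDA hgp hφp'
    · rw [wedgeIntegral, wedgeIntegral, integral_congr_ae ef, eg, integral_indicator hDm,
        integral_indicator hDm]
      have e1 : ∫ x in D, wedgeDensity vol f φ x ∂volMeasure vol = T v := by
        rw [key]
        refine integral_congr_ae ?_
        filter_upwards [hu] with x hx
        rw [wedgeDensity, wedgeDensity, hx]
      have e2 : ∫ x in D, wedgeDensity vol g₀ (extD φ) x ∂volMeasure vol =
          (-1) ^ (r + s + 1) * T v := by
        rw [hTl, ← integral_const_mul]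
        refine integral_congr_ae ?_
        filter_upwards [ae_all_iff.2 hv, ae_restrict_mem hDm] with x hx hxD
        refine (hg₀ x hxD _).trans ?_
        rw [Finset.mul_sum]
        refine Finset.sum_congr rfl fun j _ => ?_
        rw [hx j, mul_left_comm]
      rw [e1, e2, ← mul_assoc, ← pow_add, Even.neg_one_pow ⟨_, rfl⟩, one_mul]

end Solution

end CRLp

end

theorem mainTheorem12 (n m k : ℕ)
    (X : Type*) [TopologicalSpace X] [ChartedSpace (CRLp.EX n) X]
    [IsManifold 𝓘(ℂ, CRLp.EX n) ω X] [T2Space X] [SecondCountableTopology X]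
    (M : Type*) [TopologicalSpace M] [ChartedSpace (CRLp.EM m) M]
    [IsManifold 𝓘(ℝ, CRLp.EM m) ∞ M] [MeasurableSpace M] [BorelSpace M]
    (ι : M → X) (hM : CRLp.IsGenericCR (n := n) (m := m) k ι)
    (vol : CRLp.DForm (m := m) M m ℝ) (hvol : CRLp.IsVolumeForm vol)
    (D : Set M) (hD : CRLp.IsSmoothDomain (m := m) D)
    (p p' : ℝ) (hp : 1 < p) (hpp' : 1 / p + 1 / p' = 1)
    (r q : ℕ) (hr : r ≤ n) (hq₁ : 1 ≤ q) (hq₂ : q ≤ n - k)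
    (hHausdorff : CRLp.HLpHausdorff (n := n) k ι vol D p' (n - r) (n - k - q + 1))
    (hVanish : Subsingleton (CRLp.HLp (n := n) k ι vol D p' (n - r) (n - k - q))) :
    Subsingleton (CRLp.HcLp (n := n) k ι vol D p r q) ∧
      ∀ s : ℕ, q = s + 1 →
        ∀ f ∈ CRLp.LpForms (n := n) ι vol univ (closure D) p r (s + 1),
          CRLp.WeakDbar (n := n) k ι vol univ f 0 →
            ∃ g ∈ CRLp.LpForms (n := n) ι vol univ (closure D) p r s,
              CRLp.WeakDbar (n := n) k ι vol univ g f := by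
  have hm := hM.codim
  have hemb := hM.embedding.isEmbedding
  have : T2Space M := hemb.t2Space
  have : SecondCountableTopology M := hemb.secondCountableTopology
  have : LocallyCompactSpace M := ChartedSpace.locallyCompactSpace (CRLp.EM m) M
  have hp' : 1 < p' := by
    have h0 : 0 < 1 / p := by positivity
    have h1 : 1 / p < 1 := by rw [div_lt_one (by linarith)]; exact hp
    have h2 : 0 < 1 / p' := by linarith
    have h3 : 0 < p' := one_div_pos.1 h2
    have h4 : 1 / p' < 1 := by linarith
    rwa [div_lt_one h3] at h4
  have hpq : (ENNReal.ofReal p).HolderConjugate (ENNReal.ofReal p') := by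
    refine ENNReal.HolderConjugate.of_toReal ?_
    rw [ENNReal.toReal_ofReal (by linarith), ENNReal.toReal_ofReal (by linarith)]
    exact Real.holderConjugate_iff.2 ⟨hp, by simpa only [one_div] using hpp'⟩
  have key : ∀ s : ℕ, q = s + 1 →
      ∀ f ∈ CRLp.LpForms (n := n) ι vol univ (closure D) p r (s + 1),
        CRLp.WeakDbar (n := n) k ι vol univ f 0 →
          ∃ g ∈ CRLp.LpForms (n := n) ι vol univ (closure D) p r s,
            CRLp.WeakDbar (n := n) k ι vol univ g f := by
    rintro s rfl f hf hf0
    exact CRLp.exists_weakDbar_eq hM hvol hD (by omega) (by omega) hHausdorff hVanish hf hf0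
  refine ⟨?_, key⟩
  obtain ⟨s, rfl⟩ : ∃ s, q = s + 1 := ⟨q - 1, by omega⟩
  exact CRLp.subsingleton_of_forall_mem_LpExact fun f hf => key s rfl f f.2 hf
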